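/- **Setting.** Let $n\ge 2$, let $\Omega\subset\mathbb R^n$ be a nonempty bounded open convex set with $C^1$ boundary, let $d\theta$ be the normalized surface measure on $\mathbb S^{n-1}$, $\Gamma_-=\{(x,\theta)\in\partial\Omega\times\mathbb S^{n-1}: n(x)\cdot\theta<0\}$ with $n(x)$ the outer unit normal, $d\xi=|n(x)\cdot\theta|\,d\mu(x)\,d\theta$ with $d\mu$ the surface measure on $\partial\Omega$, $\tau_\pm(x,\theta)=\min\{t\ge 0: x\pm t\theta\in\partial\Omega\}$, $\tau=\tau_-+\tau_+$. For $u=u(x,\theta)$ put $\langle u\rangle(x)=\int_{\mathbb S^{n-1}}u(x,\theta)\,d\theta$ and $Ku(x,\theta)=\int_{\mathbb S^{n-1}}k(x,\theta',\theta)u(x,\theta')\,d\theta'$. Let $\sigma_a=\sigma_a(x)$, $\sigma_b=\sigma_b(x)$, and $\Sigma(m)=-(\sigma_a+\sigma_b m)$. Consider $$\theta\cdot\nabla_x u+(\sigma_a+\sigma_b|\langle u\rangle|)u-Ku=0\ \text{ in }\Omega\times\mathbb S^{n-1},\qquad u=f_-\ \text{ on }\Gamma_-, \tag{1}$$ for $u\in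 L^1(\Omega\times\mathbb S^{n-1})$ with weak derivative $\theta\cdot\nabla_xu\in L^1(\Omega\times\mathbb S^{n-1})$; the boundary value is taken as the limit along almost every characteristic line. The tuple $(\sigma_a,\sigma_b,k,f_-)$ is *admissible* if $\sigma_a,\sigma_b,k$ are nonnegative $L^\infty$ functions, $f_-\in L^1(\Gamma_-,d\xi)$, $\|f_-\|_*:=\operatorname{ess\,sup}_{x\in\Omega}\int|f_-(x-\tau_-(x,\theta)\theta,\theta)|\,d\theta<\infty$, and for some $\mu,\nu\in[0,1)$: $\|\tau\|_\infty\|k\|_\infty\le\mu$ and $\|\tau\|_\infty\|\sigma_b\|_\infty\|f_-\|_*\le\nu(1-\mu)^2$. Let $h\in C_0^\infty(B_1)$, $0\le h\le1$, $h\equiv1$ near $0$, where $B_1$ is the open unit ball; let $c_0>0$, $\theta'\in\mathbb S^{n-1}$, $\omega=\omega_{n-1}=\lim_{\varepsilon\to0^+}\varepsilon^{-(n-1)}\int h\big(\tfrac{\theta-\theta'}{\varepsilon}\big)d\theta$ and, for $\varepsilon,\delta>0$, $$f_-^{\varepsilon,\delta}(x,\theta)=c_0+\frac{\delta}{\omega\,\varepsilon^{n-1}}\,h\Big(\frac{\theta-\theta'}{\varepsilon}\Big).$$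 Assume that $(\sigma_a,\sigma_b,k,f_-^{\varepsilon,\delta})$ is admissible for all small $\delta>0$ and all $\varepsilon>0$ that are small, depending on $\delta$. For such parameters let $u^{\varepsilon,\delta}$ solve (1) with $f_-=f_-^{\varepsilon,\delta}$, and let $w$ solve (1) with $f_-=c_0$. Put $$I_{\varepsilon,\delta,\gamma}(x)=\int_{\mathbb S^{n-1}}\frac{u^{\varepsilon,\delta}(x,\theta)}{\delta}\,h\Big(\frac{\theta-\theta'}{\gamma}\Big)d\theta,\qquad A_{\theta'}(x)=\exp\Big(\int_0^{\tau_-(x,\theta')}\Sigma(|\langle w\rangle|)(x-s\theta')\,ds\Big).$$ These are functions of $x$ defined up to null sets; convergence almost everywhere as a parameter tends to $0^+$ means convergence for a.e. $x\in\Omega$ along every sequence of parameters tending to $0^+$ (the null set may depend on the sequence). Call $\theta'$ a *Lebesgue direction* of $k$ if for a.e. $(x,\theta)\in\Omega\times\mathbb S^{n-1}$ there is $c\in\mathbb R$ such that the average of $|k(x,\theta'',\theta)-c|$ over $\{\theta'':|\theta''-\theta'|\le r\}$ tends to $0$ as $r\to0^+$. **Theorem.** The limit $\omega$ exists and is positive,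 and: 1. If $\theta'$ is a Lebesgue direction of $k$, then $$\lim_{\delta\to0}\lim_{\gamma\to0}\lim_{\varepsilon\to0}I_{\varepsilon,\delta,\gamma}=A_{\theta'}\quad\text{a.e. in }\Omega ,$$ the two inner limits existing almost everywhere for all small $\delta$ (and, for the innermost one, all $\gamma$ that are small depending on $\delta$). 2. Almost every direction in $\mathbb S^{n-1}$ is a Lebesgue direction of $k$. 3. For every $\theta'$, Lebesgue direction or not: for each $\eta>0$, for all small $\delta>0$, for all $\gamma>0$ that are small depending on $\delta$, and for every sequence $\varepsilon_j\to0^+$, a.e. $x\in\Omega$ satisfies $|I_{\varepsilon_j,\delta,\gamma}(x)-A_{\theta'}(x)|<\eta$ for all large $j$. 4. There is $C>0$ with $w\ge Cc_0$ a.e. in $\Omega\times\mathbb S^{n-1}$; and, for a.e. $x\in\Omega$, $|\langle w\rangle|(x)>0$ and $\sigma_b=\big(-\Sigma(|\langle w\rangle|)-\sigma_a\big)/|\langle w\rangle|$. 5. $\sigma_a$, $k$, $c_0$ and the function in the limit determine $\sigma_b$, already through its values at the points where the lines leave $\Omega$: if $(\sigma_a,\sigma_b',k,c_0)$ is admissible,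 $w'$ solves (1) with $\sigma_b'=\sigma_b'(x)$ in place of $\sigma_b$ and $f_-=c_0$, $\Sigma'(m)=-(\sigma_a+\sigma_b'm)$, and $$\exp\Big(\int_{-\tau_+(x,\theta)}^{\tau_-(x,\theta)}\Sigma(|\langle w\rangle|)(x-s\theta)\,ds\Big)=\exp\Big(\int_{-\tau_+(x,\theta)}^{\tau_-(x,\theta)}\Sigma'(|\langle w'\rangle|)(x-s\theta)\,ds\Big)$$ for a.e. $(x,\theta)\in\Omega\times\mathbb S^{n-1}$, then $\sigma_b=\sigma_b'$ a.e. in $\Omega$. -/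

import Mathlib

open MeasureTheory Filter Topology Set
open scoped ENNReal ContDiff

noncomputable section

namespace TwoPhoton

/-- Euclidean space of dimension `n`. -/
abbrev Space (n : ℕ) : Type := EuclideanSpace ℝ (Fin n)

/-- The unit sphere of `ℝⁿ`. -/
abbrev Sph (n : ℕ) : Type := Metric.sphere (0 : Space n) 1

/-- The normalized surface measure `dθ` on the unit sphere (total mass one). -/
def sphereMeasure (n : ℕ) : Measure (Sph n) :=
  ((volume : Measure (Space n)).toSphere univ)⁻¹ • (volume : Measure (Space n)).toSphere

/-- The measure `dx dθ` on `Ω × 𝕊`. -/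
def phaseMeasure {n : ℕ} (Ω : Set (Space n)) : Measure (Space n × Sph n) :=
  (volume.restrict Ω).prod (sphereMeasure n)

/-- The boundary of `Ω` is of class `C¹`: near each of its points, `Ω` is the sublevel set
of a `C¹` function with nonvanishing differential. -/
def HasC1Boundary {n : ℕ} (Ω : Set (Space n)) : Prop :=
  ∀ x ∈ frontier Ω, ∃ ρ : Space n → ℝ,
    ContDiffAt ℝ 1 ρ x ∧ fderiv ℝ ρ x ≠ 0 ∧ ∀ᶠ y in 𝓝 x, (y ∈ Ω ↔ ρ y < 0)

/-- The standing assumptions on the domain. -/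
structure IsDomainC1 {n : ℕ} (Ω : Set (Space n)) : Prop where
  isOpen : IsOpen Ω
  nonempty : Ω.Nonempty
  isBounded : Bornology.IsBounded Ω
  convex : Convex ℝ Ω
  boundary : HasC1Boundary Ω

/-- `τ₊(x, θ) = min {t ≥ 0 | x + t θ ∈ ∂Ω}`. -/
def tauPlus {n : ℕ} (Ω : Set (Space n)) (x : Space n) (θ : Sph n) : ℝ :=
  sInf {t : ℝ | 0 ≤ t ∧ x + t • (θ : Space n) ∈ frontier Ω}

/-- `τ₋(x, θ) = min {t ≥ 0 | x - t θ ∈ ∂Ω}`. -/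
def tauMinus {n : ℕ} (Ω : Set (Space n)) (x : Space n) (θ : Sph n) : ℝ :=
  sInf {t : ℝ | 0 ≤ t ∧ x - t • (θ : Space n) ∈ frontier Ω}

/-- `‖τ‖_∞` on `Ω × 𝕊`, where `τ = τ₋ + τ₊`. -/
def tauNorm {n : ℕ} (Ω : Set (Space n)) : ℝ≥0∞ :=
  eLpNorm (fun p : Space n × Sph n => tauMinus Ω p.1 p.2 + tauPlus Ω p.1 p.2) ⊤ (phaseMeasure Ω)

open Classical in
/-- The outer unit normal of a convex open set with `C¹` boundary at a boundary point: there it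
is the one unit vector `ν` such that `Ω` lies in the half-space `(y - x) · ν ≤ 0`. -/
def outerNormal {n : ℕ} (Ω : Set (Space n)) (x : Space n) : Space n :=
  if h : ∃ ν : Space n, ‖ν‖ = 1 ∧ ∀ y ∈ Ω, inner ℝ (y - x) ν ≤ 0 then h.choose else 0

/-- The incoming boundary `Γ₋`. -/
def GammaMinus {n : ℕ} (Ω : Set (Space n)) : Set (Space n × Sph n) :=
  {p | p.1 ∈ frontier Ω ∧ inner ℝ (outerNormal Ω p.1) (p.2 : Space n) < 0}

/-- The boundary measure `dξ = |n(x)·θ| dμ(x) dθ`. The surface measure `dμ` is the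
`(n-1)`-dimensional Hausdorff measure on `∂Ω`, up to a constant factor depending on `n` only,
which plays no role because `dξ` is only used to speak of integrable functions. -/
def xiMeasure {n : ℕ} (Ω : Set (Space n)) : Measure (Space n × Sph n) :=
  (((Measure.hausdorffMeasure ((n : ℝ) - 1) : Measure (Space n)).restrict
      (frontier Ω)).prod (sphereMeasure n)).withDensity
    (fun p => ENNReal.ofReal |inner ℝ (outerNormal Ω p.1) (p.2 : Space n)|)

/-- `‖f‖_* = ess sup_{x ∈ Ω} ∫ |f(x - τ₋(x,θ) θ, θ)| dθ`. -/
def starNorm {n : ℕ} (Ω : Set (Space n)) (f : Space n → Sph n → ℝ) : ℝ≥0∞ :=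
  essSup (fun x => ∫⁻ θ, ‖f (x - tauMinus Ω x θ • (θ : Space n)) θ‖ₑ ∂(sphereMeasure n))
    (volume.restrict Ω)

/-- The space `L¹_S(Γ₋, dξ)`. -/
def MemL1S {n : ℕ} (Ω : Set (Space n)) (f : Space n → Sph n → ℝ) : Prop :=
  IntegrableOn (fun p : Space n × Sph n => f p.1 p.2) (GammaMinus Ω) (xiMeasure Ω) ∧
    starNorm Ω f < ⊤

/-- Admissibility of `(σ_a, σ_b, k, f₋)`; the kernel is written `k x θ' θ`. -/
structure Admissible {n : ℕ} (Ω : Set (Space n)) (σa σb : Space n → Sph n → ℝ)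
    (k : Space n → Sph n → Sph n → ℝ) (f : Space n → Sph n → ℝ) : Prop where
  σa_mem : MemLp (fun p : Space n × Sph n => σa p.1 p.2) ⊤ (phaseMeasure Ω)
  σb_mem : MemLp (fun p : Space n × Sph n => σb p.1 p.2) ⊤ (phaseMeasure Ω)
  σa_nonneg : ∀ᵐ p ∂(phaseMeasure Ω), 0 ≤ σa p.1 p.2
  σb_nonneg : ∀ᵐ p ∂(phaseMeasure Ω), 0 ≤ σb p.1 p.2
  k_mem : MemLp (fun q : (Space n × Sph n) × Sph n => k q.1.1 q.1.2 q.2) ⊤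
    ((phaseMeasure Ω).prod (sphereMeasure n))
  k_nonneg : ∀ᵐ q ∂((phaseMeasure Ω).prod (sphereMeasure n)), 0 ≤ k q.1.1 q.1.2 q.2
  f_mem : MemL1S Ω f
  small : ∃ μ ν : ℝ, 0 ≤ μ ∧ μ < 1 ∧ 0 ≤ ν ∧ ν < 1 ∧
    tauNorm Ω * eLpNorm (fun q : (Space n × Sph n) × Sph n => k q.1.1 q.1.2 q.2) ⊤
      ((phaseMeasure Ω).prod (sphereMeasure n)) ≤ ENNReal.ofReal μ ∧
    tauNorm Ω * eLpNorm (fun p : Space n × Sph n => σb p.1 p.2) ⊤ (phaseMeasure Ω)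
      * starNorm Ω f ≤ ENNReal.ofReal (ν * (1 - μ) ^ 2)

/-- The angular average `⟨u⟩(x) = ∫ u(x, θ) dθ`. -/
def aver {n : ℕ} (u : Space n → Sph n → ℝ) (x : Space n) : ℝ :=
  ∫ θ, u x θ ∂(sphereMeasure n)

/-- The scattering operator `Ku(x, θ) = ∫ k(x, θ', θ) u(x, θ') dθ'`. -/
def scatter {n : ℕ} (k : Space n → Sph n → Sph n → ℝ) (u : Space n → Sph n → ℝ)
    (x : Space n) (θ : Sph n) : ℝ :=
  ∫ θ', k x θ' θ * u x θ' ∂(sphereMeasure n)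

/-- `Σ(m) = -(σ_a + σ_b m)`. -/
def Sig {n : ℕ} (σa σb : Space n → Sph n → ℝ) (m : Space n → ℝ) (x : Space n) (θ : Sph n) : ℝ :=
  -(σa x θ + σb x θ * m x)

/-- `g = θ · ∇ₓ u` in the weak sense on `Ω × 𝕊`. -/
def IsWeakTransportDeriv {n : ℕ} (Ω : Set (Space n)) (u g : Space n → Sph n → ℝ) : Prop :=
  ∀ φ : Space n × Space n → ℝ, ContDiff ℝ ∞ φ → HasCompactSupport φ → tsupport φ ⊆ Ω ×ˢ univ →
    ∫ p : Space n × Sph n, u p.1 p.2 *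
        fderiv ℝ (fun y : Space n => φ (y, (p.2 : Space n))) p.1 (p.2 : Space n) ∂(phaseMeasure Ω)
      = -∫ p : Space n × Sph n, g p.1 p.2 * φ (p.1, (p.2 : Space n)) ∂(phaseMeasure Ω)

/-- `u ∈ 𝓗¹(Ω × 𝕊)` solves `θ·∇ₓu + (σ_a + σ_b |⟨u⟩|) u - Ku = 0` in `Ω × 𝕊`, `u = f` on `Γ₋`.
The boundary value of an `𝓗¹` function on `Γ₋` is its (essential) limit along almost every
characteristic line, traced back to the point where the line enters `Ω`. -/
structure IsSolution {n : ℕ} (Ω : Set (Space n)) (σa σb : Space n → Sph n → ℝ)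
    (k : Space n → Sph n → Sph n → ℝ) (f u : Space n → Sph n → ℝ) : Prop where
  integrable : Integrable (fun p : Space n × Sph n => u p.1 p.2) (phaseMeasure Ω)
  equation : ∃ g : Space n → Sph n → ℝ,
    Integrable (fun p : Space n × Sph n => g p.1 p.2) (phaseMeasure Ω) ∧
    IsWeakTransportDeriv Ω u g ∧
    ∀ᵐ p ∂(phaseMeasure Ω),
      g p.1 p.2 + (σa p.1 p.2 + σb p.1 p.2 * |aver u p.1|) * u p.1 p.2
        - scatter k u p.1 p.2 = 0
  boundary : ∀ᵐ p ∂(phaseMeasure Ω),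
    Tendsto (fun s : ℝ => u (p.1 - s • (p.2 : Space n)) p.2)
      (𝓝[<] (tauMinus Ω p.1 p.2) ⊓ ae volume)
      (𝓝 (f (p.1 - tauMinus Ω p.1 p.2 • (p.2 : Space n)) p.2))

/-- The cut-off functions: smooth, compactly supported in the open unit ball, with values in
`[0, 1]` and equal to one near the origin. -/
structure IsCutoff {n : ℕ} (h : Space n → ℝ) : Prop where
  smooth : ContDiff ℝ ∞ h
  compact : HasCompactSupport h
  supp : tsupport h ⊆ Metric.ball 0 1
  nonneg : ∀ y, 0 ≤ h y
  le_one : ∀ y, h y ≤ 1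
  eq_one : ∀ᶠ y in 𝓝 (0 : Space n), h y = 1

/-- `h((θ - θ')/r)`. -/
def bump {n : ℕ} (h : Space n → ℝ) (θ' : Sph n) (r : ℝ) (θ : Sph n) : ℝ :=
  h (r⁻¹ • ((θ : Space n) - (θ' : Space n)))

/-- `ε^{-(n-1)} ∫ h((θ - θ')/ε) dθ`. -/
def bumpMass {n : ℕ} (h : Space n → ℝ) (θ' : Sph n) (ε : ℝ) : ℝ :=
  ∫ θ, 1 / ε ^ (n - 1) * bump h θ' ε θ ∂(sphereMeasure n)

/-- The normalizing constant `ω_{n-1} = lim_{ε → 0+} ε^{-(n-1)} ∫ h((θ - θ')/ε) dθ`. -/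
def omega {n : ℕ} (h : Space n → ℝ) (θ' : Sph n) : ℝ :=
  limUnder (𝓝[>] (0 : ℝ)) (bumpMass h θ')

/-- The source `c₀ + δ ω_{n-1}⁻¹ ε^{-(n-1)} h((θ - θ')/ε)`. -/
def source {n : ℕ} (h : Space n → ℝ) (c₀ : ℝ) (θ' : Sph n) (ε δ : ℝ) :
    Space n → Sph n → ℝ :=
  fun _ θ => c₀ + δ / (omega h θ' * ε ^ (n - 1)) * bump h θ' ε θ

/-- `∫ (v(x, θ)/δ) h((θ - θ')/γ) dθ`. -/
def measurement {n : ℕ} (h : Space n → ℝ) (θ' : Sph n) (δ γ : ℝ) (v : Space n → Sph n → ℝ)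
    (x : Space n) : ℝ :=
  ∫ θ, v x θ / δ * bump h θ' γ θ ∂(sphereMeasure n)

/-- `F t → g` as `t → 0+`, almost everywhere, for a family of functions `F t` that are defined up
to null sets only: the convergence holds almost everywhere along every sequence `t j → 0+`. (The
null set depends on the sequence; as each `F t` may be changed on a null set, a null set that
serves all `t` at once would make no sense.) -/
def TendstoAE {X : Type*} [MeasurableSpace X] (μ : Measure X) (F : ℝ → X → ℝ) (g : X → ℝ) :
    Prop :=
  ∀ t : ℕ → ℝ, Tendsto t atTop (𝓝[>] 0) → ∀ᵐ x ∂μ, Tendsto (fun j => F (t j) x) atTop (𝓝 (g x))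

/-- `lim_{δ → 0+} lim_{γ → 0+} lim_{ε → 0+} F ε δ γ = g` almost everywhere, all inner limits
existing almost everywhere. -/
def IteratedLimitAE {X : Type*} [MeasurableSpace X] (μ : Measure X)
    (F : ℝ → ℝ → ℝ → X → ℝ) (g : X → ℝ) : Prop :=
  ∃ (G₂ : ℝ → ℝ → X → ℝ) (G₁ : ℝ → X → ℝ),
    (∀ᶠ δ in 𝓝[>] (0 : ℝ),
      (∀ᶠ γ in 𝓝[>] (0 : ℝ), TendstoAE μ (fun ε => F ε δ γ) (G₂ δ γ)) ∧
      TendstoAE μ (G₂ δ) (G₁ δ)) ∧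
    TendstoAE μ G₁ g

/-- `θ'` is a Lebesgue point of `k(x, ·, θ)` for almost every `(x, θ)`. -/
def IsLebesgueDirection {n : ℕ} (Ω : Set (Space n)) (k : Space n → Sph n → Sph n → ℝ)
    (θ' : Sph n) : Prop :=
  ∀ᵐ p ∂(phaseMeasure Ω), ∃ c : ℝ,
    Tendsto (fun r : ℝ => ⨍ θ'' in Metric.closedBall θ' r, |k p.1 θ'' p.2 - c| ∂(sphereMeasure n))
      (𝓝[>] 0) (𝓝 0)

/-- `exp (∫₀^{τ₋(x,θ)} Σ(|⟨w⟩|)(x - sθ) ds)`. -/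
def attenuation {n : ℕ} (Ω : Set (Space n)) (σa σb : Space n → Sph n → ℝ)
    (w : Space n → Sph n → ℝ) (θ : Sph n) (x : Space n) : ℝ :=
  Real.exp (∫ s in (0 : ℝ)..(tauMinus Ω x θ),
    Sig σa σb (fun y => |aver w y|) (x - s • (θ : Space n)) θ)

/-- The same along the whole chord through `x` in the direction `θ`; this is `attenuation` at
the point where the chord leaves `Ω`. -/
def chordAttenuation {n : ℕ} (Ω : Set (Space n)) (σa σb : Space n → Sph n → ℝ)
    (w : Space n → Sph n → ℝ) (θ : Sph n) (x : Space n) : ℝ :=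
  Real.exp (∫ s in (-(tauPlus Ω x θ))..(tauMinus Ω x θ),
    Sig σa σb (fun y => |aver w y|) (x - s • (θ : Space n)) θ)

end TwoPhoton

end

noncomputable section

namespace TwoPhoton

variable {n : ℕ} {Ω : Set (Space n)}

/-! ### Geometry of lines in a convex domain -/

/-! Reduction to lines. Testing the weak equation with translates of test functions along
characteristics shows that, on almost every line, a solution is its boundary value plus the integral
of its transport derivative (`eq_boundary_add_integral`). All later work uses this integrated form,
`Solves`, with bounded measurable representatives of the coefficients.

A priori bounds. Absorption has the favourable sign, so along a line a difference of two solutions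
is controlled by the differences of boundary values, of scattering terms and of absorptions, the
last multiplied by the second solution only (`Solves.enorm_sub_le`). Averaging over directions gives
an inequality for the angular L¹ norm which contracts by the factor μ + ν(1-μ) < 1, and
`ae_le_of_le_lineInt` turns it into a bound almost everywhere. Thus ⟨u⟩ - ⟨w⟩ is O(δ) in L^∞,
uniformly in ε.

Ballistic and regular part. Write u as the peak times exp(-∫ absorption of u), plus a remainder. The
remainder has boundary value c₀ and is bounded independently of ε, so after division by δ it
contributes to the measurement at most a constant over δ times the measure of a cap of radius γ.
Replacing the absorption of u by that of w changes the normalized ballistic average by O(δ). With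
the absorption of w frozen, the average converges to the attenuation as ε → 0: for a fixed direction
θ', almost every x is a Lebesgue point at θ' of the X-ray transform as a function of direction
(`ae_tendsto_xray_cap`). In gnomonic coordinates this reduces to Lebesgue points on hyperplanes
orthogonal to θ', integrated along the line through x. This yields the statement with η for every
direction.

Existence of the inner limits. The absorption of u depends on ε through ⟨u⟩, so convergence as ε → 0
is not automatic. Along a sequence ε_j, let P, R, O, S be the limits of the integrated tail
oscillations of |⟨u_j⟩|, of the regular parts, of the ballistic averages and of the scattered
ballistic parts. Freezing the absorption at a late index I gives O ≤ cP and S ≤ κcP with c = O(δ),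
where S needs θ' to be a Lebesgue direction of k. The equation gives P ≤ R + O and R ≤ ‖τ‖(κR + S +
eP). For small δ the admissibility constants force P = R = 0 (`closing_argument`), so ballistic
averages and measurements are Cauchy almost everywhere; the estimates above identify the limit.

Remaining claims. The sphere measure is doubling, so Lebesgue differentiation and Fubini make almost
every direction a Lebesgue direction. The lower bound for w follows by comparison with the solution
without scattering. If the chord attenuations agree, the total absorptions have the same X-ray
transform, hence coincide by the Fourier slice theorem (`ae_eq_zero_of_ae_integral_line_eq_zero`); w
and w' then solve the same linear problem, so their averages agree, and dividing by the positive
average recovers σ_b. -/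

lemma exit_time_spec (ho : IsOpen Ω) (hb : Bornology.IsBounded Ω) (hc : Convex ℝ Ω) {x v : Space n}
    (hx : x ∈ Ω) (hv : ‖v‖ = 1) {T : ℝ}
    (hT : T = sInf {t : ℝ | 0 ≤ t ∧ x + t • v ∈ frontier Ω}) :
    0 < T ∧ ∀ s : ℝ, 0 ≤ s → (x + s • v ∈ Ω ↔ s < T) := by
  set S := {t : ℝ | 0 ≤ t ∧ x + t • v ∈ frontier Ω} with hS
  have hcont : Continuous fun t : ℝ => x + t • v := by fun_prop
  have hdisj : ∀ y, y ∈ frontier Ω → y ∉ Ω := fun y hy hy' => by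
    rw [ho.frontier_eq] at hy
    exact hy.2 hy'
  -- Connectedness: a segment that starts in Ω and avoids the frontier is covered by the disjoint
  -- open sets Ω and the complement of its closure.
  have hseg : ∀ s : ℝ, 0 ≤ s → (∀ t ∈ Icc 0 s, x + t • v ∉ frontier Ω) → x + s • v ∈ Ω := by
    intro s hs h
    by_contra hns
    have hpre : IsPreconnected ((fun t : ℝ => x + t • v) '' Icc 0 s) :=
      isPreconnected_Icc.image _ hcont.continuousOn
    have hnc : ∀ t ∈ Icc 0 s, x + t • v ∉ Ω → x + t • v ∉ closure Ω := fun t ht h1 h2 =>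
      h t ht (by rw [ho.frontier_eq]; exact ⟨h2, h1⟩)
    obtain ⟨y, -, hy1, hy2⟩ := hpre Ω (closure Ω)ᶜ ho isClosed_closure.isOpen_compl
      (by
        rintro _ ⟨t, ht, rfl⟩
        by_cases hm : x + t • v ∈ Ω
        · exact Or.inl hm
        · exact Or.inr (hnc t ht hm))
      ⟨x, ⟨0, ⟨le_rfl, hs⟩, by simp⟩, hx⟩
      ⟨_, ⟨s, ⟨hs, le_rfl⟩, rfl⟩, hnc s ⟨hs, le_rfl⟩ hns⟩
    exact hy2 (subset_closure hy1)
  have hne : S.Nonempty := by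
    by_contra hemp
    rw [not_nonempty_iff_eq_empty] at hemp
    obtain ⟨R, hR⟩ := hb.exists_norm_le
    have h0 : 0 ≤ R := (norm_nonneg x).trans (hR x hx)
    -- A ray that never meets the frontier stays in Ω, but at time 2R + 1 its norm is at least 2R +
    -- 1 - R > R.
    have := hR _ (hseg (2 * R + 1) (by positivity) (fun t ht hf => by
      have : t ∈ S := ⟨ht.1, hf⟩
      rw [hemp] at this
      exact this))
    have h2 : ‖(2 * R + 1) • v‖ ≤ ‖x + (2 * R + 1) • v‖ + ‖x‖ := by
      simpa using norm_sub_le (x + (2 * R + 1) • v) x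
    rw [norm_smul, hv, Real.norm_of_nonneg (by positivity)] at h2
    have := hR x hx
    linarith
  have hclosed : IsClosed S :=
    isClosed_Ici.inter (isClosed_frontier.preimage hcont)
  have hbdd : BddBelow S := ⟨0, fun t ht => ht.1⟩
  have hTS : T ∈ S := hT ▸ hclosed.csInf_mem hne hbdd
  have hTpos : 0 < T := by
    rcases hTS.1.lt_or_eq with h | h
    · exact h
    · have := hTS.2
      rw [← h] at this
      simp only [zero_smul, add_zero] at this
      exact absurd hx (hdisj _ this)
  refine ⟨hTpos, fun s hs => ⟨fun h => ?_, fun h => ?_⟩⟩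
  · by_contra hle
    push Not at hle
    rcases hle.lt_or_eq with hlt | heq
    -- Convexity: if a later point at time s were in Ω, so would be the frontier point at time T,
    -- which lies on the segment from x to it.
    · have hmem : x + T • v ∈ Ω := by
        have := hc hx h (a := 1 - T / s) (b := T / s)
          (by rw [sub_nonneg]; exact div_le_one_of_le₀ hle hs) (by positivity) (by ring)
        convert this using 1
        rw [smul_add, smul_smul, div_mul_cancel₀ _ (hTpos.trans hlt).ne', ← add_assoc, ← add_smul]
        simp
      exact hdisj _ hTS.2 hmem
    · exact hdisj _ hTS.2 (heq ▸ h)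
  · exact hseg s hs fun t ht hf => absurd (hT ▸ csInf_le hbdd ⟨ht.1, hf⟩ : T ≤ t)
      (not_le.2 (ht.2.trans_lt h))

lemma norm_sph (θ : Sph n) : ‖(θ : Space n)‖ = 1 := by
  simp

lemma tauPlus_spec (hΩ : IsDomainC1 Ω) {x : Space n} (hx : x ∈ Ω) (θ : Sph n) :
    0 < tauPlus Ω x θ ∧ ∀ s : ℝ, 0 ≤ s → (x + s • (θ : Space n) ∈ Ω ↔ s < tauPlus Ω x θ) :=
  exit_time_spec hΩ.isOpen hΩ.isBounded hΩ.convex hx (norm_sph θ) rfl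

lemma tauMinus_spec (hΩ : IsDomainC1 Ω) {x : Space n} (hx : x ∈ Ω) (θ : Sph n) :
    0 < tauMinus Ω x θ ∧ ∀ s : ℝ, 0 ≤ s → (x - s • (θ : Space n) ∈ Ω ↔ s < tauMinus Ω x θ) := by
  have := exit_time_spec (v := -(θ : Space n)) (T := tauMinus Ω x θ) hΩ.isOpen hΩ.isBounded
    hΩ.convex hx (by rw [norm_neg, norm_sph]) (by simp [tauMinus, sub_eq_add_neg])
  simpa [sub_eq_add_neg] using this

lemma tauMinus_pos (hΩ : IsDomainC1 Ω) {x : Space n} (hx : x ∈ Ω) (θ : Sph n) :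
    0 < tauMinus Ω x θ := (tauMinus_spec hΩ hx θ).1

lemma tauPlus_pos (hΩ : IsDomainC1 Ω) {x : Space n} (hx : x ∈ Ω) (θ : Sph n) :
    0 < tauPlus Ω x θ := (tauPlus_spec hΩ hx θ).1

lemma mem_iff_lt_tauMinus (hΩ : IsDomainC1 Ω) {x : Space n} (hx : x ∈ Ω) (θ : Sph n) {s : ℝ}
    (hs : 0 ≤ s) : x - s • (θ : Space n) ∈ Ω ↔ s < tauMinus Ω x θ := (tauMinus_spec hΩ hx θ).2 s hs

lemma mem_iff_lt_tauPlus (hΩ : IsDomainC1 Ω) {x : Space n} (hx : x ∈ Ω) (θ : Sph n) {s : ℝ}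
    (hs : 0 ≤ s) : x + s • (θ : Space n) ∈ Ω ↔ s < tauPlus Ω x θ := (tauPlus_spec hΩ hx θ).2 s hs

lemma mem_line_iff (hΩ : IsDomainC1 Ω) {x : Space n} (hx : x ∈ Ω) (θ : Sph n) (s : ℝ) :
    x - s • (θ : Space n) ∈ Ω ↔ s ∈ Ioo (-tauPlus Ω x θ) (tauMinus Ω x θ) := by
  rcases le_total 0 s with hs | hs
  · rw [mem_iff_lt_tauMinus hΩ hx θ hs]
    have := tauPlus_pos hΩ hx θ
    simp only [mem_Ioo, iff_and_self]
    intro _; linarith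
  · have := mem_iff_lt_tauPlus hΩ hx θ (neg_nonneg.2 hs)
    have h2 := tauMinus_pos hΩ hx θ
    rw [neg_smul, ← sub_eq_add_neg] at this
    rw [this]
    simp only [mem_Ioo]
    constructor
    · intro h; constructor <;> linarith
    · intro h; linarith [h.1]

lemma tauMinus_shift (hΩ : IsDomainC1 Ω) {x : Space n} (hx : x ∈ Ω) (θ : Sph n) {t : ℝ}
    (ht : 0 ≤ t) (htt : t < tauMinus Ω x θ) :
    tauMinus Ω (x - t • (θ : Space n)) θ = tauMinus Ω x θ - t := by
  have hx' := (mem_iff_lt_tauMinus hΩ hx θ ht).2 htt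
  have key : ∀ s : ℝ, 0 ≤ s → (s < tauMinus Ω (x - t • (θ : Space n)) θ ↔
      s < tauMinus Ω x θ - t) := fun s hs => by
    rw [← mem_iff_lt_tauMinus hΩ hx' θ hs, sub_sub, ← add_smul,
      mem_iff_lt_tauMinus hΩ hx θ (add_nonneg ht hs)]
    constructor <;> intro h <;> linarith
  have h1 := tauMinus_pos hΩ hx' θ
  by_contra hne
  rcases lt_or_gt_of_ne hne with h | h
  · exact lt_irrefl _ ((key _ h1.le).2 h)
  · exact lt_irrefl _ ((key _ (by linarith)).1 h)

/-- This bound on the diameter controls the travel times at every point and in every direction,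
whereas `tauNorm` bounds them for almost every pair only. It is what is used when the direction θ'
is fixed. -/
lemma exists_tau_le (hΩ : IsDomainC1 Ω) :
    ∃ L : ℝ, 0 < L ∧ ∀ x ∈ Ω, ∀ y ∈ Ω, ‖x - y‖ < L := by
  obtain ⟨R, hR⟩ := hΩ.isBounded.exists_norm_le
  obtain ⟨x, hx⟩ := hΩ.nonempty
  have : 0 ≤ R := (norm_nonneg x).trans (hR x hx)
  refine ⟨2 * R + 1, by positivity, fun x hx y hy => ?_⟩
  have := norm_sub_le x y
  linarith [hR x hx, hR y hy]

lemma tauMinus_le {L : ℝ} (hΩ : IsDomainC1 Ω) (hL0 : 0 < L) (hL : ∀ x ∈ Ω, ∀ y ∈ Ω, ‖x - y‖ < L)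
    {x : Space n} (hx : x ∈ Ω) (θ : Sph n) : tauMinus Ω x θ ≤ L := by
  by_contra h
  push Not at h
  have := hL x hx _ ((mem_iff_lt_tauMinus hΩ hx θ hL0.le).2 h)
  rw [sub_sub_cancel, norm_smul, norm_sph, Real.norm_of_nonneg hL0.le] at this
  linarith

lemma tauPlus_le {L : ℝ} (hΩ : IsDomainC1 Ω) (hL0 : 0 < L) (hL : ∀ x ∈ Ω, ∀ y ∈ Ω, ‖x - y‖ < L)
    {x : Space n} (hx : x ∈ Ω) (θ : Sph n) : tauPlus Ω x θ ≤ L := by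
  by_contra h
  push Not at h
  have := hL _ ((mem_iff_lt_tauPlus hΩ hx θ hL0.le).2 h) x hx
  rw [add_sub_cancel_left, norm_smul, norm_sph, Real.norm_of_nonneg hL0.le] at this
  linarith

/-! ### Total mass of the directions and the essential bound for the chord lengths. -/

lemma sphereMeasure_isProbabilityMeasure (hn : n ≠ 0) : IsProbabilityMeasure (sphereMeasure n) := by
  have : Nontrivial (Space n) := by
    have : Nonempty (Fin n) := ⟨⟨0, Nat.pos_of_ne_zero hn⟩⟩
    infer_instance
  refine ⟨?_⟩
  rw [sphereMeasure, Measure.smul_apply, smul_eq_mul]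
  refine ENNReal.inv_mul_cancel ?_ (measure_ne_top _ _)
  rw [Ne, Measure.measure_univ_eq_zero]
  exact Measure.toSphere_ne_zero _

lemma ae_phase_mem (hΩ : IsDomainC1 Ω) [SFinite (sphereMeasure n)] :
    ∀ᵐ p ∂(phaseMeasure Ω), p.1 ∈ Ω := by
  have : ∀ᵐ x ∂(volume.restrict Ω), x ∈ Ω := ae_restrict_mem hΩ.isOpen.measurableSet
  exact Measure.quasiMeasurePreserving_fst.ae this

lemma tauNorm_lt_top (hΩ : IsDomainC1 Ω) [SFinite (sphereMeasure n)] : tauNorm Ω < ⊤ := by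
  obtain ⟨L, hL0, hL⟩ := exists_tau_le hΩ
  refine (eLpNorm_le_of_ae_bound (C := 2 * L) ?_).trans_lt ?_
  · filter_upwards [ae_phase_mem hΩ] with p hp
    rw [Real.norm_of_nonneg (add_nonneg (tauMinus_pos hΩ hp _).le (tauPlus_pos hΩ hp _).le)]
    linarith [tauMinus_le hΩ hL0 hL hp p.2, tauPlus_le hΩ hL0 hL hp p.2]
  · simpa using ENNReal.mul_lt_top (by simp) (by simp)

lemma ae_tau_le (hΩ : IsDomainC1 Ω) [SFinite (sphereMeasure n)] : ∀ᵐ p ∂(phaseMeasure Ω),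
    tauMinus Ω p.1 p.2 + tauPlus Ω p.1 p.2 ≤ (tauNorm Ω).toReal := by
  have h := ae_le_eLpNormEssSup (μ := phaseMeasure Ω)
    (f := fun p : Space n × Sph n => tauMinus Ω p.1 p.2 + tauPlus Ω p.1 p.2)
  filter_upwards [h, ae_phase_mem hΩ] with p hp hpΩ
  rw [← ENNReal.ofReal_le_iff_le_toReal (tauNorm_lt_top hΩ).ne, tauNorm, eLpNorm_exponent_top]
  refine le_trans (le_of_eq ?_) hp
  rw [Real.enorm_of_nonneg
    (add_nonneg (tauMinus_pos hΩ hpΩ _).le (tauPlus_pos hΩ hpΩ _).le)]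

end TwoPhoton

end

noncomputable section

namespace TwoPhoton

variable {n : ℕ} {Ω : Set (Space n)}

lemma ae_ae_of_ae_prod_swap {α β : Type*} [MeasurableSpace α] [MeasurableSpace β] {μ : Measure α}
    {ν : Measure β} [SFinite μ] [SFinite ν] {Q : α × β → Prop} (h : ∀ᵐ p ∂(μ.prod ν), Q p) :
    ∀ᵐ y ∂ν, ∀ᵐ x ∂μ, Q (x, y) :=
  Measure.ae_ae_of_ae_prod (p := fun q : β × α => Q q.swap)
    (Measure.measurePreserving_swap.quasiMeasurePreserving.ae h)

/-! ### Integration along characteristic lines -/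

/-- The integral of `H` over the part of the characteristic line behind `p` that lies in `Ω`. -/
def lineInt (Ω : Set (Space n)) (H : Space n × Sph n → ℝ≥0∞) (p : Space n × Sph n) : ℝ≥0∞ :=
  ∫⁻ s in Ioi (0 : ℝ), (Ω ×ˢ univ).indicator H (p.1 - s • (p.2 : Space n), p.2)

lemma lintegral_Ioi_indicator (hΩ : IsDomainC1 Ω) {x : Space n} (hx : x ∈ Ω) (θ : Sph n)
    (h : Space n → ℝ≥0∞) : ∫⁻ s in Ioi (0 : ℝ), Ω.indicator h (x - s • (θ : Space n))
      = ∫⁻ s in Ioo 0 (tauMinus Ω x θ), h (x - s • (θ : Space n)) := by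
  rw [← lintegral_indicator measurableSet_Ioi, ← lintegral_indicator measurableSet_Ioo]
  congr 1 with s
  by_cases hs : 0 < s
  · by_cases hm : s < tauMinus Ω x θ
    · rw [indicator_of_mem (mem_Ioi.2 hs), indicator_of_mem (mem_Ioo.2 ⟨hs, hm⟩),
        indicator_of_mem ((mem_iff_lt_tauMinus hΩ hx θ hs.le).2 hm)]
    · rw [indicator_of_mem (mem_Ioi.2 hs), indicator_of_notMem (s := Ioo _ _) (fun h => hm h.2),
        indicator_of_notMem (s := Ω) (fun h => hm ((mem_iff_lt_tauMinus hΩ hx θ hs.le).1 h))]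
  · rw [indicator_of_notMem (s := Ioi _) (fun h => hs h),
      indicator_of_notMem (s := Ioo _ _) (fun h => hs h.1)]

lemma indicator_prod_univ_apply (H : Space n × Sph n → ℝ≥0∞) (y : Space n) (θ : Sph n) :
    (Ω ×ˢ (univ : Set (Sph n))).indicator H (y, θ) = Ω.indicator (fun y => H (y, θ)) y := by
  by_cases hy : y ∈ Ω <;> simp [hy]

lemma lineInt_apply (H : Space n × Sph n → ℝ≥0∞) (p : Space n × Sph n) : lineInt Ω H p =
    ∫⁻ s in Ioi (0 : ℝ), Ω.indicator (fun y => H (y, p.2)) (p.1 - s • (p.2 : Space n)) := by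
  simp only [lineInt, indicator_prod_univ_apply]

lemma lineInt_eq (hΩ : IsDomainC1 Ω) {p : Space n × Sph n} (hp : p.1 ∈ Ω)
    (H : Space n × Sph n → ℝ≥0∞) : lineInt Ω H p =
      ∫⁻ s in Ioo 0 (tauMinus Ω p.1 p.2), H (p.1 - s • (p.2 : Space n), p.2) := by
  rw [lineInt_apply, lintegral_Ioi_indicator hΩ hp p.2 (fun y => H (y, p.2))]

lemma measurable_lineInt (hΩ : IsOpen Ω) {H : Space n × Sph n → ℝ≥0∞} (hH : Measurable H) :
    Measurable (lineInt Ω H) := by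
  unfold lineInt
  refine Measurable.lintegral_prod_right'
    (f := fun q : (Space n × Sph n) × ℝ =>
      (Ω ×ˢ (univ : Set (Sph n))).indicator H
        ((q.1.1 - q.2 • (q.1.2 : Space n), q.1.2) : Space n × Sph n)) ?_
  refine (hH.indicator (hΩ.measurableSet.prod MeasurableSet.univ)).comp ?_
  fun_prop

/-- Tonelli and translation invariance: a point y is met from y + sθ for those s > 0 with y + sθ in
Ω, that is for s < τ₊(y, θ). Being valid for each single θ, it permits statements in a prescribed
direction. -/
lemma lintegral_line_fixed (hΩ : IsDomainC1 Ω) (θ : Sph n) {h : Space n → ℝ≥0∞}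
    (hh : Measurable h) :
    ∫⁻ x in Ω, ∫⁻ s in Ioi (0 : ℝ), Ω.indicator h (x - s • (θ : Space n))
      = ∫⁻ y in Ω, ENNReal.ofReal (tauPlus Ω y θ) * h y := by
  have hm := hΩ.isOpen.measurableSet
  have hhi := hh.indicator hm
  have h1 : Measurable fun q : Space n × ℝ => Ω.indicator h (q.1 - q.2 • (θ : Space n)) :=
    hhi.comp (by fun_prop)
  rw [lintegral_lintegral_swap h1.aemeasurable]
  have h2 : ∀ s : ℝ, ∫⁻ x in Ω, Ω.indicator h (x - s • (θ : Space n))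
      = ∫⁻ y in Ω, Ω.indicator 1 (y + s • (θ : Space n)) * h y := fun s => by
    rw [← lintegral_indicator hm, ← lintegral_indicator hm,
      ← lintegral_add_right_eq_self _ (s • (θ : Space n))]
    congr 1 with y
    by_cases hy : y ∈ Ω <;> by_cases hy' : y + s • (θ : Space n) ∈ Ω <;> simp [hy, hy']
  simp_rw [h2]
  rw [lintegral_lintegral_swap (f := fun s y => Ω.indicator 1 (y + s • (θ : Space n)) * h y)]
  · refine setLIntegral_congr_fun hm fun y hy => ?_
    have h3 : Measurable fun s : ℝ => Ω.indicator (1 : Space n → ℝ≥0∞) (y + s • (θ : Space n)) :=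
      (measurable_one.indicator hm).comp (by fun_prop)
    rw [lintegral_mul_const _ h3]
    congr 1
    have h4 : ∫⁻ s in Ioi (0 : ℝ), Ω.indicator (1 : Space n → ℝ≥0∞) (y + s • (θ : Space n))
        = ∫⁻ s in Ioi (0 : ℝ), (Iio (tauPlus Ω y θ)).indicator 1 s := by
      refine setLIntegral_congr_fun measurableSet_Ioi fun s hs => ?_
      have := mem_iff_lt_tauPlus hΩ hy θ (le_of_lt hs)
      by_cases hlt : s < tauPlus Ω y θ
      · rw [indicator_of_mem (this.2 hlt), indicator_of_mem (mem_Iio.2 hlt)]; rfl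
      · rw [indicator_of_notMem (fun h => hlt (this.1 h)),
          indicator_of_notMem (s := Iio _) (fun h => hlt h)]
    rw [h4, lintegral_indicator_one measurableSet_Iio, Measure.restrict_apply measurableSet_Iio,
      Set.inter_comm, Ioi_inter_Iio, Real.volume_Ioo, sub_zero]
  · refine Measurable.aemeasurable ?_
    refine ((measurable_one.indicator hm).comp (by fun_prop)).mul (hh.comp measurable_snd)

/-- A property that holds almost everywhere in `Ω` holds along almost every line of a given
direction. -/
lemma ae_line_of_ae_fixed (hΩ : IsDomainC1 Ω) (θ : Sph n) {Q : Space n → Prop}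
    (hQ : ∀ᵐ x ∂(volume.restrict Ω), Q x) : ∀ᵐ x ∂(volume.restrict Ω),
      ∀ᵐ s ∂(volume.restrict (Ioo 0 (tauMinus Ω x θ))), Q (x - s • (θ : Space n)) := by
  have hm := hΩ.isOpen.measurableSet
  -- The integral formula is applied to the indicator of a measurable null set containing all
  -- exceptions; its integral along almost every line then vanishes.
  obtain ⟨N, hNs, hNm, hN0⟩ := exists_measurable_superset_of_null (ae_iff.1 hQ)
  have h0 := lintegral_line_fixed hΩ θ (h := N.indicator 1) (measurable_one.indicator hNm)
  have h1 : ∫⁻ y in Ω, ENNReal.ofReal (tauPlus Ω y θ) * N.indicator 1 y = 0 := by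
    rw [lintegral_eq_zero_of_ae_eq_zero]
    have : ∀ᵐ y ∂(volume.restrict Ω), y ∉ N := measure_eq_zero_iff_ae_notMem.1 hN0
    filter_upwards [this] with y hy
    simp [hy]
  have h2 : Measurable fun q : Space n × ℝ =>
      Ω.indicator (N.indicator (1 : Space n → ℝ≥0∞)) (q.1 - q.2 • (θ : Space n)) :=
    ((measurable_one.indicator hNm).indicator hm).comp (by fun_prop)
  rw [h1, lintegral_eq_zero_iff h2.lintegral_prod_right'] at h0
  filter_upwards [h0, ae_restrict_mem hm] with x hx hxΩ
  rw [Pi.zero_apply, lintegral_Ioi_indicator hΩ hxΩ, lintegral_eq_zero_iff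
    (f := fun s : ℝ => N.indicator (1 : Space n → ℝ≥0∞) (x - s • (θ : Space n)))
    ((measurable_one.indicator hNm).comp (by fun_prop))] at hx
  filter_upwards [hx] with s hs
  by_contra hc
  have : x - s • (θ : Space n) ∈ N := hNs hc
  simp [this] at hs

lemma lintegral_phase [SFinite (sphereMeasure n)] {H : Space n × Sph n → ℝ≥0∞}
    (hH : Measurable H) :
    ∫⁻ p, H p ∂(phaseMeasure Ω) = ∫⁻ θ, (∫⁻ x in Ω, H (x, θ)) ∂(sphereMeasure n) := by
  rw [phaseMeasure, lintegral_prod_symm _ hH.aemeasurable]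

lemma lintegral_lineInt_phase (hΩ : IsDomainC1 Ω) [SFinite (sphereMeasure n)]
    {H : Space n × Sph n → ℝ≥0∞} (hH : Measurable H) : ∫⁻ p, lineInt Ω H p ∂(phaseMeasure Ω) =
      ∫⁻ θ, (∫⁻ y in Ω, ENNReal.ofReal (tauPlus Ω y θ) * H (y, θ)) ∂(sphereMeasure n) := by
  rw [lintegral_phase (measurable_lineInt hΩ.isOpen hH)]
  congr 1 with θ
  simp_rw [lineInt_apply]
  exact lintegral_line_fixed hΩ θ (h := fun y => H (y, θ)) (by fun_prop)

/-- A property that holds almost everywhere in phase space holds along almost every line. -/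
lemma ae_line_of_ae (hΩ : IsDomainC1 Ω) [SFinite (sphereMeasure n)] {Q : Space n × Sph n → Prop}
    (hQ : ∀ᵐ p ∂(phaseMeasure Ω), Q p) : ∀ᵐ p ∂(phaseMeasure Ω),
      ∀ᵐ s ∂(volume.restrict (Ioo 0 (tauMinus Ω p.1 p.2))),
        Q (p.1 - s • (p.2 : Space n), p.2) := by
  obtain ⟨N, hNs, hNm, hN0⟩ := exists_measurable_superset_of_null (ae_iff.1 hQ)
  have hNi : Measurable (N.indicator (1 : Space n × Sph n → ℝ≥0∞)) :=
    measurable_one.indicator hNm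
  have h0 := lintegral_lineInt_phase hΩ hNi
  have h1 : ∀ᵐ θ ∂(sphereMeasure n), ∀ᵐ y ∂(volume.restrict Ω), (y, θ) ∉ N := by
    have h := measure_eq_zero_iff_ae_notMem.1 hN0
    exact ae_ae_of_ae_prod_swap h
  have h2 : ∫⁻ θ, (∫⁻ y in Ω, ENNReal.ofReal (tauPlus Ω y θ) * N.indicator 1 (y, θ))
      ∂(sphereMeasure n) = 0 := by
    rw [lintegral_eq_zero_of_ae_eq_zero]
    filter_upwards [h1] with θ hθ
    rw [Pi.zero_apply, lintegral_eq_zero_of_ae_eq_zero]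
    filter_upwards [hθ] with y hy
    simp [hy]
  rw [h2, lintegral_eq_zero_iff (measurable_lineInt hΩ.isOpen hNi)] at h0
  filter_upwards [h0, ae_phase_mem hΩ] with p hp hpΩ
  rw [Pi.zero_apply, lineInt_eq hΩ hpΩ, lintegral_eq_zero_iff
    (f := fun s : ℝ => N.indicator (1 : Space n × Sph n → ℝ≥0∞) (p.1 - s • (p.2 : Space n), p.2))
    (hNi.comp (by fun_prop))] at hp
  filter_upwards [hp] with s hs
  by_contra hc
  have : (p.1 - s • (p.2 : Space n), p.2) ∈ N := hNs hc
  simp [this] at hs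

lemma lineInt_mono_ae (hΩ : IsDomainC1 Ω) [SFinite (sphereMeasure n)]
    {H K : Space n × Sph n → ℝ≥0∞} (h : H ≤ᵐ[phaseMeasure Ω] K) :
    lineInt Ω H ≤ᵐ[phaseMeasure Ω] lineInt Ω K := by
  filter_upwards [ae_line_of_ae hΩ h, ae_phase_mem hΩ] with p hp hpΩ
  rw [lineInt_eq hΩ hpΩ, lineInt_eq hΩ hpΩ]
  exact lintegral_mono_ae hp

lemma lineInt_congr_ae (hΩ : IsDomainC1 Ω) [SFinite (sphereMeasure n)]
    {H K : Space n × Sph n → ℝ≥0∞} (h : H =ᵐ[phaseMeasure Ω] K) :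
    lineInt Ω H =ᵐ[phaseMeasure Ω] lineInt Ω K := by
  filter_upwards [lineInt_mono_ae hΩ h.le, lineInt_mono_ae hΩ h.symm.le] with p h1 h2
  exact le_antisymm h1 h2

lemma aemeasurable_lineInt (hΩ : IsDomainC1 Ω) [SFinite (sphereMeasure n)]
    {H : Space n × Sph n → ℝ≥0∞} (hH : AEMeasurable H (phaseMeasure Ω)) :
    AEMeasurable (lineInt Ω H) (phaseMeasure Ω) :=
  ⟨_, measurable_lineInt hΩ.isOpen hH.measurable_mk, lineInt_congr_ae hΩ hH.ae_eq_mk⟩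

lemma ae_tauPlus_le (hΩ : IsDomainC1 Ω) [SFinite (sphereMeasure n)] : ∀ᵐ p ∂(phaseMeasure Ω),
    tauPlus Ω p.1 p.2 ≤ (tauNorm Ω).toReal := by
  filter_upwards [ae_tau_le hΩ, ae_phase_mem hΩ] with p hp hpΩ
  linarith [tauMinus_pos hΩ hpΩ p.2]

lemma ae_tauMinus_le (hΩ : IsDomainC1 Ω) [SFinite (sphereMeasure n)] : ∀ᵐ p ∂(phaseMeasure Ω),
    tauMinus Ω p.1 p.2 ≤ (tauNorm Ω).toReal := by
  filter_upwards [ae_tau_le hΩ, ae_phase_mem hΩ] with p hp hpΩ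
  linarith [tauPlus_pos hΩ hpΩ p.2]

lemma ofReal_tauNorm (hΩ : IsDomainC1 Ω) [SFinite (sphereMeasure n)] :
    ENNReal.ofReal (tauNorm Ω).toReal = tauNorm Ω := ENNReal.ofReal_toReal (tauNorm_lt_top hΩ).ne

/-- The weight left by Tonelli is `tauPlus`, so integration along lines has norm at most `tauNorm`
on L¹. The companion bound for constants, `lineInt_const_le`, uses `tauMinus` instead. -/
lemma lintegral_lineInt_le (hΩ : IsDomainC1 Ω) [SFinite (sphereMeasure n)]
    {H : Space n × Sph n → ℝ≥0∞} (hH : AEMeasurable H (phaseMeasure Ω)) :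
    ∫⁻ p, lineInt Ω H p ∂(phaseMeasure Ω) ≤ tauNorm Ω * ∫⁻ p, H p ∂(phaseMeasure Ω) := by
  have hm := hH.measurable_mk
  rw [lintegral_congr_ae (lineInt_congr_ae hΩ hH.ae_eq_mk), lintegral_congr_ae hH.ae_eq_mk,
    lintegral_lineInt_phase hΩ hm, lintegral_phase hm]
  have h1 := ae_ae_of_ae_prod_swap (ae_tauPlus_le hΩ)
  rw [← lintegral_const_mul _ (Measurable.lintegral_prod_left' hm)]
  refine lintegral_mono_ae ?_
  filter_upwards [h1] with θ hθ
  rw [← lintegral_const_mul _ (by fun_prop)]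
  refine lintegral_mono_ae ?_
  filter_upwards [hθ] with y hy
  gcongr
  rw [← ofReal_tauNorm hΩ]
  exact ENNReal.ofReal_le_ofReal hy

lemma lineInt_const_le (hΩ : IsDomainC1 Ω) [SFinite (sphereMeasure n)] (c : ℝ≥0∞) :
    ∀ᵐ p ∂(phaseMeasure Ω), lineInt Ω (fun _ => c) p ≤ tauNorm Ω * c := by
  filter_upwards [ae_tauMinus_le hΩ, ae_phase_mem hΩ] with p hp hpΩ
  rw [lineInt_eq hΩ hpΩ, setLIntegral_const, Real.volume_Ioo, sub_zero, mul_comm]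
  gcongr
  rw [← ofReal_tauNorm hΩ]
  exact ENNReal.ofReal_le_ofReal hp

lemma lineInt_add_le {H K : Space n × Sph n → ℝ≥0∞} (hΩ : IsDomainC1 Ω)
    [SFinite (sphereMeasure n)] (hH : AEMeasurable H (phaseMeasure Ω)) :
    ∀ᵐ p ∂(phaseMeasure Ω), lineInt Ω (fun q => H q + K q) p = lineInt Ω H p + lineInt Ω K p := by
  have h1 : (fun q => H q + K q) =ᵐ[phaseMeasure Ω] fun q => hH.mk H q + K q := by
    filter_upwards [hH.ae_eq_mk] with q hq
    rw [hq]
  filter_upwards [lineInt_congr_ae hΩ h1, lineInt_congr_ae hΩ hH.ae_eq_mk, ae_phase_mem hΩ]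
    with p hp1 hp2 hpΩ
  rw [hp1, hp2, lineInt_eq hΩ hpΩ, lineInt_eq hΩ hpΩ, lineInt_eq hΩ hpΩ,
    lintegral_add_left
      (f := fun s : ℝ => hH.mk H (p.1 - s • (p.2 : Space n), p.2))
      (hH.measurable_mk.comp (by fun_prop))]

lemma lineInt_const_mul (hΩ : IsDomainC1 Ω) {c : ℝ≥0∞} (hc : c ≠ ⊤)
    (H : Space n × Sph n → ℝ≥0∞) {p : Space n × Sph n} (hp : p.1 ∈ Ω) :
    lineInt Ω (fun q => c * H q) p = c * lineInt Ω H p := by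
  rw [lineInt_eq hΩ hp, lineInt_eq hΩ hp, lintegral_const_mul' _ _ hc]

/-- Integrable functions on phase space are integrable along almost every line. -/
lemma ae_line_integrable (hΩ : IsDomainC1 Ω) [SFinite (sphereMeasure n)]
    {G : Space n × Sph n → ℝ} (hG : Integrable G (phaseMeasure Ω)) :
    ∀ᵐ p ∂(phaseMeasure Ω),
      IntegrableOn (fun s : ℝ => G (p.1 - s • (p.2 : Space n), p.2))
        (Ioo 0 (tauMinus Ω p.1 p.2)) := by
  have hm := hG.1.stronglyMeasurable_mk
  set G' := hG.1.mk G
  have hlt : ∫⁻ p, lineInt Ω (fun q => ‖G' q‖ₑ) p ∂(phaseMeasure Ω) < ⊤ := by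
    refine (lintegral_lineInt_le hΩ hm.enorm.aemeasurable).trans_lt ?_
    refine ENNReal.mul_lt_top (tauNorm_lt_top hΩ) ?_
    have : ∀ᵐ q ∂(phaseMeasure Ω), ‖G q‖ₑ = ‖G' q‖ₑ :=
      hG.1.ae_eq_mk.mono fun q hq => by rw [hq]
    rw [← lintegral_congr_ae this]
    exact hG.2
  filter_upwards [ae_lt_top (measurable_lineInt hΩ.isOpen hm.enorm) hlt.ne, ae_phase_mem hΩ,
    ae_line_of_ae hΩ hG.1.ae_eq_mk] with p hp hpΩ heq
  rw [lineInt_eq hΩ hpΩ] at hp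
  have : IntegrableOn (fun s : ℝ => G' (p.1 - s • (p.2 : Space n), p.2))
      (Ioo 0 (tauMinus Ω p.1 p.2)) :=
    ⟨(hm.comp_measurable (by fun_prop)).aestronglyMeasurable, hp⟩
  exact this.congr (heq.mono fun s hs => hs.symm)

/-- A truncated fixed point inequality for the averaged line integral is a bound. -/
lemma ae_le_of_le_lineInt (hΩ : IsDomainC1 Ω) [IsProbabilityMeasure (sphereMeasure n)]
    {D : Space n → ℝ≥0∞} (hD : AEMeasurable D (volume.restrict Ω))
    (hfin : ∫⁻ x in Ω, D x ≠ ⊤) {F F' κ₀ : ℝ≥0∞} (hκ₀ : κ₀ ≠ ⊤) (hκ : κ₀ * tauNorm Ω < 1)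
    (hF' : F + κ₀ * tauNorm Ω * F' ≤ F')
    (h : ∀ᵐ x ∂(volume.restrict Ω),
      D x ≤ F + κ₀ * ∫⁻ θ, lineInt Ω (fun q => D q.1) (x, θ) ∂(sphereMeasure n)) :
    ∀ᵐ x ∂(volume.restrict Ω), D x ≤ F' := by
  -- The constant F' is a supersolution, so the excess E = (D - F')₊ satisfies the inequality
  -- without the constant term. Integrating, ∫E ≤ κ₀‖τ‖∫E with factor below 1, and ∫E is finite
  -- because ∫D is; hence E = 0.
  set E : Space n → ℝ≥0∞ := fun x => D x - F' with hE
  have hEm : AEMeasurable E (volume.restrict Ω) := hD.sub_const _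
  have hEp : AEMeasurable (fun q : Space n × Sph n => E q.1) (phaseMeasure Ω) :=
    hEm.comp_quasiMeasurePreserving Measure.quasiMeasurePreserving_fst
  have hle : (fun q : Space n × Sph n => D q.1) ≤ᵐ[phaseMeasure Ω] fun q => F' + E q.1 :=
    Eventually.of_forall fun q => le_add_tsub
  have h1 : ∀ᵐ p ∂(phaseMeasure Ω), lineInt Ω (fun q => D q.1) p
      ≤ tauNorm Ω * F' + lineInt Ω (fun q => E q.1) p := by
    filter_upwards [lineInt_mono_ae hΩ hle, lineInt_const_le hΩ F',
      lineInt_add_le (H := fun _ => F') (K := fun q => E q.1) hΩ aemeasurable_const]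
      with p hp1 hp2 hp3
    refine hp1.trans (hp3.le.trans ?_)
    gcongr
  have h2 := Measure.ae_ae_of_ae_prod h1
  have h3 : ∀ᵐ x ∂(volume.restrict Ω),
      E x ≤ κ₀ * ∫⁻ θ, lineInt Ω (fun q => E q.1) (x, θ) ∂(sphereMeasure n) := by
    filter_upwards [h, h2] with x hx hx2
    have h4 : ∫⁻ θ, lineInt Ω (fun q => D q.1) (x, θ) ∂(sphereMeasure n)
        ≤ tauNorm Ω * F' + ∫⁻ θ, lineInt Ω (fun q => E q.1) (x, θ) ∂(sphereMeasure n) := by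
      refine (lintegral_mono_ae hx2).trans ?_
      rw [lintegral_add_left measurable_const, lintegral_const, measure_univ, mul_one]
    rw [hE, tsub_le_iff_left]
    calc D x ≤ _ := hx
      _ ≤ F + κ₀ * (tauNorm Ω * F' +
          ∫⁻ θ, lineInt Ω (fun q => E q.1) (x, θ) ∂(sphereMeasure n)) := by gcongr
      _ = (F + κ₀ * tauNorm Ω * F') +
          κ₀ * ∫⁻ θ, lineInt Ω (fun q => E q.1) (x, θ) ∂(sphereMeasure n) := by ring
      _ ≤ _ := by gcongr
  have h5 : ∫⁻ x in Ω, E x ≤ κ₀ * tauNorm Ω * ∫⁻ x in Ω, E x := by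
    calc ∫⁻ x in Ω, E x
        ≤ ∫⁻ x in Ω, κ₀ * ∫⁻ θ, lineInt Ω (fun q => E q.1) (x, θ) ∂(sphereMeasure n) :=
          lintegral_mono_ae h3
      _ = κ₀ * ∫⁻ p, lineInt Ω (fun q => E q.1) p ∂(phaseMeasure Ω) := by
          rw [lintegral_const_mul' _ _ hκ₀, phaseMeasure,
            lintegral_prod _ (aemeasurable_lineInt hΩ hEp)]
      _ ≤ κ₀ * (tauNorm Ω * ∫⁻ p, E p.1 ∂(phaseMeasure Ω)) := by
          gcongr
          exact lintegral_lineInt_le hΩ hEp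
      _ = κ₀ * tauNorm Ω * ∫⁻ x in Ω, E x := by
          rw [phaseMeasure, lintegral_prod _ hEp, mul_assoc]
          simp
  have hEfin : ∫⁻ x in Ω, E x ≠ ⊤ :=
    ((lintegral_mono fun x => tsub_le_self).trans_lt hfin.lt_top).ne
  have h6 : ∫⁻ x in Ω, E x = 0 := by
    by_contra hne
    have : κ₀ * tauNorm Ω * ∫⁻ x in Ω, E x < 1 * ∫⁻ x in Ω, E x :=
      ENNReal.mul_lt_mul_left hne hEfin hκ
    rw [one_mul] at this
    exact absurd h5 (not_le.2 this)
  rw [lintegral_eq_zero_iff' hEm] at h6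
  filter_upwards [h6] with x hx
  exact tsub_eq_zero_iff_le.1 hx

end TwoPhoton

end

noncomputable section

namespace TwoPhoton

variable {n : ℕ} {Ω : Set (Space n)}

/-! ### From the weak transport equation to integration along lines -/

/-- The measure `dx dθ` on the whole space. -/
def fullMeasure (n : ℕ) : Measure (Space n × Sph n) :=
  (volume : Measure (Space n)).prod (sphereMeasure n)

lemma phaseMeasure_eq_restrict [SFinite (sphereMeasure n)] :
    phaseMeasure Ω = (fullMeasure n).restrict (Ω ×ˢ univ) := by
  rw [phaseMeasure, fullMeasure, ← Measure.prod_restrict, Measure.restrict_univ]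

/-- Translation along the characteristic direction. -/
def shear (s : ℝ) (p : Space n × Sph n) : Space n × Sph n := (p.1 + s • (p.2 : Space n), p.2)

lemma measurable_shear (s : ℝ) : Measurable (shear (n := n) s) := by
  unfold shear
  fun_prop

lemma measurePreserving_shear [SFinite (sphereMeasure n)] (s : ℝ) :
    MeasurePreserving (shear s) (fullMeasure n) (fullMeasure n) := by
  refine ⟨measurable_shear s, Measure.ext_of_lintegral _ fun f hf => ?_⟩
  rw [lintegral_map hf (measurable_shear s), fullMeasure,
    lintegral_prod_symm (fun p => f (shear s p)) (hf.comp (measurable_shear s)).aemeasurable,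
    lintegral_prod_symm _ hf.aemeasurable]
  congr 1 with θ
  exact lintegral_add_right_eq_self (fun x => f (x, θ)) (s • (θ : Space n))

/-- Translation along the characteristic direction, as an equivalence. -/
def shearEquiv (s : ℝ) : (Space n × Sph n) ≃ᵐ (Space n × Sph n) where
  toFun := shear s
  invFun := shear (-s)
  left_inv p := by simp [shear]
  right_inv p := by simp [shear]
  measurable_toFun := measurable_shear s
  measurable_invFun := measurable_shear (-s)

lemma integral_shear [SFinite (sphereMeasure n)] (s : ℝ) (f : Space n × Sph n → ℝ) :
    ∫ p, f (shear s p) ∂(fullMeasure n) = ∫ p, f p ∂(fullMeasure n) :=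
  (measurePreserving_shear s).integral_comp (shearEquiv s).measurableEmbedding f

lemma stronglyMeasurable_shear_neg {G : Space n × Sph n → ℝ} (hG : StronglyMeasurable G) :
    StronglyMeasurable fun q : ℝ × (Space n × Sph n) => G (shear (-q.1) q.2) :=
  hG.comp_measurable (by unfold shear; fun_prop)

lemma integrable_shear_prod [SFinite (sphereMeasure n)] {G : Space n × Sph n → ℝ}
    (hGm : StronglyMeasurable G) (hG : Integrable G (fullMeasure n)) (s : ℝ) :
    Integrable (fun q : ℝ × (Space n × Sph n) => G (shear (-q.1) q.2))
      ((volume.restrict (Ioc 0 s)).prod (fullMeasure n)) := by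
  have : SFinite (fullMeasure n) := by unfold fullMeasure; infer_instance
  rw [integrable_prod_iff (stronglyMeasurable_shear_neg hGm).aestronglyMeasurable]
  refine ⟨Eventually.of_forall fun r => (measurePreserving_shear (-r)).integrable_comp_of_integrable hG, ?_⟩
  have : ∀ r : ℝ, ∫ p, ‖G (shear (-r) p)‖ ∂(fullMeasure n) = ∫ p, ‖G p‖ ∂(fullMeasure n) :=
    fun r => integral_shear (-r) fun p => ‖G p‖
  simp only [this]
  exact integrable_const _

lemma continuous_shearE (r : ℝ) :
    Continuous fun z : Space n × Space n => (z.1 + r • z.2, z.2) := by fun_prop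

/-- Translation along the direction given by the second component. -/
def shearHomeo (r : ℝ) : (Space n × Space n) ≃ₜ (Space n × Space n) where
  toFun z := (z.1 + r • z.2, z.2)
  invFun z := (z.1 + (-r) • z.2, z.2)
  left_inv z := by simp
  right_inv z := by simp
  continuous_toFun := continuous_shearE r
  continuous_invFun := continuous_shearE (-r)

/-- The weak equation is tested with Φ(x + rθ, θ) for 0 ≤ r ≤ s and integrated in r. The derivative
integrates to Φ(x + sθ, θ) - Φ(x, θ), and invariance of the measure under shears moves the
translations from Φ onto U and G. -/
lemma integral_line_weak [SFinite (sphereMeasure n)] (hΩ : Convex ℝ Ω)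
    {U G : Space n × Sph n → ℝ}
    (hUi : Integrable U (fullMeasure n))
    (hGm : StronglyMeasurable G) (hGi : Integrable G (fullMeasure n))
    (hweak : ∀ φ : Space n × Space n → ℝ, ContDiff ℝ ∞ φ → HasCompactSupport φ →
      tsupport φ ⊆ Ω ×ˢ univ →
      ∫ p : Space n × Sph n, U p *
        fderiv ℝ (fun y : Space n => φ (y, (p.2 : Space n))) p.1 (p.2 : Space n) ∂(fullMeasure n)
      = -∫ p : Space n × Sph n, G p * φ (p.1, (p.2 : Space n)) ∂(fullMeasure n))
    {s : ℝ} (hs : 0 ≤ s) {Φ : Space n × Space n → ℝ} (hΦ : ContDiff ℝ ∞ Φ)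
    (hΦc : HasCompactSupport Φ)
    (hΦs : tsupport Φ ⊆ {z | z.1 ∈ Ω ∧ z.1 - s • z.2 ∈ Ω}) :
    ∫ p : Space n × Sph n, (U p - U (shear (-s) p) - ∫ r in Ioc 0 s, G (shear (-r) p))
      * Φ (p.1, (p.2 : Space n)) ∂(fullMeasure n) = 0 := by
  have : SFinite (fullMeasure n) := by unfold fullMeasure; infer_instance
  obtain ⟨B, hB⟩ := hΦ.continuous.bounded_above_of_compact_support hΦc
  set ψ : Space n × Sph n → ℝ := fun p => Φ (p.1, (p.2 : Space n)) with hψ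
  have hψm : StronglyMeasurable ψ :=
    (hΦ.continuous.comp (by fun_prop)).stronglyMeasurable
  have hψb : ∀ p, ‖ψ p‖ ≤ B := fun p => hB _
  set D : Space n × Sph n → ℝ := fun p =>
    fderiv ℝ Φ (p.1, (p.2 : Space n)) ((p.2 : Space n), 0) with hD
  have hDcont : Continuous D := by
    have := hΦ.continuous_fderiv (by simp)
    fun_prop
  obtain ⟨B', hB'⟩ := (hΦ.continuous_fderiv (by simp)).bounded_above_of_compact_support
    (hΦc.fderiv (𝕜 := ℝ))
  have hDb : ∀ p, ‖D p‖ ≤ B' := fun p => by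
    refine (ContinuousLinearMap.le_opNorm _ _).trans ?_
    have : ‖((p.2 : Space n), (0 : Space n))‖ ≤ 1 := by simp [Prod.norm_def]
    calc _ ≤ B' * 1 := by
          gcongr
          · exact (norm_nonneg _).trans (hB' (0, 0))
          · exact hB' _
      _ = B' := mul_one _
  have hshear : ∀ (r : ℝ) (p : Space n × Sph n), HasDerivAt (fun r => ψ (shear r p)) (D (shear r p)) r := by
    intro r p
    have h1 : HasFDerivAt Φ (fderiv ℝ Φ (p.1 + r • (p.2 : Space n), (p.2 : Space n)))
        (p.1 + r • (p.2 : Space n), (p.2 : Space n)) :=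
      (hΦ.differentiable (by simp) _).hasFDerivAt
    have h2 : HasDerivAt (fun r : ℝ => (p.1 + r • (p.2 : Space n), (p.2 : Space n)))
        ((p.2 : Space n), (0 : Space n)) r := by
      refine HasDerivAt.prodMk ?_ (hasDerivAt_const _ _)
      simpa using ((hasDerivAt_id r).smul_const (p.2 : Space n)).const_add p.1
    exact h1.comp_hasDerivAt r h2
  have hwr : ∀ r ∈ Icc 0 s, ∫ p, U p * D (shear r p) ∂(fullMeasure n)
      = -∫ p, G (shear (-r) p) * ψ p ∂(fullMeasure n) := by
    intro r hr
    have hsh : ContDiff ℝ ∞ fun z : Space n × Space n => (z.1 + r • z.2, z.2) := by fun_prop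
    have hsupp : tsupport (fun z : Space n × Space n => Φ (z.1 + r • z.2, z.2))
        ⊆ Ω ×ˢ univ := by
      intro z hz
      have hz' : (z.1 + r • z.2, z.2) ∈ tsupport Φ :=
        tsupport_comp_subset_preimage Φ (continuous_shearE r) hz
      obtain ⟨h1, h2⟩ := hΦs hz'
      refine ⟨?_, mem_univ _⟩
      simp only at h1 h2
      -- Convexity keeps every translate supported in Ω: the point z.1 is the convex combination,
      -- with weight r/s, of z.1 + r z.2 and z.1 + (r - s) z.2, both in Ω. For s = 0 there is only r
      -- = 0.
      rcases hs.lt_or_eq with hs' | hs'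
      · have := hΩ h1 h2 (a := 1 - r / s) (b := r / s)
          (by rw [sub_nonneg]; exact div_le_one_of_le₀ hr.2 hs) (div_nonneg hr.1 hs) (by ring)
        convert this using 1
        rw [smul_sub, smul_smul (r / s) s, div_mul_cancel₀ _ hs'.ne', sub_smul, one_smul]
        abel
      · have : r = 0 := le_antisymm (hs' ▸ hr.2) hr.1
        simpa [this] using h1
    have := hweak _ (hΦ.comp hsh) (hΦc.comp_homeomorph (shearHomeo r)) hsupp
    have e1 : ∀ p : Space n × Sph n,
        fderiv ℝ (fun y : Space n => Φ (y + r • (p.2 : Space n), (p.2 : Space n))) p.1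
          (p.2 : Space n) = D (shear r p) := fun p => by
      have h1 : HasFDerivAt Φ (fderiv ℝ Φ (p.1 + r • (p.2 : Space n), (p.2 : Space n)))
          (p.1 + r • (p.2 : Space n), (p.2 : Space n)) :=
        (hΦ.differentiable (by simp) _).hasFDerivAt
      have h2 : HasFDerivAt (fun y : Space n => (y + r • (p.2 : Space n), (p.2 : Space n)))
          ((ContinuousLinearMap.id ℝ (Space n)).prod 0) p.1 :=
        ((hasFDerivAt_id p.1).add_const _).prodMk (hasFDerivAt_const _ _)
      have h3 : HasFDerivAt (fun y : Space n => Φ (y + r • (p.2 : Space n), (p.2 : Space n))) _ p.1 :=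
        h1.comp p.1 h2
      rw [h3.fderiv]
      rfl
    have e2 : ∫ p, G (shear (-r) p) * ψ p ∂(fullMeasure n)
        = ∫ p, G p * ψ (shear r p) ∂(fullMeasure n) := by
      rw [← integral_shear r]
      congr 1 with p
      simp [shear]
    rw [e2]
    simp only [Function.comp_def, e1] at this
    exact this
  have hGΦ : Integrable (fun q : ℝ × (Space n × Sph n) => G (shear (-q.1) q.2) * ψ q.2)
      ((volume.restrict (Ioc 0 s)).prod (fullMeasure n)) :=
    (integrable_shear_prod hGm hGi s).mul_bdd (c := B)
      (hψm.comp_measurable measurable_snd).aestronglyMeasurable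
      (Eventually.of_forall fun q => hψb _)
  have hUD : Integrable (fun q : ℝ × (Space n × Sph n) => U q.2 * D (shear q.1 q.2))
      ((volume.restrict (Ioc 0 s)).prod (fullMeasure n)) := by
    refine Integrable.mul_bdd (c := B') (hUi.comp_snd _) ?_ (Eventually.of_forall fun q => hDb _)
    exact (hDcont.comp (by unfold shear; fun_prop)).aestronglyMeasurable
  have hI1 : Integrable (fun p => U p * ψ p) (fullMeasure n) :=
    hUi.mul_bdd hψm.aestronglyMeasurable (Eventually.of_forall hψb)
  have hI2 : Integrable (fun p => U (shear (-s) p) * ψ p) (fullMeasure n) :=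
    ((measurePreserving_shear (-s)).integrable_comp_of_integrable hUi).mul_bdd
      hψm.aestronglyMeasurable (Eventually.of_forall hψb)
  have hI2' : Integrable (fun p => U p * ψ (shear s p)) (fullMeasure n) :=
    hUi.mul_bdd (hψm.comp_measurable (measurable_shear s)).aestronglyMeasurable
      (Eventually.of_forall fun p => hψb _)
  have hI3 : Integrable (fun p => (∫ r in Ioc 0 s, G (shear (-r) p)) * ψ p) (fullMeasure n) := by
    have := hGΦ.integral_prod_right
    simpa only [integral_mul_const] using this
  have k1 : ∫ p, (∫ r in Ioc 0 s, G (shear (-r) p)) * ψ p ∂(fullMeasure n)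
      = -∫ p, U p * (ψ (shear s p) - ψ p) ∂(fullMeasure n) := by
    have a1 : ∫ p, (∫ r in Ioc 0 s, G (shear (-r) p)) * ψ p ∂(fullMeasure n)
        = ∫ r in Ioc 0 s, ∫ p, G (shear (-r) p) * ψ p ∂(fullMeasure n) := by
      simp only [← integral_mul_const]
      exact (integral_integral_swap hGΦ).symm
    have a2 : ∫ r in Ioc 0 s, (∫ p, U p * D (shear r p) ∂(fullMeasure n))
        = ∫ p, U p * (ψ (shear s p) - ψ p) ∂(fullMeasure n) := by
      rw [integral_integral_swap hUD]
      congr 1 with p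
      rw [integral_const_mul, ← intervalIntegral.integral_of_le hs,
        intervalIntegral.integral_eq_sub_of_hasDerivAt (fun r _ => hshear r p)
          (Continuous.intervalIntegrable (hDcont.comp (by unfold shear; fun_prop)) _ _)]
      simp [shear]
    rw [a1, ← a2, ← integral_neg]
    refine setIntegral_congr_fun measurableSet_Ioc fun r hr => ?_
    have := hwr r ⟨hr.1.le, hr.2⟩
    simp only [this, neg_neg]
  have k2 : ∫ p, U (shear (-s) p) * ψ p ∂(fullMeasure n)
      = ∫ p, U p * ψ (shear s p) ∂(fullMeasure n) := by
    rw [← integral_shear s]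
    congr 1 with p
    simp [shear]
  have k3 : ∫ p, U p * (ψ (shear s p) - ψ p) ∂(fullMeasure n)
      = ∫ p, U p * ψ (shear s p) ∂(fullMeasure n) - ∫ p, U p * ψ p ∂(fullMeasure n) := by
    rw [← integral_sub hI2' hI1]
    congr 1 with p
    ring
  calc _ = ∫ p, (U p * ψ p - U (shear (-s) p) * ψ p
        - (∫ r in Ioc 0 s, G (shear (-r) p)) * ψ p) ∂(fullMeasure n) := by
        congr 1 with p
        ring
    _ = 0 := by
        rw [integral_sub (f := fun p => U p * ψ p - U (shear (-s) p) * ψ p) (hI1.sub hI2) hI3,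
          integral_sub hI1 hI2, k1, k2, k3]
        ring

lemma measurableEmbedding_coe : MeasurableEmbedding
    (fun p : Space n × Sph n => (p.1, (p.2 : Space n))) :=
  MeasurableEmbedding.id.prodMap (MeasurableEmbedding.subtype_coe
    (Metric.isClosed_sphere.measurableSet))

/-- The fundamental lemma of the calculus of variations, for the pushforward of the measure under
the embedding of Ω × 𝕊 directions into a product of two vector spaces, where the test functions
live. The function W is extended by zero off the sphere; only its values on the image matter. -/
lemma ae_line_weak_fixed [SFinite (sphereMeasure n)] (hΩ : Convex ℝ Ω) (ho : IsOpen Ω)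
    {U G : Space n × Sph n → ℝ}
    (hUi : Integrable U (fullMeasure n))
    (hGm : StronglyMeasurable G) (hGi : Integrable G (fullMeasure n))
    (hweak : ∀ φ : Space n × Space n → ℝ, ContDiff ℝ ∞ φ → HasCompactSupport φ →
      tsupport φ ⊆ Ω ×ˢ univ →
      ∫ p : Space n × Sph n, U p *
        fderiv ℝ (fun y : Space n => φ (y, (p.2 : Space n))) p.1 (p.2 : Space n) ∂(fullMeasure n)
      = -∫ p : Space n × Sph n, G p * φ (p.1, (p.2 : Space n)) ∂(fullMeasure n))
    {s : ℝ} (hs : 0 ≤ s) :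
    ∀ᵐ p ∂(fullMeasure n), p.1 ∈ Ω → (shear (-s) p).1 ∈ Ω →
      U p - U (shear (-s) p) - ∫ r in Ioc 0 s, G (shear (-r) p) = 0 := by
  have : SFinite (fullMeasure n) := by unfold fullMeasure; infer_instance
  set ι : Space n × Sph n → Space n × Space n := fun p => (p.1, (p.2 : Space n)) with hι
  have hemb : MeasurableEmbedding ι := measurableEmbedding_coe
  set W : Space n × Sph n → ℝ := fun p =>
    U p - U (shear (-s) p) - ∫ r in Ioc 0 s, G (shear (-r) p) with hW
  have hWi : Integrable W (fullMeasure n) :=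
    (hUi.sub ((measurePreserving_shear (-s)).integrable_comp_of_integrable hUi)).sub
      (integrable_shear_prod hGm hGi s).integral_prod_right
  set F : Space n × Space n → ℝ := Function.extend ι W 0
  have hF : ∀ p, F (ι p) = W p := fun p => hemb.injective.extend_apply _ _ _
  have hFi : Integrable F (Measure.map ι (fullMeasure n)) := by
    rw [hemb.integrable_map_iff]
    exact hWi.congr (Eventually.of_forall fun p => (hF p).symm)
  have hopen : IsOpen {z : Space n × Space n | z.1 ∈ Ω ∧ z.1 - s • z.2 ∈ Ω} :=
    (ho.preimage continuous_fst).inter (ho.preimage (by fun_prop))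
  have := hopen.ae_eq_zero_of_integral_contDiff_smul_eq_zero
    (hFi.locallyIntegrable.locallyIntegrableOn _) (fun Φ h1 h2 h3 => by
      rw [hemb.integral_map]
      simp only [hF, smul_eq_mul]
      rw [← integral_line_weak hΩ hUi hGm hGi hweak hs h1 h2 h3]
      congr 1 with p
      ring)
  rw [hemb.ae_map_iff] at this
  filter_upwards [this] with p hp h1 h2
  have h3 := hp ⟨h1, by simpa [hι, shear, sub_eq_add_neg] using h2⟩
  rwa [hF] at h3

/-- Fubini exchanges "for each s, almost every p" with "almost every p, almost every s". This needs
joint measurability in (s, p), hence the strongly measurable representatives. -/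
lemma ae_line_weak [SFinite (sphereMeasure n)] (hΩ : Convex ℝ Ω) (ho : IsOpen Ω)
    {U G : Space n × Sph n → ℝ}
    (hUm : StronglyMeasurable U) (hUi : Integrable U (fullMeasure n))
    (hGm : StronglyMeasurable G) (hGi : Integrable G (fullMeasure n))
    (hweak : ∀ φ : Space n × Space n → ℝ, ContDiff ℝ ∞ φ → HasCompactSupport φ →
      tsupport φ ⊆ Ω ×ˢ univ →
      ∫ p : Space n × Sph n, U p *
        fderiv ℝ (fun y : Space n => φ (y, (p.2 : Space n))) p.1 (p.2 : Space n) ∂(fullMeasure n)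
      = -∫ p : Space n × Sph n, G p * φ (p.1, (p.2 : Space n)) ∂(fullMeasure n)) :
    ∀ᵐ p ∂(fullMeasure n), ∀ᵐ s ∂(volume.restrict (Ioi (0 : ℝ))),
      p.1 ∈ Ω → (shear (-s) p).1 ∈ Ω →
        U p - U (shear (-s) p) - ∫ r in Ioc 0 s, G (shear (-r) p) = 0 := by
  have : SFinite (fullMeasure n) := by unfold fullMeasure; infer_instance
  rw [← Measure.ae_ae_comm (μ := volume.restrict (Ioi (0 : ℝ)))
    (p := fun s p => p.1 ∈ Ω → (shear (-s) p).1 ∈ Ω →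
        U p - U (shear (-s) p) - ∫ r in Ioc 0 s, G (shear (-r) p) = 0)]
  · filter_upwards [ae_restrict_mem measurableSet_Ioi] with s hs
    exact ae_line_weak_fixed hΩ ho hUi hGm hGi hweak (le_of_lt hs)
  · have m1 : Measurable fun q : ℝ × (Space n × Sph n) => U q.2 - U (shear (-q.1) q.2)
        - ∫ r in Ioc 0 q.1, G (shear (-r) q.2) := by
      refine ((hUm.measurable.comp measurable_snd).sub
        (stronglyMeasurable_shear_neg hUm).measurable).sub ?_
      have : (fun q : ℝ × (Space n × Sph n) => ∫ r in Ioc 0 q.1, G (shear (-r) q.2))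
          = fun q => ∫ r, {z : (ℝ × (Space n × Sph n)) × ℝ | 0 < z.2 ∧ z.2 ≤ z.1.1}.indicator
            (fun z => G (shear (-z.2) z.1.2)) (q, r) := by
        ext q
        rw [← integral_indicator measurableSet_Ioc]
        rfl
      rw [this]
      refine StronglyMeasurable.measurable ?_
      refine StronglyMeasurable.integral_prod_right
        (f := fun q r => {z : (ℝ × (Space n × Sph n)) × ℝ | 0 < z.2 ∧ z.2 ≤ z.1.1}.indicator
            (fun z => G (shear (-z.2) z.1.2)) (q, r)) ?_
      refine StronglyMeasurable.indicator (hGm.comp_measurable (by unfold shear; fun_prop)) ?_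
      exact (measurableSet_lt measurable_const measurable_snd).inter
        (measurableSet_le measurable_snd (by fun_prop))
    have m2 : MeasurableSet {q : ℝ × (Space n × Sph n) | q.2.1 ∈ Ω} :=
      ho.measurableSet.preimage (by fun_prop)
    have m3 : MeasurableSet {q : ℝ × (Space n × Sph n) | (shear (-q.1) q.2).1 ∈ Ω} :=
      ho.measurableSet.preimage (by unfold shear; fun_prop)
    have m4 := measurableSet_eq_fun m1 (measurable_const (a := (0 : ℝ)))
    exact m2.imp (m3.imp m4)

/-- Left neighbourhoods have positive measure, so essential limits from the left are unique. This is
why the boundary condition prescribes a definite value on almost every line. -/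
lemma neBot_nhdsLT_inf_ae (a : ℝ) : (𝓝[<] a ⊓ ae (volume : Measure ℝ)).NeBot := by
  rw [Filter.inf_neBot_iff]
  intro A hA B hB
  obtain ⟨l, hl, hlA⟩ := (mem_nhdsLT_iff_exists_Ioo_subset (a := a)).1 hA
  by_contra hne
  rw [not_nonempty_iff_eq_empty] at hne
  have hsub : Ioo l a ⊆ Bᶜ := fun x hx hxB => by
    have : x ∈ A ∩ B := ⟨hlA hx, hxB⟩
    rw [hne] at this
    exact this
  have h0 := measure_mono_null hsub (mem_ae_iff.1 hB)
  rw [Real.volume_Ioo, ENNReal.ofReal_eq_zero] at h0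
  have := mem_Iio.1 hl
  linarith

/-- A solution of the weak transport equation with given boundary values is the boundary value
plus the integral of the transport derivative along the characteristic line. -/
lemma eq_boundary_add_integral [SFinite (sphereMeasure n)] (hΩ : IsDomainC1 Ω)
    {u g f : Space n → Sph n → ℝ}
    (hu : Integrable (fun p : Space n × Sph n => u p.1 p.2) (phaseMeasure Ω))
    (hg : Integrable (fun p : Space n × Sph n => g p.1 p.2) (phaseMeasure Ω))
    (hweak : IsWeakTransportDeriv Ω u g)
    (hbd : ∀ᵐ p ∂(phaseMeasure Ω),
      Tendsto (fun s : ℝ => u (p.1 - s • (p.2 : Space n)) p.2)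
        (𝓝[<] (tauMinus Ω p.1 p.2) ⊓ ae volume)
        (𝓝 (f (p.1 - tauMinus Ω p.1 p.2 • (p.2 : Space n)) p.2))) :
    ∀ᵐ p ∂(phaseMeasure Ω), u p.1 p.2 = f (p.1 - tauMinus Ω p.1 p.2 • (p.2 : Space n)) p.2
      + ∫ s in (0 : ℝ)..(tauMinus Ω p.1 p.2), g (p.1 - s • (p.2 : Space n)) p.2 := by
  have hm : MeasurableSet (Ω ×ˢ (univ : Set (Sph n))) :=
    hΩ.isOpen.measurableSet.prod MeasurableSet.univ
  -- Representatives that are strongly measurable and vanish outside Ω, so that translates make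
  -- sense on the whole space and the integrals over Ω become integrals over it.
  have rep : ∀ {v : Space n → Sph n → ℝ},
      Integrable (fun p : Space n × Sph n => v p.1 p.2) (phaseMeasure Ω) →
      ∃ V : Space n × Sph n → ℝ, StronglyMeasurable V ∧ Integrable V (fullMeasure n) ∧
        (∀ᵐ p ∂(phaseMeasure Ω), v p.1 p.2 = V p) ∧ (∀ p, p ∉ Ω ×ˢ (univ : Set (Sph n)) → V p = 0) := by
    intro v hv
    refine ⟨(Ω ×ˢ univ).indicator (hv.1.mk _), hv.1.stronglyMeasurable_mk.indicator hm, ?_, ?_, ?_⟩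
    · rw [integrable_indicator_iff hm, IntegrableOn, ← phaseMeasure_eq_restrict]
      exact hv.congr hv.1.ae_eq_mk
    · filter_upwards [hv.1.ae_eq_mk, ae_phase_mem hΩ] with p hp hpΩ
      rw [indicator_of_mem (mk_mem_prod hpΩ (mem_univ _)), ← hp]
    · intro p hp
      exact indicator_of_notMem hp _
  obtain ⟨U, hUm, hUi, hUe, hU0⟩ := rep hu
  obtain ⟨G, hGm, hGi, hGe, hG0⟩ := rep hg
  have full : ∀ (V : Space n × Sph n → ℝ) (φ : Space n × Sph n → ℝ),
      (∀ p, p ∉ Ω ×ˢ (univ : Set (Sph n)) → V p = 0) →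
      ∫ p, V p * φ p ∂(phaseMeasure Ω) = ∫ p, V p * φ p ∂(fullMeasure n) := by
    intro V φ hV
    rw [phaseMeasure_eq_restrict]
    exact setIntegral_eq_integral_of_forall_compl_eq_zero fun p hp => by rw [hV p hp, zero_mul]
  have hw := ae_line_weak hΩ.convex hΩ.isOpen hUm hUi hGm hGi (fun φ h1 h2 h3 => by
    have := hweak φ h1 h2 h3
    rw [← full U _ hU0, ← full G _ hG0]
    rw [integral_congr_ae (g := fun p => U p *
        fderiv ℝ (fun y : Space n => φ (y, (p.2 : Space n))) p.1 (p.2 : Space n))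
        (hUe.mono fun p hp => by simp only [hp])] at this
    rw [this, integral_congr_ae (g := fun p => G p * φ (p.1, (p.2 : Space n)))
      (hGe.mono fun p hp => by simp only [hp])])
  have hw' : ∀ᵐ p ∂(phaseMeasure Ω), ∀ᵐ s ∂(volume.restrict (Ioi (0 : ℝ))),
      p.1 ∈ Ω → (shear (-s) p).1 ∈ Ω →
        U p - U (shear (-s) p) - ∫ r in Ioc 0 s, G (shear (-r) p) = 0 := by
    rw [phaseMeasure_eq_restrict]
    exact ae_restrict_of_ae hw
  have hGint := ae_line_integrable hΩ hg
  filter_upwards [hw', hbd, hGint, ae_line_of_ae hΩ hUe, ae_line_of_ae hΩ hGe, ae_phase_mem hΩ, hUe]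
    with p h1 h2 h3 h4 h5 hpΩ h6
  have hτ := tauMinus_pos hΩ hpΩ p.2
  set τ := tauMinus Ω p.1 p.2 with hτd
  have hsh : ∀ s : ℝ, shear (-s) p = (p.1 - s • (p.2 : Space n), p.2) := fun s => by
    simp [shear, sub_eq_add_neg]
  have hI : IntervalIntegrable (fun s : ℝ => g (p.1 - s • (p.2 : Space n)) p.2) volume 0 τ := by
    rw [intervalIntegrable_iff_integrableOn_Ioo_of_le hτ.le]
    exact h3
  -- Going back a distance s from p lowers the value by the integral of g over (0, s). Letting s
  -- increase to τ, the left side tends to the boundary value and the right side is continuous,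
  -- which gives the claim.
  have key : ∀ᵐ s ∂(volume : Measure ℝ), s ∈ Ioo 0 τ → u (p.1 - s • (p.2 : Space n)) p.2
      = u p.1 p.2 - ∫ r in (0 : ℝ)..s, g (p.1 - r • (p.2 : Space n)) p.2 := by
    have h1' := (ae_restrict_iff' measurableSet_Ioi).1 h1
    have h4' := (ae_restrict_iff' measurableSet_Ioo).1 h4
    have h5' := (ae_restrict_iff' measurableSet_Ioo).1 h5
    filter_upwards [h1', h4'] with s e1 e4 hs
    have hmem : (shear (-s) p).1 ∈ Ω := by
      rw [hsh]
      exact (mem_iff_lt_tauMinus hΩ hpΩ p.2 hs.1.le).2 hs.2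
    have e := e1 hs.1 hpΩ hmem
    rw [h6, e4 hs, intervalIntegral.integral_of_le hs.1.le]
    rw [hsh] at e
    have : ∫ r in Ioc 0 s, g (p.1 - r • (p.2 : Space n)) p.2
        = ∫ r in Ioc 0 s, G (shear (-r) p) := by
      refine setIntegral_congr_ae measurableSet_Ioc ?_
      filter_upwards [h5'] with r hr hrs
      rw [hsh]
      exact hr ⟨hrs.1, hrs.2.trans_lt hs.2⟩
    rw [this]
    linarith
  have lim1 : Tendsto (fun s : ℝ => u p.1 p.2
      - ∫ r in (0 : ℝ)..s, g (p.1 - r • (p.2 : Space n)) p.2) (𝓝[<] τ ⊓ ae volume)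
      (𝓝 (u p.1 p.2 - ∫ r in (0 : ℝ)..τ, g (p.1 - r • (p.2 : Space n)) p.2)) := by
    refine Tendsto.mono_left ?_ inf_le_left
    refine tendsto_const_nhds.sub ?_
    have hc := intervalIntegral.continuousOn_primitive_interval' hI (left_mem_uIcc)
    have := (hc τ right_mem_uIcc).tendsto
    refine this.mono_left ?_
    rw [uIcc_of_le hτ.le]
    rw [← nhdsWithin_Ico_eq_nhdsLT hτ]
    exact nhdsWithin_mono _ Ico_subset_Icc_self
  have hev : (fun s : ℝ => u (p.1 - s • (p.2 : Space n)) p.2) =ᶠ[𝓝[<] τ ⊓ ae volume]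
      fun s => u p.1 p.2 - ∫ r in (0 : ℝ)..s, g (p.1 - r • (p.2 : Space n)) p.2 := by
    have a1 : ∀ᶠ s in 𝓝[<] τ ⊓ ae (volume : Measure ℝ), s ∈ Ioo 0 τ :=
      Filter.mem_inf_of_left (Ioo_mem_nhdsLT hτ)
    have a2 := key.filter_mono (inf_le_right : 𝓝[<] τ ⊓ ae (volume : Measure ℝ) ≤ _)
    filter_upwards [a1, a2] with s b1 b2 using b2 b1
  have := neBot_nhdsLT_inf_ae τ
  have := tendsto_nhds_unique h2 (lim1.congr' hev.symm)
  rw [this]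
  ring

end TwoPhoton

end

noncomputable section

namespace TwoPhoton

variable {n : ℕ} {Ω : Set (Space n)}

/-! ### Transport equations with absorption -/

lemma ofReal_integral_le_lintegral {α : Type*} [MeasurableSpace α] {μ : Measure α} {f : α → ℝ}
    (hf : Integrable f μ) : ENNReal.ofReal (∫ x, f x ∂μ) ≤ ∫⁻ x, ENNReal.ofReal (f x) ∂μ := by
  have h1 : ∫ x, f x ∂μ ≤ ∫ x, max (f x) 0 ∂μ :=
    integral_mono hf hf.pos_part fun x => le_max_left _ _
  refine (ENNReal.ofReal_le_ofReal h1).trans ?_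
  rw [ofReal_integral_eq_lintegral_ofReal hf.pos_part
    (Eventually.of_forall fun x => le_max_right _ _)]
  refine lintegral_mono fun x => ?_
  simp

/-- A one-dimensional comparison principle for `Y' = -ρ` with `Y(τ) = c`. -/
lemma ofReal_le_of_backward_integral {τ c : ℝ} (hτ : 0 ≤ τ) {ρ : ℝ → ℝ}
    (hρ : IntervalIntegrable ρ volume 0 τ) {q : ℝ → ℝ≥0∞}
    (h : ∀ᵐ t ∂(volume.restrict (Ioo 0 τ)), 0 ≤ c + ∫ s in t..τ, ρ s → ENNReal.ofReal (ρ t) ≤ q t) :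
    ENNReal.ofReal (c + ∫ s in (0 : ℝ)..τ, ρ s) ≤
      ENNReal.ofReal c + ∫⁻ t in Ioo 0 τ, q t := by
  set Y : ℝ → ℝ := fun t => c + ∫ s in t..τ, ρ s with hY
  have hYc : ContinuousOn Y (Icc 0 τ) := by
    have h1 := intervalIntegral.continuousOn_primitive_interval' hρ (left_mem_uIcc)
    rw [uIcc_of_le hτ] at h1
    have h2 : ∀ t ∈ Icc 0 τ, Y t = c + ((∫ s in (0 : ℝ)..τ, ρ s) - ∫ s in (0 : ℝ)..t, ρ s) := by
      intro t ht
      simp only [hY]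
      rw [← intervalIntegral.integral_interval_sub_left hρ
        (hρ.mono_set (by rw [uIcc_of_le hτ, uIcc_of_le ht.1]; exact Icc_subset_Icc_right ht.2))]
    exact (continuousOn_const.add (continuousOn_const.sub h1)).congr h2
  have hsplit : ∀ t ∈ Icc 0 τ, Y 0 = Y t + ∫ s in (0 : ℝ)..t, ρ s := by
    intro t ht
    have := intervalIntegral.integral_add_adjacent_intervals
      (hρ.mono_set (c := 0) (d := t)
        (by rw [uIcc_of_le hτ, uIcc_of_le ht.1]; exact Icc_subset_Icc_right ht.2))
      (hρ.mono_set (c := t) (d := τ)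
        (by rw [uIcc_of_le hτ, uIcc_of_le ht.2]; exact Icc_subset_Icc_left ht.1))
    simp only [hY]
    linarith
  -- Here t = 0 is the point of interest and t = τ the boundary. Take t₁ to be the first time with Y
  -- ≤ 0, or τ if there is none: before t₁ the hypothesis on ρ is available, and at t₁ the value is
  -- at most the positive part of c.
  obtain ⟨t₁, ht₁, hYt, hpos⟩ : ∃ t₁ ∈ Icc 0 τ, Y t₁ ≤ max c 0 ∧ ∀ t ∈ Ico 0 t₁, 0 ≤ Y t := by
    set S := {t ∈ Icc 0 τ | Y t ≤ 0} with hS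
    by_cases hne : S.Nonempty
    · have hcl : IsClosed S := by
        have := hYc.preimage_isClosed_of_isClosed isClosed_Icc (isClosed_Iic (a := (0 : ℝ)))
        exact this
      have hbdd : BddBelow S := ⟨0, fun t ht => ht.1.1⟩
      have hmem := hcl.csInf_mem hne hbdd
      refine ⟨sInf S, hmem.1, hmem.2.trans (le_max_right _ _), fun t ht => ?_⟩
      by_contra hlt
      push Not at hlt
      have : t ∈ S := ⟨⟨ht.1, ht.2.le.trans hmem.1.2⟩, hlt.le⟩
      exact absurd (csInf_le hbdd this) (not_le.2 ht.2)
    · refine ⟨τ, ⟨hτ, le_rfl⟩, by simp [hY], fun t ht => ?_⟩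
      by_contra hlt
      push Not at hlt
      exact hne ⟨t, ⟨ht.1, ht.2.le⟩, hlt.le⟩
  have hρ₁ : IntegrableOn ρ (Ioo 0 t₁) := by
    rw [← intervalIntegrable_iff_integrableOn_Ioo_of_le ht₁.1]
    exact hρ.mono_set (by rw [uIcc_of_le hτ, uIcc_of_le ht₁.1]; exact Icc_subset_Icc_right ht₁.2)
  have h1 : Y 0 ≤ max c 0 + ∫ s in Ioo 0 t₁, ρ s := by
    rw [hsplit t₁ ht₁, intervalIntegral.integral_of_le ht₁.1, integral_Ioc_eq_integral_Ioo]
    linarith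
  calc ENNReal.ofReal (Y 0) ≤ ENNReal.ofReal (max c 0 + ∫ s in Ioo 0 t₁, ρ s) :=
        ENNReal.ofReal_le_ofReal h1
    _ ≤ ENNReal.ofReal (max c 0) + ENNReal.ofReal (∫ s in Ioo 0 t₁, ρ s) :=
        ENNReal.ofReal_add_le
    _ ≤ ENNReal.ofReal c + ∫⁻ t in Ioo 0 t₁, q t := by
        refine add_le_add ?_ ?_
        · rcases le_total c 0 with hc | hc
          · simp [hc]
          · simp [hc]
        · refine (ofReal_integral_le_lintegral hρ₁).trans ?_
          rw [ae_restrict_iff' measurableSet_Ioo] at h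
          refine lintegral_mono_ae ((ae_restrict_iff' measurableSet_Ioo).2 ?_)
          filter_upwards [h] with t ht hts
          exact ht ⟨hts.1, hts.2.trans_le ht₁.2⟩ (hpos t ⟨hts.1.le, hts.2⟩)
    _ ≤ _ := by
        gcongr
        exact ht₁.2

/-- `v` solves `θ·∇v + A v = S` in integrated form, with boundary value `c`. -/
structure Solves (Ω : Set (Space n)) (c : Sph n → ℝ) (A : Space n → ℝ)
    (S v : Space n × Sph n → ℝ) : Prop where
  integrable : Integrable v (phaseMeasure Ω)
  integrable_deriv : Integrable (fun p => S p - A p.1 * v p) (phaseMeasure Ω)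
  eq : ∀ᵐ p ∂(phaseMeasure Ω), v p = c p.2 + ∫ s in (0 : ℝ)..(tauMinus Ω p.1 p.2),
    (S (p.1 - s • (p.2 : Space n), p.2)
      - A (p.1 - s • (p.2 : Space n)) * v (p.1 - s • (p.2 : Space n), p.2))

/-- A one-sided bound for a function that is an integral along characteristic lines. -/
lemma ofReal_le_of_integral_line (hΩ : IsDomainC1 Ω) [SFinite (sphereMeasure n)]
    {c : Sph n → ℝ} {R v : Space n × Sph n → ℝ} (hR : Integrable R (phaseMeasure Ω))
    (hv : ∀ᵐ p ∂(phaseMeasure Ω), v p = c p.2 + ∫ s in (0 : ℝ)..(tauMinus Ω p.1 p.2),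
      R (p.1 - s • (p.2 : Space n), p.2))
    {Q : Space n × Sph n → ℝ≥0∞}
    (hQ : ∀ᵐ p ∂(phaseMeasure Ω), 0 ≤ v p → ENNReal.ofReal (R p) ≤ Q p) :
    ∀ᵐ p ∂(phaseMeasure Ω), ENNReal.ofReal (v p) ≤ ENNReal.ofReal (c p.2) + lineInt Ω Q p := by
  filter_upwards [hv, ae_line_of_ae hΩ hv, ae_line_of_ae hΩ hQ, ae_line_integrable hΩ hR,
    ae_phase_mem hΩ] with p h1 h2 h3 h4 hp
  have hτ := tauMinus_pos hΩ hp p.2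
  rw [h1, lineInt_eq hΩ hp]
  refine ofReal_le_of_backward_integral hτ.le ?_ ?_
  · rwa [intervalIntegrable_iff_integrableOn_Ioo_of_le hτ.le]
  · filter_upwards [h2, h3, ae_restrict_mem measurableSet_Ioo] with t a2 a3 ht hpos
    refine a3 ?_
    rw [a2]
    rw [tauMinus_shift hΩ hp p.2 ht.1.le ht.2]
    convert hpos using 2
    have := intervalIntegral.integral_comp_add_left (a := 0) (b := tauMinus Ω p.1 p.2 - t)
      (fun s => R (p.1 - s • (p.2 : Space n), p.2)) t
    rw [add_zero, add_sub_cancel] at this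
    rw [← this]
    congr 1 with s
    rw [add_smul, sub_sub]

lemma integral_line_congr_ae (hΩ : IsDomainC1 Ω) [SFinite (sphereMeasure n)]
    {R R' : Space n × Sph n → ℝ} (h : R =ᵐ[phaseMeasure Ω] R') :
    ∀ᵐ p ∂(phaseMeasure Ω), ∫ s in (0 : ℝ)..(tauMinus Ω p.1 p.2), R (p.1 - s • (p.2 : Space n), p.2)
      = ∫ s in (0 : ℝ)..(tauMinus Ω p.1 p.2), R' (p.1 - s • (p.2 : Space n), p.2) := by
  filter_upwards [ae_line_of_ae hΩ h, ae_phase_mem hΩ] with p h1 hp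
  have hτ := tauMinus_pos hΩ hp p.2
  rw [intervalIntegral.integral_of_le hτ.le, intervalIntegral.integral_of_le hτ.le,
    integral_Ioc_eq_integral_Ioo, integral_Ioc_eq_integral_Ioo]
  exact integral_congr_ae h1

lemma integral_line_sub (hΩ : IsDomainC1 Ω) [SFinite (sphereMeasure n)]
    {R R' : Space n × Sph n → ℝ} (hR : Integrable R (phaseMeasure Ω))
    (hR' : Integrable R' (phaseMeasure Ω)) :
    ∀ᵐ p ∂(phaseMeasure Ω), ∫ s in (0 : ℝ)..(tauMinus Ω p.1 p.2),
        (R (p.1 - s • (p.2 : Space n), p.2) - R' (p.1 - s • (p.2 : Space n), p.2))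
      = (∫ s in (0 : ℝ)..(tauMinus Ω p.1 p.2), R (p.1 - s • (p.2 : Space n), p.2))
        - ∫ s in (0 : ℝ)..(tauMinus Ω p.1 p.2), R' (p.1 - s • (p.2 : Space n), p.2) := by
  filter_upwards [ae_line_integrable hΩ hR, ae_line_integrable hΩ hR', ae_phase_mem hΩ]
    with p h1 h2 hp
  have hτ := tauMinus_pos hΩ hp p.2
  rw [intervalIntegral.integral_sub]
  · rwa [intervalIntegrable_iff_integrableOn_Ioo_of_le hτ.le]
  · rwa [intervalIntegrable_iff_integrableOn_Ioo_of_le hτ.le]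

namespace Solves

variable {c c' : Sph n → ℝ} {A A' : Space n → ℝ} {S S' v v' : Space n × Sph n → ℝ}

lemma congr (hΩ : IsDomainC1 Ω) [SFinite (sphereMeasure n)] (h : Solves Ω c A S v)
    (hA : ∀ᵐ p ∂(phaseMeasure Ω), A p.1 = A' p.1) (hS : S =ᵐ[phaseMeasure Ω] S')
    (hv : v =ᵐ[phaseMeasure Ω] v') : Solves Ω c A' S' v' := by
  have hR : (fun p => S p - A p.1 * v p) =ᵐ[phaseMeasure Ω] fun p => S' p - A' p.1 * v' p := by
    filter_upwards [hA, hS, hv] with p h1 h2 h3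
    rw [h1, h2, h3]
  refine ⟨h.integrable.congr hv, h.integrable_deriv.congr hR, ?_⟩
  filter_upwards [hv, h.eq, integral_line_congr_ae hΩ hR] with p h1 h2 h3
  rw [← h1, h2, h3]

lemma sub (hΩ : IsDomainC1 Ω) [SFinite (sphereMeasure n)] (h : Solves Ω c A S v)
    (h' : Solves Ω c' A S' v') :
    Solves Ω (fun θ => c θ - c' θ) A (fun p => S p - S' p) (fun p => v p - v' p) := by
  refine ⟨h.integrable.sub h'.integrable, ?_, ?_⟩
  · refine (h.integrable_deriv.sub h'.integrable_deriv).congr (Eventually.of_forall fun p => ?_)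
    simp only [Pi.sub_apply]
    ring
  · filter_upwards [h.eq, h'.eq, integral_line_sub hΩ h.integrable_deriv h'.integrable_deriv]
      with p h1 h2 h3
    rw [h1, h2, add_sub_add_comm, ← h3]
    congr 2 with s
    ring

lemma zero : Solves Ω (fun _ => 0) A (fun _ => 0) (fun _ => 0) :=
  ⟨integrable_zero _ _ _, by simp, by simp⟩

lemma neg (hΩ : IsDomainC1 Ω) [SFinite (sphereMeasure n)] (h : Solves Ω c A S v) :
    Solves Ω (fun θ => -c θ) A (fun p => -S p) (fun p => -v p) := by
  simpa using (Solves.zero (A := A)).sub hΩ h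

/-- The upper bound by the boundary value and the source. -/
lemma ofReal_le (hΩ : IsDomainC1 Ω) [SFinite (sphereMeasure n)] (h : Solves Ω c A S v)
    (hA : ∀ᵐ p ∂(phaseMeasure Ω), 0 ≤ A p.1) : ∀ᵐ p ∂(phaseMeasure Ω),
      ENNReal.ofReal (v p) ≤ ENNReal.ofReal (c p.2) + lineInt Ω (fun q => ENNReal.ofReal (S q)) p := by
  refine ofReal_le_of_integral_line hΩ h.integrable_deriv h.eq ?_
  filter_upwards [hA] with p hp hv
  exact ENNReal.ofReal_le_ofReal (by linarith [mul_nonneg hp hv])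

/-- Stability with respect to the boundary value, the source and the absorption. -/
lemma enorm_sub_le (hΩ : IsDomainC1 Ω) [SFinite (sphereMeasure n)] (h : Solves Ω c A S v)
    (h' : Solves Ω c' A' S' v') (hA : ∀ᵐ p ∂(phaseMeasure Ω), 0 ≤ A p.1) :
    ∀ᵐ p ∂(phaseMeasure Ω), ‖v p - v' p‖ₑ ≤ ‖c p.2 - c' p.2‖ₑ +
      lineInt Ω (fun q => ‖S q - S' q‖ₑ + ‖A q.1 - A' q.1‖ₑ * ‖v' q‖ₑ) p := by
  set R : Space n × Sph n → ℝ := fun p => (S p - A p.1 * v p) - (S' p - A' p.1 * v' p) with hRd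
  have hR : Integrable R (phaseMeasure Ω) := h.integrable_deriv.sub h'.integrable_deriv
  have heq : ∀ᵐ p ∂(phaseMeasure Ω), v p - v' p = (c p.2 - c' p.2) +
      ∫ s in (0 : ℝ)..(tauMinus Ω p.1 p.2), R (p.1 - s • (p.2 : Space n), p.2) := by
    filter_upwards [h.eq, h'.eq, integral_line_sub hΩ h.integrable_deriv h'.integrable_deriv]
      with p h1 h2 h3
    rw [h1, h2, add_sub_add_comm, ← h3]
  -- The difference A v - A' v' is split so that A acts on v - v'. Where v - v' ≥ 0 this term only
  -- decreases R and may be dropped, so no bound on A enters; the mismatch A - A' meets v' alone.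
  -- The same argument applied to v' - v gives the other side.
  have hRe : ∀ p, R p = ((S p - S' p) - (A p.1 - A' p.1) * v' p) - A p.1 * (v p - v' p) :=
    fun p => by simp only [hRd]; ring
  have bd : ∀ p, ENNReal.ofReal |(S p - S' p) - (A p.1 - A' p.1) * v' p| ≤
      ‖S p - S' p‖ₑ + ‖A p.1 - A' p.1‖ₑ * ‖v' p‖ₑ := fun p => by
    rw [← enorm_mul, ← Real.enorm_eq_ofReal_abs]
    exact _root_.enorm_sub_le
  have b1 := ofReal_le_of_integral_line (c := fun θ => c θ - c' θ) hΩ hR heq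
    (Q := fun q => ‖S q - S' q‖ₑ + ‖A q.1 - A' q.1‖ₑ * ‖v' q‖ₑ) (by
      filter_upwards [hA] with p hp hv
      refine (ENNReal.ofReal_le_ofReal ?_).trans (bd p)
      rw [hRe]
      linarith [mul_nonneg hp hv, le_abs_self ((S p - S' p) - (A p.1 - A' p.1) * v' p)])
  have b2 := ofReal_le_of_integral_line (c := fun θ => -(c θ - c' θ)) (v := fun p => -(v p - v' p))
    hΩ hR.neg (by
      filter_upwards [heq] with p hp
      rw [hp, neg_add, ← intervalIntegral.integral_neg]
      rfl)
    (Q := fun q => ‖S q - S' q‖ₑ + ‖A q.1 - A' q.1‖ₑ * ‖v' q‖ₑ) (by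
      filter_upwards [hA] with p hp hv
      refine (ENNReal.ofReal_le_ofReal ?_).trans (bd p)
      rw [Pi.neg_apply, hRe]
      nlinarith [mul_nonneg hp hv, neg_abs_le ((S p - S' p) - (A p.1 - A' p.1) * v' p)])
  filter_upwards [b1, b2] with p h1 h2
  rw [Real.enorm_eq_ofReal_abs (v p - v' p)]
  have e1 : ENNReal.ofReal (c p.2 - c' p.2) ≤ ‖c p.2 - c' p.2‖ₑ := by
    rw [Real.enorm_eq_ofReal_abs]
    exact ENNReal.ofReal_le_ofReal (le_abs_self _)
  have e2 : ENNReal.ofReal (-(c p.2 - c' p.2)) ≤ ‖c p.2 - c' p.2‖ₑ := by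
    rw [Real.enorm_eq_ofReal_abs]
    exact ENNReal.ofReal_le_ofReal (neg_le_abs _)
  rcases abs_choice (v p - v' p) with hc | hc <;> rw [hc]
  · exact h1.trans (by gcongr)
  · exact h2.trans (by gcongr)

end Solves

/-! ### The ballistic part -/

/-- The integral of `a` over the half-line behind `x` in direction `θ`, restricted to `Ω`. -/
def xray (Ω : Set (Space n)) (a : Space n → ℝ) (p : Space n × Sph n) : ℝ :=
  ∫ s in Ioi (0 : ℝ), Ω.indicator a (p.1 - s • (p.2 : Space n))

lemma xray_eq (hΩ : IsDomainC1 Ω) (a : Space n → ℝ) {p : Space n × Sph n} (hp : p.1 ∈ Ω) :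
    xray Ω a p = ∫ s in (0 : ℝ)..(tauMinus Ω p.1 p.2), a (p.1 - s • (p.2 : Space n)) := by
  have hτ := tauMinus_pos hΩ hp p.2
  rw [xray, intervalIntegral.integral_of_le hτ.le, integral_Ioc_eq_integral_Ioo,
    ← integral_indicator measurableSet_Ioi, ← integral_indicator measurableSet_Ioo]
  congr 1 with s
  by_cases hs : 0 < s
  · by_cases hm : s < tauMinus Ω p.1 p.2
    · rw [indicator_of_mem (mem_Ioi.2 hs), indicator_of_mem (mem_Ioo.2 ⟨hs, hm⟩),
        indicator_of_mem ((mem_iff_lt_tauMinus hΩ hp p.2 hs.le).2 hm)]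
    · rw [indicator_of_mem (mem_Ioi.2 hs), indicator_of_notMem (s := Ioo _ _) (fun h => hm h.2),
        indicator_of_notMem (s := Ω) (fun h => hm ((mem_iff_lt_tauMinus hΩ hp p.2 hs.le).1 h))]
  · rw [indicator_of_notMem (s := Ioi _) (fun h => hs h),
      indicator_of_notMem (s := Ioo _ _) (fun h => hs h.1)]

lemma stronglyMeasurable_xray (hΩ : IsOpen Ω) {a : Space n → ℝ} (ha : StronglyMeasurable a) :
    StronglyMeasurable (xray Ω a) := by
  unfold xray
  refine StronglyMeasurable.integral_prod_right
    (f := fun (p : Space n × Sph n) (s : ℝ) => Ω.indicator a (p.1 - s • (p.2 : Space n))) ?_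
  refine (ha.indicator hΩ.measurableSet).comp_measurable ?_
  fun_prop

/-- The attenuation factor `exp (-∫ a)` along the characteristic line behind `p`. -/
def lineExp (Ω : Set (Space n)) (a : Space n → ℝ) (p : Space n × Sph n) : ℝ :=
  Real.exp (-xray Ω a p)

lemma lineExp_pos (a : Space n → ℝ) (p : Space n × Sph n) : 0 < lineExp Ω a p := Real.exp_pos _

lemma xray_nonneg {a : Space n → ℝ} (ha : ∀ x, 0 ≤ a x) (p : Space n × Sph n) :
    0 ≤ xray Ω a p :=
  integral_nonneg fun _ => indicator_nonneg (fun x _ => ha x) _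

lemma lineExp_le_one {a : Space n → ℝ} (ha : ∀ x, 0 ≤ a x) (p : Space n × Sph n) :
    lineExp Ω a p ≤ 1 :=
  Real.exp_le_one_iff.2 (neg_nonpos.2 (xray_nonneg ha p))

/-- The integrand is the derivative of r ↦ exp(-∫_r^τ a). As a is merely bounded and integrable,
this function is only Lipschitz, and the fundamental theorem of calculus is used in its version for
absolutely continuous functions. -/
lemma integral_mul_exp_neg {τ B : ℝ} (hτ : 0 ≤ τ) {a : ℝ → ℝ}
    (ha : IntervalIntegrable a volume 0 τ) (hB : ∀ s, ‖a s‖ ≤ B) :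
    ∫ r in (0 : ℝ)..τ, a r * Real.exp (-∫ s in r..τ, a s)
      = 1 - Real.exp (-∫ s in (0 : ℝ)..τ, a s) := by
  have hsub : ∀ r ∈ Icc 0 τ, IntervalIntegrable a volume 0 r := fun r hr =>
    ha.mono_set (by rw [uIcc_of_le hτ, uIcc_of_le hr.1]; exact Icc_subset_Icc_right hr.2)
  -- Integrating from τ makes H(t) = -∫_t^τ a, with upper limit t, so that its almost everywhere
  -- derivative is a(t) without a sign.
  set H : ℝ → ℝ := fun t => ∫ s in τ..t, a s with hH
  set F : ℝ → ℝ := fun t => Real.exp (H t) with hF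
  have hHr : ∀ r, H r = -∫ s in r..τ, a s := fun r => intervalIntegral.integral_symm _ _
  have hB0 : 0 ≤ B := (norm_nonneg _).trans (hB 0)
  have hlip : ∀ r ∈ Icc 0 τ, ∀ t ∈ Icc 0 τ, |H r - H t| ≤ B * |r - t| := by
    intro r hr t ht
    have h1 : IntervalIntegrable a volume τ r := ha.symm.mono_set (by
      rw [uIcc_of_ge hτ, uIcc_of_ge hr.2]; exact Icc_subset_Icc_left hr.1)
    have h2 : IntervalIntegrable a volume τ t := ha.symm.mono_set (by
      rw [uIcc_of_ge hτ, uIcc_of_ge ht.2]; exact Icc_subset_Icc_left ht.1)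
    simp only [hH]
    rw [intervalIntegral.integral_interval_sub_left h1 h2]
    exact intervalIntegral.norm_integral_le_of_norm_le_const fun s _ => hB s
  have hHb : ∀ r ∈ Icc 0 τ, H r ≤ B * τ := by
    intro r hr
    have := hlip r hr τ ⟨hτ, le_rfl⟩
    have h0 : H τ = 0 := intervalIntegral.integral_same
    rw [h0, sub_zero] at this
    refine (le_abs_self _).trans (this.trans ?_)
    gcongr
    rw [abs_sub_comm, abs_of_nonneg (by linarith [hr.2])]
    linarith [hr.1]
  have hac : AbsolutelyContinuousOnInterval F 0 τ := by
    have hL : LipschitzOnWith (Real.toNNReal (Real.exp (B * τ) * B)) F (uIcc 0 τ) := by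
      refine LipschitzOnWith.of_dist_le_mul fun r hr t ht => ?_
      rw [uIcc_of_le hτ] at hr ht
      rw [Real.coe_toNNReal _ (by positivity), Real.dist_eq, Real.dist_eq, mul_assoc]
      have key : ∀ x y : ℝ, x ≤ B * τ → y ≤ B * τ → x ≤ y →
          |Real.exp x - Real.exp y| ≤ Real.exp (B * τ) * |x - y| := by
        intro x y hx hy hxy
        rw [abs_sub_comm, abs_of_nonneg (sub_nonneg.2 (Real.exp_le_exp.2 hxy)), abs_sub_comm,
          abs_of_nonneg (sub_nonneg.2 hxy)]
        have e1 := Real.add_one_le_exp (x - y)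
        have e2 : Real.exp x = Real.exp y * Real.exp (x - y) := by rw [← Real.exp_add]; ring_nf
        have e3 := Real.exp_le_exp.2 hy
        have e4 := Real.exp_pos y
        have : Real.exp y - Real.exp x ≤ Real.exp y * (y - x) := by rw [e2]; nlinarith
        refine this.trans ?_
        gcongr
      have : |Real.exp (H r) - Real.exp (H t)| ≤ Real.exp (B * τ) * |H r - H t| := by
        rcases le_total (H r) (H t) with h | h
        · exact key _ _ (hHb r hr) (hHb t ht) h
        · rw [abs_sub_comm, abs_sub_comm (H r)]
          exact key _ _ (hHb t ht) (hHb r hr) h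
      refine this.trans ?_
      gcongr
      exact hlip r hr t ht
    exact hL.absolutelyContinuousOnInterval
  have hder := ha.ae_hasDerivAt_integral
  have h1 := hac.integral_deriv_eq_sub
  have h2 : F τ - F 0 = 1 - Real.exp (-∫ s in (0 : ℝ)..τ, a s) := by
    simp only [hF, hHr]
    simp
  rw [← h2, ← h1]
  refine intervalIntegral.integral_congr_ae ?_
  filter_upwards [hder] with r hr hrm
  have hrm' : r ∈ uIcc 0 τ := uIoc_subset_uIcc hrm
  have := ((hr hrm' τ right_mem_uIcc).exp).deriv
  rw [← hHr r]
  simp only [hF, hH]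
  rw [this]
  ring

lemma xray_shift (hΩ : IsDomainC1 Ω) (a : Space n → ℝ) {p : Space n × Sph n} (hp : p.1 ∈ Ω)
    {t : ℝ} (ht : t ∈ Ioo 0 (tauMinus Ω p.1 p.2)) :
    xray Ω a (p.1 - t • (p.2 : Space n), p.2) =
      ∫ s in t..(tauMinus Ω p.1 p.2), a (p.1 - s • (p.2 : Space n)) := by
  rw [xray_eq hΩ a (p := (p.1 - t • (p.2 : Space n), p.2))
    ((mem_iff_lt_tauMinus hΩ hp p.2 ht.1.le).2 ht.2)]
  simp only
  rw [tauMinus_shift hΩ hp p.2 ht.1.le ht.2]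
  have := intervalIntegral.integral_comp_add_left (a := 0) (b := tauMinus Ω p.1 p.2 - t)
    (fun s => a (p.1 - s • (p.2 : Space n))) t
  rw [add_zero, add_sub_cancel] at this
  rw [← this]
  congr 1 with s
  rw [add_smul, sub_sub]

lemma isFiniteMeasure_phase (hΩ : IsDomainC1 Ω) [IsFiniteMeasure (sphereMeasure n)] :
    IsFiniteMeasure (phaseMeasure Ω) := by
  have : IsFiniteMeasure ((volume : Measure (Space n)).restrict Ω) :=
    ⟨by rw [Measure.restrict_apply_univ]; exact hΩ.isBounded.measure_lt_top⟩
  unfold phaseMeasure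
  infer_instance

/-- The ballistic part solves the transport equation without source. -/
lemma solves_lineExp (hΩ : IsDomainC1 Ω) [IsFiniteMeasure (sphereMeasure n)] {a : Space n → ℝ}
    (ha : StronglyMeasurable a) {B : ℝ} (hB : ∀ x, ‖a x‖ ≤ B) (ha0 : ∀ x, 0 ≤ a x)
    {φ : Sph n → ℝ} (hφ : StronglyMeasurable φ) {M : ℝ} (hM : ∀ θ, ‖φ θ‖ ≤ M) :
    Solves Ω φ a (fun _ => 0) (fun p => φ p.2 * lineExp Ω a p) := by
  have := isFiniteMeasure_phase hΩ
  have hEm : StronglyMeasurable (lineExp Ω a) :=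
    Real.continuous_exp.comp_stronglyMeasurable (stronglyMeasurable_xray hΩ.isOpen ha).neg
  have hEb : ∀ p, ‖lineExp Ω a p‖ ≤ 1 := fun p => by
    rw [Real.norm_of_nonneg (lineExp_pos a p).le]
    exact lineExp_le_one ha0 p
  have hi : Integrable (fun p : Space n × Sph n => φ p.2 * lineExp Ω a p) (phaseMeasure Ω) := by
    refine Integrable.of_bound
      ((hφ.comp_measurable measurable_snd).mul hEm).aestronglyMeasurable (M * 1)
      (Eventually.of_forall fun p => ?_)
    rw [norm_mul]
    exact mul_le_mul (hM _) (hEb p) (norm_nonneg _) ((norm_nonneg _).trans (hM p.2))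
  refine ⟨hi, ?_, ?_⟩
  · simp only [zero_sub]
    exact (hi.bdd_mul (ha.comp_measurable measurable_fst).aestronglyMeasurable
      (Eventually.of_forall fun p => hB p.1)).neg
  · filter_upwards [ae_phase_mem hΩ] with p hp
    have hτ := tauMinus_pos hΩ hp p.2
    set τ := tauMinus Ω p.1 p.2
    have hai : IntervalIntegrable (fun s : ℝ => a (p.1 - s • (p.2 : Space n))) volume 0 τ := by
      rw [intervalIntegrable_iff_integrableOn_Ioo_of_le hτ.le]
      exact Integrable.of_bound (ha.comp_measurable (by fun_prop)).aestronglyMeasurable B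
        (Eventually.of_forall fun s => hB _)
    -- After factoring out φ(θ), the integrated equation for the ballistic part is 1 - ∫ a exp(-∫ a)
    -- = exp(-∫ a).
    have key := integral_mul_exp_neg hτ.le hai (fun s => hB _)
    have h1 : ∫ s in (0 : ℝ)..τ, ((0 : ℝ) - a (p.1 - s • (p.2 : Space n)) *
          (φ p.2 * lineExp Ω a (p.1 - s • (p.2 : Space n), p.2)))
        = ∫ s in (0 : ℝ)..τ, -φ p.2 * (a (p.1 - s • (p.2 : Space n)) *
          Real.exp (-∫ r in s..τ, a (p.1 - r • (p.2 : Space n)))) := by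
      rw [intervalIntegral.integral_of_le hτ.le, intervalIntegral.integral_of_le hτ.le,
        integral_Ioc_eq_integral_Ioo, integral_Ioc_eq_integral_Ioo]
      refine setIntegral_congr_fun measurableSet_Ioo fun s hs => ?_
      simp only [lineExp]
      rw [xray_shift hΩ a hp hs]
      ring
    rw [h1, intervalIntegral.integral_const_mul, key, lineExp, xray_eq hΩ a hp]
    ring

end TwoPhoton

end

noncomputable section

namespace TwoPhoton

variable {n : ℕ} {Ω : Set (Space n)}

/-! ### Bounds for solutions -/

/-- The angular norm `∫ |v(x, θ)| dθ`. -/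
def angNorm (v : Space n → Sph n → ℝ) (x : Space n) : ℝ≥0∞ := ∫⁻ θ, ‖v x θ‖ₑ ∂(sphereMeasure n)

lemma enorm_aver_le (v : Space n → Sph n → ℝ) (x : Space n) : ‖aver v x‖ₑ ≤ angNorm v x :=
  enorm_integral_le_lintegral_enorm _

lemma ae_phase_of_ae {Q : Space n → Prop} (h : ∀ᵐ x ∂(volume.restrict Ω), Q x) :
    ∀ᵐ p ∂(phaseMeasure Ω), Q p.1 := Measure.quasiMeasurePreserving_fst.ae h

lemma nonempty_sph (n : ℕ) [IsProbabilityMeasure (sphereMeasure n)] : Nonempty (Sph n) :=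
  nonempty_of_isProbabilityMeasure (sphereMeasure n)

section

variable [SFinite (sphereMeasure n)] {v v' : Space n → Sph n → ℝ}

lemma aemeasurable_angNorm (hv : AEStronglyMeasurable (fun p : Space n × Sph n => v p.1 p.2)
    (phaseMeasure Ω)) : AEMeasurable (angNorm v) (volume.restrict Ω) :=
  hv.enorm.lintegral_prod_right'

lemma lintegral_angNorm (hv : AEStronglyMeasurable (fun p : Space n × Sph n => v p.1 p.2)
    (phaseMeasure Ω)) :
    ∫⁻ x in Ω, angNorm v x = ∫⁻ p, ‖v p.1 p.2‖ₑ ∂(phaseMeasure Ω) := by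
  rw [phaseMeasure, lintegral_prod _ hv.enorm]
  rfl

lemma lintegral_angNorm_ne_top (hv : Integrable (fun p : Space n × Sph n => v p.1 p.2)
    (phaseMeasure Ω)) : ∫⁻ x in Ω, angNorm v x ≠ ⊤ := by
  rw [lintegral_angNorm hv.1]
  exact hv.2.ne

lemma ae_integrable_slice (hv : Integrable (fun p : Space n × Sph n => v p.1 p.2)
    (phaseMeasure Ω)) :
    ∀ᵐ x ∂(volume.restrict Ω), Integrable (v x) (sphereMeasure n) := hv.prod_right_ae

end

/-- Bounded measurable coefficients satisfying the smallness conditions. -/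
structure Coeff (Ω : Set (Space n)) (σa σb : Space n → ℝ) (k : Space n → Sph n → Sph n → ℝ)
    (a b κ c₀ μ ν : ℝ) : Prop where
  measurable_a : Measurable σa
  measurable_b : Measurable σb
  measurable_k : Measurable fun q : (Space n × Sph n) × Sph n => k q.1.1 q.1.2 q.2
  a_nonneg : ∀ x, 0 ≤ σa x
  a_le : ∀ x, σa x ≤ a
  b_nonneg : ∀ x, 0 ≤ σb x
  b_le : ∀ x, σb x ≤ b
  k_nonneg : ∀ x θ' θ, 0 ≤ k x θ' θ
  k_le : ∀ x θ' θ, k x θ' θ ≤ κ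
  c_pos : 0 < c₀
  mu_nonneg : 0 ≤ μ
  mu_lt : μ < 1
  nu_nonneg : 0 ≤ ν
  nu_lt : ν < 1
  scatter_small : (tauNorm Ω).toReal * κ ≤ μ
  nonlin_small : (tauNorm Ω).toReal * b * c₀ ≤ ν * (1 - μ) ^ 2

/-- Averaging over θ closes the inequality in the angular norm alone. The bound M/(1 - κ') is the
fixed point of F ↦ M + κ'F, as required by `ae_le_of_le_lineInt`. -/
lemma ae_angNorm_le (hΩ : IsDomainC1 Ω) [IsProbabilityMeasure (sphereMeasure n)]
    {v : Space n → Sph n → ℝ}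
    (hv : Integrable (fun p : Space n × Sph n => v p.1 p.2) (phaseMeasure Ω))
    {C : Sph n → ℝ≥0∞} (hC : Measurable C) {M κ₀ κ' : ℝ} (hM : 0 ≤ M) (hκ₀ : 0 ≤ κ₀) (hκ' : κ' < 1)
    (hκ : (tauNorm Ω).toReal * κ₀ ≤ κ') (hCM : ∫⁻ θ, C θ ∂(sphereMeasure n) ≤ ENNReal.ofReal M)
    (h : ∀ᵐ p ∂(phaseMeasure Ω), ‖v p.1 p.2‖ₑ ≤ C p.2 +
      lineInt Ω (fun q => ENNReal.ofReal κ₀ * angNorm v q.1) p) :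
    ∀ᵐ x ∂(volume.restrict Ω), angNorm v x ≤ ENNReal.ofReal (M / (1 - κ')) := by
  have hT : 0 ≤ (tauNorm Ω).toReal := ENNReal.toReal_nonneg
  have hκT : ENNReal.ofReal κ₀ * tauNorm Ω ≤ ENNReal.ofReal κ' := by
    rw [← ofReal_tauNorm hΩ, ← ENNReal.ofReal_mul hκ₀, mul_comm]
    exact ENNReal.ofReal_le_ofReal hκ
  have hκ'0 : 0 ≤ κ' := (mul_nonneg hT hκ₀).trans hκ
  refine ae_le_of_le_lineInt hΩ (aemeasurable_angNorm hv.1) (lintegral_angNorm_ne_top hv)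
    (F := ENNReal.ofReal M) (κ₀ := ENNReal.ofReal κ₀) ENNReal.ofReal_ne_top
    (hκT.trans_lt (by simpa using hκ')) ?_ ?_
  · calc ENNReal.ofReal M + ENNReal.ofReal κ₀ * tauNorm Ω * ENNReal.ofReal (M / (1 - κ'))
        ≤ ENNReal.ofReal M + ENNReal.ofReal κ' * ENNReal.ofReal (M / (1 - κ')) := by gcongr
      _ = ENNReal.ofReal (M / (1 - κ')) := by
          rw [← ENNReal.ofReal_mul hκ'0, ← ENNReal.ofReal_add hM
            (mul_nonneg hκ'0 (div_nonneg hM (by linarith)))]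
          congr 1
          have : 1 - κ' ≠ 0 := by linarith
          field_simp
          ring
  · filter_upwards [Measure.ae_ae_of_ae_prod h, ae_restrict_mem hΩ.isOpen.measurableSet]
      with x hx hxΩ
    calc angNorm v x ≤ ∫⁻ θ, (C θ + lineInt Ω (fun q => ENNReal.ofReal κ₀ * angNorm v q.1) (x, θ))
          ∂(sphereMeasure n) := lintegral_mono_ae hx
      _ = ∫⁻ θ, C θ ∂(sphereMeasure n) + ∫⁻ θ, lineInt Ω
          (fun q => ENNReal.ofReal κ₀ * angNorm v q.1) (x, θ) ∂(sphereMeasure n) :=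
          lintegral_add_left hC _
      _ ≤ _ := by
          gcongr
          rw [← lintegral_const_mul' _ _ ENNReal.ofReal_ne_top]
          refine lintegral_mono fun θ => ?_
          rw [lineInt_const_mul hΩ ENNReal.ofReal_ne_top (fun q => angNorm v q.1) (p := (x, θ)) hxΩ]

/-- The nonlinear absorption coefficient built from the angular average `m`. -/
def absorb (σa σb : Space n → ℝ) (m : Space n → ℝ) (x : Space n) : ℝ := σa x + σb x * m x

/-- `u` is an integrated solution of the nonlinear transport equation with the source `c`, and `m`
is a bounded measurable representative of `|⟨u⟩|`. -/
structure NiceSolution (Ω : Set (Space n)) (σa σb : Space n → ℝ) (k : Space n → Sph n → Sph n → ℝ)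
    (c : Sph n → ℝ) (B : ℝ) (u : Space n → Sph n → ℝ) (m : Space n → ℝ) : Prop where
  solves : Solves Ω c (absorb σa σb m) (fun p => scatter k u p.1 p.2) (fun p => u p.1 p.2)
  measurable : Measurable m
  nonneg : ∀ x, 0 ≤ m x
  le : ∀ x, m x ≤ B
  ae_eq : ∀ᵐ x ∂(volume.restrict Ω), |aver u x| = m x
  angNorm_le : ∀ᵐ x ∂(volume.restrict Ω), angNorm u x ≤ ENNReal.ofReal B

namespace Coeff

variable {σa σb : Space n → ℝ} {k : Space n → Sph n → Sph n → ℝ} {a b κ c₀ μ ν : ℝ}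

lemma enorm_scatter_le (H : Coeff Ω σa σb k a b κ c₀ μ ν) (u : Space n → Sph n → ℝ) (x : Space n)
    (θ : Sph n) : ‖scatter k u x θ‖ₑ ≤ ENNReal.ofReal κ * angNorm u x := by
  refine (enorm_integral_le_lintegral_enorm _).trans ?_
  rw [angNorm, ← lintegral_const_mul' _ _ ENNReal.ofReal_ne_top]
  refine lintegral_mono fun θ' => ?_
  rw [enorm_mul]
  gcongr
  rw [Real.enorm_of_nonneg (H.k_nonneg _ _ _)]
  exact ENNReal.ofReal_le_ofReal (H.k_le _ _ _)

lemma kappa_nonneg (H : Coeff Ω σa σb k a b κ c₀ μ ν) (θ : Sph n) : 0 ≤ κ :=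
  (H.k_nonneg 0 θ θ).trans (H.k_le _ _ _)

lemma b_const_nonneg (H : Coeff Ω σa σb k a b κ c₀ μ ν) : 0 ≤ b := (H.b_nonneg 0).trans (H.b_le 0)

lemma a_const_nonneg (H : Coeff Ω σa σb k a b κ c₀ μ ν) : 0 ≤ a := (H.a_nonneg 0).trans (H.a_le 0)

lemma integrable_kernel_mul (H : Coeff Ω σa σb k a b κ c₀ μ ν) {f : Sph n → ℝ}
    (hf : Integrable f (sphereMeasure n)) (x : Space n) (θ : Sph n) :
    Integrable (fun θ' => k x θ' θ * f θ') (sphereMeasure n) := by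
  refine hf.bdd_mul (c := κ) ?_ (Eventually.of_forall fun θ' => ?_)
  · exact (H.measurable_k.comp (by fun_prop : Measurable fun θ' : Sph n => (((x, θ') , θ) :
      (Space n × Sph n) × Sph n))).aestronglyMeasurable
  · rw [Real.norm_of_nonneg (H.k_nonneg _ _ _)]
    exact H.k_le _ _ _

lemma ae_scatter_sub (H : Coeff Ω σa σb k a b κ c₀ μ ν) [SFinite (sphereMeasure n)]
    {u w : Space n → Sph n → ℝ}
    (hu : Integrable (fun p : Space n × Sph n => u p.1 p.2) (phaseMeasure Ω))
    (hw : Integrable (fun p : Space n × Sph n => w p.1 p.2) (phaseMeasure Ω)) :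
    ∀ᵐ p ∂(phaseMeasure Ω), scatter k u p.1 p.2 - scatter k w p.1 p.2
      = scatter k (fun x θ => u x θ - w x θ) p.1 p.2 := by
  filter_upwards [ae_phase_of_ae (ae_integrable_slice hu), ae_phase_of_ae (ae_integrable_slice hw)]
    with p h1 h2
  rw [scatter, scatter, scatter, ← integral_sub (H.integrable_kernel_mul h1 _ _)
    (H.integrable_kernel_mul h2 _ _)]
  congr 1 with θ'
  ring

lemma absorb_nonneg (H : Coeff Ω σa σb k a b κ c₀ μ ν) {m : Space n → ℝ} (hm : ∀ x, 0 ≤ m x)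
    (x : Space n) : 0 ≤ absorb σa σb m x :=
  add_nonneg (H.a_nonneg x) (mul_nonneg (H.b_nonneg x) (hm x))

lemma absorb_le (H : Coeff Ω σa σb k a b κ c₀ μ ν) {m : Space n → ℝ} {B : ℝ}
    (hm : ∀ x, 0 ≤ m x) (hB : ∀ x, m x ≤ B) (x : Space n) : absorb σa σb m x ≤ a + b * B :=
  add_le_add (H.a_le x) (mul_le_mul (H.b_le x) (hB x) (hm x) H.b_const_nonneg)

lemma norm_absorb_le (H : Coeff Ω σa σb k a b κ c₀ μ ν) {m : Space n → ℝ} {B : ℝ}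
    (hm : ∀ x, 0 ≤ m x) (hB : ∀ x, m x ≤ B) (x : Space n) : ‖absorb σa σb m x‖ ≤ a + b * B := by
  rw [Real.norm_of_nonneg (H.absorb_nonneg hm x)]
  exact H.absorb_le hm hB x

lemma measurable_absorb (H : Coeff Ω σa σb k a b κ c₀ μ ν) {m : Space n → ℝ} (hm : Measurable m) :
    Measurable (absorb σa σb m) := H.measurable_a.add (H.measurable_b.mul hm)

lemma absorb_sub (m m' : Space n → ℝ) (x : Space n) :
    absorb σa σb m x - absorb σa σb m' x = σb x * (m x - m' x) := by
  simp only [absorb]; ring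

lemma enorm_absorb_sub_le (H : Coeff Ω σa σb k a b κ c₀ μ ν) (m m' : Space n → ℝ) (x : Space n) :
    ‖absorb σa σb m x - absorb σa σb m' x‖ₑ ≤ ENNReal.ofReal b * ‖m x - m' x‖ₑ := by
  rw [absorb_sub, enorm_mul]
  gcongr
  rw [Real.enorm_of_nonneg (H.b_nonneg x)]
  exact ENNReal.ofReal_le_ofReal (H.b_le x)

/-- Integrated solutions are bounded in `L^∞_x L^1_θ`. -/
lemma niceSolution (H : Coeff Ω σa σb k a b κ c₀ μ ν) (hΩ : IsDomainC1 Ω)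
    [IsProbabilityMeasure (sphereMeasure n)] {c : Sph n → ℝ} (hc : Measurable c) {M : ℝ}
    (hM : 0 ≤ M) (hcM : ∫⁻ θ, ‖c θ‖ₑ ∂(sphereMeasure n) ≤ ENNReal.ofReal M)
    {u : Space n → Sph n → ℝ} (h : Solves Ω c (absorb σa σb fun x => |aver u x|)
      (fun p => scatter k u p.1 p.2) (fun p => u p.1 p.2)) :
    ∃ m, NiceSolution Ω σa σb k c (M / (1 - μ)) u m := by
  obtain ⟨θ₀⟩ := nonempty_sph n
  have hκ0 := H.kappa_nonneg θ₀
  have hbd : ∀ᵐ x ∂(volume.restrict Ω), angNorm u x ≤ ENNReal.ofReal (M / (1 - μ)) := by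
    refine ae_angNorm_le hΩ h.integrable (C := fun θ => ‖c θ‖ₑ) hc.enorm hM hκ0 H.mu_lt
      H.scatter_small hcM ?_
    -- Comparison with the zero solution for the same absorption: the nonlinear term disappears and
    -- only boundary value and scattering remain.
    have := h.enorm_sub_le hΩ (Solves.zero (A := absorb σa σb fun x => |aver u x|))
      (Eventually.of_forall fun p => H.absorb_nonneg (fun x => abs_nonneg _) p.1)
    have hmono := lineInt_mono_ae hΩ (Ω := Ω) (H := fun q : Space n × Sph n => ‖scatter k u q.1 q.2‖ₑ)
      (K := fun q => ENNReal.ofReal κ * angNorm u q.1)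
      (Eventually.of_forall fun q => H.enorm_scatter_le u q.1 q.2)
    filter_upwards [this, hmono] with p h1 h2
    simp only [sub_zero, sub_self, enorm_zero, mul_zero, add_zero] at h1
    exact h1.trans (by gcongr)
  have hB0 : 0 ≤ M / (1 - μ) := div_nonneg hM (by linarith [H.mu_lt])
  have hme : AEMeasurable (aver u) (volume.restrict Ω) :=
    (h.integrable.1.integral_prod_right').aemeasurable
  -- Truncating at the a priori bound changes the representative on a null set only and makes the
  -- bound hold at every point.
  set m : Space n → ℝ := fun x => min |hme.mk _ x| (M / (1 - μ)) with hm
  have hae : ∀ᵐ x ∂(volume.restrict Ω), |aver u x| = m x := by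
    filter_upwards [hme.ae_eq_mk, hbd] with x h1 h2
    have h3 := (enorm_aver_le u x).trans h2
    rw [Real.enorm_eq_ofReal_abs, ENNReal.ofReal_le_ofReal_iff hB0] at h3
    simp only [hm]
    rw [← h1, min_eq_left h3]
  refine ⟨m, ?_, ?_, ?_, ?_, hae, hbd⟩
  · refine h.congr hΩ ?_ (ae_eq_refl _) (ae_eq_refl _)
    filter_upwards [ae_phase_of_ae hae] with p hp
    simp only [absorb, hp]
  · exact (continuous_abs.measurable.comp hme.measurable_mk).min measurable_const
  · exact fun x => le_min (abs_nonneg _) hB0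
  · exact fun x => min_le_right _ _

end Coeff

namespace NiceSolution

variable {σa σb : Space n → ℝ} {k : Space n → Sph n → Sph n → ℝ} {a b κ c₀ μ ν : ℝ}
  {c c' : Sph n → ℝ} {B B' : ℝ} {u w : Space n → Sph n → ℝ} {m m' : Space n → ℝ}
  [IsProbabilityMeasure (sphereMeasure n)]

/-- Along a line the only gain is scattering, at most κB per unit length over a length at most ‖τ‖,
and ‖τ‖κ ≤ μ. -/
lemma ae_enorm_le (h : NiceSolution Ω σa σb k c B u m) (H : Coeff Ω σa σb k a b κ c₀ μ ν)
    (hΩ : IsDomainC1 Ω) : ∀ᵐ p ∂(phaseMeasure Ω),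
      ‖u p.1 p.2‖ₑ ≤ ‖c p.2‖ₑ + ENNReal.ofReal (μ * B) := by
  have h0 := h.solves.enorm_sub_le hΩ (Solves.zero (A := absorb σa σb m))
      (Eventually.of_forall fun p => H.absorb_nonneg h.nonneg p.1)
  have hmono := lineInt_mono_ae hΩ (Ω := Ω) (H := fun q : Space n × Sph n => ‖scatter k u q.1 q.2‖ₑ)
      (K := fun q => ENNReal.ofReal κ * ENNReal.ofReal B) (by
      filter_upwards [ae_phase_of_ae h.angNorm_le] with q hq
      exact (H.enorm_scatter_le u q.1 q.2).trans (by gcongr))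
  filter_upwards [h0, hmono, lineInt_const_le hΩ (ENNReal.ofReal κ * ENNReal.ofReal B)]
    with p h1 h2 h3
  simp only [sub_zero, sub_self, enorm_zero, mul_zero, add_zero] at h1
  refine h1.trans ?_
  gcongr
  refine (h2.trans h3).trans ?_
  have hκ := H.kappa_nonneg p.2
  rw [← ofReal_tauNorm hΩ, ← ENNReal.ofReal_mul hκ, ← ENNReal.ofReal_mul ENNReal.toReal_nonneg,
    ← mul_assoc]
  have hB0 : 0 ≤ B := (h.nonneg 0).trans (h.le 0)
  exact ENNReal.ofReal_le_ofReal (mul_le_mul_of_nonneg_right H.scatter_small hB0)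

lemma ae_enorm_m_sub_le (h : NiceSolution Ω σa σb k c B u m)
    (h' : NiceSolution Ω σa σb k c' B' w m') : ∀ᵐ x ∂(volume.restrict Ω),
      ‖m x - m' x‖ₑ ≤ ‖aver u x - aver w x‖ₑ ∧
        ‖aver u x - aver w x‖ₑ ≤ angNorm (fun x θ => u x θ - w x θ) x := by
  filter_upwards [h.ae_eq, h'.ae_eq, ae_integrable_slice h.solves.integrable,
    ae_integrable_slice h'.solves.integrable] with x h1 h2 h3 h4
  constructor
  · rw [← h1, ← h2, Real.enorm_eq_ofReal_abs, Real.enorm_eq_ofReal_abs]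
    exact ENNReal.ofReal_le_ofReal (abs_abs_sub_abs_le_abs_sub _ _)
  · rw [aver, aver, ← integral_sub h3 h4]
    exact enorm_aver_le (fun x θ => u x θ - w x θ) x

/-- The solution depends on the source in a Lipschitz way. -/
lemma ae_angNorm_sub_le (h : NiceSolution Ω σa σb k c B u m)
    (h' : NiceSolution Ω σa σb k c' B' w m') (H : Coeff Ω σa σb k a b κ c₀ μ ν)
    (hΩ : IsDomainC1 Ω) (hc : Measurable c) (hc' : Measurable c') {D W : ℝ} (hD : 0 ≤ D)
    (hW0 : 0 ≤ W) (hW : ∀ᵐ p ∂(phaseMeasure Ω), ‖w p.1 p.2‖ₑ ≤ ENNReal.ofReal W)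
    (hWs : W ≤ c₀ / (1 - μ)) (hcD : ∫⁻ θ, ‖c θ - c' θ‖ₑ ∂(sphereMeasure n) ≤ ENNReal.ofReal D) :
    ∀ᵐ x ∂(volume.restrict Ω), angNorm (fun x θ => u x θ - w x θ) x
      ≤ ENNReal.ofReal (D / ((1 - μ) * (1 - ν))) := by
  have hμ := H.mu_lt
  have hν := H.nu_lt
  obtain ⟨θ₀⟩ := nonempty_sph n
  have hκ0 := H.kappa_nonneg θ₀
  have hb0 := H.b_const_nonneg
  have hT : 0 ≤ (tauNorm Ω).toReal := ENNReal.toReal_nonneg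
  -- The contraction factor: μ from scattering, and ν(1 - μ) from the nonlinearity because W ≤ c₀/(1
  -- - μ). One minus this factor is (1 - μ)(1 - ν). Only w multiplies the difference of absorptions,
  -- so u, whose source is large, needs no pointwise bound.
  have hrate : (tauNorm Ω).toReal * (κ + b * W) ≤ μ + ν * (1 - μ) := by
    have e1 : (tauNorm Ω).toReal * b * W ≤ (tauNorm Ω).toReal * b * (c₀ / (1 - μ)) := by gcongr
    have e2 : (tauNorm Ω).toReal * b * (c₀ / (1 - μ)) ≤ ν * (1 - μ) := by
      rw [← mul_div_assoc, div_le_iff₀ (by linarith)]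
      calc _ ≤ _ := H.nonlin_small
        _ = _ := by ring
    linarith [H.scatter_small, mul_add (tauNorm Ω).toReal κ (b * W)]
  have hd := h.solves.enorm_sub_le hΩ h'.solves
    (Eventually.of_forall fun p => H.absorb_nonneg h.nonneg p.1)
  have hmono : (fun q : Space n × Sph n => ‖scatter k u q.1 q.2 - scatter k w q.1 q.2‖ₑ
      + ‖absorb σa σb m q.1 - absorb σa σb m' q.1‖ₑ * ‖w q.1 q.2‖ₑ) ≤ᵐ[phaseMeasure Ω]
      fun q => ENNReal.ofReal (κ + b * W) * angNorm (fun x θ => u x θ - w x θ) q.1 := by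
    filter_upwards [H.ae_scatter_sub h.solves.integrable h'.solves.integrable, hW,
      ae_phase_of_ae (h.ae_enorm_m_sub_le h')] with q h1 h2 h3
    rw [h1, ENNReal.ofReal_add hκ0 (by positivity), add_mul]
    refine add_le_add (H.enorm_scatter_le _ _ _) ?_
    calc _ ≤ ENNReal.ofReal b * angNorm (fun x θ => u x θ - w x θ) q.1 * ENNReal.ofReal W := by
          gcongr
          exact (H.enorm_absorb_sub_le m m' q.1).trans (by gcongr; exact h3.1.trans h3.2)
      _ = _ := by rw [ENNReal.ofReal_mul hb0]; ring
  have := ae_angNorm_le hΩ (v := fun x θ => u x θ - w x θ)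
    (h.solves.integrable.sub h'.solves.integrable) (C := fun θ => ‖c θ - c' θ‖ₑ)
    (hc.sub hc').enorm hD (κ₀ := κ + b * W) (by positivity) (κ' := μ + ν * (1 - μ))
    (by nlinarith) hrate hcD (by
      filter_upwards [hd, lineInt_mono_ae hΩ hmono] with p h1 h2
      exact h1.trans (by gcongr))
  convert this using 4
  ring

/-- Solutions with nonnegative sources are nonnegative. -/
lemma ae_nonneg (h : NiceSolution Ω σa σb k c B u m) (H : Coeff Ω σa σb k a b κ c₀ μ ν)
    (hΩ : IsDomainC1 Ω) (hc0 : ∀ θ, 0 ≤ c θ) : ∀ᵐ p ∂(phaseMeasure Ω), 0 ≤ u p.1 p.2 := by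
  obtain ⟨θ₀⟩ := nonempty_sph n
  -- The negative part of u is fed only by scattering of the negative part, so it satisfies the
  -- averaged inequality with M = 0 and vanishes.
  set v : Space n → Sph n → ℝ := fun x θ => max (-u x θ) 0 with hv
  have hvi : Integrable (fun p : Space n × Sph n => v p.1 p.2) (phaseMeasure Ω) :=
    h.solves.integrable.neg.pos_part
  have henorm : ∀ x θ, ‖v x θ‖ₑ = ENNReal.ofReal (-u x θ) := fun x θ => by
    rw [Real.enorm_of_nonneg (le_max_right _ _)]
    rcases le_total (-u x θ) 0 with hc | hc
    · simp [hc]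
    · simp [hc]
  have hneg := (h.solves.neg hΩ).ofReal_le hΩ
    (Eventually.of_forall fun p => H.absorb_nonneg h.nonneg p.1)
  have hsc : ∀ q : Space n × Sph n, ENNReal.ofReal (-scatter k u q.1 q.2)
      ≤ ENNReal.ofReal κ * angNorm v q.1 := by
    intro q
    by_cases hi : Integrable (fun θ' => k q.1 θ' q.2 * u q.1 θ') (sphereMeasure n)
    · rw [scatter, ← integral_neg]
      refine (ofReal_integral_le_lintegral hi.neg).trans ?_
      rw [angNorm, ← lintegral_const_mul' _ _ ENNReal.ofReal_ne_top]
      refine lintegral_mono fun θ' => ?_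
      rw [henorm, Pi.neg_apply, ← mul_neg, ENNReal.ofReal_mul (H.k_nonneg _ _ _)]
      gcongr
      exact H.k_le _ _ _
    -- If the product is not integrable, the integral takes the default value 0 and the bound is
    -- trivial.
    · rw [scatter, integral_undef hi]
      simp
  have := ae_angNorm_le hΩ hvi (C := fun _ => 0) measurable_const le_rfl (H.kappa_nonneg θ₀)
    H.mu_lt H.scatter_small (by simp) (by
      filter_upwards [hneg, lineInt_mono_ae hΩ (Ω := Ω) (Eventually.of_forall hsc)] with p h1 h2
      rw [henorm, zero_add]
      refine h1.trans ?_
      rw [ENNReal.ofReal_of_nonpos (neg_nonpos.2 (hc0 _)), zero_add]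
      exact h2)
  have hz : ∫⁻ p, ‖v p.1 p.2‖ₑ ∂(phaseMeasure Ω) = 0 := by
    rw [← lintegral_angNorm hvi.1]
    refine lintegral_eq_zero_of_ae_eq_zero ?_
    filter_upwards [this] with x hx
    simpa using hx
  rw [lintegral_eq_zero_iff' hvi.1.enorm] at hz
  filter_upwards [hz] with p hp
  rw [henorm, Pi.zero_apply, ENNReal.ofReal_eq_zero] at hp
  linarith

lemma ae_xray_le (hΩ : IsDomainC1 Ω) {f : Space n → ℝ} {C : ℝ} (hC0 : 0 ≤ C) (hC : ∀ x, f x ≤ C) :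
    ∀ᵐ p ∂(phaseMeasure Ω), xray Ω f p ≤ (tauNorm Ω).toReal * C := by
  filter_upwards [ae_tauMinus_le hΩ, ae_phase_mem hΩ] with p h1 h2
  have hτ := tauMinus_pos hΩ h2 p.2
  rw [xray_eq hΩ f h2]
  by_cases hi : IntervalIntegrable (fun s : ℝ => f (p.1 - s • (p.2 : Space n))) volume 0
      (tauMinus Ω p.1 p.2)
  · calc _ ≤ ∫ s in (0 : ℝ)..(tauMinus Ω p.1 p.2), C :=
          intervalIntegral.integral_mono_on hτ.le hi (by simp) fun s _ => hC _
      _ = tauMinus Ω p.1 p.2 * C := by simp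
      _ ≤ _ := by gcongr
  · rw [intervalIntegral.integral_undef hi]
    positivity

/-- The lower bound for the solution with constant source. -/
lemma ae_lower_bound (h : NiceSolution Ω σa σb k (fun _ => c₀) B u m)
    (H : Coeff Ω σa σb k a b κ c₀ μ ν) (hΩ : IsDomainC1 Ω) : ∀ᵐ p ∂(phaseMeasure Ω),
      Real.exp (-((tauNorm Ω).toReal * (a + b * B))) * c₀ ≤ u p.1 p.2 := by
  have hpos := h.ae_nonneg H hΩ fun _ => H.c_pos.le
  have hB0 : 0 ≤ B := (h.nonneg 0).trans (h.le 0)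
  -- The comparison function is the solution with the same absorption and boundary value but no
  -- scattering. Scattering of the nonnegative u is a nonnegative source, so the difference has a
  -- nonpositive one.
  have hE := solves_lineExp hΩ (H.measurable_absorb h.measurable).stronglyMeasurable
    (H.norm_absorb_le h.nonneg h.le) (H.absorb_nonneg h.nonneg)
    (φ := fun _ => c₀) stronglyMeasurable_const (M := |c₀|) (fun _ => le_rfl)
  have hd := (hE.sub hΩ h.solves).ofReal_le hΩ
    (Eventually.of_forall fun p => H.absorb_nonneg h.nonneg p.1)
  have hsc : (fun q : Space n × Sph n => ENNReal.ofReal (0 - scatter k u q.1 q.2))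
      ≤ᵐ[phaseMeasure Ω] fun _ => 0 := by
    filter_upwards [ae_phase_of_ae (Measure.ae_ae_of_ae_prod hpos)] with q hq
    rw [ENNReal.ofReal_of_nonpos]
    rw [zero_sub, neg_nonpos]
    refine integral_nonneg_of_ae ?_
    filter_upwards [hq] with θ' hθ'
    exact mul_nonneg (H.k_nonneg _ _ _) hθ'
  filter_upwards [hd, lineInt_mono_ae hΩ hsc, lineInt_const_le hΩ 0, ae_xray_le hΩ
    (add_nonneg H.a_const_nonneg (mul_nonneg H.b_const_nonneg hB0))
    (H.absorb_le h.nonneg h.le)] with p h1 h2 h3 h4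
  have h5 := h1.trans (add_le_add_right (h2.trans h3) _)
  rw [sub_self, ENNReal.ofReal_zero, mul_zero, add_zero, nonpos_iff_eq_zero,
    ENNReal.ofReal_eq_zero, sub_nonpos] at h5
  refine le_trans ?_ h5
  rw [mul_comm]
  have := H.c_pos.le
  gcongr
  exact Real.exp_le_exp.2 (neg_le_neg h4)

end NiceSolution

end TwoPhoton

end

noncomputable section

namespace TwoPhoton

variable {n : ℕ} {Ω : Set (Space n)}

/-! ### Measurable representatives of the coefficients -/

/-- Clamping to [0, B] makes the bounds hold everywhere, so that estimates at a prescribed point or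
in a prescribed direction need no further exceptional sets in the coefficients. -/
lemma exists_clamped_rep {α : Type*} [MeasurableSpace α] {μ : Measure α} {f : α → ℝ}
    (hf : AEStronglyMeasurable f μ) {B : ℝ} (hB : 0 ≤ B) (h0 : ∀ᵐ x ∂μ, 0 ≤ f x)
    (hle : ∀ᵐ x ∂μ, f x ≤ B) :
    ∃ g : α → ℝ, Measurable g ∧ (∀ x, 0 ≤ g x) ∧ (∀ x, g x ≤ B) ∧ f =ᵐ[μ] g := by
  refine ⟨fun x => max 0 (min (hf.mk f x) B), ?_, fun x => le_max_left _ _,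
    fun x => max_le hB (min_le_right _ _), ?_⟩
  · exact measurable_const.max (hf.stronglyMeasurable_mk.measurable.min measurable_const)
  · filter_upwards [hf.ae_eq_mk, h0, hle] with x h1 h2 h3
    rw [← h1, min_eq_left h3, max_eq_right h2]

lemma ae_le_toReal_eLpNorm_top {α : Type*} [MeasurableSpace α] {μ : Measure α} {f : α → ℝ}
    (hf : MemLp f ⊤ μ) : ∀ᵐ x ∂μ, f x ≤ (eLpNorm f ⊤ μ).toReal := by
  have h := ae_le_eLpNormEssSup (μ := μ) (f := f)
  filter_upwards [h] with x hx
  rw [← eLpNorm_exponent_top] at hx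
  have h2 := ENNReal.toReal_mono hf.2.ne hx
  rw [toReal_enorm] at h2
  exact (Real.le_norm_self _).trans h2

lemma ae_of_ae_phase [IsProbabilityMeasure (sphereMeasure n)] {Q : Space n → Prop}
    (h : ∀ᵐ p ∂(phaseMeasure Ω), Q p.1) : ∀ᵐ x ∂(volume.restrict Ω), Q x := by
  filter_upwards [Measure.ae_ae_of_ae_prod h] with x hx
  obtain ⟨θ, hθ⟩ := hx.exists
  exact hθ

/-- The representative of an absorption coefficient. -/
lemma exists_rep_coeff [IsProbabilityMeasure (sphereMeasure n)] {σ : Space n → ℝ}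
    (h : MemLp (fun p : Space n × Sph n => σ p.1) ⊤ (phaseMeasure Ω))
    (h0 : ∀ᵐ p ∂(phaseMeasure Ω), 0 ≤ σ p.1) :
    ∃ σ' : Space n → ℝ, Measurable σ' ∧ (∀ x, 0 ≤ σ' x) ∧
      (∀ x, σ' x ≤ (eLpNorm (fun p : Space n × Sph n => σ p.1) ⊤ (phaseMeasure Ω)).toReal) ∧
      ∀ᵐ x ∂(volume.restrict Ω), σ x = σ' x := by
  have hm : AEStronglyMeasurable σ (volume.restrict Ω) := by
    have h1 := h.1
    have h2 := Measure.ae_ae_of_ae_prod h1.ae_eq_mk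
    -- Measurability of σ on Ω is inherited from a slice, at a direction θ for which the joint
    -- representative agrees with σ almost everywhere.
    have h3 : ∀ᵐ θ ∂(sphereMeasure n), ∀ᵐ x ∂(volume.restrict Ω),
        σ x = h1.mk (fun p : Space n × Sph n => σ p.1) (x, θ) := ae_ae_of_ae_prod_swap h1.ae_eq_mk
    obtain ⟨θ, hθ⟩ := h3.exists
    exact ⟨fun x => h1.mk _ (x, θ),
      h1.stronglyMeasurable_mk.comp_measurable (by fun_prop), hθ⟩
  exact exists_clamped_rep hm ENNReal.toReal_nonneg (ae_of_ae_phase h0)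
    (ae_of_ae_phase (ae_le_toReal_eLpNorm_top h))

lemma exists_rep_kernel {k : Space n → Sph n → Sph n → ℝ}
    (h : MemLp (fun q : (Space n × Sph n) × Sph n => k q.1.1 q.1.2 q.2) ⊤
      ((phaseMeasure Ω).prod (sphereMeasure n)))
    (h0 : ∀ᵐ q ∂((phaseMeasure Ω).prod (sphereMeasure n)), 0 ≤ k q.1.1 q.1.2 q.2) :
    ∃ k' : Space n → Sph n → Sph n → ℝ,
      Measurable (fun q : (Space n × Sph n) × Sph n => k' q.1.1 q.1.2 q.2) ∧
      (∀ x θ' θ, 0 ≤ k' x θ' θ) ∧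
      (∀ x θ' θ, k' x θ' θ ≤ (eLpNorm (fun q : (Space n × Sph n) × Sph n => k q.1.1 q.1.2 q.2) ⊤
        ((phaseMeasure Ω).prod (sphereMeasure n))).toReal) ∧
      ∀ᵐ q ∂((phaseMeasure Ω).prod (sphereMeasure n)), k q.1.1 q.1.2 q.2 = k' q.1.1 q.1.2 q.2 := by
  obtain ⟨g, h1, h2, h3, h4⟩ := exists_clamped_rep h.1 ENNReal.toReal_nonneg h0
    (ae_le_toReal_eLpNorm_top h)
  exact ⟨fun x θ' θ => g ((x, θ'), θ), h1, fun _ _ _ => h2 _, fun _ _ _ => h3 _, h4⟩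

/-- Exchanging the two directions in an almost everywhere statement on `Ω × 𝕊 × 𝕊`. -/
lemma ae_phase_ae_swap [SFinite (sphereMeasure n)] {Q : Space n → Sph n → Sph n → Prop}
    (h : ∀ᵐ q ∂((phaseMeasure Ω).prod (sphereMeasure n)), Q q.1.1 q.1.2 q.2) :
    ∀ᵐ p ∂(phaseMeasure Ω), ∀ᵐ θ' ∂(sphereMeasure n), Q p.1 θ' p.2 := by
  have m1 := measurePreserving_prodAssoc (volume.restrict Ω) (sphereMeasure n) (sphereMeasure n)
  have m2 : MeasurePreserving (Prod.map id Prod.swap) ((volume.restrict Ω).prod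
      ((sphereMeasure n).prod (sphereMeasure n))) ((volume.restrict Ω).prod
      ((sphereMeasure n).prod (sphereMeasure n))) :=
    (MeasurePreserving.id (volume.restrict Ω)).prod (Measure.measurePreserving_swap)
  have m3 := m1.symm.comp (m2.comp m1)
  have := m3.quasiMeasurePreserving.ae h
  exact Measure.ae_ae_of_ae_prod this

lemma restrict_ne_zero (hΩ : IsDomainC1 Ω) : (volume : Measure (Space n)).restrict Ω ≠ 0 := by
  rw [Ne, Measure.restrict_eq_zero]
  exact (hΩ.isOpen.measure_pos volume hΩ.nonempty).ne'

lemma starNorm_eq (hΩ : IsDomainC1 Ω) (c : Sph n → ℝ) :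
    starNorm Ω (fun _ θ => c θ) = ∫⁻ θ, ‖c θ‖ₑ ∂(sphereMeasure n) :=
  essSup_const _ (restrict_ne_zero hΩ)

/-- For a source independent of x, `starNorm` is its L¹ norm on the sphere, hence at least c₀ as the
total mass is one. So the smallness condition for the peaked source already contains the one for the
constant source c₀. -/
lemma coeff_of_admissible (hΩ : IsDomainC1 Ω) [IsProbabilityMeasure (sphereMeasure n)]
    {σa σb σa' σb' : Space n → ℝ} {k k' : Space n → Sph n → Sph n → ℝ} {c : Sph n → ℝ} {c₀ : ℝ}
    (h : Admissible Ω (fun x _ => σa x) (fun x _ => σb x) k (fun _ θ => c θ)) (hc₀ : 0 < c₀)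
    (hc : ∀ θ, c₀ ≤ c θ)
    (ha1 : Measurable σa') (ha2 : ∀ x, 0 ≤ σa' x)
    (ha3 : ∀ x, σa' x ≤ (eLpNorm (fun p : Space n × Sph n => σa p.1) ⊤ (phaseMeasure Ω)).toReal)
    (hb1 : Measurable σb') (hb2 : ∀ x, 0 ≤ σb' x)
    (hb3 : ∀ x, σb' x ≤ (eLpNorm (fun p : Space n × Sph n => σb p.1) ⊤ (phaseMeasure Ω)).toReal)
    (hk1 : Measurable (fun q : (Space n × Sph n) × Sph n => k' q.1.1 q.1.2 q.2))
    (hk2 : ∀ x θ' θ, 0 ≤ k' x θ' θ)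
    (hk3 : ∀ x θ' θ, k' x θ' θ ≤
      (eLpNorm (fun q : (Space n × Sph n) × Sph n => k q.1.1 q.1.2 q.2) ⊤
        ((phaseMeasure Ω).prod (sphereMeasure n))).toReal) :
    ∃ μ ν, Coeff Ω σa' σb' k'
      (eLpNorm (fun p : Space n × Sph n => σa p.1) ⊤ (phaseMeasure Ω)).toReal
      (eLpNorm (fun p : Space n × Sph n => σb p.1) ⊤ (phaseMeasure Ω)).toReal
      (eLpNorm (fun q : (Space n × Sph n) × Sph n => k q.1.1 q.1.2 q.2) ⊤
        ((phaseMeasure Ω).prod (sphereMeasure n))).toReal c₀ μ ν := by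
  obtain ⟨μ, ν, hμ0, hμ1, hν0, hν1, hs1, hs2⟩ := h.small
  refine ⟨μ, ν, ha1, hb1, hk1, ha2, ha3, hb2, hb3, hk2, hk3, hc₀, hμ0, hμ1, hν0, hν1, ?_, ?_⟩
  · rw [← ENNReal.toReal_mul]
    exact ENNReal.toReal_le_of_le_ofReal hμ0 hs1
  · have hstar : ENNReal.ofReal c₀ ≤ starNorm Ω (fun _ θ => c θ) := by
      rw [starNorm_eq hΩ]
      calc ENNReal.ofReal c₀ = ∫⁻ _ : Sph n, ENNReal.ofReal c₀ ∂(sphereMeasure n) := by simp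
        _ ≤ _ := lintegral_mono fun θ => by
          rw [Real.enorm_of_nonneg (hc₀.le.trans (hc θ))]
          exact ENNReal.ofReal_le_ofReal (hc θ)
    have h3 : tauNorm Ω * eLpNorm (fun p : Space n × Sph n => σb p.1) ⊤ (phaseMeasure Ω)
        * ENNReal.ofReal c₀ ≤ ENNReal.ofReal (ν * (1 - μ) ^ 2) := le_trans (by gcongr) hs2
    have h4 := ENNReal.toReal_le_of_le_ofReal (by positivity) h3
    rwa [ENNReal.toReal_mul, ENNReal.toReal_mul, ENNReal.toReal_ofReal hc₀.le] at h4

/-- Weak solutions are integrated solutions for the representatives of the coefficients. -/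
lemma IsSolution.solves (hΩ : IsDomainC1 Ω) [IsProbabilityMeasure (sphereMeasure n)]
    {σa σb σa' σb' : Space n → ℝ} {k k' : Space n → Sph n → Sph n → ℝ} {c : Sph n → ℝ}
    {u : Space n → Sph n → ℝ}
    (h : IsSolution Ω (fun x _ => σa x) (fun x _ => σb x) k (fun _ θ => c θ) u)
    (ha : ∀ᵐ x ∂(volume.restrict Ω), σa x = σa' x) (hb : ∀ᵐ x ∂(volume.restrict Ω), σb x = σb' x)
    (hk : ∀ᵐ q ∂((phaseMeasure Ω).prod (sphereMeasure n)), k q.1.1 q.1.2 q.2 = k' q.1.1 q.1.2 q.2) :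
    Solves Ω c (absorb σa' σb' fun x => |aver u x|) (fun p => scatter k' u p.1 p.2)
      (fun p => u p.1 p.2) := by
  obtain ⟨g, hg, hweak, heq⟩ := h.equation
  have hbd := eq_boundary_add_integral (f := fun _ θ => c θ) hΩ h.integrable hg hweak h.boundary
  have hgR : (fun p : Space n × Sph n => g p.1 p.2) =ᵐ[phaseMeasure Ω] fun p =>
      scatter k' u p.1 p.2 - absorb σa' σb' (fun x => |aver u x|) p.1 * u p.1 p.2 := by
    filter_upwards [heq, ae_phase_of_ae ha, ae_phase_of_ae hb, ae_phase_ae_swap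
      (Q := fun x θ' θ => k x θ' θ = k' x θ' θ) hk] with p h1 h2 h3 h4
    have : scatter k u p.1 p.2 = scatter k' u p.1 p.2 :=
      integral_congr_ae (h4.mono fun θ' hθ' => by simp only [hθ'])
    rw [← this, absorb, ← h2, ← h3]
    linarith
  refine ⟨h.integrable, hg.congr hgR, ?_⟩
  filter_upwards [hbd, integral_line_congr_ae hΩ hgR] with p h1 h2
  rw [h1, ← h2]

/-- The direction is prescribed, so null sets are transported along lines by `ae_line_of_ae_fixed`,
and not by its counterpart for almost every direction. -/
lemma attenuation_ae_eq (hΩ : IsDomainC1 Ω) {σa σb σa' σb' : Space n → ℝ}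
    {w : Space n → Sph n → ℝ} {m : Space n → ℝ}
    (ha : ∀ᵐ x ∂(volume.restrict Ω), σa x = σa' x) (hb : ∀ᵐ x ∂(volume.restrict Ω), σb x = σb' x)
    (hm : ∀ᵐ x ∂(volume.restrict Ω), |aver w x| = m x) (θ : Sph n) :
    ∀ᵐ x ∂(volume.restrict Ω), attenuation Ω (fun x _ => σa x) (fun x _ => σb x) w θ x
      = lineExp Ω (absorb σa' σb' m) (x, θ) := by
  have h : ∀ᵐ x ∂(volume.restrict Ω),
      Sig (fun x _ => σa x) (fun x _ => σb x) (fun y => |aver w y|) x θ = -absorb σa' σb' m x := by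
    filter_upwards [ha, hb, hm] with x h1 h2 h3
    rw [Sig, absorb, h1, h2, h3]
  filter_upwards [ae_line_of_ae_fixed hΩ θ h, ae_restrict_mem hΩ.isOpen.measurableSet] with x h1 hx
  have hτ := tauMinus_pos hΩ hx θ
  rw [attenuation, lineExp, xray_eq hΩ _ (p := (x, θ)) hx, ← intervalIntegral.integral_neg,
    intervalIntegral.integral_of_le hτ.le, intervalIntegral.integral_of_le hτ.le,
    integral_Ioc_eq_integral_Ioo, integral_Ioc_eq_integral_Ioo, integral_congr_ae h1]

lemma isLebesgueDirection_congr [SFinite (sphereMeasure n)] {k k' : Space n → Sph n → Sph n → ℝ}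
    (hk : ∀ᵐ q ∂((phaseMeasure Ω).prod (sphereMeasure n)), k q.1.1 q.1.2 q.2 = k' q.1.1 q.1.2 q.2)
    {θ' : Sph n} (h : IsLebesgueDirection Ω k θ') : IsLebesgueDirection Ω k' θ' := by
  filter_upwards [h, ae_phase_ae_swap (Q := fun x θ' θ => k x θ' θ = k' x θ' θ) hk] with p h1 h2
  obtain ⟨c, hc⟩ := h1
  refine ⟨c, hc.congr fun r => ?_⟩
  exact average_congr (ae_restrict_of_ae (h2.mono fun θ'' hθ => by simp only [hθ]))

end TwoPhoton

end

noncomputable section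

namespace TwoPhoton

/-! ### Gnomonic coordinates on the sphere -/

variable {m : ℕ}

/-- An isometric parametrization of the hyperplane orthogonal to `θ'`. -/
structure IsFrame (θ' : Sph (m + 1)) (e : Space m →ₗᵢ[ℝ] Space (m + 1)) : Prop where
  orth : ∀ η, inner ℝ (θ' : Space (m + 1)) (e η) = 0
  preserving : MeasurePreserving (fun q : ℝ × Space m => q.1 • (θ' : Space (m + 1)) + e q.2)

/-- The decomposition into the line of θ' and its orthogonal complement is isometric, hence
preserves volume; an orthonormal basis identifies the complement with `Space m`. -/
lemma exists_isFrame (θ' : Sph (m + 1)) : ∃ e : Space m →ₗᵢ[ℝ] Space (m + 1), IsFrame θ' e := by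
  have hne : (θ' : Space (m + 1)) ≠ 0 := ne_zero_of_mem_unit_sphere θ'
  have : Fact (Module.finrank ℝ (Space (m + 1)) = m + 1) := ⟨by simp⟩
  set b := OrthonormalBasis.fromOrthogonalSpanSingleton (𝕜 := ℝ) m hne
  set K : Submodule ℝ (Space (m + 1)) := ℝ ∙ (θ' : Space (m + 1)) with hK
  refine ⟨Kᗮ.subtypeₗᵢ.comp b.repr.symm.toLinearIsometry, ?_, ?_⟩
  · intro η
    exact Submodule.mem_orthogonal_singleton_iff_inner_right.1 (b.repr.symm η).2
  · have m1 := (LinearIsometryEquiv.toSpanUnitSingleton (𝕜 := ℝ) (θ' : Space (m + 1))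
      (norm_sph θ')).measurePreserving
    have m2 := b.repr.symm.measurePreserving
    have m3 := m1.prod m2
    have m4 := (WithLp.volume_preserving_toLp K Kᗮ).comp m3
    have m5 := K.orthogonalDecomposition.symm.measurePreserving.comp m4
    convert m5 using 1
    · ext1 q
      simp [Submodule.orthogonalDecomposition_symm_apply]
    · exact Measure.volume_eq_prod _ _

/-- Normalization, as a map to the sphere. -/
def nrm (θ' : Sph (m + 1)) (y : Space (m + 1)) : Sph (m + 1) :=
  open Classical in
  if h : y ∈ ({0}ᶜ : Set (Space (m + 1))) then (homeomorphUnitSphereProd _ ⟨y, h⟩).1 else θ'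

lemma measurable_nrm (θ' : Sph (m + 1)) : Measurable (nrm θ') := by
  classical
  refine Measurable.dite (s := ({0}ᶜ : Set (Space (m + 1))))
    (f := fun y => (homeomorphUnitSphereProd _ y).1) (g := fun _ => θ') ?_ measurable_const
    (measurableSet_singleton _).compl
  exact (continuous_fst.comp (homeomorphUnitSphereProd _).continuous).measurable

lemma coe_nrm (θ' : Sph (m + 1)) {y : Space (m + 1)} (hy : y ≠ 0) :
    (nrm θ' y : Space (m + 1)) = ‖y‖⁻¹ • y := by
  have : y ∈ ({0}ᶜ : Set (Space (m + 1))) := hy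
  simp only [nrm, this, dite_true, homeomorphUnitSphereProd_apply_fst_coe]

lemma nrm_smul (θ' : Sph (m + 1)) {y : Space (m + 1)} {r : ℝ} (hr : 0 < r) :
    nrm θ' (r • y) = nrm θ' y := by
  by_cases hy : y = 0
  · simp [hy]
  · refine Subtype.ext ?_
    rw [coe_nrm θ' hy, coe_nrm θ' (smul_ne_zero hr.ne' hy), norm_smul, Real.norm_of_nonneg hr.le,
      smul_smul]
    congr 1
    have := norm_ne_zero_iff.2 hy
    field_simp

lemma nrm_coe (θ' θ : Sph (m + 1)) : nrm θ' (θ : Space (m + 1)) = θ := by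
  refine Subtype.ext ?_
  rw [coe_nrm θ' (ne_zero_of_mem_unit_sphere θ), norm_sph]
  simp

/-- The gnomonic parametrization of the open hemisphere around `θ'`. -/
def gno (θ' : Sph (m + 1)) (e : Space m →ₗᵢ[ℝ] Space (m + 1)) (η : Space m) : Sph (m + 1) :=
  nrm θ' (θ' + e η)

lemma measurable_gno (θ' : Sph (m + 1)) (e : Space m →ₗᵢ[ℝ] Space (m + 1)) :
    Measurable (gno θ' e) :=
  (measurable_nrm θ').comp (by have := e.continuous; fun_prop)

lemma lintegral_comp_smul_space (f : Space m → ℝ≥0∞) (hf : Measurable f) {c : ℝ} (hc : 0 < c) :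
    ∫⁻ η, f (c • η) = ENNReal.ofReal ((c ^ m)⁻¹) * ∫⁻ η, f η := by
  have h := Measure.map_addHaar_smul (volume : Measure (Space m)) hc.ne'
  rw [← lintegral_map hf (measurable_const_smul c), h, lintegral_smul_measure,
    finrank_euclideanSpace_fin, abs_of_pos (by positivity), smul_eq_mul]

/-- The slab 0 < θ'·y < 1 is integrated in two ways, in polar coordinates here and in Cartesian ones
in `cartesian_side`. Since F ∘ `nrm` is constant on rays, the radial integral runs over 0 < r <
1/(θ'·θ) and yields (θ'·θ)^{-(m+1)}/(m+1); rays with θ'·θ ≤ 0 miss the slab. -/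
lemma polar_side (θ' : Sph (m + 1)) {F : Sph (m + 1) → ℝ≥0∞} (hF : Measurable F) :
    ∫⁻ y : Space (m + 1), F (nrm θ' y) *
        (Ioo (0 : ℝ) 1).indicator 1 (inner ℝ (θ' : Space (m + 1)) y)
      = ∫⁻ θ, F θ * {θ : Sph (m + 1) | 0 < inner ℝ (θ' : Space (m + 1)) (θ : Space (m + 1))}.indicator
          (fun θ => ENNReal.ofReal
            ((inner ℝ (θ' : Space (m + 1)) (θ : Space (m + 1)))⁻¹ ^ (m + 1) / (m + 1))) θ
        ∂((volume : Measure (Space (m + 1))).toSphere) := by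
  set G : Space (m + 1) → ℝ≥0∞ := fun y => F (nrm θ' y) *
    (Ioo (0 : ℝ) 1).indicator 1 (inner ℝ (θ' : Space (m + 1)) y) with hG
  have hGm : Measurable G := by
    refine (hF.comp (measurable_nrm θ')).mul ?_
    exact (measurable_one.indicator measurableSet_Ioo).comp (by fun_prop)
  have h0 : ∫⁻ y, G y = ∫⁻ y in ({0}ᶜ : Set (Space (m + 1))), G y := by
    rw [Measure.restrict_eq_self_of_ae_mem]
    exact compl_mem_ae_iff.2 (measure_singleton _)
  have hmp := (volume : Measure (Space (m + 1))).measurePreserving_homeomorphUnitSphereProd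
  have h1 : ∫⁻ y in ({0}ᶜ : Set (Space (m + 1))), G y
      = ∫⁻ z, G ((z.2 : ℝ) • (z.1 : Space (m + 1))) ∂((volume : Measure (Space (m + 1))).toSphere.prod
        (Measure.volumeIoiPow (Module.finrank ℝ (Space (m + 1)) - 1))) := by
    rw [← lintegral_subtype_comap (measurableSet_singleton _).compl, ← hmp.lintegral_comp (by fun_prop)]
    refine lintegral_congr fun y => ?_
    rw [← homeomorphUnitSphereProd_symm_apply_coe, Homeomorph.symm_apply_apply]
  rw [h0, h1, lintegral_prod _ (by fun_prop)]
  refine lintegral_congr fun θ => ?_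
  have hr : ∀ r : Ioi (0 : ℝ), G ((r : ℝ) • (θ : Space (m + 1))) = F θ *
      {r : Ioi (0 : ℝ) | (r : ℝ) * inner ℝ (θ' : Space (m + 1)) (θ : Space (m + 1)) ∈ Ioo (0 : ℝ) 1}.indicator
        1 r := by
    intro r
    simp only [hG]
    rw [nrm_smul θ' r.2, nrm_coe, real_inner_smul_right]
    rfl
  simp only [hr]
  have hms : MeasurableSet {r : Ioi (0 : ℝ) |
      (r : ℝ) * inner ℝ (θ' : Space (m + 1)) (θ : Space (m + 1)) ∈ Ioo (0 : ℝ) 1} :=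
    measurableSet_Ioo.preimage (by fun_prop)
  rw [lintegral_const_mul _ (measurable_one.indicator hms), lintegral_indicator_one hms]
  congr 1
  set t := inner ℝ (θ' : Space (m + 1)) (θ : Space (m + 1)) with ht
  by_cases hpos : 0 < t
  · have hset : {r : Ioi (0 : ℝ) | (r : ℝ) * t ∈ Ioo (0 : ℝ) 1} = Iio ⟨t⁻¹, inv_pos.2 hpos⟩ := by
      ext r
      have hr0 : (0 : ℝ) < r := r.2
      simp only [mem_ofPred_eq, mem_Ioo, mem_Iio, ← Subtype.coe_lt_coe]
      rw [lt_inv_comm₀ hr0 hpos, ← one_div, lt_div_iff₀ hr0, mul_comm t]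
      exact ⟨fun h => h.2, fun h => ⟨by positivity, h⟩⟩
    rw [hset, Measure.volumeIoiPow_apply_Iio, indicator_of_mem (by exact hpos)]
    simp [ht]
  · have hset : {r : Ioi (0 : ℝ) | (r : ℝ) * t ∈ Ioo (0 : ℝ) 1} = ∅ := by
      ext r
      have hr0 : (0 : ℝ) < r := r.2
      simp only [mem_ofPred_eq, mem_Ioo, mem_empty_iff_false, iff_false, not_and]
      intro h
      exact absurd (pos_of_mul_pos_right h hr0.le) hpos
    rw [hset, measure_empty, indicator_of_notMem (by exact hpos)]

/-- The slice θ'·y = t is the gnomonic plane t = 1 dilated by t, so it contributes t^m times the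
same integral, and ∫₀¹ t^m dt = 1/(m+1). -/
lemma cartesian_side {θ' : Sph (m + 1)} {e : Space m →ₗᵢ[ℝ] Space (m + 1)} (he : IsFrame θ' e)
    {F : Sph (m + 1) → ℝ≥0∞} (hF : Measurable F) :
    ∫⁻ y : Space (m + 1), F (nrm θ' y) *
        (Ioo (0 : ℝ) 1).indicator 1 (inner ℝ (θ' : Space (m + 1)) y)
      = ENNReal.ofReal (1 / (m + 1)) * ∫⁻ η, F (gno θ' e η) := by
  have hGm : Measurable fun y : Space (m + 1) => F (nrm θ' y) *
        (Ioo (0 : ℝ) 1).indicator (1 : ℝ → ℝ≥0∞) (inner ℝ (θ' : Space (m + 1)) y) := by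
    refine (hF.comp (measurable_nrm θ')).mul ?_
    exact (measurable_one.indicator measurableSet_Ioo).comp (by fun_prop)
  have hgm : Measurable fun η => F (gno θ' e η) := hF.comp (measurable_gno θ' e)
  rw [← he.preserving.lintegral_comp hGm]
  have hin : ∀ q : ℝ × Space m, inner ℝ (θ' : Space (m + 1)) (q.1 • (θ' : Space (m + 1)) + e q.2)
      = q.1 := fun q => by
    rw [inner_add_right, he.orth, real_inner_smul_right, real_inner_self_eq_norm_sq, norm_sph]
    simp
  simp only [hin]
  have hm1 : Measurable fun q : ℝ × Space m => F (nrm θ' (q.1 • (θ' : Space (m + 1)) + e q.2)) *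
      (Ioo (0 : ℝ) 1).indicator (1 : ℝ → ℝ≥0∞) q.1 := by
    refine ((hF.comp (measurable_nrm θ')).comp ?_).mul ?_
    · have := e.continuous
      fun_prop
    · exact (measurable_one.indicator measurableSet_Ioo).comp (by fun_prop)
  rw [Measure.volume_eq_prod, lintegral_prod _ hm1.aemeasurable]
  have h2 : ∀ t : ℝ, ∫⁻ η : Space m, F (nrm θ' (t • (θ' : Space (m + 1)) + e η)) *
      (Ioo (0 : ℝ) 1).indicator (1 : ℝ → ℝ≥0∞) t
      = (Ioo (0 : ℝ) 1).indicator (fun t => ENNReal.ofReal (t ^ m)) t * ∫⁻ η, F (gno θ' e η) := by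
    intro t
    by_cases ht : t ∈ Ioo (0 : ℝ) 1
    · rw [indicator_of_mem ht, indicator_of_mem ht]
      simp only [Pi.one_apply, mul_one]
      have h3 : ∀ η : Space m, F (nrm θ' (t • (θ' : Space (m + 1)) + e η))
          = F (gno θ' e (t⁻¹ • η)) := fun η => by
        rw [gno, ← nrm_smul θ' ht.1 (y := θ' + e (t⁻¹ • η)), smul_add, map_smul, smul_smul,
          mul_inv_cancel₀ ht.1.ne', one_smul]
      simp only [h3]
      rw [lintegral_comp_smul_space _ hgm (inv_pos.2 ht.1), inv_pow, inv_inv]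
    · rw [indicator_of_notMem ht, indicator_of_notMem ht]
      simp
  simp only [h2]
  rw [lintegral_mul_const _ (by
    exact (Measurable.indicator (by fun_prop) measurableSet_Ioo)),
    lintegral_indicator measurableSet_Ioo]
  congr 1
  rw [← ofReal_integral_eq_lintegral_ofReal]
  · rw [← integral_Ioc_eq_integral_Ioo, ← intervalIntegral.integral_of_le zero_le_one]
    simp
  · exact ((continuous_pow m).integrableOn_Icc (a := 0) (b := 1)).mono_set Ioo_subset_Icc_self
  · filter_upwards [ae_restrict_mem measurableSet_Ioo] with t ht
    exact pow_nonneg ht.1.le _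

/-- Integration in gnomonic coordinates. -/
lemma lintegral_gno {θ' : Sph (m + 1)} {e : Space m →ₗᵢ[ℝ] Space (m + 1)} (he : IsFrame θ' e)
    {F : Sph (m + 1) → ℝ≥0∞} (hF : Measurable F) :
    ∫⁻ θ in {θ : Sph (m + 1) | 0 < inner ℝ (θ' : Space (m + 1)) (θ : Space (m + 1))},
      F θ * ENNReal.ofReal ((inner ℝ (θ' : Space (m + 1)) (θ : Space (m + 1)))⁻¹ ^ (m + 1))
        ∂((volume : Measure (Space (m + 1))).toSphere) = ∫⁻ η, F (gno θ' e η) := by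
  have h := (polar_side θ' hF).symm.trans (cartesian_side he hF)
  have hm : MeasurableSet {θ : Sph (m + 1) | 0 < inner ℝ (θ' : Space (m + 1)) (θ : Space (m + 1))} :=
    (isOpen_lt continuous_const (by fun_prop)).measurableSet
  have hpos : (0 : ℝ) < m + 1 := by positivity
  have e1 : ENNReal.ofReal (1 / ((m : ℝ) + 1)) ≠ 0 := by
    rw [Ne, ENNReal.ofReal_eq_zero, not_le]; positivity
  rw [← ENNReal.mul_right_inj e1 ENNReal.ofReal_ne_top, ← h, ← lintegral_const_mul _ (by fun_prop),
    ← lintegral_indicator hm]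
  refine lintegral_congr fun θ => ?_
  by_cases ht : θ ∈ {θ : Sph (m + 1) | 0 < inner ℝ (θ' : Space (m + 1)) (θ : Space (m + 1))}
  · rw [indicator_of_mem ht, indicator_of_mem ht, div_eq_mul_one_div (_ ^ _), mul_comm (_ ^ _),
      ENNReal.ofReal_mul (by positivity)]
    ring
  · rw [indicator_of_notMem ht, indicator_of_notMem ht, mul_zero]

/-! ### Measures of spherical caps -/

lemma norm_frame_sq {θ' : Sph (m + 1)} {e : Space m →ₗᵢ[ℝ] Space (m + 1)} (he : IsFrame θ' e)
    (η : Space m) : ‖(θ' : Space (m + 1)) + e η‖ ^ 2 = 1 + ‖η‖ ^ 2 := by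
  rw [norm_add_sq_real, he.orth, norm_sph, e.norm_map]
  ring

lemma frame_ne_zero {θ' : Sph (m + 1)} {e : Space m →ₗᵢ[ℝ] Space (m + 1)} (he : IsFrame θ' e)
    (η : Space m) : (θ' : Space (m + 1)) + e η ≠ 0 := by
  intro h
  have := norm_frame_sq he η
  rw [h] at this
  simp only [norm_zero] at this
  nlinarith [sq_nonneg ‖η‖]

lemma norm_frame {θ' : Sph (m + 1)} {e : Space m →ₗᵢ[ℝ] Space (m + 1)} (he : IsFrame θ' e)
    (η : Space m) : ‖(θ' : Space (m + 1)) + e η‖ = √(1 + ‖η‖ ^ 2) := by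
  rw [← norm_frame_sq he, Real.sqrt_sq (norm_nonneg _)]

lemma inner_gno {θ' : Sph (m + 1)} {e : Space m →ₗᵢ[ℝ] Space (m + 1)} (he : IsFrame θ' e)
    (η : Space m) : inner ℝ (θ' : Space (m + 1)) (gno θ' e η : Space (m + 1))
      = (√(1 + ‖η‖ ^ 2))⁻¹ := by
  rw [gno, coe_nrm θ' (frame_ne_zero he η), real_inner_smul_right, inner_add_right, he.orth,
    real_inner_self_eq_norm_sq, norm_sph, norm_frame he]
  simp

lemma sq_dist_sph (θ' θ : Sph (m + 1)) :
    dist θ θ' ^ 2 = 2 - 2 * inner ℝ (θ' : Space (m + 1)) (θ : Space (m + 1)) := by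
  rw [Subtype.dist_eq, dist_eq_norm, norm_sub_sq_real, norm_sph, norm_sph, real_inner_comm]
  ring

lemma inner_pos_of_dist {θ' θ : Sph (m + 1)} (h : dist θ θ' ≤ 1) :
    1 / 2 ≤ inner ℝ (θ' : Space (m + 1)) (θ : Space (m + 1)) := by
  have := sq_dist_sph θ' θ
  nlinarith [dist_nonneg (x := θ) (y := θ')]

lemma inner_sph_le_one (θ' θ : Sph (m + 1)) :
    inner ℝ (θ' : Space (m + 1)) (θ : Space (m + 1)) ≤ 1 := by
  have := sq_dist_sph θ' θ
  nlinarith [sq_nonneg (dist θ θ')]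

lemma dist_gno_le {θ' : Sph (m + 1)} {e : Space m →ₗᵢ[ℝ] Space (m + 1)} (he : IsFrame θ' e)
    (η : Space m) : dist (gno θ' e η) θ' ≤ ‖η‖ := by
  refine abs_le_of_sq_le_sq' ?_ (norm_nonneg _) |>.2
  rw [sq_dist_sph, inner_gno he]
  set x := ‖η‖ ^ 2
  have hx : 0 ≤ x := sq_nonneg _
  have h1 : 1 ≤ √(1 + x) := Real.one_le_sqrt.2 (by linarith)
  have h2 : √(1 + x) ^ 2 = 1 + x := Real.sq_sqrt (by linarith)
  set s := √(1 + x)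
  have h3 : s * s⁻¹ = 1 := mul_inv_cancel₀ (by positivity)
  have h4 : 0 < s⁻¹ := by positivity
  have h5 : s⁻¹ ≤ 1 := inv_le_one_of_one_le₀ h1
  nlinarith [mul_nonneg (sub_nonneg.2 h1) (sub_nonneg.2 h1), mul_nonneg (sub_nonneg.2 h5) (sub_nonneg.2 h1)]

/-- With s = √(1 + ‖η‖²), the squared distance is 2 - 2/s. So 1/s ≥ 1 - r²/2, whence s ≤ 1 + r² for
r ≤ 1 and ‖η‖² = s² - 1 ≤ 3r². -/
lemma norm_le_of_dist_gno {θ' : Sph (m + 1)} {e : Space m →ₗᵢ[ℝ] Space (m + 1)} (he : IsFrame θ' e)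
    {η : Space m} {r : ℝ} (hr0 : 0 ≤ r) (hr : r ≤ 1) (h : dist (gno θ' e η) θ' ≤ r) :
    ‖η‖ ≤ 2 * r := by
  have hd := sq_dist_sph θ' (gno θ' e η)
  rw [inner_gno he] at hd
  refine abs_le_of_sq_le_sq' ?_ (by positivity) |>.2
  set x := ‖η‖ ^ 2
  have hx : 0 ≤ x := sq_nonneg _
  have h2 : √(1 + x) ^ 2 = 1 + x := Real.sq_sqrt (by linarith)
  have h1 : 1 ≤ √(1 + x) := Real.one_le_sqrt.2 (by linarith)
  set s := √(1 + x)
  have h3 : s * s⁻¹ = 1 := mul_inv_cancel₀ (by positivity)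
  have h6 : dist (gno θ' e η) θ' ^ 2 ≤ r ^ 2 := by gcongr
  have hr2 : r ^ 2 ≤ 1 := by nlinarith
  have h7 : 1 - r ^ 2 / 2 ≤ s⁻¹ := by linarith
  have h8 : s * (1 - r ^ 2 / 2) ≤ 1 := by
    calc s * (1 - r ^ 2 / 2) ≤ s * s⁻¹ := by gcongr
      _ = 1 := h3
  have h9 : s ≤ 1 + r ^ 2 := by nlinarith
  nlinarith

/-- The ratio between `dθ` and the surface measure of the sphere. -/
def sphereConst (n : ℕ) : ℝ≥0∞ := ((volume : Measure (Space n)).toSphere univ)⁻¹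

lemma sphereConst_ne_top : sphereConst (m + 1) ≠ ⊤ := by
  rw [sphereConst, Ne, ENNReal.inv_eq_top, Measure.measure_univ_eq_zero]
  exact Measure.toSphere_ne_zero _

lemma sphereConst_ne_zero (n : ℕ) : sphereConst n ≠ 0 := by
  rw [sphereConst, Ne, ENNReal.inv_eq_zero]
  exact measure_ne_top _ _

/-- Integrals over small caps are controlled by integrals in gnomonic coordinates. -/
lemma setLIntegral_cap_le {θ' : Sph (m + 1)} {e : Space m →ₗᵢ[ℝ] Space (m + 1)} (he : IsFrame θ' e)
    {F : Sph (m + 1) → ℝ≥0∞} (hF : Measurable F) {r : ℝ} (hr0 : 0 ≤ r) (hr : r ≤ 1) :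
    ∫⁻ θ in Metric.closedBall θ' r, F θ ∂(sphereMeasure (m + 1))
      ≤ sphereConst (m + 1) * ∫⁻ η in Metric.closedBall 0 (2 * r), F (gno θ' e η) := by
  have hcm : MeasurableSet (Metric.closedBall θ' r) := Metric.isClosed_closedBall.measurableSet
  have hm : MeasurableSet {θ : Sph (m + 1) | 0 < inner ℝ (θ' : Space (m + 1)) (θ : Space (m + 1))} :=
    (isOpen_lt continuous_const (by fun_prop)).measurableSet
  rw [sphereMeasure, Measure.restrict_smul, lintegral_smul_measure, smul_eq_mul]
  refine mul_le_mul_right ?_ _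
  calc ∫⁻ θ in Metric.closedBall θ' r, F θ ∂((volume : Measure (Space (m + 1))).toSphere)
      ≤ ∫⁻ θ in {θ : Sph (m + 1) | 0 < inner ℝ (θ' : Space (m + 1)) (θ : Space (m + 1))},
        (Metric.closedBall θ' r).indicator F θ *
          ENNReal.ofReal ((inner ℝ (θ' : Space (m + 1)) (θ : Space (m + 1)))⁻¹ ^ (m + 1))
          ∂((volume : Measure (Space (m + 1))).toSphere) := by
        rw [← lintegral_indicator hcm, ← lintegral_indicator hm]
        refine lintegral_mono fun θ => ?_
        by_cases hθ : θ ∈ Metric.closedBall θ' r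
        · have h1 := inner_pos_of_dist (le_trans hθ hr)
          have h2 : θ ∈ {θ : Sph (m + 1) |
              0 < inner ℝ (θ' : Space (m + 1)) (θ : Space (m + 1))} :=
            lt_of_lt_of_le (by norm_num) h1
          rw [indicator_of_mem hθ, indicator_of_mem h2, indicator_of_mem hθ]
          -- The Jacobian (θ'·θ)^{-(m+1)} is at least 1 on the cap, so it may be inserted in an
          -- upper bound.
          refine le_mul_of_one_le_right (zero_le) ?_
          rw [ENNReal.one_le_ofReal]
          exact one_le_pow₀ ((one_le_inv₀ h2).2 (inner_sph_le_one θ' θ))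
        · rw [indicator_of_notMem hθ]
          exact zero_le
    _ = ∫⁻ η, (Metric.closedBall θ' r).indicator F (gno θ' e η) := lintegral_gno he (hF.indicator hcm)
    _ ≤ _ := by
        rw [← lintegral_indicator Metric.isClosed_closedBall.measurableSet]
        refine lintegral_mono fun η => ?_
        by_cases hθ : gno θ' e η ∈ Metric.closedBall θ' r
        · have : η ∈ Metric.closedBall (0 : Space m) (2 * r) := by
            rw [mem_closedBall_zero_iff]
            exact norm_le_of_dist_gno he hr0 hr hθ
          rw [indicator_of_mem hθ, indicator_of_mem this]
        · rw [indicator_of_notMem hθ]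
          exact zero_le

/-- The volume of the unit ball of the hyperplane. -/
def ballVol (m : ℕ) : ℝ≥0∞ := volume (Metric.closedBall (0 : Space m) 1)

lemma ballVol_ne_zero (m : ℕ) : ballVol m ≠ 0 := (Metric.measure_closedBall_pos _ _ one_pos).ne'

lemma ballVol_ne_top (m : ℕ) : ballVol m ≠ ⊤ := measure_closedBall_lt_top.ne

lemma volume_closedBall_space {r : ℝ} (hr : 0 ≤ r) (x : Space m) :
    volume (Metric.closedBall x r) = ENNReal.ofReal (r ^ m) * ballVol m := by
  rw [Measure.addHaar_closedBall' _ x hr, finrank_euclideanSpace_fin, ballVol]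

lemma cap_le (θ' : Sph (m + 1)) {r : ℝ} (hr0 : 0 ≤ r) (hr : r ≤ 1) :
    sphereMeasure (m + 1) (Metric.closedBall θ' r)
      ≤ sphereConst (m + 1) * ENNReal.ofReal ((2 * r) ^ m) * ballVol m := by
  obtain ⟨e, he⟩ := exists_isFrame θ'
  have := setLIntegral_cap_le he (F := fun _ => 1) measurable_const hr0 hr
  rw [setLIntegral_const, setLIntegral_const, one_mul, one_mul,
    volume_closedBall_space (by positivity)] at this
  rwa [mul_assoc]

/-- The cap contains the gnomonic image of the ball of radius r, and on it θ'·θ ≥ 1/2, so the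
Jacobian is at most 2^{m+1}. -/
lemma le_cap (θ' : Sph (m + 1)) {r : ℝ} (hr0 : 0 ≤ r) (hr : r ≤ 1) :
    sphereConst (m + 1) * (ENNReal.ofReal (r ^ m) * ballVol m) ≤
      ENNReal.ofReal (2 ^ (m + 1)) * sphereMeasure (m + 1) (Metric.closedBall θ' r) := by
  obtain ⟨e, he⟩ := exists_isFrame θ'
  have hcm : MeasurableSet (Metric.closedBall θ' r) := Metric.isClosed_closedBall.measurableSet
  have hm : MeasurableSet {θ : Sph (m + 1) | 0 < inner ℝ (θ' : Space (m + 1)) (θ : Space (m + 1))} :=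
    (isOpen_lt continuous_const (by fun_prop)).measurableSet
  have h1 : ENNReal.ofReal (r ^ m) * ballVol m ≤
      ∫⁻ η, (Metric.closedBall θ' r).indicator 1 (gno θ' e η) := by
    rw [← volume_closedBall_space hr0 (0 : Space m),
      ← lintegral_indicator_one Metric.isClosed_closedBall.measurableSet]
    refine lintegral_mono fun η => ?_
    by_cases hη : η ∈ Metric.closedBall (0 : Space m) r
    · have : gno θ' e η ∈ Metric.closedBall θ' r :=
        (dist_gno_le he η).trans (mem_closedBall_zero_iff.1 hη)
      rw [indicator_of_mem hη, indicator_of_mem this]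
      simp
    · rw [indicator_of_notMem hη]
      exact zero_le
  rw [← lintegral_gno he (measurable_one.indicator hcm)] at h1
  have h2 : ∫⁻ θ in {θ : Sph (m + 1) | 0 < inner ℝ (θ' : Space (m + 1)) (θ : Space (m + 1))},
        (Metric.closedBall θ' r).indicator 1 θ *
          ENNReal.ofReal ((inner ℝ (θ' : Space (m + 1)) (θ : Space (m + 1)))⁻¹ ^ (m + 1))
          ∂((volume : Measure (Space (m + 1))).toSphere)
      ≤ ENNReal.ofReal (2 ^ (m + 1)) * (volume : Measure (Space (m + 1))).toSphere
        (Metric.closedBall θ' r) := by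
    rw [← lintegral_indicator_one hcm, ← lintegral_const_mul _ (measurable_one.indicator hcm)]
    refine (setLIntegral_le_lintegral _ _).trans (lintegral_mono fun θ => ?_)
    by_cases hθ : θ ∈ Metric.closedBall θ' r
    · have h1 := inner_pos_of_dist (le_trans hθ hr)
      rw [indicator_of_mem hθ, Pi.one_apply, one_mul, mul_one]
      refine ENNReal.ofReal_le_ofReal ?_
      have h0 : 0 < inner ℝ (θ' : Space (m + 1)) (θ : Space (m + 1)) := by linarith
      have : (inner ℝ (θ' : Space (m + 1)) (θ : Space (m + 1)))⁻¹ ≤ 2 := by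
        rw [inv_le_comm₀ h0 two_pos]
        linarith
      have h3 : 0 ≤ (inner ℝ (θ' : Space (m + 1)) (θ : Space (m + 1)))⁻¹ := (inv_pos.2 h0).le
      gcongr
    · rw [indicator_of_notMem hθ]
      simp
  have h3 : sphereMeasure (m + 1) (Metric.closedBall θ' r) = sphereConst (m + 1) *
      (volume : Measure (Space (m + 1))).toSphere (Metric.closedBall θ' r) := by
    rw [sphereMeasure, Measure.smul_apply, smul_eq_mul, sphereConst]
  rw [h3]
  calc _ ≤ sphereConst (m + 1) * (ENNReal.ofReal (2 ^ (m + 1)) *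
        (volume : Measure (Space (m + 1))).toSphere (Metric.closedBall θ' r)) := by
        exact mul_le_mul' le_rfl (h1.trans h2)
    _ = _ := by ring

/-- Both cap estimates are of order r^m. The constant combines 4^m, from radius 2(2r) against r,
with the bound 2^{m+1} for the Jacobian. This makes Lebesgue differentiation available on the
sphere. -/
instance sphereMeasure_isUnifLocDoubling (m : ℕ) :
    IsUnifLocDoublingMeasure (sphereMeasure (m + 1)) := by
  refine ⟨(4 : NNReal) ^ m * 2 ^ (m + 1), ?_⟩
  have : Ioo (0 : ℝ) (1 / 2) ∈ 𝓝[>] (0 : ℝ) := Ioo_mem_nhdsGT (by norm_num)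
  filter_upwards [this] with r hr θ'
  have h1 := cap_le θ' (r := 2 * r) (by linarith [hr.1]) (by linarith [hr.2])
  have h2 := le_cap θ' (r := r) hr.1.le (by linarith [hr.2])
  have e1 : ENNReal.ofReal ((2 * (2 * r)) ^ m) = 4 ^ m * ENNReal.ofReal (r ^ m) := by
    rw [show 2 * (2 * r) = 4 * r by ring, mul_pow, ENNReal.ofReal_mul (by positivity),
      ENNReal.ofReal_pow (by norm_num)]
    norm_num
  have e2 : ENNReal.ofReal ((2 : ℝ) ^ (m + 1)) = 2 ^ (m + 1) := by
    rw [ENNReal.ofReal_pow (by norm_num)]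
    norm_num
  rw [e2] at h2
  calc _ ≤ _ := h1
    _ = 4 ^ m * (sphereConst (m + 1) * (ENNReal.ofReal (r ^ m) * ballVol m)) := by
        rw [e1]; ring
    _ ≤ 4 ^ m * (2 ^ (m + 1) * sphereMeasure (m + 1) (Metric.closedBall θ' r)) := by gcongr
    _ = _ := by
        push_cast
        ring

end TwoPhoton

end

noncomputable section

namespace TwoPhoton

/-! ### The normalizing constant of the source -/

variable {m : ℕ} {h : Space (m + 1) → ℝ}

lemma continuous_bump (hh : IsCutoff h) (θ' : Sph (m + 1)) (r : ℝ) : Continuous (bump h θ' r) := by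
  have := hh.smooth.continuous
  unfold bump
  fun_prop

lemma bump_nonneg (hh : IsCutoff h) (θ' : Sph (m + 1)) (r : ℝ) (θ : Sph (m + 1)) :
    0 ≤ bump h θ' r θ := hh.nonneg _

lemma bump_le_one (hh : IsCutoff h) (θ' : Sph (m + 1)) (r : ℝ) (θ : Sph (m + 1)) :
    bump h θ' r θ ≤ 1 := hh.le_one _

lemma dist_lt_of_bump_ne_zero (hh : IsCutoff h) {θ' θ : Sph (m + 1)} {r : ℝ} (hr : 0 < r)
    (hb : bump h θ' r θ ≠ 0) : dist θ θ' < r := by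
  have h1 : r⁻¹ • ((θ : Space (m + 1)) - θ') ∈ Metric.ball (0 : Space (m + 1)) 1 :=
    hh.supp (subset_tsupport _ hb)
  rw [mem_ball_zero_iff, norm_smul, Real.norm_of_nonneg (inv_pos.2 hr).le, inv_mul_lt_iff₀ hr,
    mul_one] at h1
  rwa [Subtype.dist_eq, dist_eq_norm]

lemma bump_le_indicator (hh : IsCutoff h) {θ' : Sph (m + 1)} {r : ℝ} (hr : 0 < r)
    (θ : Sph (m + 1)) : bump h θ' r θ ≤ (Metric.closedBall θ' r).indicator 1 θ := by
  by_cases hb : θ ∈ Metric.closedBall θ' r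
  · rw [indicator_of_mem hb]
    exact bump_le_one hh _ _ _
  · rw [indicator_of_notMem hb]
    by_contra hne
    exact hb (dist_lt_of_bump_ne_zero hh hr (ne_of_gt (not_le.1 hne))).le

/-- A scale at which the cut-off equals one. -/
lemma IsCutoff.exists_eq_one (hh : IsCutoff h) : ∃ r₀ : ℝ, 0 < r₀ ∧ r₀ < 1 ∧
    ∀ y, ‖y‖ ≤ r₀ → h y = 1 := by
  obtain ⟨r, hr, hb⟩ := Metric.eventually_nhds_iff.1 hh.eq_one
  refine ⟨min (r / 2) (1 / 2), by positivity, (min_le_right _ _).trans_lt (by norm_num),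
    fun y hy => hb ?_⟩
  rw [dist_zero_right]
  linarith [min_le_left (r / 2) (1 / 2 : ℝ)]

lemma bump_eq_one {θ' θ : Sph (m + 1)} {r₀ r : ℝ}
    (h1 : ∀ y, ‖y‖ ≤ r₀ → h y = 1) (hr : 0 < r) (hd : dist θ θ' ≤ r₀ * r) :
    bump h θ' r θ = 1 := by
  refine h1 _ ?_
  rw [norm_smul, Real.norm_of_nonneg (inv_pos.2 hr).le, inv_mul_le_iff₀ hr, mul_comm]
  rwa [Subtype.dist_eq, dist_eq_norm] at hd

/-- The integrand of `bumpMass` in rescaled gnomonic coordinates. -/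
def gnoBump (h : Space (m + 1) → ℝ) (θ' : Sph (m + 1)) (e : Space m →ₗᵢ[ℝ] Space (m + 1)) (ε : ℝ)
    (ζ : Space m) : ℝ≥0∞ :=
  ENNReal.ofReal (bump h θ' ε (gno θ' e (ε • ζ)) * (√(1 + ‖ε • ζ‖ ^ 2))⁻¹ ^ (m + 1))

lemma measurable_gnoBump (hh : IsCutoff h) (θ' : Sph (m + 1))
    (e : Space m →ₗᵢ[ℝ] Space (m + 1)) (ε : ℝ) : Measurable (gnoBump h θ' e ε) := by
  have h1 := (continuous_bump hh θ' ε).measurable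
  have h2 := measurable_gno θ' e
  unfold gnoBump
  fun_prop

lemma integrable_bump (hh : IsCutoff h) (θ' : Sph (m + 1)) (ε : ℝ) :
    Integrable (bump h θ' ε) (sphereMeasure (m + 1)) := by
  have := sphereMeasure_isProbabilityMeasure (n := m + 1) (by omega)
  refine Integrable.of_bound (continuous_bump hh θ' ε).aestronglyMeasurable 1 (.of_forall fun θ => ?_)
  rw [Real.norm_of_nonneg (bump_nonneg hh _ _ _)]
  exact bump_le_one hh _ _ _

/-- The factor (θ'·θ)^{m+1} cancels the Jacobian of the gnomonic chart and becomes the power of the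
root in `gnoBump`; the substitution η = εζ absorbs ε^{-m}. The condition ε ≤ 1 keeps the support of
the cut-off in the open hemisphere. -/
lemma ofReal_bumpMass (hh : IsCutoff h) {θ' : Sph (m + 1)} {e : Space m →ₗᵢ[ℝ] Space (m + 1)}
    (he : IsFrame θ' e) {ε : ℝ} (hε0 : 0 < ε) (hε : ε ≤ 1) :
    ENNReal.ofReal (bumpMass h θ' ε) = sphereConst (m + 1) * ∫⁻ ζ, gnoBump h θ' e ε ζ := by
  have hm : MeasurableSet {θ : Sph (m + 1) | 0 < inner ℝ (θ' : Space (m + 1)) (θ : Space (m + 1))} :=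
    (isOpen_lt continuous_const (by fun_prop)).measurableSet
  have hF : Measurable fun θ : Sph (m + 1) => ENNReal.ofReal
      (bump h θ' ε θ * inner ℝ (θ' : Space (m + 1)) (θ : Space (m + 1)) ^ (m + 1)) := by
    have h1 := (continuous_bump hh θ' ε).measurable
    fun_prop
  have h1 := lintegral_gno he hF
  simp only [inner_gno he] at h1
  have h2 : ∫⁻ θ in {θ : Sph (m + 1) | 0 < inner ℝ (θ' : Space (m + 1)) (θ : Space (m + 1))},
      ENNReal.ofReal (bump h θ' ε θ * inner ℝ (θ' : Space (m + 1)) (θ : Space (m + 1)) ^ (m + 1)) *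
        ENNReal.ofReal ((inner ℝ (θ' : Space (m + 1)) (θ : Space (m + 1)))⁻¹ ^ (m + 1))
        ∂((volume : Measure (Space (m + 1))).toSphere)
      = ∫⁻ θ, ENNReal.ofReal (bump h θ' ε θ) ∂((volume : Measure (Space (m + 1))).toSphere) := by
    rw [← lintegral_indicator hm]
    refine lintegral_congr fun θ => ?_
    by_cases ht : θ ∈ {θ : Sph (m + 1) | 0 < inner ℝ (θ' : Space (m + 1)) (θ : Space (m + 1))}
    · have ht' : 0 < inner ℝ (θ' : Space (m + 1)) (θ : Space (m + 1)) := ht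
      rw [indicator_of_mem ht, ← ENNReal.ofReal_mul
        (mul_nonneg (bump_nonneg hh _ _ _) (pow_nonneg ht'.le _)), mul_assoc, ← mul_pow,
        mul_inv_cancel₀ ht'.ne', one_pow, mul_one]
    · rw [indicator_of_notMem ht]
      by_contra hne
      have hb : bump h θ' ε θ ≠ 0 := fun h0 => hne (by rw [h0, ENNReal.ofReal_zero])
      have := inner_pos_of_dist ((dist_lt_of_bump_ne_zero hh hε0 hb).le.trans hε)
      exact ht (by simp only [mem_ofPred_eq]; linarith)
  rw [h2] at h1
  have h3 := lintegral_comp_smul_space (fun η => ENNReal.ofReal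
      (bump h θ' ε (gno θ' e η) * (√(1 + ‖η‖ ^ 2))⁻¹ ^ (m + 1))) (by
    have h1 := (continuous_bump hh θ' ε).measurable
    have h2 := measurable_gno θ' e
    fun_prop) hε0
  have h4 : ∫⁻ ζ, gnoBump h θ' e ε ζ = ENNReal.ofReal ((ε ^ m)⁻¹) *
      ∫⁻ θ, ENNReal.ofReal (bump h θ' ε θ) ∂((volume : Measure (Space (m + 1))).toSphere) := by
    rw [h1, ← h3]
    rfl
  rw [h4, bumpMass, integral_const_mul, Nat.add_sub_cancel, ENNReal.ofReal_mul (by positivity),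
    ofReal_integral_eq_lintegral_ofReal (integrable_bump hh θ' ε)
      (.of_forall fun θ => bump_nonneg hh _ _ _), sphereMeasure, lintegral_smul_measure,
    sphereConst, one_div, smul_eq_mul]
  ring

/-- Normalizing θ' + εe(ζ) changes it only to second order in ε, because ζ is mapped to the
orthogonal hyperplane. -/
lemma tendsto_rescaled_gno {θ' : Sph (m + 1)} {e : Space m →ₗᵢ[ℝ] Space (m + 1)}
    (he : IsFrame θ' e) (ζ : Space m) :
    Tendsto (fun ε : ℝ => ε⁻¹ • ((gno θ' e (ε • ζ) : Space (m + 1)) - θ')) (𝓝[>] 0) (𝓝 (e ζ)) := by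
  have hs : Tendsto (fun ε : ℝ => (√(1 + ‖ε • ζ‖ ^ 2))⁻¹) (𝓝[>] 0) (𝓝 1) := by
    have : ContinuousAt (fun ε : ℝ => (√(1 + ‖ε • ζ‖ ^ 2))⁻¹) 0 := by
      refine ContinuousAt.inv₀ (by fun_prop) (by simp)
    have h2 := this.tendsto.mono_left (nhdsWithin_le_nhds (s := Ioi 0))
    simpa using h2
  have hz : Tendsto (fun ε : ℝ => ε⁻¹ * ((√(1 + ‖ε • ζ‖ ^ 2))⁻¹ - 1)) (𝓝[>] 0) (𝓝 0) := by
    have hb : Tendsto (fun ε : ℝ => ε * ‖ζ‖ ^ 2) (𝓝[>] 0) (𝓝 0) := by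
      have : Tendsto (fun ε : ℝ => ε * ‖ζ‖ ^ 2) (𝓝 0) (𝓝 (0 * ‖ζ‖ ^ 2)) :=
        tendsto_id.mul_const _
      rw [zero_mul] at this
      exact this.mono_left nhdsWithin_le_nhds
    refine squeeze_zero_norm' ?_ hb
    filter_upwards [self_mem_nhdsWithin] with ε hε
    have hε0 : (0 : ℝ) < ε := hε
    have h1 : 1 ≤ √(1 + ‖ε • ζ‖ ^ 2) := Real.one_le_sqrt.2 (by nlinarith [sq_nonneg ‖ε • ζ‖])
    have h2 : √(1 + ‖ε • ζ‖ ^ 2) ^ 2 = 1 + ‖ε • ζ‖ ^ 2 := Real.sq_sqrt (by positivity)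
    have h3 : ‖ε • ζ‖ ^ 2 = ε ^ 2 * ‖ζ‖ ^ 2 := by
      rw [norm_smul, mul_pow, Real.norm_of_nonneg hε0.le]
    rw [h3] at h1 h2 ⊢
    set s := √(1 + ε ^ 2 * ‖ζ‖ ^ 2)
    have h4 : s * s⁻¹ = 1 := mul_inv_cancel₀ (by positivity)
    have h5 : s⁻¹ ≤ 1 := inv_le_one_of_one_le₀ h1
    have h6 : 0 < s⁻¹ := by positivity
    rw [norm_mul, Real.norm_of_nonneg (inv_pos.2 hε0).le, Real.norm_of_nonpos (by linarith),
      inv_mul_le_iff₀ hε0]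
    have h7 : -(s⁻¹ - 1) ≤ s - 1 := by nlinarith
    nlinarith
  have := (hz.smul_const (θ' : Space (m + 1))).add (hs.smul_const (e ζ))
  rw [zero_smul, one_smul, zero_add] at this
  refine this.congr' ?_
  filter_upwards [self_mem_nhdsWithin] with ε hε
  have hε0 : (ε : ℝ) ≠ 0 := ne_of_gt hε
  rw [gno, coe_nrm θ' (frame_ne_zero he _), norm_frame he, map_smul]
  set s := (√(1 + ‖ε • ζ‖ ^ 2))⁻¹
  rw [smul_add, smul_sub, smul_add, smul_smul, smul_smul, smul_smul, mul_sub, sub_smul, mul_one]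
  rw [show ε⁻¹ * s * ε = s by field_simp]
  module

lemma tendsto_gnoBump (hh : IsCutoff h) {θ' : Sph (m + 1)} {e : Space m →ₗᵢ[ℝ] Space (m + 1)}
    (he : IsFrame θ' e) (ζ : Space m) :
    Tendsto (fun ε => gnoBump h θ' e ε ζ) (𝓝[>] 0) (𝓝 (ENNReal.ofReal (h (e ζ)))) := by
  refine ENNReal.tendsto_ofReal ?_
  have h1 : Tendsto (fun ε => bump h θ' ε (gno θ' e (ε • ζ))) (𝓝[>] 0) (𝓝 (h (e ζ))) :=
    (hh.smooth.continuous.tendsto _).comp (tendsto_rescaled_gno he ζ)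
  have hs : Tendsto (fun ε : ℝ => (√(1 + ‖ε • ζ‖ ^ 2))⁻¹ ^ (m + 1)) (𝓝[>] 0) (𝓝 1) := by
    have : ContinuousAt (fun ε : ℝ => (√(1 + ‖ε • ζ‖ ^ 2))⁻¹ ^ (m + 1)) 0 := by
      refine (ContinuousAt.inv₀ (by fun_prop) (by simp)).pow _
    have h2 := this.tendsto.mono_left (nhdsWithin_le_nhds (s := Ioi 0))
    simpa using h2
  simpa using h1.mul hs

lemma gnoBump_le (hh : IsCutoff h) {θ' : Sph (m + 1)} {e : Space m →ₗᵢ[ℝ] Space (m + 1)}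
    (he : IsFrame θ' e) {ε : ℝ} (hε0 : 0 < ε) (hε : ε ≤ 1) (ζ : Space m) :
    gnoBump h θ' e ε ζ ≤ (Metric.closedBall (0 : Space m) 2).indicator 1 ζ := by
  by_cases hb : bump h θ' ε (gno θ' e (ε • ζ)) = 0
  · simp [gnoBump, hb]
  · have h1 := norm_le_of_dist_gno he hε0.le hε (dist_lt_of_bump_ne_zero hh hε0 hb).le
    rw [norm_smul, Real.norm_of_nonneg hε0.le, mul_comm, mul_le_mul_iff_left₀ hε0] at h1
    rw [indicator_of_mem (by simpa using h1), Pi.one_apply, gnoBump, ENNReal.ofReal_le_one]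
    have h2 : 1 ≤ √(1 + ‖ε • ζ‖ ^ 2) := Real.one_le_sqrt.2 (by nlinarith [sq_nonneg ‖ε • ζ‖])
    exact mul_le_one₀ (bump_le_one hh _ _ _) (by positivity)
      (pow_le_one₀ (by positivity) (inv_le_one_of_one_le₀ h2))

lemma tendsto_lintegral_gnoBump (hh : IsCutoff h) {θ' : Sph (m + 1)}
    {e : Space m →ₗᵢ[ℝ] Space (m + 1)} (he : IsFrame θ' e) :
    Tendsto (fun ε => ∫⁻ ζ, gnoBump h θ' e ε ζ) (𝓝[>] 0) (𝓝 (∫⁻ ζ, ENNReal.ofReal (h (e ζ)))) := by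
  refine tendsto_lintegral_filter_of_dominated_convergence
    ((Metric.closedBall (0 : Space m) 2).indicator 1)
    (.of_forall fun ε => measurable_gnoBump hh θ' e ε) ?_ ?_
    (.of_forall fun ζ => tendsto_gnoBump hh he ζ)
  · filter_upwards [Ioo_mem_nhdsGT (zero_lt_one (α := ℝ))] with ε hε
    exact .of_forall fun ζ => gnoBump_le hh he hε.1 hε.2.le ζ
  · rw [lintegral_indicator_one Metric.isClosed_closedBall.measurableSet]
    exact measure_closedBall_lt_top.ne

lemma lintegral_profile_ne_top (hh : IsCutoff h) (e : Space m →ₗᵢ[ℝ] Space (m + 1)) :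
    ∫⁻ ζ, ENNReal.ofReal (h (e ζ)) ≠ ⊤ := by
  refine ne_top_of_le_ne_top (b := volume (Metric.closedBall (0 : Space m) 1))
    measure_closedBall_lt_top.ne ?_
  rw [← lintegral_indicator_one Metric.isClosed_closedBall.measurableSet]
  refine lintegral_mono fun ζ => ?_
  by_cases hb : h (e ζ) = 0
  · simp [hb]
  · have h1 := hh.supp (subset_tsupport _ hb)
    rw [mem_ball_zero_iff, e.norm_map] at h1
    rw [indicator_of_mem (by simpa using h1.le), Pi.one_apply, ENNReal.ofReal_le_one]
    exact hh.le_one _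

lemma lintegral_profile_ne_zero (hh : IsCutoff h) (e : Space m →ₗᵢ[ℝ] Space (m + 1)) :
    ∫⁻ ζ, ENNReal.ofReal (h (e ζ)) ≠ 0 := by
  obtain ⟨r, hr, -, h1⟩ := hh.exists_eq_one
  have hpos := Metric.measure_closedBall_pos (volume : Measure (Space m)) 0 hr
  refine ne_of_gt (hpos.trans_le ?_)
  rw [← lintegral_indicator_one Metric.isClosed_closedBall.measurableSet]
  refine lintegral_mono fun ζ => ?_
  by_cases hb : ζ ∈ Metric.closedBall (0 : Space m) r
  · rw [indicator_of_mem hb, h1 _ (by rw [e.norm_map]; simpa using hb)]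
    simp
  · rw [indicator_of_notMem hb]
    exact bot_le

lemma bumpMass_nonneg (hh : IsCutoff h) (θ' : Sph (m + 1)) {ε : ℝ} (hε : 0 < ε) :
    0 ≤ bumpMass h θ' ε :=
  integral_nonneg fun θ => mul_nonneg (by positivity) (bump_nonneg hh _ _ _)

/-- Dominated convergence in rescaled gnomonic coordinates: the limit is `sphereConst` times the
integral of h over the hyperplane orthogonal to θ', positive because h = 1 near the origin. Once the
limit exists, `limUnder` in `omega` equals it. -/
lemma tendsto_bumpMass (hh : IsCutoff h) (θ' : Sph (m + 1)) :
    Tendsto (bumpMass h θ') (𝓝[>] 0) (𝓝 (omega h θ')) ∧ 0 < omega h θ' := by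
  obtain ⟨e, he⟩ := exists_isFrame θ'
  have hne : sphereConst (m + 1) * ∫⁻ ζ, ENNReal.ofReal (h (e ζ)) ≠ ⊤ :=
    ENNReal.mul_ne_top sphereConst_ne_top (lintegral_profile_ne_top hh e)
  have h1 := (ENNReal.tendsto_toReal hne).comp
    (ENNReal.Tendsto.const_mul (tendsto_lintegral_gnoBump hh he) (.inr sphereConst_ne_top))
  have h2 : Tendsto (bumpMass h θ') (𝓝[>] 0)
      (𝓝 (sphereConst (m + 1) * ∫⁻ ζ, ENNReal.ofReal (h (e ζ))).toReal) := by
    refine h1.congr' ?_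
    filter_upwards [Ioo_mem_nhdsGT (zero_lt_one (α := ℝ))] with ε hε
    rw [Function.comp_apply, ← ofReal_bumpMass hh he hε.1 hε.2.le,
      ENNReal.toReal_ofReal (bumpMass_nonneg hh θ' hε.1)]
  have h3 : omega h θ' = _ := h2.limUnder_eq
  rw [h3]
  exact ⟨h2, ENNReal.toReal_pos (mul_ne_zero (sphereConst_ne_zero _)
    (lintegral_profile_ne_zero hh e)) hne⟩

/-- The singular part `δ ω⁻¹ ε^{-(n-1)} h((θ - θ')/ε)` of the source. -/
def peak (h : Space (m + 1) → ℝ) (θ' : Sph (m + 1)) (ε δ : ℝ) (θ : Sph (m + 1)) : ℝ :=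
  δ / (omega h θ' * ε ^ m) * bump h θ' ε θ

lemma source_eq (c₀ : ℝ) (θ' : Sph (m + 1)) (ε δ : ℝ) :
    source h c₀ θ' ε δ = fun _ θ => c₀ + peak h θ' ε δ θ := rfl

lemma continuous_peak (hh : IsCutoff h) (θ' : Sph (m + 1)) (ε δ : ℝ) :
    Continuous (peak h θ' ε δ) :=
  continuous_const.mul (continuous_bump hh θ' ε)

lemma peak_nonneg (hh : IsCutoff h) (θ' : Sph (m + 1)) {ε δ : ℝ} (hε : 0 < ε) (hδ : 0 < δ)
    (θ : Sph (m + 1)) : 0 ≤ peak h θ' ε δ θ := by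
  have := (tendsto_bumpMass hh θ').2
  exact mul_nonneg (by positivity) (bump_nonneg hh _ _ _)

lemma integrable_peak (hh : IsCutoff h) (θ' : Sph (m + 1)) (ε δ : ℝ) :
    Integrable (peak h θ' ε δ) (sphereMeasure (m + 1)) :=
  (integrable_bump hh θ' ε).const_mul _

lemma integral_peak (θ' : Sph (m + 1)) (ε δ : ℝ) :
    ∫ θ, peak h θ' ε δ θ ∂(sphereMeasure (m + 1)) = δ * (bumpMass h θ' ε / omega h θ') := by
  simp only [peak, bumpMass]
  rw [integral_const_mul, integral_const_mul, Nat.add_sub_cancel]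
  ring

lemma tendsto_integral_peak (hh : IsCutoff h) (θ' : Sph (m + 1)) (δ : ℝ) :
    Tendsto (fun ε => ∫ θ, peak h θ' ε δ θ ∂(sphereMeasure (m + 1))) (𝓝[>] 0) (𝓝 δ) := by
  obtain ⟨h1, h2⟩ := tendsto_bumpMass hh θ'
  simp only [integral_peak]
  simpa [div_self h2.ne'] using (h1.div_const (omega h θ')).const_mul δ

/-- The mass of the peak tends to δ, so it is eventually below 2δ; this is the origin of the factor
2 in `lipConst`. -/
lemma eventually_lintegral_peak_le (hh : IsCutoff h) (θ' : Sph (m + 1)) {δ : ℝ} (hδ : 0 < δ) :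
    ∀ᶠ ε in 𝓝[>] (0 : ℝ), ∫⁻ θ, ‖peak h θ' ε δ θ‖ₑ ∂(sphereMeasure (m + 1))
      ≤ ENNReal.ofReal (2 * δ) := by
  filter_upwards [(tendsto_integral_peak hh θ' δ).eventually (gt_mem_nhds (show δ < 2 * δ by linarith)),
    self_mem_nhdsWithin] with ε h1 hε
  have h2 : ∀ θ, ‖peak h θ' ε δ θ‖ₑ = ENNReal.ofReal (peak h θ' ε δ θ) := fun θ =>
    Real.enorm_of_nonneg (peak_nonneg hh θ' hε hδ θ)
  simp only [h2]
  rw [← ofReal_integral_eq_lintegral_ofReal (integrable_peak hh θ' ε δ)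
    (.of_forall fun θ => peak_nonneg hh θ' hε hδ θ)]
  exact ENNReal.ofReal_le_ofReal h1.le

lemma peak_le (hh : IsCutoff h) (θ' : Sph (m + 1)) {ε δ : ℝ} (hε : 0 < ε) (hδ : 0 < δ)
    (θ : Sph (m + 1)) :
    peak h θ' ε δ θ ≤ (Metric.closedBall θ' ε).indicator (fun _ => δ / (omega h θ' * ε ^ m)) θ := by
  have h0 := (tendsto_bumpMass hh θ').2
  have h1 : 0 ≤ δ / (omega h θ' * ε ^ m) := by positivity
  calc peak h θ' ε δ θ ≤ δ / (omega h θ' * ε ^ m) * (Metric.closedBall θ' ε).indicator 1 θ :=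
        mul_le_mul_of_nonneg_left (bump_le_indicator hh hε θ) h1
    _ = _ := by
        by_cases hθ : θ ∈ Metric.closedBall θ' ε
        · simp [hθ]
        · simp [hθ]

end TwoPhoton

end

noncomputable section

namespace TwoPhoton

/-! ### Lebesgue points of functions depending on a parameter -/

section Lebesgue

variable {X Y : Type*} [MeasurableSpace X] [MetricSpace Y] [ProperSpace Y] [MeasurableSpace Y]

/-- The mean oscillation of `g` around `y` at scale `r`. -/
def meanOsc {Y : Type*} [MetricSpace Y] [MeasurableSpace Y] (ν : Measure Y) (g : Y → ℝ) (y : Y) (r : ℝ) : ℝ≥0∞ :=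
  (∫⁻ z in Metric.closedBall y r, ‖g z - g y‖ₑ ∂ν) / ν (Metric.closedBall y r)

lemma measurable_meanOsc {Y : Type*} [MetricSpace Y] [SecondCountableTopology Y]
    [MeasurableSpace Y] [BorelSpace Y] (ν : Measure Y) [SFinite ν] {f : X → Y → ℝ}
    (hf : Measurable (Function.uncurry f)) (r : ℝ) :
    Measurable fun p : X × Y => meanOsc ν (f p.1) p.2 r := by
  have hs : MeasurableSet {q : (X × Y) × Y | dist q.2 q.1.2 ≤ r} :=
    measurableSet_le (by fun_prop) measurable_const
  have h1 : Measurable fun q : (X × Y) × Y => {q : (X × Y) × Y | dist q.2 q.1.2 ≤ r}.indicator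
      (fun q => ‖f q.1.1 q.2 - f q.1.1 q.1.2‖ₑ) q := by
    refine Measurable.indicator ?_ hs
    have e1 : Measurable fun q : (X × Y) × Y => f q.1.1 q.2 :=
      hf.comp (f := fun q : (X × Y) × Y => (q.1.1, q.2)) (by fun_prop)
    have e2 : Measurable fun q : (X × Y) × Y => f q.1.1 q.1.2 :=
      hf.comp (f := fun q : (X × Y) × Y => (q.1.1, q.1.2)) (by fun_prop)
    fun_prop
  have h2 : Measurable fun q : (X × Y) × Y => {q : (X × Y) × Y | dist q.2 q.1.2 ≤ r}.indicator
      (1 : (X × Y) × Y → ℝ≥0∞) q := measurable_one.indicator hs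
  have h3 := h1.lintegral_prod_right' (ν := ν)
  have h4 := h2.lintegral_prod_right' (ν := ν)
  convert h3.div h4 using 2 with p
  simp only [meanOsc]
  rw [← lintegral_indicator Metric.isClosed_closedBall.measurableSet,
    ← lintegral_indicator_one Metric.isClosed_closedBall.measurableSet]
  rfl

/-- By doubling, the oscillation at radius r is at most a constant times that at the next larger
power of 1/2. Restricting to countably many radii makes the set of Lebesgue points measurable in a
product, as Fubini requires. -/
lemma tendsto_meanOsc_of_dyadic (ν : Measure Y) [IsUnifLocDoublingMeasure ν]
    [IsFiniteMeasureOnCompacts ν] [ν.IsOpenPosMeasure] {g : Y → ℝ} {y : Y}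
    (h : Tendsto (fun j : ℕ => meanOsc ν g y ((1 / 2) ^ j)) atTop (𝓝 0)) :
    Tendsto (fun r => meanOsc ν g y r) (𝓝[>] 0) (𝓝 0) := by
  obtain ⟨C, hC⟩ := IsUnifLocDoublingMeasure.exists_measure_closedBall_le_mul ν
  obtain ⟨r₀, hr₀, hC⟩ := (mem_nhdsGT_iff_exists_Ioo_subset).1 hC
  have hr₀' : (0 : ℝ) < r₀ := hr₀
  rw [ENNReal.tendsto_nhds_zero] at h ⊢
  intro η hη
  -- The constant C + 1 replaces C to avoid dividing by zero.
  have hη' : 0 < η / (C + 1) := ENNReal.div_pos hη.ne' (by simp)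
  obtain ⟨J, hJ⟩ := eventually_atTop.1 (h _ hη')
  filter_upwards [Ioo_mem_nhdsGT hr₀', Ioo_mem_nhdsGT (zero_lt_one (α := ℝ)),
    Ioo_mem_nhdsGT (show (0 : ℝ) < (1 / 2) ^ (J + 1) by positivity)] with r hr hr1 hrJ
  obtain ⟨j, hj1, hj2⟩ := exists_nat_pow_near_of_lt_one hr1.1 hr1.2.le
    (by norm_num : (0 : ℝ) < 1 / 2) (by norm_num)
  have hjJ : J ≤ j := by
    by_contra hlt
    have : (1 / 2 : ℝ) ^ J ≤ (1 / 2) ^ (j + 1) :=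
      pow_le_pow_of_le_one (by norm_num) (by norm_num) (by omega)
    have h2 : (1 / 2 : ℝ) ^ (J + 1) ≤ (1 / 2) ^ J :=
      pow_le_pow_of_le_one (by norm_num) (by norm_num) (by omega)
    linarith [hrJ.2]
  have hd : ν (Metric.closedBall y ((1 / 2) ^ j)) ≤ C * ν (Metric.closedBall y r) := by
    have hm : (1 / 2 : ℝ) ^ (j + 1) ∈ Ioo 0 r₀ := ⟨by positivity, hj1.trans hr.2⟩
    have h1 := hC hm y
    rw [show 2 * (1 / 2 : ℝ) ^ (j + 1) = (1 / 2) ^ j by rw [pow_succ]; ring] at h1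
    exact h1.trans (mul_le_mul_right (measure_mono (Metric.closedBall_subset_closedBall hj1.le)) _)
  have hpos : ν (Metric.closedBall y r) ≠ 0 := (Metric.measure_closedBall_pos ν y hr.1).ne'
  have hpos2 : ν (Metric.closedBall y ((1 / 2) ^ j)) ≠ 0 :=
    (Metric.measure_closedBall_pos ν y (by positivity)).ne'
  have hfin : ν (Metric.closedBall y r) ≠ ⊤ := measure_closedBall_lt_top.ne
  have hfin2 : ν (Metric.closedBall y ((1 / 2) ^ j)) ≠ ⊤ := measure_closedBall_lt_top.ne
  calc meanOsc ν g y r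
      ≤ (∫⁻ z in Metric.closedBall y ((1 / 2) ^ j), ‖g z - g y‖ₑ ∂ν) / ν (Metric.closedBall y r) :=
        ENNReal.div_le_div_right (lintegral_mono_set (Metric.closedBall_subset_closedBall hj2)) _
    _ = meanOsc ν g y ((1 / 2) ^ j) * (ν (Metric.closedBall y ((1 / 2) ^ j))
        / ν (Metric.closedBall y r)) := by
        rw [meanOsc, ← mul_div_assoc, ENNReal.div_mul_cancel hpos2 hfin2]
    _ ≤ η / (C + 1) * (C + 1) := by
        refine mul_le_mul' (hJ j hjJ) ?_
        rw [ENNReal.div_le_iff hpos hfin]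
        exact hd.trans (mul_le_mul_left (le_self_add) _)
    _ = η := ENNReal.div_mul_cancel (by simp) (by simp)

lemma ae_tendsto_meanOsc [BorelSpace Y] (ν : Measure Y) [IsUnifLocDoublingMeasure ν]
    [IsFiniteMeasureOnCompacts ν] {g : Y → ℝ} (hg : Measurable g) {B : ℝ} (hB : ∀ y, |g y| ≤ B) :
    ∀ᵐ y ∂ν, Tendsto (fun r => meanOsc ν g y r) (𝓝[>] 0) (𝓝 0) := by
  have hloc : LocallyIntegrable g ν := by
    intro y
    refine ⟨Metric.closedBall y 1, Metric.closedBall_mem_nhds _ one_pos,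
      IntegrableOn.of_bound measure_closedBall_lt_top hg.aestronglyMeasurable B
        (.of_forall fun z => hB z)⟩
  filter_upwards [IsUnifLocDoublingMeasure.ae_tendsto_average_norm_sub ν hloc 1] with y hy
  have h1 := hy (l := 𝓝[>] (0 : ℝ)) (fun _ => y) id tendsto_id (by
    filter_upwards [self_mem_nhdsWithin] with r hr
    have : (0 : ℝ) < r := hr
    simp [this.le])
  have h2 := ENNReal.tendsto_ofReal h1
  rw [ENNReal.ofReal_zero] at h2
  refine h2.congr fun r => ?_
  rw [ofReal_setAverage]
  · simp only [ofReal_norm, meanOsc]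
    rfl
  · refine Integrable.norm (IntegrableOn.of_bound measure_closedBall_lt_top
      (by fun_prop) (B + B) (.of_forall fun z => ?_))
    exact (norm_sub_le _ _).trans (add_le_add (hB _) (hB _))
  · exact .of_forall fun z => norm_nonneg _

/-- Almost every point of a product is a Lebesgue point in its second variable. -/
lemma ae_prod_tendsto_meanOsc [BorelSpace Y] (μ : Measure X) [SFinite μ] (ν : Measure Y)
    [IsUnifLocDoublingMeasure ν] [IsFiniteMeasureOnCompacts ν] [SFinite ν] [ν.IsOpenPosMeasure]
    {f : X → Y → ℝ} (hf : Measurable (Function.uncurry f)) {B : ℝ} (hB : ∀ x y, |f x y| ≤ B) :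
    ∀ᵐ p ∂(μ.prod ν), Tendsto (fun r => meanOsc ν (f p.1) p.2 r) (𝓝[>] 0) (𝓝 0) := by
  have hm : MeasurableSet {p : X × Y |
      Tendsto (fun j : ℕ => meanOsc ν (f p.1) p.2 ((1 / 2) ^ j)) atTop (𝓝 0)} :=
    measurableSet_tendsto _ fun j => measurable_meanOsc ν hf _
  have h : ∀ᵐ p ∂(μ.prod ν),
      Tendsto (fun j : ℕ => meanOsc ν (f p.1) p.2 ((1 / 2) ^ j)) atTop (𝓝 0) := by
    rw [Measure.ae_prod_iff_ae_ae hm]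
    refine .of_forall fun x => ?_
    filter_upwards [ae_tendsto_meanOsc ν (g := f x) 
      (hf.comp (f := fun y => (x, y)) (by fun_prop)) (hB x)] with y hy
    refine hy.comp (tendsto_nhdsWithin_iff.2 ⟨?_, .of_forall fun j => ?_⟩)
    · exact tendsto_pow_atTop_nhds_zero_of_lt_one (by norm_num) (by norm_num)
    · simp
  exact h.mono fun p hp => tendsto_meanOsc_of_dyadic ν hp

end Lebesgue

/-! ### Lebesgue directions -/

variable {m : ℕ}

instance sphereMeasure_isOpenPosMeasure (m : ℕ) : (sphereMeasure (m + 1)).IsOpenPosMeasure := by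
  refine ⟨fun U hU hne h0 => ?_⟩
  obtain ⟨θ, hθ⟩ := hne
  obtain ⟨r, hr, hb⟩ := Metric.isOpen_iff.1 hU θ hθ
  set s := min (r / 2) 1
  have hs : 0 < s := by positivity
  have h1 := le_cap θ hs.le (min_le_right _ _)
  have h2 : sphereMeasure (m + 1) (Metric.closedBall θ s) = 0 := by
    refine measure_mono_null ?_ h0
    refine (Metric.closedBall_subset_ball ?_).trans hb
    linarith [min_le_left (r / 2) 1]
  rw [h2, mul_zero, nonpos_iff_eq_zero] at h1
  have h3 : 0 < s ^ m := by positivity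
  simp [sphereConst_ne_zero, ballVol_ne_zero, h3.not_ge] at h1

/-- The parameter is the pair of x and the outgoing direction θ, and the incoming direction is the
variable. Almost every triple is a Lebesgue point in it, and Fubini isolates the incoming direction.
-/
lemma ae_isLebesgueDirection {Ω : Set (Space (m + 1))}
    {k : Space (m + 1) → Sph (m + 1) → Sph (m + 1) → ℝ}
    (hk : Measurable (fun q : (Space (m + 1) × Sph (m + 1)) × Sph (m + 1) => k q.1.1 q.1.2 q.2))
    {B : ℝ} (hB : ∀ x θ' θ, |k x θ' θ| ≤ B) :
    ∀ᵐ θ'' ∂(sphereMeasure (m + 1)), IsLebesgueDirection Ω k θ'' := by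
  have := sphereMeasure_isProbabilityMeasure (n := m + 1) (by omega)
  have : SFinite (phaseMeasure Ω) := by unfold phaseMeasure; infer_instance
  have := ae_ae_of_ae_prod_swap (ae_prod_tendsto_meanOsc (phaseMeasure Ω) (sphereMeasure (m + 1))
    (f := fun p θ'' => k p.1 θ'' p.2)
    (hk.comp (f := fun q : (Space (m + 1) × Sph (m + 1)) × Sph (m + 1) => ((q.1.1, q.2), q.1.2))
      (by fun_prop)) (fun p θ'' => hB _ _ _))
  filter_upwards [this] with θ'' h
  filter_upwards [h] with p hp
  refine ⟨k p.1 θ'' p.2, ?_⟩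
  have h1 := (ENNReal.tendsto_toReal ENNReal.zero_ne_top).comp hp
  rw [ENNReal.toReal_zero] at h1
  refine h1.congr fun r => ?_
  have hm : Measurable fun θ => k p.1 θ p.2 :=
    hk.comp (f := fun θ => ((p.1, θ), p.2)) (by fun_prop)
  have h0 : 0 ≤ ⨍ z in Metric.closedBall θ'' r, |k p.1 z p.2 - k p.1 θ'' p.2|
    ∂(sphereMeasure (m + 1)) := integral_nonneg fun _ => abs_nonneg _
  rw [Function.comp_apply, meanOsc, ← ENNReal.toReal_ofReal h0, ofReal_setAverage]
  · simp only [Real.enorm_eq_ofReal_abs]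
  · refine Integrable.abs (IntegrableOn.of_bound (measure_lt_top _ _)
      (by fun_prop) (B + B) (.of_forall fun z => ?_))
    exact (norm_sub_le _ _).trans (add_le_add (hB _ _ _) (hB _ _ _))
  · exact .of_forall fun z => abs_nonneg _

/-- At a Lebesgue direction the oscillation of the kernel over caps is `o(r^{n-1})`. -/
lemma IsLebesgueDirection.ae_tendsto {Ω : Set (Space (m + 1))}
    {k : Space (m + 1) → Sph (m + 1) → Sph (m + 1) → ℝ} {θ' : Sph (m + 1)}
    (h : IsLebesgueDirection Ω k θ')
    (hk : Measurable (fun q : (Space (m + 1) × Sph (m + 1)) × Sph (m + 1) => k q.1.1 q.1.2 q.2))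
    {B : ℝ} (hB : ∀ x θ' θ, |k x θ' θ| ≤ B) :
    ∀ᵐ p ∂(phaseMeasure Ω), ∃ c : ℝ, Tendsto (fun r : ℝ => ENNReal.ofReal ((r ^ m)⁻¹) *
      ∫⁻ θ'' in Metric.closedBall θ' r, ‖k p.1 θ'' p.2 - c‖ₑ ∂(sphereMeasure (m + 1)))
      (𝓝[>] 0) (𝓝 0) := by
  have := sphereMeasure_isProbabilityMeasure (n := m + 1) (by omega)
  filter_upwards [h] with p ⟨c, hc⟩
  refine ⟨c, ?_⟩
  have hm : Measurable fun θ => k p.1 θ p.2 :=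
    hk.comp (f := fun θ => ((p.1, θ), p.2)) (by fun_prop)
  set D : ℝ≥0∞ := sphereConst (m + 1) * 2 ^ m * ballVol m with hD
  have hDt : D ≠ ⊤ := ENNReal.mul_ne_top (ENNReal.mul_ne_top sphereConst_ne_top (by simp))
    (ballVol_ne_top m)
  have h1 := ENNReal.Tendsto.const_mul (ENNReal.tendsto_ofReal hc) (.inr hDt)
  rw [ENNReal.ofReal_zero, mul_zero] at h1
  refine tendsto_of_tendsto_of_tendsto_of_le_of_le' tendsto_const_nhds h1
    (.of_forall fun r => bot_le) ?_
  filter_upwards [Ioo_mem_nhdsGT (zero_lt_one (α := ℝ))] with r hr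
  have hr0 : 0 < r := hr.1
  rw [ofReal_setAverage]
  · simp only [← Real.enorm_eq_ofReal_abs]
    set I := ∫⁻ θ'' in Metric.closedBall θ' r, ‖k p.1 θ'' p.2 - c‖ₑ ∂(sphereMeasure (m + 1))
    set V := sphereMeasure (m + 1) (Metric.closedBall θ' r)
    have hV0 : V ≠ 0 := (Metric.measure_closedBall_pos _ _ hr.1).ne'
    have hVt : V ≠ ⊤ := measure_ne_top _ _
    have hV : V ≤ D * ENNReal.ofReal (r ^ m) := by
      refine (cap_le θ' hr.1.le hr.2.le).trans_eq ?_
      rw [mul_pow, ENNReal.ofReal_mul (by positivity), ENNReal.ofReal_pow zero_le_two, hD]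
      norm_num
      ring
    calc ENNReal.ofReal ((r ^ m)⁻¹) * I
        = ENNReal.ofReal ((r ^ m)⁻¹) * (I / V * V) := by rw [ENNReal.div_mul_cancel hV0 hVt]
      _ ≤ ENNReal.ofReal ((r ^ m)⁻¹) * (I / V * (D * ENNReal.ofReal (r ^ m))) := by gcongr
      _ = D * (I / V) * (ENNReal.ofReal ((r ^ m)⁻¹) * ENNReal.ofReal (r ^ m)) := by ring
      _ = D * (I / V) := by
        rw [← ENNReal.ofReal_mul (by positivity), inv_mul_cancel₀ (by positivity),
          ENNReal.ofReal_one, mul_one]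
  · refine Integrable.abs (IntegrableOn.of_bound (measure_lt_top _ _)
      (by fun_prop) (B + |c|) (.of_forall fun z => ?_))
    exact (norm_sub_le _ _).trans (add_le_add (hB _ _ _) le_rfl)
  · exact .of_forall fun z => abs_nonneg _

end TwoPhoton

end

noncomputable section

namespace TwoPhoton

/-! ### Directional Lebesgue points of the X-ray transform -/

variable {m : ℕ} {Ω : Set (Space (m + 1))}

lemma IsFrame.measurableEmbedding {θ' : Sph (m + 1)} {e : Space m →ₗᵢ[ℝ] Space (m + 1)}
    (he : IsFrame θ' e) :
    MeasurableEmbedding (fun q : ℝ × Space m => q.1 • (θ' : Space (m + 1)) + e q.2) := by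
  have hc := e.continuous
  refine Continuous.measurableEmbedding (by fun_prop) ?_
  have hin : ∀ q : ℝ × Space m, inner ℝ (θ' : Space (m + 1)) (q.1 • (θ' : Space (m + 1)) + e q.2)
      = q.1 := fun q => by
    rw [inner_add_right, he.orth, real_inner_smul_right, real_inner_self_eq_norm_sq, norm_sph]
    simp
  intro q q' h
  have h1 : q.1 = q'.1 := by rw [← hin q, ← hin q']; exact congrArg _ h
  simp only [h1, add_right_inj] at h
  exact Prod.ext h1 (e.injective h)

lemma setLIntegral_closedBall_sub_left (G : Space m → ℝ≥0∞) (ζ : Space m) (r : ℝ) :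
    ∫⁻ z in Metric.closedBall ζ r, G z = ∫⁻ η in Metric.closedBall 0 r, G (ζ - η) := by
  rw [← lintegral_indicator Metric.isClosed_closedBall.measurableSet,
    ← lintegral_indicator Metric.isClosed_closedBall.measurableSet,
    ← lintegral_sub_left_eq_self _ ζ]
  refine lintegral_congr fun η => ?_
  have : ζ - η ∈ Metric.closedBall ζ r ↔ η ∈ Metric.closedBall 0 r := by simp
  by_cases hη : η ∈ Metric.closedBall 0 r
  · rw [indicator_of_mem hη, indicator_of_mem (this.2 hη)]
  · rw [indicator_of_notMem hη, indicator_of_notMem (fun h => hη (this.1 h))]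

/-- The normalized oscillation of `a` around `y` along the hyperplane orthogonal to `θ'`. -/
def planeOsc (e : Space m →ₗᵢ[ℝ] Space (m + 1)) (a : Space (m + 1) → ℝ) (y : Space (m + 1))
    (r : ℝ) : ℝ≥0∞ :=
  ENNReal.ofReal ((r ^ m)⁻¹) * ∫⁻ η in Metric.closedBall (0 : Space m) r, ‖a (y - e η) - a y‖ₑ

/-- In the coordinates of the frame, the hyperplanes orthogonal to θ' are the slices s = const of ℝ
× `Space m`, and almost every point of a product is a Lebesgue point within its slice. -/
lemma ae_tendsto_planeOsc {θ' : Sph (m + 1)} {e : Space m →ₗᵢ[ℝ] Space (m + 1)}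
    (he : IsFrame θ' e) {a : Space (m + 1) → ℝ} (ha : Measurable a) {B : ℝ} (hB : ∀ x, |a x| ≤ B) :
    ∀ᵐ y, Tendsto (fun r => planeOsc e a y r) (𝓝[>] 0) (𝓝 0) := by
  rw [← he.preserving.map_eq, he.measurableEmbedding.ae_map_iff, Measure.volume_eq_prod]
  have hc := e.continuous
  filter_upwards [ae_prod_tendsto_meanOsc (volume : Measure ℝ) (volume : Measure (Space m))
    (f := fun s ζ => a (s • (θ' : Space (m + 1)) + e ζ)) (ha.comp (by fun_prop))
    (fun _ _ => hB _)] with q hq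
  have h1 := ENNReal.Tendsto.const_mul (a := ballVol m) hq (.inr (ballVol_ne_top m))
  rw [mul_zero] at h1
  refine h1.congr' ?_
  filter_upwards [self_mem_nhdsWithin] with r hr
  have hr0 : (0 : ℝ) < r := hr
  rw [meanOsc, planeOsc, volume_closedBall_space hr0.le, setLIntegral_closedBall_sub_left,
    ENNReal.div_eq_inv_mul, ENNReal.mul_inv (.inl (by simp [hr0])) (.inl ENNReal.ofReal_ne_top),
    ENNReal.ofReal_inv_of_pos (by positivity)]
  simp only [map_sub, add_sub_assoc]
  rw [mul_comm (ENNReal.ofReal (r ^ m))⁻¹, mul_assoc, ← mul_assoc, ENNReal.mul_inv_cancel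
    (ballVol_ne_zero m) (ballVol_ne_top m), one_mul]

lemma ae_ae_translate {n : ℕ} {P : Space n → Prop} (h : ∀ᵐ y, P y) (v : Space n) :
    ∀ᵐ x : Space n, ∀ᵐ t : ℝ, P (x - t • v) := by
  obtain ⟨N, hN, hNm, hN0⟩ := exists_measurable_superset_of_null (ae_iff.1 h)
  have h1 : ∀ᵐ t : ℝ, ∀ᵐ x : Space n, x - t • v ∉ N := by
    refine .of_forall fun t => ?_
    have : ∀ᵐ y : Space n, y ∉ N := by rw [ae_iff]; simpa using hN0
    exact (measurePreserving_sub_right volume (t • v)).quasiMeasurePreserving.ae this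
  rw [← Measure.ae_ae_comm (p := fun (x : Space n) (t : ℝ) => x - t • v ∉ N)] at h1
  · filter_upwards [h1] with x hx
    filter_upwards [hx] with t ht
    by_contra hP
    exact ht (hN hP)
  · exact (hNm.preimage (f := fun q : Space n × ℝ => q.1 - q.2 • v) (by fun_prop)).compl

/-- Reparametrizing by s = t√(1 + ‖η‖²), the ray in direction `gno θ' e η` passes at time t through
x - tθ' - te(η). So rays of different directions are compared within the same hyperplane orthogonal
to θ'. -/
lemma xray_gno {θ' : Sph (m + 1)} {e : Space m →ₗᵢ[ℝ] Space (m + 1)} (he : IsFrame θ' e)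
    (a : Space (m + 1) → ℝ) (x : Space (m + 1)) (η : Space m) :
    xray Ω a (x, gno θ' e η) = √(1 + ‖η‖ ^ 2) *
      ∫ t in Ioi (0 : ℝ), Ω.indicator a (x - t • ((θ' : Space (m + 1)) + e η)) := by
  have hρ : 0 < √(1 + ‖η‖ ^ 2) := by positivity
  have h1 := integral_comp_mul_left_Ioi
    (fun s : ℝ => Ω.indicator a (x - s • (gno θ' e η : Space (m + 1)))) 0 hρ
  rw [mul_zero] at h1
  have h2 : ∀ t : ℝ, (√(1 + ‖η‖ ^ 2) * t) • (gno θ' e η : Space (m + 1))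
      = t • ((θ' : Space (m + 1)) + e η) := fun t => by
    rw [gno, coe_nrm θ' (frame_ne_zero he η), norm_frame he, smul_smul, mul_right_comm,
      mul_inv_cancel₀ hρ.ne', one_mul]
  simp only [h2] at h1
  rw [h1, smul_eq_mul, ← mul_assoc, mul_inv_cancel₀ hρ.ne', one_mul, xray]

lemma setIntegral_Ioi_line {L : ℝ} (hL : ∀ x ∈ Ω, ∀ y ∈ Ω, ‖x - y‖ < L) {x : Space (m + 1)}
    (hx : x ∈ Ω) {v : Space (m + 1)} (hv : 1 ≤ ‖v‖) (a : Space (m + 1) → ℝ) :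
    ∫ t in Ioi (0 : ℝ), Ω.indicator a (x - t • v)
      = ∫ t in Ioo (0 : ℝ) L, Ω.indicator a (x - t • v) := by
  refine setIntegral_eq_of_subset_of_forall_sdiff_eq_zero measurableSet_Ioi
    Ioo_subset_Ioi_self fun t ht => ?_
  refine indicator_of_notMem (fun hmem => ht.2 (mem_Ioo.2 ⟨ht.1, ?_⟩)) _
  have h1 := hL x hx _ hmem
  have ht0 : (0 : ℝ) < t := ht.1
  rw [sub_sub_cancel, norm_smul, Real.norm_of_nonneg ht0.le] at h1
  nlinarith

/-- Two errors: the change of speed √(1 + ‖η‖²) - 1 ≤ ‖η‖², and the lateral displacement te(η). Both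
rays have left Ω by time L, so one integration interval serves both. -/
lemma enorm_xray_gno_sub_le {L : ℝ} (hL0 : 0 < L) (hL : ∀ x ∈ Ω, ∀ y ∈ Ω, ‖x - y‖ < L)
    (hΩ : MeasurableSet Ω) {θ' : Sph (m + 1)} {e : Space m →ₗᵢ[ℝ] Space (m + 1)} (he : IsFrame θ' e)
    {a : Space (m + 1) → ℝ} (ha : Measurable a) {B : ℝ} (hB : ∀ x, |a x| ≤ B)
    {x : Space (m + 1)} (hx : x ∈ Ω) (η : Space m) :
    ‖xray Ω a (x, gno θ' e η) - xray Ω a (x, θ')‖ₑ ≤ ENNReal.ofReal (‖η‖ ^ 2 * (B * L)) +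
      ∫⁻ t in Ioo (0 : ℝ) L, ‖Ω.indicator a (x - t • (θ' : Space (m + 1)) - e (t • η))
        - Ω.indicator a (x - t • (θ' : Space (m + 1)))‖ₑ := by
  have hB0 : 0 ≤ B := (abs_nonneg _).trans (hB x)
  have hi : Measurable (Ω.indicator a) := ha.indicator hΩ
  have hiB : ∀ y, ‖Ω.indicator a y‖ ≤ B := fun y => by
    by_cases hy : y ∈ Ω
    · rw [indicator_of_mem hy]; exact hB y
    · rw [indicator_of_notMem hy]; simpa using hB0
  have h1 : 1 ≤ √(1 + ‖η‖ ^ 2) := Real.one_le_sqrt.2 (by nlinarith [sq_nonneg ‖η‖])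
  have h2 : √(1 + ‖η‖ ^ 2) ^ 2 = 1 + ‖η‖ ^ 2 := Real.sq_sqrt (by positivity)
  have hint : ∀ v : Space (m + 1), IntegrableOn (fun t : ℝ => Ω.indicator a (x - t • v)) (Ioo 0 L) :=
    fun v => IntegrableOn.of_bound (by simp) (hi.comp (by fun_prop)).aestronglyMeasurable B
      (.of_forall fun t => hiB _)
  rw [xray_gno he, setIntegral_Ioi_line hL hx (by rw [norm_frame he]; exact h1)]
  rw [xray]
  simp only
  rw [setIntegral_Ioi_line hL hx (norm_sph θ').ge]
  set A := ∫ t in Ioo (0 : ℝ) L, Ω.indicator a (x - t • ((θ' : Space (m + 1)) + e η)) with hA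
  set C := ∫ t in Ioo (0 : ℝ) L, Ω.indicator a (x - t • (θ' : Space (m + 1)))
  have hAB : ‖A‖ ≤ B * L := by
    refine (norm_setIntegral_le_of_norm_le_const (by simp) fun t _ => hiB _).trans_eq ?_
    simp [hL0.le]
  have hAC : ‖A - C‖ₑ ≤ ∫⁻ t in Ioo (0 : ℝ) L,
      ‖Ω.indicator a (x - t • (θ' : Space (m + 1)) - e (t • η))
        - Ω.indicator a (x - t • (θ' : Space (m + 1)))‖ₑ := by
    rw [hA, ← integral_sub (hint _) (hint _)]
    refine (enorm_integral_le_lintegral_enorm _).trans_eq ?_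
    refine lintegral_congr fun t => ?_
    rw [smul_add, map_smul, sub_add_eq_sub_sub]
  calc ‖√(1 + ‖η‖ ^ 2) * A - C‖ₑ = ‖(√(1 + ‖η‖ ^ 2) - 1) * A + (A - C)‖ₑ := by congr 1; ring
    _ ≤ ‖(√(1 + ‖η‖ ^ 2) - 1) * A‖ₑ + ‖A - C‖ₑ := enorm_add_le _ _
    _ ≤ _ := by
        refine add_le_add ?_ hAC
        rw [← ofReal_norm, norm_mul, Real.norm_of_nonneg (by linarith)]
        refine ENNReal.ofReal_le_ofReal (mul_le_mul ?_ hAB (norm_nonneg _) (sq_nonneg _))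
        nlinarith

lemma lintegral_closedBall_comp_smul {f : Space m → ℝ≥0∞} (hf : Measurable f) {t : ℝ} (ht : 0 < t)
    (r : ℝ) : ∫⁻ η in Metric.closedBall 0 r, f (t • η)
      = ENNReal.ofReal ((t ^ m)⁻¹) * ∫⁻ η in Metric.closedBall 0 (t * r), f η := by
  have hm : MeasurableSet (Metric.closedBall (0 : Space m) (t * r)) :=
    Metric.isClosed_closedBall.measurableSet
  rw [← lintegral_indicator hm, ← lintegral_comp_smul_space _ (hf.indicator hm) ht,
    ← lintegral_indicator Metric.isClosed_closedBall.measurableSet]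
  refine lintegral_congr fun η => ?_
  have : t • η ∈ Metric.closedBall (0 : Space m) (t * r) ↔ η ∈ Metric.closedBall 0 r := by
    simp only [mem_closedBall_zero_iff, norm_smul, Real.norm_of_nonneg ht.le]
    exact mul_le_mul_iff_right₀ ht
  by_cases hη : η ∈ Metric.closedBall 0 r
  · rw [indicator_of_mem hη, indicator_of_mem (this.2 hη)]
  · rw [indicator_of_notMem hη, indicator_of_notMem (fun h => hη (this.1 h))]

lemma ofReal_inv_pow_mul {r : ℝ} (hr : 0 < r) :
    ENNReal.ofReal ((r ^ m)⁻¹) * ENNReal.ofReal ((2 * r) ^ m) = 2 ^ m := by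
  rw [← ENNReal.ofReal_mul (by positivity), mul_pow, mul_comm, mul_assoc,
    mul_inv_cancel₀ (by positivity), mul_one, ENNReal.ofReal_pow zero_le_two]
  norm_num

/-- At time t the directions near θ' sweep a ball of radius 2rt around x - tθ' in the orthogonal
hyperplane. Scaling by t turns the average over directions into `planeOsc` at that radius, so
angular oscillation of the X-ray transform is bounded by a line integral of hyperplane oscillations.
-/
lemma xray_cap_le {L : ℝ} (hL0 : 0 < L) (hL : ∀ x ∈ Ω, ∀ y ∈ Ω, ‖x - y‖ < L)
    (hΩ : IsOpen Ω) {θ' : Sph (m + 1)} {e : Space m →ₗᵢ[ℝ] Space (m + 1)} (he : IsFrame θ' e)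
    {a : Space (m + 1) → ℝ} (ha : Measurable a) {B : ℝ} (hB : ∀ x, |a x| ≤ B)
    {x : Space (m + 1)} (hx : x ∈ Ω) {r : ℝ} (hr0 : 0 < r) (hr : r ≤ 1) :
    ENNReal.ofReal ((r ^ m)⁻¹) * ∫⁻ θ in Metric.closedBall θ' r,
        ‖xray Ω a (x, θ) - xray Ω a (x, θ')‖ₑ ∂(sphereMeasure (m + 1))
      ≤ sphereConst (m + 1) * (ENNReal.ofReal ((2 * r) ^ 2 * (B * L)) * (2 ^ m * ballVol m) +
        2 ^ m * ∫⁻ t in Ioo (0 : ℝ) L,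
          planeOsc e (Ω.indicator a) (x - t • (θ' : Space (m + 1))) (t * (2 * r))) := by
  have hB0 : 0 ≤ B := (abs_nonneg _).trans (hB x)
  have hi : Measurable (Ω.indicator a) := ha.indicator hΩ.measurableSet
  have hc := e.continuous
  have hxm : Measurable fun θ : Sph (m + 1) => xray Ω a (x, θ) :=
    ((stronglyMeasurable_xray hΩ ha.stronglyMeasurable).measurable).comp
      (f := fun θ : Sph (m + 1) => (x, θ)) (by fun_prop)
  have h1 := setLIntegral_cap_le he (F := fun θ => ‖xray Ω a (x, θ) - xray Ω a (x, θ')‖ₑ)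
    (by fun_prop) hr0.le hr
  have h2 : ∫⁻ η in Metric.closedBall (0 : Space m) (2 * r),
      ‖xray Ω a (x, gno θ' e η) - xray Ω a (x, θ')‖ₑ
      ≤ ENNReal.ofReal ((2 * r) ^ 2 * (B * L)) * (ENNReal.ofReal ((2 * r) ^ m) * ballVol m) +
        ∫⁻ η in Metric.closedBall (0 : Space m) (2 * r), ∫⁻ t in Ioo (0 : ℝ) L,
          ‖Ω.indicator a (x - t • (θ' : Space (m + 1)) - e (t • η))
            - Ω.indicator a (x - t • (θ' : Space (m + 1)))‖ₑ := by
    rw [← volume_closedBall_space (by positivity) (0 : Space m), ← setLIntegral_const,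
      ← lintegral_add_left measurable_const]
    refine setLIntegral_mono' Metric.isClosed_closedBall.measurableSet fun η hη => ?_
    refine (enorm_xray_gno_sub_le hL0 hL hΩ.measurableSet he ha hB hx η).trans (add_le_add_left ?_ _)
    refine ENNReal.ofReal_le_ofReal ?_
    have := mem_closedBall_zero_iff.1 hη
    gcongr
  have h3 : ENNReal.ofReal ((r ^ m)⁻¹) * ∫⁻ η in Metric.closedBall (0 : Space m) (2 * r),
      ∫⁻ t in Ioo (0 : ℝ) L, ‖Ω.indicator a (x - t • (θ' : Space (m + 1)) - e (t • η))
            - Ω.indicator a (x - t • (θ' : Space (m + 1)))‖ₑ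
      = 2 ^ m * ∫⁻ t in Ioo (0 : ℝ) L,
          planeOsc e (Ω.indicator a) (x - t • (θ' : Space (m + 1))) (t * (2 * r)) := by
    rw [lintegral_lintegral_swap]
    · rw [← lintegral_const_mul', ← lintegral_const_mul']
      · refine setLIntegral_congr_fun measurableSet_Ioo fun t ht => ?_
        have ht0 : 0 < t := ht.1
        have h4 := lintegral_closedBall_comp_smul
          (f := fun η => ‖Ω.indicator a (x - t • (θ' : Space (m + 1)) - e η)
            - Ω.indicator a (x - t • (θ' : Space (m + 1)))‖ₑ) (by fun_prop) ht0 (2 * r)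
        rw [h4, planeOsc, ← ofReal_inv_pow_mul hr0]
        simp only [← mul_assoc]
        congr 1
        rw [← ENNReal.ofReal_mul (by positivity), ← ENNReal.ofReal_mul (by positivity),
          ← ENNReal.ofReal_mul (by positivity)]
        congr 1
        rw [mul_assoc t, mul_pow t]
        field_simp
      · simp
      · exact ENNReal.ofReal_ne_top
    · have : Measurable fun q : Space m × ℝ =>
        ‖Ω.indicator a (x - q.2 • (θ' : Space (m + 1)) - e (q.2 • q.1))
            - Ω.indicator a (x - q.2 • (θ' : Space (m + 1)))‖ₑ := by
        have e1 : Measurable fun q : Space m × ℝ =>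
            Ω.indicator a (x - q.2 • (θ' : Space (m + 1)) - e (q.2 • q.1)) :=
          hi.comp (by fun_prop)
        have e2 : Measurable fun q : Space m × ℝ =>
            Ω.indicator a (x - q.2 • (θ' : Space (m + 1))) := hi.comp (by fun_prop)
        fun_prop
      exact this.aemeasurable
  calc _ ≤ ENNReal.ofReal ((r ^ m)⁻¹) * (sphereConst (m + 1) * (_ + _)) :=
        mul_le_mul_right (h1.trans (mul_le_mul_right h2 _)) _
    _ = sphereConst (m + 1) * (ENNReal.ofReal ((2 * r) ^ 2 * (B * L)) *
          ((ENNReal.ofReal ((r ^ m)⁻¹) * ENNReal.ofReal ((2 * r) ^ m)) * ballVol m) +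
          ENNReal.ofReal ((r ^ m)⁻¹) * ∫⁻ η in Metric.closedBall (0 : Space m) (2 * r),
            ∫⁻ t in Ioo (0 : ℝ) L, ‖Ω.indicator a (x - t • (θ' : Space (m + 1)) - e (t • η))
            - Ω.indicator a (x - t • (θ' : Space (m + 1)))‖ₑ) := by ring
    _ = _ := by rw [h3, ofReal_inv_pow_mul hr0]

/-- Provides the bound, uniform in t and r, for dominated convergence along the line. -/
lemma planeOsc_le (e : Space m →ₗᵢ[ℝ] Space (m + 1)) {a : Space (m + 1) → ℝ} {B : ℝ}
    (hB : ∀ x, |a x| ≤ B) (y : Space (m + 1)) {r : ℝ} (hr : 0 < r) :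
    planeOsc e a y r ≤ ENNReal.ofReal (B + B) * ballVol m := by
  have h1 : ∫⁻ η in Metric.closedBall (0 : Space m) r, ‖a (y - e η) - a y‖ₑ
      ≤ ENNReal.ofReal (B + B) * (ENNReal.ofReal (r ^ m) * ballVol m) := by
    rw [← volume_closedBall_space hr.le (0 : Space m), ← setLIntegral_const]
    refine lintegral_mono fun η => ?_
    rw [← ofReal_norm]
    exact ENNReal.ofReal_le_ofReal ((norm_sub_le _ _).trans (add_le_add (hB _) (hB _)))
  calc planeOsc e a y r ≤ ENNReal.ofReal ((r ^ m)⁻¹) * _ := mul_le_mul_right h1 _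
    _ = ENNReal.ofReal (B + B) * ((ENNReal.ofReal ((r ^ m)⁻¹) * ENNReal.ofReal (r ^ m)) *
        ballVol m) := by ring
    _ = _ := by
        rw [← ENNReal.ofReal_mul (by positivity), inv_mul_cancel₀ (by positivity),
          ENNReal.ofReal_one, one_mul]

lemma measurable_planeOsc_line (e : Space m →ₗᵢ[ℝ] Space (m + 1)) {a : Space (m + 1) → ℝ}
    (ha : Measurable a) (x v : Space (m + 1)) (r : ℝ) :
    Measurable fun t : ℝ => planeOsc e a (x - t • v) (t * r) := by
  have hc := e.continuous
  have hs : MeasurableSet {q : ℝ × Space m | ‖q.2‖ ≤ q.1 * r} :=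
    measurableSet_le (by fun_prop) (by fun_prop)
  have h1 : Measurable fun q : ℝ × Space m => {q : ℝ × Space m | ‖q.2‖ ≤ q.1 * r}.indicator
      (fun q => ‖a (x - q.1 • v - e q.2) - a (x - q.1 • v)‖ₑ) q := by
    refine Measurable.indicator ?_ hs
    have e1 : Measurable fun q : ℝ × Space m => a (x - q.1 • v - e q.2) := ha.comp (by fun_prop)
    have e2 : Measurable fun q : ℝ × Space m => a (x - q.1 • v) := ha.comp (by fun_prop)
    fun_prop
  have h2 : Measurable fun t : ℝ => ENNReal.ofReal (((t * r) ^ m)⁻¹) := by fun_prop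
  convert h2.mul (h1.lintegral_prod_right' (ν := volume)) using 2 with t
  rw [planeOsc, Pi.mul_apply, ← lintegral_indicator Metric.isClosed_closedBall.measurableSet]
  congr 2 with η
  simp only [indicator, mem_closedBall_zero_iff, mem_ofPred_eq]

/-- For a fixed direction, almost every point is a Lebesgue point of the X-ray transform as a
function of the direction. -/
lemma ae_tendsto_xray_cap (hΩ : IsDomainC1 Ω) {a : Space (m + 1) → ℝ} (ha : Measurable a) {B : ℝ}
    (hB : ∀ x, |a x| ≤ B) (θ' : Sph (m + 1)) :
    ∀ᵐ x ∂(volume.restrict Ω), Tendsto (fun r : ℝ => ENNReal.ofReal ((r ^ m)⁻¹) *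
      ∫⁻ θ in Metric.closedBall θ' r, ‖xray Ω a (x, θ) - xray Ω a (x, θ')‖ₑ
        ∂(sphereMeasure (m + 1))) (𝓝[>] 0) (𝓝 0) := by
  obtain ⟨e, he⟩ := exists_isFrame θ'
  obtain ⟨L, hL0, hL⟩ := exists_tau_le hΩ
  have hm := hΩ.isOpen.measurableSet
  have hi : Measurable (Ω.indicator a) := ha.indicator hm
  obtain ⟨x₀, -⟩ := hΩ.nonempty
  have hB0 : 0 ≤ B := (abs_nonneg _).trans (hB x₀)
  have hiB : ∀ y, |Ω.indicator a y| ≤ B := fun y => by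
    by_cases hy : y ∈ Ω
    · rw [indicator_of_mem hy]; exact hB y
    · rw [indicator_of_notMem hy]; simpa using hB0
  -- For almost every x, almost every point of its line in direction θ' is a Lebesgue point in the
  -- orthogonal hyperplane; the oscillations then tend to zero under the integral in t.
  have h1 := ae_ae_translate (ae_tendsto_planeOsc he hi hiB) (θ' : Space (m + 1))
  filter_upwards [ae_restrict_of_ae h1, ae_restrict_mem hm] with x hx hxΩ
  have hdct : Tendsto (fun r : ℝ => ∫⁻ t in Ioo (0 : ℝ) L,
      planeOsc e (Ω.indicator a) (x - t • (θ' : Space (m + 1))) (t * (2 * r))) (𝓝[>] 0)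
      (𝓝 (∫⁻ _ in Ioo (0 : ℝ) L, 0)) := by
    refine tendsto_lintegral_filter_of_dominated_convergence
      (fun _ => ENNReal.ofReal (B + B) * ballVol m)
      (.of_forall fun r => measurable_planeOsc_line e hi x θ' (2 * r)) ?_ ?_ ?_
    · filter_upwards [self_mem_nhdsWithin] with r hr
      have hr0 : (0 : ℝ) < r := hr
      filter_upwards [ae_restrict_mem measurableSet_Ioo] with t ht
      exact planeOsc_le e hiB _ (mul_pos ht.1 (by positivity))
    · rw [setLIntegral_const]
      exact ENNReal.mul_ne_top (ENNReal.mul_ne_top ENNReal.ofReal_ne_top (ballVol_ne_top m))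
        (by simp)
    · filter_upwards [ae_restrict_of_ae hx, ae_restrict_mem measurableSet_Ioo] with t ht ht0
      refine ht.comp (tendsto_nhdsWithin_iff.2 ⟨?_, ?_⟩)
      · have : Tendsto (fun r : ℝ => t * (2 * r)) (𝓝 0) (𝓝 (t * (2 * 0))) := by
          exact Continuous.tendsto (by fun_prop) _
        simp only [mul_zero] at this
        exact this.mono_left nhdsWithin_le_nhds
      · filter_upwards [self_mem_nhdsWithin] with r hr
        have hr0 : (0 : ℝ) < r := hr
        exact mul_pos ht0.1 (by positivity)
  have hq : Tendsto (fun r : ℝ => ENNReal.ofReal ((2 * r) ^ 2 * (B * L))) (𝓝[>] 0) (𝓝 0) := by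
    have : Tendsto (fun r : ℝ => ENNReal.ofReal ((2 * r) ^ 2 * (B * L))) (𝓝 0)
        (𝓝 (ENNReal.ofReal ((2 * 0) ^ 2 * (B * L)))) :=
      ENNReal.tendsto_ofReal (Continuous.tendsto (by fun_prop) _)
    simp only [mul_zero, ne_eq, OfNat.ofNat_ne_zero, not_false_eq_true, zero_pow, zero_mul,
      ENNReal.ofReal_zero] at this
    exact this.mono_left nhdsWithin_le_nhds
  have hsum := ENNReal.Tendsto.const_mul (a := sphereConst (m + 1))
    ((ENNReal.Tendsto.mul_const (b := 2 ^ m * ballVol m) hq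
      (.inr (ENNReal.mul_ne_top (by simp) (ballVol_ne_top m)))).add
      (ENNReal.Tendsto.const_mul (a := 2 ^ m) hdct (.inr (by simp)))) (.inr sphereConst_ne_top)
  simp only [zero_mul, lintegral_zero, mul_zero, add_zero] at hsum
  refine tendsto_of_tendsto_of_tendsto_of_le_of_le' tendsto_const_nhds hsum
    (.of_forall fun r => bot_le) ?_
  filter_upwards [Ioo_mem_nhdsGT (zero_lt_one (α := ℝ))] with r hr
  exact xray_cap_le hL0 hL hΩ.isOpen he ha hB hxΩ hr.1 hr.2.le

end TwoPhoton

end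

noncomputable section

namespace TwoPhoton

/-! ### Decomposition of the solution into its ballistic and its regular part -/

lemma abs_exp_neg_sub_le {s t : ℝ} (hs : 0 ≤ s) (ht : 0 ≤ t) :
    |Real.exp (-s) - Real.exp (-t)| ≤ |s - t| := by
  wlog hst : s ≤ t generalizing s t
  · rw [abs_sub_comm, abs_sub_comm s]
    exact this ht hs (le_of_not_ge hst)
  rw [abs_of_nonneg (sub_nonneg.2 (Real.exp_le_exp.2 (by linarith))), abs_of_nonpos (by linarith)]
  have h1 := Real.add_one_le_exp (s - t)
  have h2 : Real.exp (-t) = Real.exp (-s) * Real.exp (s - t) := by rw [← Real.exp_add]; congr 1; ring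
  have h3 : Real.exp (-s) ≤ 1 := Real.exp_le_one_iff.2 (by linarith)
  have h4 := Real.exp_pos (-s)
  nlinarith

section

variable {n : ℕ} {Ω : Set (Space n)}

lemma abs_lineExp_sub_le {a a' : Space n → ℝ} (ha : ∀ x, 0 ≤ a x) (ha' : ∀ x, 0 ≤ a' x)
    (p p' : Space n × Sph n) : |lineExp Ω a p - lineExp Ω a' p'| ≤ |xray Ω a p - xray Ω a' p'| :=
  abs_exp_neg_sub_le (xray_nonneg ha p) (xray_nonneg ha' p')

lemma measurable_lineExp (hΩ : IsOpen Ω) {a : Space n → ℝ} (ha : Measurable a) :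
    Measurable (lineExp Ω a) :=
  Real.measurable_exp.comp (stronglyMeasurable_xray hΩ ha.stronglyMeasurable).measurable.neg

lemma integrableOn_line (hΩ : IsDomainC1 Ω) {x : Space n} (hx : x ∈ Ω) (θ : Sph n) {a : Space n → ℝ}
    (ha : Measurable a) {B : ℝ} (hB : ∀ x, |a x| ≤ B) :
    IntegrableOn (fun s : ℝ => Ω.indicator a (x - s • (θ : Space n))) (Ioi 0) := by
  have h1 : IntegrableOn (fun s : ℝ => Ω.indicator a (x - s • (θ : Space n)))
      (Ioo 0 (tauMinus Ω x θ)) := by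
    refine IntegrableOn.of_bound (by simp)
      ((ha.indicator hΩ.isOpen.measurableSet).comp (by fun_prop)).aestronglyMeasurable B
      (.of_forall fun s => ?_)
    by_cases hs : x - s • (θ : Space n) ∈ Ω
    · rw [indicator_of_mem hs]; exact hB _
    · rw [indicator_of_notMem hs, norm_zero]; exact (abs_nonneg _).trans (hB x)
  refine h1.of_forall_sdiff_eq_zero measurableSet_Ioi fun s hs => indicator_of_notMem (fun hm => ?_) _
  exact hs.2 (mem_Ioo.2 ⟨hs.1, (mem_iff_lt_tauMinus hΩ hx θ (le_of_lt hs.1)).1 hm⟩)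

lemma abs_xray_sub_le (hΩ : IsDomainC1 Ω) {x : Space n} (hx : x ∈ Ω) (θ : Sph n)
    {a a' q : Space n → ℝ} (ha : Measurable a) (ha' : Measurable a') (hq : Measurable q) {B : ℝ}
    (hB : ∀ x, |a x| ≤ B) (hB' : ∀ x, |a' x| ≤ B) (hqB : ∀ x, |q x| ≤ B)
    (hle : ∀ x, |a x - a' x| ≤ q x) :
    |xray Ω a (x, θ) - xray Ω a' (x, θ)| ≤ xray Ω q (x, θ) := by
  rw [xray, xray, xray, ← integral_sub (integrableOn_line hΩ hx θ ha hB)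
    (integrableOn_line hΩ hx θ ha' hB')]
  refine (norm_integral_le_integral_norm _).trans (integral_mono
    ((integrableOn_line hΩ hx θ ha hB).sub (integrableOn_line hΩ hx θ ha' hB')).norm
    (integrableOn_line hΩ hx θ hq hqB) fun s => ?_)
  simp only [Pi.sub_apply]
  by_cases hs : x - s • (θ : Space n) ∈ Ω
  · simp only [indicator_of_mem hs]; exact hle _
  · simp [indicator_of_notMem hs]

lemma ae_abs_xray_sub_le (hΩ : IsDomainC1 Ω) [SFinite (sphereMeasure n)] {a a' : Space n → ℝ}
    (ha : Measurable a) (ha' : Measurable a') {B : ℝ} (hB : ∀ x, |a x| ≤ B)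
    (hB' : ∀ x, |a' x| ≤ B) {D : ℝ} (hD : 0 ≤ D)
    (hle : ∀ᵐ x ∂(volume.restrict Ω), |a x - a' x| ≤ D) :
    ∀ᵐ p ∂(phaseMeasure Ω), |xray Ω a p - xray Ω a' p| ≤ (tauNorm Ω).toReal * D := by
  filter_upwards [ae_line_of_ae hΩ (ae_phase_of_ae hle), ae_phase_mem hΩ, ae_tauMinus_le hΩ]
    with p h1 hp hτ
  have hτ0 := tauMinus_pos hΩ hp p.2
  have hi : ∀ {f : Space n → ℝ}, Measurable f → (∀ x, |f x| ≤ B) →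
      IntervalIntegrable (fun s : ℝ => f (p.1 - s • (p.2 : Space n))) volume 0
        (tauMinus Ω p.1 p.2) := fun {f} hf hfB => by
    rw [intervalIntegrable_iff_integrableOn_Ioo_of_le hτ0.le]
    exact IntegrableOn.of_bound (by simp) (hf.comp (by fun_prop)).aestronglyMeasurable B
      (.of_forall fun s => hfB _)
  rw [xray_eq hΩ _ hp, xray_eq hΩ _ hp, ← intervalIntegral.integral_sub (hi ha hB) (hi ha' hB')]
  calc _ ≤ D * |tauMinus Ω p.1 p.2 - 0| := by
        rw [← Real.norm_eq_abs]
        refine intervalIntegral.norm_integral_le_of_norm_le_const_ae ?_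
        rw [uIoc_of_le hτ0.le, ← ae_restrict_iff' measurableSet_Ioc, ← restrict_Ioo_eq_restrict_Ioc]
        exact h1
    _ ≤ _ := by
        rw [sub_zero, abs_of_pos hτ0, mul_comm]
        gcongr

end

variable {m : ℕ} {Ω : Set (Space (m + 1))} {h : Space (m + 1) → ℝ} {θ' : Sph (m + 1)}

instance isProbabilityMeasure_sphereMeasure_succ (m : ℕ) :
    IsProbabilityMeasure (sphereMeasure (m + 1)) :=
  sphereMeasure_isProbabilityMeasure (by omega)

/-- Averages against the peak converge at Lebesgue points. -/
lemma tendsto_integral_peak_mul (hh : IsCutoff h) {δ : ℝ} (hδ : 0 < δ) {g : Sph (m + 1) → ℝ}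
    (hg : Measurable g) {B : ℝ} (hB : ∀ θ, |g θ| ≤ B) {g₀ : ℝ}
    (hlim : Tendsto (fun r : ℝ => ENNReal.ofReal ((r ^ m)⁻¹) *
      ∫⁻ θ in Metric.closedBall θ' r, ‖g θ - g₀‖ₑ ∂(sphereMeasure (m + 1))) (𝓝[>] 0) (𝓝 0)) :
    Tendsto (fun ε => ∫ θ, peak h θ' ε δ θ * g θ ∂(sphereMeasure (m + 1))) (𝓝[>] 0)
      (𝓝 (δ * g₀)) := by
  have hω := (tendsto_bumpMass hh θ').2
  have h1 := (tendsto_integral_peak hh θ' δ).mul_const g₀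
  have hpg : ∀ ε, Integrable (fun θ => peak h θ' ε δ θ * g θ) (sphereMeasure (m + 1)) := fun ε =>
    (integrable_peak hh θ' ε δ).mul_bdd (c := B) hg.aestronglyMeasurable (.of_forall hB)
  have h2 : Tendsto (fun ε => ∫ θ, peak h θ' ε δ θ * (g θ - g₀) ∂(sphereMeasure (m + 1)))
      (𝓝[>] 0) (𝓝 0) := by
    have h3 := ENNReal.Tendsto.const_mul (a := ENNReal.ofReal (δ / omega h θ')) hlim
      (.inr ENNReal.ofReal_ne_top)
    rw [mul_zero] at h3
    rw [tendsto_zero_iff_enorm_tendsto_zero]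
    refine tendsto_of_tendsto_of_tendsto_of_le_of_le' tendsto_const_nhds h3
      (.of_forall fun r => bot_le) ?_
    filter_upwards [self_mem_nhdsWithin] with ε hε
    have hε0 : (0 : ℝ) < ε := hε
    refine (enorm_integral_le_lintegral_enorm _).trans ?_
    rw [← mul_assoc, ← ENNReal.ofReal_mul (by positivity),
      ← lintegral_indicator Metric.isClosed_closedBall.measurableSet,
      ← lintegral_const_mul' _ _ ENNReal.ofReal_ne_top]
    refine lintegral_mono fun θ => ?_
    rw [enorm_mul, Real.enorm_of_nonneg (peak_nonneg hh θ' hε0 hδ θ)]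
    have hp := peak_le hh θ' hε0 hδ θ
    by_cases hθ : θ ∈ Metric.closedBall θ' ε
    · rw [indicator_of_mem hθ] at hp ⊢
      gcongr
      refine hp.trans_eq ?_
      field_simp
    · rw [indicator_of_notMem hθ] at hp ⊢
      rw [ENNReal.ofReal_of_nonpos hp, zero_mul, mul_zero]
  have h3 := h1.add h2
  rw [add_zero] at h3
  refine h3.congr fun ε => ?_
  rw [← integral_mul_const, ← integral_add ((integrable_peak hh θ' ε δ).mul_const _)]
  · congr 1 with θ
    ring
  · simp only [mul_sub]
    exact (hpg ε).sub ((integrable_peak hh θ' ε δ).mul_const _)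

/-- The ballistic part of the solution. -/
def ballistic (Ω : Set (Space (m + 1))) (h : Space (m + 1) → ℝ) (θ' : Sph (m + 1)) (ε δ : ℝ)
    (A : Space (m + 1) → ℝ) (x : Space (m + 1)) (θ : Sph (m + 1)) : ℝ :=
  peak h θ' ε δ θ * lineExp Ω A (x, θ)

/-- Since exp(-·) is 1-Lipschitz on [0, ∞), directional Lebesgue points of the X-ray transform are
Lebesgue points of the attenuation. The exceptional set concerns x only, so θ' is arbitrary. -/
lemma ae_tendsto_aver_ballistic (hΩ : IsDomainC1 Ω) (hh : IsCutoff h) {δ : ℝ} (hδ : 0 < δ)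
    {A : Space (m + 1) → ℝ} (hA : Measurable A) (hA0 : ∀ x, 0 ≤ A x) {B : ℝ} (hB : ∀ x, |A x| ≤ B) :
    ∀ᵐ x ∂(volume.restrict Ω), Tendsto (fun ε => aver (ballistic Ω h θ' ε δ A) x) (𝓝[>] 0)
      (𝓝 (δ * lineExp Ω A (x, θ'))) := by
  filter_upwards [ae_tendsto_xray_cap hΩ hA hB θ'] with x hx
  refine tendsto_integral_peak_mul hh hδ (g := fun θ => lineExp Ω A (x, θ))
    ((measurable_lineExp hΩ.isOpen hA).comp (by fun_prop)) (B := 1) (fun θ => ?_) ?_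
  · rw [abs_of_pos (lineExp_pos _ _)]
    exact lineExp_le_one hA0 _
  · refine tendsto_of_tendsto_of_tendsto_of_le_of_le tendsto_const_nhds hx
      (fun r => bot_le) fun r => ?_
    refine mul_le_mul_right (lintegral_mono fun θ => ?_) _
    rw [Real.enorm_eq_ofReal_abs, Real.enorm_eq_ofReal_abs]
    exact ENNReal.ofReal_le_ofReal (abs_lineExp_sub_le hA0 hA0 _ _)

/-- `u` is a solution for the source `c₀ +` peak. -/
structure PeakSolution (Ω : Set (Space (m + 1))) (σa σb : Space (m + 1) → ℝ)
    (k : Space (m + 1) → Sph (m + 1) → Sph (m + 1) → ℝ) (c₀ μ : ℝ) (h : Space (m + 1) → ℝ)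
    (θ' : Sph (m + 1)) (ε δ : ℝ) (u : Space (m + 1) → Sph (m + 1) → ℝ) (q : Space (m + 1) → ℝ) :
    Prop where
  eps_pos : 0 < ε
  delta_pos : 0 < δ
  mass_le : ∫⁻ θ, ‖peak h θ' ε δ θ‖ₑ ∂(sphereMeasure (m + 1)) ≤ ENNReal.ofReal (2 * δ)
  nice : NiceSolution Ω σa σb k (fun θ => c₀ + peak h θ' ε δ θ) ((c₀ + 2 * δ) / (1 - μ)) u q

/-- The Lipschitz constant of the solution with respect to the source. -/
def lipConst (μ ν : ℝ) : ℝ := 2 / ((1 - μ) * (1 - ν))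

/-- A bound for the regular part of the solution. -/
def regBound (T b κ c₀ μ ν δ : ℝ) : ℝ :=
  c₀ / (1 - μ) + T * (κ + b * (c₀ / (1 - μ))) * (lipConst μ ν * δ)

/-! ### Estimates, uniform in ε, for a solution with peaked source. -/

section Bounds

variable {σa σb : Space (m + 1) → ℝ} {k : Space (m + 1) → Sph (m + 1) → Sph (m + 1) → ℝ}
  {a b κ c₀ μ ν ε δ : ℝ} {u w : Space (m + 1) → Sph (m + 1) → ℝ} {q qw : Space (m + 1) → ℝ}

lemma Coeff.lipConst_nonneg (H : Coeff Ω σa σb k a b κ c₀ μ ν) : 0 ≤ lipConst μ ν := by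
  have := H.mu_lt
  have := H.nu_lt
  exact div_nonneg two_pos.le (mul_nonneg (by linarith) (by linarith))

lemma Coeff.base_nonneg (H : Coeff Ω σa σb k a b κ c₀ μ ν) : 0 ≤ c₀ / (1 - μ) :=
  div_nonneg H.c_pos.le (by linarith [H.mu_lt])

lemma NiceSolution.ae_enorm_le_base (hw : NiceSolution Ω σa σb k (fun _ => c₀) (c₀ / (1 - μ)) w qw)
    (H : Coeff Ω σa σb k a b κ c₀ μ ν) (hΩ : IsDomainC1 Ω) :
    ∀ᵐ p ∂(phaseMeasure Ω), ‖w p.1 p.2‖ₑ ≤ ENNReal.ofReal (c₀ / (1 - μ)) := by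
  have hμ := H.mu_lt
  filter_upwards [hw.ae_enorm_le H hΩ] with p hp
  refine hp.trans_eq ?_
  rw [Real.enorm_of_nonneg H.c_pos.le, ← ENNReal.ofReal_add H.c_pos.le
    (mul_nonneg H.mu_nonneg H.base_nonneg)]
  congr 1
  have : 1 - μ ≠ 0 := by linarith
  field_simp
  ring

namespace PeakSolution

lemma ae_angNorm_sub_le (hu : PeakSolution Ω σa σb k c₀ μ h θ' ε δ u q)
    (hw : NiceSolution Ω σa σb k (fun _ => c₀) (c₀ / (1 - μ)) w qw)
    (H : Coeff Ω σa σb k a b κ c₀ μ ν) (hΩ : IsDomainC1 Ω) (hh : IsCutoff h) :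
    ∀ᵐ x ∂(volume.restrict Ω), angNorm (fun x θ => u x θ - w x θ) x
      ≤ ENNReal.ofReal (lipConst μ ν * δ) := by
  have := hu.nice.ae_angNorm_sub_le hw H hΩ ((continuous_peak hh θ' ε δ).measurable.const_add c₀)
    measurable_const (D := 2 * δ) (by linarith [hu.delta_pos]) H.base_nonneg
    (hw.ae_enorm_le_base H hΩ) le_rfl (by simpa using hu.mass_le)
  filter_upwards [this] with x hx
  refine hx.trans_eq ?_
  rw [lipConst]
  congr 1
  ring

lemma ae_abs_sub_le (hu : PeakSolution Ω σa σb k c₀ μ h θ' ε δ u q)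
    (hw : NiceSolution Ω σa σb k (fun _ => c₀) (c₀ / (1 - μ)) w qw)
    (H : Coeff Ω σa σb k a b κ c₀ μ ν) (hΩ : IsDomainC1 Ω) (hh : IsCutoff h) :
    ∀ᵐ x ∂(volume.restrict Ω), |q x - qw x| ≤ lipConst μ ν * δ := by
  have hC : 0 ≤ lipConst μ ν * δ := mul_nonneg H.lipConst_nonneg hu.delta_pos.le
  filter_upwards [hu.ae_angNorm_sub_le hw H hΩ hh, hu.nice.ae_enorm_m_sub_le hw] with x h1 h2
  have h3 := (h2.1.trans h2.2).trans h1
  rwa [Real.enorm_eq_ofReal_abs, ENNReal.ofReal_le_ofReal_iff hC] at h3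

/-- The ballistic part solves the equation with boundary value `peak` and without source, so
subtracting it removes the singular boundary value. The scattering source still involves the whole
of u. -/
lemma solves_regular (hu : PeakSolution Ω σa σb k c₀ μ h θ' ε δ u q)
    (H : Coeff Ω σa σb k a b κ c₀ μ ν) (hΩ : IsDomainC1 Ω) (hh : IsCutoff h) :
    Solves Ω (fun _ => c₀) (absorb σa σb q) (fun p => scatter k u p.1 p.2)
      (fun p => u p.1 p.2 - ballistic Ω h θ' ε δ (absorb σa σb q) p.1 p.2) := by
  have hω := (tendsto_bumpMass hh θ').2
  have hε := hu.eps_pos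
  have hδ := hu.delta_pos
  have h1 := solves_lineExp hΩ (H.measurable_absorb hu.nice.measurable).stronglyMeasurable
    (H.norm_absorb_le hu.nice.nonneg hu.nice.le) (H.absorb_nonneg hu.nice.nonneg)
    (φ := peak h θ' ε δ) (continuous_peak hh θ' ε δ).stronglyMeasurable
    (M := δ / (omega h θ' * ε ^ m)) (fun θ => by
      rw [Real.norm_of_nonneg (peak_nonneg hh θ' hε hδ θ)]
      refine mul_le_of_le_one_right (by positivity) (bump_le_one hh _ _ _))
  have h2 := hu.nice.solves.sub hΩ h1
  simp only [add_sub_cancel_right, sub_zero] at h2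
  exact h2

lemma integrable_ballistic (hu : PeakSolution Ω σa σb k c₀ μ h θ' ε δ u q)
    (H : Coeff Ω σa σb k a b κ c₀ μ ν) (hΩ : IsDomainC1 Ω) (hh : IsCutoff h) :
    Integrable (fun p : Space (m + 1) × Sph (m + 1) =>
      ballistic Ω h θ' ε δ (absorb σa σb q) p.1 p.2) (phaseMeasure Ω) := by
  refine (hu.nice.solves.integrable.sub (hu.solves_regular H hΩ hh).integrable).congr
    (.of_forall fun p => ?_)
  simp

lemma ae_scatter_sub_le (hu : PeakSolution Ω σa σb k c₀ μ h θ' ε δ u q)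
    (hw : NiceSolution Ω σa σb k (fun _ => c₀) (c₀ / (1 - μ)) w qw)
    (H : Coeff Ω σa σb k a b κ c₀ μ ν) (hΩ : IsDomainC1 Ω) (hh : IsCutoff h) :
    ∀ᵐ p ∂(phaseMeasure Ω), ‖scatter k u p.1 p.2 - scatter k w p.1 p.2‖ₑ
      ≤ ENNReal.ofReal κ * ENNReal.ofReal (lipConst μ ν * δ) := by
  filter_upwards [H.ae_scatter_sub hu.nice.solves.integrable hw.solves.integrable,
    ae_phase_of_ae (hu.ae_angNorm_sub_le hw H hΩ hh)] with p h1 h2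
  rw [h1]
  exact (H.enorm_scatter_le _ _ _).trans (mul_le_mul_right h2 _)

/-- The regular part and w have the same boundary value c₀. Their scattering terms and absorptions
differ by O(δ), since both depend on u through angular L¹ norms only, which do not see the
concentration of the peak. -/
lemma ae_regular_le (hu : PeakSolution Ω σa σb k c₀ μ h θ' ε δ u q)
    (hw : NiceSolution Ω σa σb k (fun _ => c₀) (c₀ / (1 - μ)) w qw)
    (H : Coeff Ω σa σb k a b κ c₀ μ ν) (hΩ : IsDomainC1 Ω) (hh : IsCutoff h) :
    ∀ᵐ p ∂(phaseMeasure Ω), ‖u p.1 p.2 - ballistic Ω h θ' ε δ (absorb σa σb q) p.1 p.2‖ₑ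
      ≤ ENNReal.ofReal (regBound (tauNorm Ω).toReal b κ c₀ μ ν δ) := by
  obtain ⟨θ₀⟩ := nonempty_sph (m + 1)
  have hκ := H.kappa_nonneg θ₀
  have hb := H.b_const_nonneg
  have hW := H.base_nonneg
  have hL : 0 ≤ lipConst μ ν * δ := mul_nonneg H.lipConst_nonneg hu.delta_pos.le
  have hT : 0 ≤ (tauNorm Ω).toReal := ENNReal.toReal_nonneg
  have h1 := (hu.solves_regular H hΩ hh).enorm_sub_le hΩ hw.solves
    (.of_forall fun p => H.absorb_nonneg hu.nice.nonneg p.1)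
  have h2 : (fun p : Space (m + 1) × Sph (m + 1) => ‖scatter k u p.1 p.2 - scatter k w p.1 p.2‖ₑ +
      ‖absorb σa σb q p.1 - absorb σa σb qw p.1‖ₑ * ‖w p.1 p.2‖ₑ) ≤ᵐ[phaseMeasure Ω]
      fun _ => ENNReal.ofReal ((κ + b * (c₀ / (1 - μ))) * (lipConst μ ν * δ)) := by
    filter_upwards [hu.ae_scatter_sub_le hw H hΩ hh, ae_phase_of_ae (hu.ae_abs_sub_le hw H hΩ hh),
      hw.ae_enorm_le_base H hΩ] with p e1 e2 e3
    rw [add_mul, ENNReal.ofReal_add (by positivity) (by positivity), ENNReal.ofReal_mul hκ]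
    refine add_le_add e1 ?_
    calc _ ≤ ENNReal.ofReal b * ENNReal.ofReal (lipConst μ ν * δ) * ENNReal.ofReal (c₀ / (1 - μ)) := by
          refine mul_le_mul' ((H.enorm_absorb_sub_le q qw p.1).trans (mul_le_mul_right ?_ _)) e3
          rw [Real.enorm_eq_ofReal_abs]
          exact ENNReal.ofReal_le_ofReal e2
      _ = _ := by
          rw [← ENNReal.ofReal_mul hb, ← ENNReal.ofReal_mul (by positivity)]
          congr 1
          ring
  filter_upwards [h1, lineInt_mono_ae hΩ h2, lineInt_const_le hΩ
    (ENNReal.ofReal ((κ + b * (c₀ / (1 - μ))) * (lipConst μ ν * δ))),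
    hw.ae_enorm_le_base H hΩ] with p e1 e2 e3 e4
  simp only [sub_self, enorm_zero, zero_add] at e1
  calc ‖u p.1 p.2 - ballistic Ω h θ' ε δ (absorb σa σb q) p.1 p.2‖ₑ
      = ‖w p.1 p.2 + (u p.1 p.2 - ballistic Ω h θ' ε δ (absorb σa σb q) p.1 p.2 - w p.1 p.2)‖ₑ := by
        congr 1; ring
    _ ≤ ENNReal.ofReal (c₀ / (1 - μ)) + tauNorm Ω *
        ENNReal.ofReal ((κ + b * (c₀ / (1 - μ))) * (lipConst μ ν * δ)) :=
        (enorm_add_le _ _).trans (add_le_add e4 ((e1.trans e2).trans e3))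
    _ = _ := by
        nth_rw 1 [← ofReal_tauNorm hΩ]
        rw [← ENNReal.ofReal_mul hT, ← ENNReal.ofReal_add hW (by positivity),
          regBound]
        congr 1
        ring

lemma ae_abs_lineExp_sub_le (hu : PeakSolution Ω σa σb k c₀ μ h θ' ε δ u q)
    (hw : NiceSolution Ω σa σb k (fun _ => c₀) (c₀ / (1 - μ)) w qw)
    (H : Coeff Ω σa σb k a b κ c₀ μ ν) (hΩ : IsDomainC1 Ω) (hh : IsCutoff h) :
    ∀ᵐ p ∂(phaseMeasure Ω), |lineExp Ω (absorb σa σb q) p - lineExp Ω (absorb σa σb qw) p|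
      ≤ (tauNorm Ω).toReal * (b * (lipConst μ ν * δ)) := by
  have hb := H.b_const_nonneg
  have hL : 0 ≤ lipConst μ ν * δ := mul_nonneg H.lipConst_nonneg hu.delta_pos.le
  have hle : ∀ᵐ x ∂(volume.restrict Ω), |absorb σa σb q x - absorb σa σb qw x|
      ≤ b * (lipConst μ ν * δ) := by
    filter_upwards [hu.ae_abs_sub_le hw H hΩ hh] with x hx
    rw [Coeff.absorb_sub, abs_mul, abs_of_nonneg (H.b_nonneg x)]
    exact mul_le_mul (H.b_le x) hx (abs_nonneg _) hb
  have hmax := ae_abs_xray_sub_le hΩ (H.measurable_absorb hu.nice.measurable)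
    (H.measurable_absorb hw.measurable)
    (B := max (a + b * ((c₀ + 2 * δ) / (1 - μ))) (a + b * (c₀ / (1 - μ))))
    (fun x => (H.norm_absorb_le hu.nice.nonneg hu.nice.le x).trans (le_max_left _ _))
    (fun x => (H.norm_absorb_le hw.nonneg hw.le x).trans (le_max_right _ _)) (by positivity) hle
  filter_upwards [hmax] with p hp
  exact (abs_lineExp_sub_le (H.absorb_nonneg hu.nice.nonneg) (H.absorb_nonneg hw.nonneg) p p).trans hp

lemma integral_peak_le (hu : PeakSolution Ω σa σb k c₀ μ h θ' ε δ u q) (hh : IsCutoff h) :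
    ∫ θ, peak h θ' ε δ θ ∂(sphereMeasure (m + 1)) ≤ 2 * δ := by
  have hn := peak_nonneg hh θ' hu.eps_pos hu.delta_pos
  have h1 := hu.mass_le
  simp only [fun θ => Real.enorm_of_nonneg (hn θ)] at h1
  rw [← ofReal_integral_eq_lintegral_ofReal (integrable_peak hh θ' ε δ) (.of_forall hn)] at h1
  exact (ENNReal.ofReal_le_ofReal_iff (by linarith [hu.delta_pos])).1 h1

lemma integrable_ballistic_slice (hh : IsCutoff h) (hΩ : IsDomainC1 Ω) {A : Space (m + 1) → ℝ}
    (hA : Measurable A) (hA0 : ∀ x, 0 ≤ A x) (ε δ : ℝ) (x : Space (m + 1)) :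
    Integrable (ballistic Ω h θ' ε δ A x) (sphereMeasure (m + 1)) := by
  refine (integrable_peak hh θ' ε δ).mul_bdd (c := 1)
    ((measurable_lineExp hΩ.isOpen hA).comp (by fun_prop)).aestronglyMeasurable
    (.of_forall fun θ => ?_)
  rw [Real.norm_of_nonneg (lineExp_pos _ _).le]
  exact lineExp_le_one hA0 _

/-- The ballistic part is close to the one for the unperturbed absorption. -/
lemma ae_abs_aver_ballistic_sub_le (hu : PeakSolution Ω σa σb k c₀ μ h θ' ε δ u q)
    (hw : NiceSolution Ω σa σb k (fun _ => c₀) (c₀ / (1 - μ)) w qw)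
    (H : Coeff Ω σa σb k a b κ c₀ μ ν) (hΩ : IsDomainC1 Ω) (hh : IsCutoff h) :
    ∀ᵐ x ∂(volume.restrict Ω), |aver (ballistic Ω h θ' ε δ (absorb σa σb q)) x
      - aver (ballistic Ω h θ' ε δ (absorb σa σb qw)) x|
      ≤ δ * (2 * (tauNorm Ω).toReal * b * lipConst μ ν * δ) := by
  have hb := H.b_const_nonneg
  have hL : 0 ≤ lipConst μ ν * δ := mul_nonneg H.lipConst_nonneg hu.delta_pos.le
  have hT : 0 ≤ (tauNorm Ω).toReal := ENNReal.toReal_nonneg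
  have hn := peak_nonneg hh θ' hu.eps_pos hu.delta_pos
  filter_upwards [Measure.ae_ae_of_ae_prod (hu.ae_abs_lineExp_sub_le hw H hΩ hh)] with x hx
  have i1 := integrable_ballistic_slice (θ' := θ') hh hΩ (H.measurable_absorb hu.nice.measurable)
    (H.absorb_nonneg hu.nice.nonneg) ε δ x
  have i2 := integrable_ballistic_slice (θ' := θ') hh hΩ (H.measurable_absorb hw.measurable)
    (H.absorb_nonneg hw.nonneg) ε δ x
  rw [aver, aver, ← integral_sub i1 i2]
  calc _ ≤ ∫ θ, peak h θ' ε δ θ * ((tauNorm Ω).toReal * (b * (lipConst μ ν * δ)))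
        ∂(sphereMeasure (m + 1)) := by
        refine (norm_integral_le_integral_norm _).trans (integral_mono_ae (i1.sub i2).norm
          ((integrable_peak hh θ' ε δ).mul_const _) ?_)
        filter_upwards [hx] with θ hθ
        simp only [Pi.sub_apply, ballistic]
        rw [← mul_sub, norm_mul, Real.norm_of_nonneg (hn θ)]
        exact mul_le_mul_of_nonneg_left hθ (hn θ)
    _ ≤ 2 * δ * ((tauNorm Ω).toReal * (b * (lipConst μ ν * δ))) := by
        rw [integral_mul_const]
        exact mul_le_mul_of_nonneg_right (hu.integral_peak_le hh) (by positivity)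
    _ = _ := by ring

/-- For ε ≤ r₀γ the peak is supported where the wider cut-off equals one, so the measurement sees
the whole ballistic part. -/
lemma ballistic_mul_bump (hh : IsCutoff h) {r₀ γ : ℝ} (h1 : ∀ y, ‖y‖ ≤ r₀ → h y = 1) (hγ : 0 < γ)
    (hε : 0 < ε) (hεγ : ε ≤ r₀ * γ) (A : Space (m + 1) → ℝ) (x : Space (m + 1)) (θ : Sph (m + 1)) :
    ballistic Ω h θ' ε δ A x θ * bump h θ' γ θ = ballistic Ω h θ' ε δ A x θ := by
  by_cases hb : bump h θ' ε θ = 0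
  · simp [ballistic, peak, hb]
  · rw [bump_eq_one h1 hγ ((dist_lt_of_bump_ne_zero hh hε hb).le.trans hεγ), mul_one]

lemma integrable_mul_bump (hh : IsCutoff h) {g : Sph (m + 1) → ℝ}
    (hg : Integrable g (sphereMeasure (m + 1))) (γ : ℝ) :
    Integrable (fun θ => g θ * bump h θ' γ θ) (sphereMeasure (m + 1)) := by
  refine hg.mul_bdd (c := 1) (continuous_bump hh θ' γ).aestronglyMeasurable (.of_forall fun θ => ?_)
  rw [Real.norm_of_nonneg (bump_nonneg hh _ _ _)]
  exact bump_le_one hh _ _ _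

lemma integral_bump_le (hh : IsCutoff h) {γ : ℝ} (hγ : 0 < γ) :
    ∫ θ, bump h θ' γ θ ∂(sphereMeasure (m + 1))
      ≤ (sphereMeasure (m + 1)).real (Metric.closedBall θ' γ) := by
  have hm : MeasurableSet (Metric.closedBall θ' γ) := Metric.isClosed_closedBall.measurableSet
  rw [← integral_indicator_one hm]
  exact integral_mono (integrable_bump hh θ' γ) ((integrable_const 1).indicator hm)
    fun θ => bump_le_indicator hh hγ θ

lemma ae_measurement_sub_eq (hu : PeakSolution Ω σa σb k c₀ μ h θ' ε δ u q)
    (H : Coeff Ω σa σb k a b κ c₀ μ ν) (hΩ : IsDomainC1 Ω) (hh : IsCutoff h) {r₀ γ : ℝ}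
    (h1 : ∀ y, ‖y‖ ≤ r₀ → h y = 1) (hγ : 0 < γ) (hεγ : ε ≤ r₀ * γ) :
    ∀ᵐ x ∂(volume.restrict Ω), measurement h θ' δ γ u x
      - aver (ballistic Ω h θ' ε δ (absorb σa σb q)) x / δ
      = ∫ θ, (u x θ - ballistic Ω h θ' ε δ (absorb σa σb q) x θ) / δ * bump h θ' γ θ
        ∂(sphereMeasure (m + 1)) := by
  filter_upwards [ae_integrable_slice
    (v := fun x θ => u x θ - ballistic Ω h θ' ε δ (absorb σa σb q) x θ)
    (hu.solves_regular H hΩ hh).integrable] with x hi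
  have i1 := integrable_ballistic_slice (θ' := θ') hh hΩ (H.measurable_absorb hu.nice.measurable)
    (H.absorb_nonneg hu.nice.nonneg) ε δ x
  rw [measurement, aver, ← integral_div, sub_eq_iff_eq_add,
    ← integral_add (integrable_mul_bump hh (hi.div_const δ) γ) (i1.div_const δ)]
  congr 1 with θ
  rw [sub_div, sub_mul, div_mul_eq_mul_div (ballistic _ _ _ _ _ _ _ _),
    ballistic_mul_bump hh h1 hγ hu.eps_pos hεγ]
  ring

lemma regBound_nonneg (H : Coeff Ω σa σb k a b κ c₀ μ ν) (hδ : 0 < δ) :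
    0 ≤ regBound (tauNorm Ω).toReal b κ c₀ μ ν δ := by
  obtain ⟨θ₀⟩ := nonempty_sph (m + 1)
  have hκ := H.kappa_nonneg θ₀
  have hb := H.b_const_nonneg
  have hW := H.base_nonneg
  have hL : 0 ≤ lipConst μ ν * δ := mul_nonneg H.lipConst_nonneg hδ.le
  have hT : 0 ≤ (tauNorm Ω).toReal := ENNReal.toReal_nonneg
  rw [regBound]
  positivity

/-- The measurement is the contribution of the ballistic part up to a small cap. -/
lemma ae_abs_measurement_sub_le (hu : PeakSolution Ω σa σb k c₀ μ h θ' ε δ u q)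
    (hw : NiceSolution Ω σa σb k (fun _ => c₀) (c₀ / (1 - μ)) w qw)
    (H : Coeff Ω σa σb k a b κ c₀ μ ν) (hΩ : IsDomainC1 Ω) (hh : IsCutoff h) {r₀ γ : ℝ}
    (h1 : ∀ y, ‖y‖ ≤ r₀ → h y = 1) (hγ : 0 < γ) (hεγ : ε ≤ r₀ * γ) :
    ∀ᵐ x ∂(volume.restrict Ω), |measurement h θ' δ γ u x
      - aver (ballistic Ω h θ' ε δ (absorb σa σb q)) x / δ|
      ≤ regBound (tauNorm Ω).toReal b κ c₀ μ ν δ / δ *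
        (sphereMeasure (m + 1)).real (Metric.closedBall θ' γ) := by
  have hδ := hu.delta_pos
  have hV := regBound_nonneg H hδ
  filter_upwards [Measure.ae_ae_of_ae_prod (hu.ae_regular_le hw H hΩ hh),
    ae_integrable_slice (v := fun x θ => u x θ - ballistic Ω h θ' ε δ (absorb σa σb q) x θ)
      (hu.solves_regular H hΩ hh).integrable, hu.ae_measurement_sub_eq H hΩ hh h1 hγ hεγ]
    with x hx hi hsplit
  rw [hsplit]
  calc _ ≤ ∫ θ, regBound (tauNorm Ω).toReal b κ c₀ μ ν δ / δ * bump h θ' γ θ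
        ∂(sphereMeasure (m + 1)) := by
        refine (norm_integral_le_integral_norm _).trans (integral_mono_ae
          (integrable_mul_bump hh (hi.div_const δ) γ).norm
          ((integrable_bump hh θ' γ).const_mul _) ?_)
        filter_upwards [hx] with θ hθ
        rw [Real.enorm_eq_ofReal_abs, ENNReal.ofReal_le_ofReal_iff hV] at hθ
        rw [norm_mul, norm_div, Real.norm_of_nonneg hδ.le, Real.norm_of_nonneg (bump_nonneg hh _ _ _)]
        have := bump_nonneg hh θ' γ θ
        have : ‖u x θ - ballistic Ω h θ' ε δ (absorb σa σb q) x θ‖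
          ≤ regBound (tauNorm Ω).toReal b κ c₀ μ ν δ := hθ
        gcongr
    _ ≤ _ := by
        rw [integral_const_mul]
        exact mul_le_mul_of_nonneg_left (integral_bump_le hh hγ) (by positivity)

end PeakSolution

end Bounds

/-- Dimension at least two enters here: for m = 0 the sphere has two points and caps do not shrink
to measure zero. -/
lemma tendsto_cap (θ' : Sph (m + 1)) (hm : m ≠ 0) :
    Tendsto (fun γ => (sphereMeasure (m + 1)).real (Metric.closedBall θ' γ)) (𝓝[>] 0) (𝓝 0) := by
  have h1 : Tendsto (fun γ : ℝ => (sphereConst (m + 1) * ENNReal.ofReal ((2 * γ) ^ m)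
      * ballVol m).toReal) (𝓝[>] 0) (𝓝 0) := by
    have : Tendsto (fun γ : ℝ => ENNReal.ofReal ((2 * γ) ^ m)) (𝓝 0)
        (𝓝 (ENNReal.ofReal ((2 * 0) ^ m))) :=
      ENNReal.tendsto_ofReal (Continuous.tendsto (by fun_prop) _)
    rw [mul_zero, zero_pow hm, ENNReal.ofReal_zero] at this
    have h2 := ENNReal.Tendsto.mul_const (b := ballVol m)
      (ENNReal.Tendsto.const_mul (a := sphereConst (m + 1))
        (this.mono_left (nhdsWithin_le_nhds (s := Ioi 0))) (.inr sphereConst_ne_top))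
      (.inr (ballVol_ne_top m))
    rw [mul_zero, zero_mul] at h2
    exact (ENNReal.tendsto_toReal ENNReal.zero_ne_top).comp h2
  refine squeeze_zero' (.of_forall fun _ => measureReal_nonneg) ?_ h1
  filter_upwards [Ioo_mem_nhdsGT (zero_lt_one (α := ℝ))] with γ hγ
  exact ENNReal.toReal_mono (ENNReal.mul_ne_top (ENNReal.mul_ne_top sphereConst_ne_top
    ENNReal.ofReal_ne_top) (ballVol_ne_top m)) (cap_le θ' hγ.1.le hγ.2.le)

end TwoPhoton

end

noncomputable section

namespace TwoPhoton

/-! ### Oscillation of the tails of a sequence of functions -/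

section TailOsc

variable {X : Type*}

/-- The largest difference between two members of the tail of a sequence. -/
def tailOsc (f : ℕ → X → ℝ) (J : ℕ) (x : X) : ℝ≥0∞ := ⨆ j, ⨆ l, ‖f (J + j) x - f (J + l) x‖ₑ

lemma le_tailOsc (f : ℕ → X → ℝ) {J j l : ℕ} (hj : J ≤ j) (hl : J ≤ l) (x : X) :
    ‖f j x - f l x‖ₑ ≤ tailOsc f J x := by
  obtain ⟨j, rfl⟩ := Nat.exists_eq_add_of_le hj
  obtain ⟨l, rfl⟩ := Nat.exists_eq_add_of_le hl
  exact le_iSup₂ (f := fun j l => ‖f (J + j) x - f (J + l) x‖ₑ) j l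

lemma tailOsc_le {f : ℕ → X → ℝ} {J : ℕ} {x : X} {C : ℝ≥0∞}
    (h : ∀ j l, J ≤ j → J ≤ l → ‖f j x - f l x‖ₑ ≤ C) : tailOsc f J x ≤ C :=
  iSup₂_le fun _ _ => h _ _ (Nat.le_add_right _ _) (Nat.le_add_right _ _)

lemma tailOsc_antitone (f : ℕ → X → ℝ) (x : X) : Antitone fun J => tailOsc f J x :=
  fun _ _ hJ => tailOsc_le fun _ _ hj hl => le_tailOsc f (hJ.trans hj) (hJ.trans hl) x

lemma tailOsc_le_of_bound {f : ℕ → X → ℝ} {x : X} {C : ℝ≥0∞} (h : ∀ j, ‖f j x‖ₑ ≤ C) (J : ℕ) :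
    tailOsc f J x ≤ C + C :=
  tailOsc_le fun j l _ _ => (_root_.enorm_sub_le).trans (add_le_add (h j) (h l))

lemma cauchySeq_of_iInf_eq_zero {C : ℝ≥0∞} (hC : C ≠ ⊤) {g : ℕ → ℝ≥0∞}
    (hg : ⨅ J, g J = 0) {v : ℕ → ℝ} (h : ∀ J j l, J ≤ j → J ≤ l → ‖v j - v l‖ₑ ≤ C * g J) :
    CauchySeq v := by
  rw [EMetric.cauchySeq_iff]
  intro ε hε
  have h0 : ⨅ J, C * g J = 0 := by
    rw [← ENNReal.mul_iInf (by simp [hC]), hg, mul_zero]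
  obtain ⟨J, hJ⟩ := iInf_lt_iff.1 (h0.trans_lt hε)
  refine ⟨J, fun j hj l hl => ?_⟩
  rw [edist_eq_enorm_sub]
  exact (h J j l hj hl).trans_lt hJ

/-- Far out, every member of the tail is within P + 2η of g₀, one η for the limit of g and one for
that of p; two members therefore differ by at most 2P + 4η. -/
lemma iInf_tailOsc_le {f : ℕ → X → ℝ} {x : X} {I : ℕ} {g p : ℕ → ℝ} {g₀ P : ℝ}
    (h : ∀ j, I ≤ j → |f j x - g j| ≤ p j) (hg : Tendsto g atTop (𝓝 g₀))
    (hp : Tendsto p atTop (𝓝 P)) : ⨅ J, tailOsc f J x ≤ ENNReal.ofReal (2 * P) := by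
  have hlim : Tendsto (fun η : ℝ => ENNReal.ofReal (2 * P + 4 * η)) (𝓝[>] 0)
      (𝓝 (ENNReal.ofReal (2 * P))) := by
    have : Tendsto (fun η : ℝ => ENNReal.ofReal (2 * P + 4 * η)) (𝓝 0)
        (𝓝 (ENNReal.ofReal (2 * P + 4 * 0))) :=
      ENNReal.tendsto_ofReal (Continuous.tendsto (by fun_prop) _)
    rw [mul_zero, add_zero] at this
    exact this.mono_left nhdsWithin_le_nhds
  refine ge_of_tendsto hlim ?_
  filter_upwards [self_mem_nhdsWithin] with η hη
  have hη0 : (0 : ℝ) < η := hη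
  obtain ⟨J, hJ⟩ := eventually_atTop.1 (((Metric.tendsto_nhds.1 hg η hη0).and
    (Metric.tendsto_nhds.1 hp η hη0)).and (eventually_ge_atTop I))
  refine (iInf_le _ J).trans (tailOsc_le fun j l hj hl => ?_)
  rw [Real.enorm_eq_ofReal_abs]
  refine ENNReal.ofReal_le_ofReal ?_
  obtain ⟨⟨a1, a2⟩, a3⟩ := hJ j hj
  obtain ⟨⟨b1, b2⟩, b3⟩ := hJ l hl
  have c1 := abs_le.1 (h j a3)
  have c2 := abs_le.1 (h l b3)
  rw [Real.dist_eq] at a1 a2 b1 b2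
  have d1 := abs_lt.1 a1
  have d2 := abs_lt.1 a2
  have d3 := abs_lt.1 b1
  have d4 := abs_lt.1 b2
  rw [abs_le]
  constructor <;> linarith

variable [MeasurableSpace X] {μ : Measure X}

lemma measurable_tailOsc {f : ℕ → X → ℝ} (hf : ∀ j, Measurable (f j)) (J : ℕ) :
    Measurable (tailOsc f J) := by
  unfold tailOsc
  exact .iSup fun j => .iSup fun l => ((hf _).sub (hf _)).enorm

lemma aemeasurable_tailOsc {f : ℕ → X → ℝ} (hf : ∀ j, AEMeasurable (f j) μ) (J : ℕ) :
    AEMeasurable (tailOsc f J) μ := by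
  unfold tailOsc
  exact .iSup fun j => .iSup fun l => ((hf _).sub (hf _)).enorm

lemma lintegral_iInf_tailOsc {f : ℕ → X → ℝ} (hf : ∀ j, AEMeasurable (f j) μ) [IsFiniteMeasure μ]
    {C : ℝ≥0∞} (hC : C ≠ ⊤) (hfC : ∀ j, ∀ᵐ x ∂μ, ‖f j x‖ₑ ≤ C) :
    ∫⁻ x, ⨅ J, tailOsc f J x ∂μ = ⨅ J, ∫⁻ x, tailOsc f J x ∂μ := by
  refine lintegral_iInf' (aemeasurable_tailOsc hf) (.of_forall fun x => tailOsc_antitone f x) ?_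
  refine ne_top_of_le_ne_top (b := (C + C) * μ univ)
    (ENNReal.mul_ne_top (by simp [hC]) (measure_ne_top _ _)) ?_
  rw [← lintegral_const]
  exact lintegral_mono_ae ((ae_all_iff.2 hfC).mono fun x hx => tailOsc_le_of_bound hx 0)

lemma lintegral_tailOsc_ne_top {f : ℕ → X → ℝ} [IsFiniteMeasure μ]
    {C : ℝ≥0∞} (hC : C ≠ ⊤) (hfC : ∀ j, ∀ᵐ x ∂μ, ‖f j x‖ₑ ≤ C) (J : ℕ) :
    ∫⁻ x, tailOsc f J x ∂μ ≠ ⊤ := by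
  refine ne_top_of_le_ne_top (b := (C + C) * μ univ)
    (ENNReal.mul_ne_top (by simp [hC]) (measure_ne_top _ _)) ?_
  rw [← lintegral_const]
  exact lintegral_mono_ae ((ae_all_iff.2 hfC).mono fun x hx => tailOsc_le_of_bound hx J)

end TailOsc

/-! ### Oscillation of averages of the ballistic parts -/

variable {m : ℕ} {Ω : Set (Space (m + 1))} {h : Space (m + 1) → ℝ} {θ' : Sph (m + 1)}

lemma measurable_ballistic (hΩ : IsDomainC1 Ω) (hh : IsCutoff h) {A : Space (m + 1) → ℝ}
    (hA : Measurable A) (ε δ : ℝ) :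
    Measurable fun p : Space (m + 1) × Sph (m + 1) => ballistic Ω h θ' ε δ A p.1 p.2 :=
  ((continuous_peak hh θ' ε δ).measurable.comp measurable_snd).mul
    (measurable_lineExp hΩ.isOpen hA)

/-- At a point `x`, the weighted averages of the ballistic parts oscillate at most by an X-ray
transform of the oscillation of the absorption coefficients. -/
lemma iInf_tailOsc_peak_le {Y : Type*} {y : Y} (hΩ : IsDomainC1 Ω) (hh : IsCutoff h) {δ : ℝ}
    (hδ : 0 < δ) {x : Space (m + 1)} (hx : x ∈ Ω) {ε : ℕ → ℝ} (hε0 : ∀ j, 0 < ε j)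
    (hε : Tendsto ε atTop (𝓝[>] 0))
    {A : ℕ → Space (m + 1) → ℝ} (hA : ∀ j, Measurable (A j)) (hA0 : ∀ j x, 0 ≤ A j x) {B : ℝ}
    (hB : ∀ j x, |A j x| ≤ B) {I : ℕ} {r : Space (m + 1) → ℝ} (hr : Measurable r)
    (hrB : ∀ x, |r x| ≤ B) (hAr : ∀ j, I ≤ j → ∀ x, |A j x - A I x| ≤ r x)
    (hlr : Tendsto (fun s : ℝ => ENNReal.ofReal ((s ^ m)⁻¹) * ∫⁻ θ in Metric.closedBall θ' s,
      ‖xray Ω r (x, θ) - xray Ω r (x, θ')‖ₑ ∂(sphereMeasure (m + 1))) (𝓝[>] 0) (𝓝 0))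
    (hlA : Tendsto (fun s : ℝ => ENNReal.ofReal ((s ^ m)⁻¹) * ∫⁻ θ in Metric.closedBall θ' s,
      ‖xray Ω (A I) (x, θ) - xray Ω (A I) (x, θ')‖ₑ ∂(sphereMeasure (m + 1))) (𝓝[>] 0) (𝓝 0))
    {κ : Sph (m + 1) → ℝ} (hκ : Measurable κ) {K : ℝ} (hκ0 : ∀ θ, 0 ≤ κ θ) (hκK : ∀ θ, κ θ ≤ K)
    {c : ℝ} (hlκ : Tendsto (fun s : ℝ => ENNReal.ofReal ((s ^ m)⁻¹) *
      ∫⁻ θ in Metric.closedBall θ' s, ‖κ θ - c‖ₑ ∂(sphereMeasure (m + 1))) (𝓝[>] 0) (𝓝 0))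
    {f : ℕ → Y → ℝ} (hf : ∀ j, f j y = ∫ θ, κ θ * ballistic Ω h θ' (ε j) δ (A j) x θ
      ∂(sphereMeasure (m + 1))) :
    ⨅ J, tailOsc f J y ≤ ENNReal.ofReal (2 * (K * (δ * xray Ω r (x, θ')))) := by
  have hK0 : 0 ≤ K := (hκ0 θ').trans (hκK θ')
  have hEm : ∀ j, Measurable fun θ => lineExp Ω (A j) (x, θ) := fun j =>
    (measurable_lineExp hΩ.isOpen (hA j)).comp (by fun_prop)
  have hxm : Measurable fun θ : Sph (m + 1) => xray Ω r (x, θ) :=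
    ((stronglyMeasurable_xray hΩ.isOpen hr.stronglyMeasurable).measurable).comp
      (f := fun θ : Sph (m + 1) => (x, θ)) (by fun_prop)
  obtain ⟨L, hL0, hL⟩ := exists_tau_le hΩ
  have hxB : ∀ θ, |xray Ω r (x, θ)| ≤ B * L := fun θ => by
    have hτ := tauMinus_pos hΩ hx θ
    have hτL := tauMinus_le hΩ hL0 hL hx θ
    have hB0 : 0 ≤ B := (abs_nonneg _).trans (hrB x)
    rw [xray_eq hΩ r (p := (x, θ)) hx, ← Real.norm_eq_abs]
    calc _ ≤ B * |tauMinus Ω x θ - 0| :=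
          intervalIntegral.norm_integral_le_of_norm_le_const fun s _ => hrB _
      _ ≤ B * L := by rw [sub_zero, abs_of_pos hτ]; gcongr
  -- The absorption is frozen at the index I. With it the weighted averages converge, as θ' is a
  -- Lebesgue point of weight and attenuation; the error of freezing is at most K times the average
  -- of the X-ray transform of r against the peak, which tends to Kδ times its value at θ'.
  have hlim1 := (tendsto_integral_peak_mul hh hδ hxm hxB hlr).comp hε
  have hlim2 := (tendsto_integral_peak_mul hh hδ (θ' := θ')
    (g := fun θ => κ θ * lineExp Ω (A I) (x, θ)) (hκ.mul (hEm I)) (B := K)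
    (g₀ := c * lineExp Ω (A I) (x, θ')) (fun θ => by
      rw [abs_mul, abs_of_nonneg (hκ0 θ), abs_of_pos (lineExp_pos _ _)]
      exact (mul_le_of_le_one_right (hκ0 θ) (lineExp_le_one (hA0 I) _)).trans (hκK θ)) (by
      have hs := (ENNReal.Tendsto.const_mul (a := 1) hlκ (.inr ENNReal.one_ne_top)).add
        (ENNReal.Tendsto.const_mul (a := ‖c‖ₑ) hlA (.inr enorm_ne_top))
      rw [mul_zero, mul_zero, add_zero] at hs
      refine tendsto_of_tendsto_of_tendsto_of_le_of_le tendsto_const_nhds hs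
        (fun _ => bot_le) fun s => ?_
      simp only
      rw [one_mul, mul_left_comm, ← mul_add, ← lintegral_const_mul' _ _ enorm_ne_top,
        ← lintegral_add_left (by fun_prop)]
      refine mul_le_mul_right (lintegral_mono fun θ => ?_) _
      calc ‖κ θ * lineExp Ω (A I) (x, θ) - c * lineExp Ω (A I) (x, θ')‖ₑ
          = ‖(κ θ - c) * lineExp Ω (A I) (x, θ)
            + c * (lineExp Ω (A I) (x, θ) - lineExp Ω (A I) (x, θ'))‖ₑ := by congr 1; ring
        _ ≤ ‖κ θ - c‖ₑ * 1 + ‖c‖ₑ * ‖xray Ω (A I) (x, θ) - xray Ω (A I) (x, θ')‖ₑ := by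
            refine (enorm_add_le _ _).trans ?_
            rw [enorm_mul, enorm_mul]
            gcongr
            · rw [Real.enorm_of_nonneg (lineExp_pos _ _).le, ENNReal.ofReal_le_one]
              exact lineExp_le_one (hA0 I) _
            · rw [Real.enorm_eq_ofReal_abs, Real.enorm_eq_ofReal_abs]
              exact ENNReal.ofReal_le_ofReal (abs_lineExp_sub_le (hA0 I) (hA0 I) _ _)
        _ = _ := by rw [mul_one])).comp hε
  refine iInf_tailOsc_le (I := I) (fun j hj => ?_) hlim2 (hlim1.const_mul K)
  have hpn := peak_nonneg hh θ' (hε0 j) hδ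
  have i1 : ∀ l, Integrable (fun θ => peak h θ' (ε j) δ θ * (κ θ * lineExp Ω (A l) (x, θ)))
      (sphereMeasure (m + 1)) := fun l => by
    refine (integrable_peak hh θ' (ε j) δ).mul_bdd (c := K) (hκ.mul (hEm l)).aestronglyMeasurable
      (.of_forall fun θ => ?_)
    rw [norm_mul, Real.norm_of_nonneg (hκ0 θ), Real.norm_of_nonneg (lineExp_pos _ _).le]
    exact (mul_le_of_le_one_right (hκ0 θ) (lineExp_le_one (hA0 l) _)).trans (hκK θ)
  have i2 : Integrable (fun θ => peak h θ' (ε j) δ θ * xray Ω r (x, θ)) (sphereMeasure (m + 1)) :=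
    (integrable_peak hh θ' (ε j) δ).mul_bdd (c := B * L) hxm.aestronglyMeasurable (.of_forall hxB)
  have e1 : f j y = ∫ θ, peak h θ' (ε j) δ θ * (κ θ * lineExp Ω (A j) (x, θ))
      ∂(sphereMeasure (m + 1)) := by
    rw [hf]
    congr 1 with θ
    rw [ballistic]
    ring
  simp only [Function.comp_apply]
  rw [e1, ← integral_sub (i1 j) (i1 I), ← integral_const_mul]
  refine (norm_integral_le_integral_norm _).trans (integral_mono ((i1 j).sub (i1 I)).norm
    (i2.const_mul K) fun θ => ?_)
  simp only [Pi.sub_apply]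
  rw [← mul_sub, ← mul_sub, norm_mul, norm_mul, Real.norm_of_nonneg (hpn θ),
    Real.norm_of_nonneg (hκ0 θ), mul_left_comm]
  have h1 : ‖lineExp Ω (A j) (x, θ) - lineExp Ω (A I) (x, θ)‖ ≤ xray Ω r (x, θ) :=
    (abs_lineExp_sub_le (hA0 j) (hA0 I) _ _).trans
      (abs_xray_sub_le hΩ hx θ (hA j) (hA I) hr (hB j) (hB I) hrB (hAr j hj))
  have := hpn θ
  have := hκ0 θ
  have := hκK θ
  gcongr

/-- The direction is fixed, so the travel time is bounded by L; `tauNorm` would do for almost every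
direction only. -/
lemma lintegral_ofReal_xray_le (hΩ : IsDomainC1 Ω) {L : ℝ} (hL0 : 0 < L)
    (hL : ∀ x ∈ Ω, ∀ y ∈ Ω, ‖x - y‖ < L) {r : Space (m + 1) → ℝ} (hr : Measurable r)
    (θ' : Sph (m + 1)) :
    ∫⁻ x in Ω, ENNReal.ofReal (xray Ω r (x, θ'))
      ≤ ENNReal.ofReal L * ∫⁻ x in Ω, ENNReal.ofReal (r x) := by
  have h1 : ∀ x, ENNReal.ofReal (xray Ω r (x, θ')) ≤
      ∫⁻ s in Ioi (0 : ℝ), Ω.indicator (fun y => ENNReal.ofReal (r y)) (x - s • (θ' : Space (m + 1))) := by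
    intro x
    by_cases hi : IntegrableOn (fun s : ℝ => Ω.indicator r (x - s • (θ' : Space (m + 1)))) (Ioi 0)
    · refine (ofReal_integral_le_lintegral hi).trans_eq (lintegral_congr fun s => ?_)
      by_cases hs : x - s • (θ' : Space (m + 1)) ∈ Ω
      · simp only [indicator_of_mem hs]
      · simp only [indicator_of_notMem hs, ENNReal.ofReal_zero]
    · rw [xray]
      simp only
      rw [integral_undef hi]
      simp
  refine (lintegral_mono h1).trans ?_
  rw [lintegral_line_fixed hΩ θ' hr.ennreal_ofReal, ← lintegral_const_mul _ hr.ennreal_ofReal]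
  refine setLIntegral_mono' hΩ.isOpen.measurableSet fun x hx => ?_
  gcongr
  exact tauPlus_le hΩ hL0 hL hx θ'

end TwoPhoton

end

noncomputable section

namespace TwoPhoton

/-! ### Convergence of the ballistic parts as the peak concentrates -/

variable {m : ℕ} {Ω : Set (Space (m + 1))} {h : Space (m + 1) → ℝ} {θ' : Sph (m + 1)}
  {σa σb : Space (m + 1) → ℝ} {k : Space (m + 1) → Sph (m + 1) → Sph (m + 1) → ℝ}
  {a b κ c₀ μ ν δ : ℝ} {w : Space (m + 1) → Sph (m + 1) → ℝ} {qw : Space (m + 1) → ℝ}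
  {ε : ℕ → ℝ} {u : ℕ → Space (m + 1) → Sph (m + 1) → ℝ} {q : ℕ → Space (m + 1) → ℝ}

/-- A sequence of solutions whose sources concentrate in the direction `θ'`. -/
structure PeakSequence (Ω : Set (Space (m + 1))) (σa σb : Space (m + 1) → ℝ)
    (k : Space (m + 1) → Sph (m + 1) → Sph (m + 1) → ℝ) (c₀ μ : ℝ) (h : Space (m + 1) → ℝ)
    (θ' : Sph (m + 1)) (δ : ℝ) (ε : ℕ → ℝ) (u : ℕ → Space (m + 1) → Sph (m + 1) → ℝ)
    (q : ℕ → Space (m + 1) → ℝ) : Prop where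
  tendsto : Tendsto ε atTop (𝓝[>] 0)
  solution : ∀ j, PeakSolution Ω σa σb k c₀ μ h θ' (ε j) δ (u j) (q j)

namespace PeakSequence

/-- The ballistic parts of a sequence of solutions. -/
abbrev ball (Ω : Set (Space (m + 1))) (σa σb : Space (m + 1) → ℝ) (h : Space (m + 1) → ℝ)
    (θ' : Sph (m + 1)) (δ : ℝ) (ε : ℕ → ℝ) (q : ℕ → Space (m + 1) → ℝ) (j : ℕ) :
    Space (m + 1) → Sph (m + 1) → ℝ := ballistic Ω h θ' (ε j) δ (absorb σa σb (q j))

/-- The regular parts of a sequence of solutions. -/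
abbrev reg (Ω : Set (Space (m + 1))) (σa σb : Space (m + 1) → ℝ) (h : Space (m + 1) → ℝ)
    (θ' : Sph (m + 1)) (δ : ℝ) (ε : ℕ → ℝ) (u : ℕ → Space (m + 1) → Sph (m + 1) → ℝ)
    (q : ℕ → Space (m + 1) → ℝ) (j : ℕ) (p : Space (m + 1) × Sph (m + 1)) : ℝ :=
  u j p.1 p.2 - ball Ω σa σb h θ' δ ε q j p.1 p.2

/-- The averages of the ballistic parts. -/
abbrev ballAver (Ω : Set (Space (m + 1))) (σa σb : Space (m + 1) → ℝ) (h : Space (m + 1) → ℝ)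
    (θ' : Sph (m + 1)) (δ : ℝ) (ε : ℕ → ℝ) (q : ℕ → Space (m + 1) → ℝ) (j : ℕ) :
    Space (m + 1) → ℝ := aver (ball Ω σa σb h θ' δ ε q j)

/-- The ballistic parts after scattering. -/
abbrev ballScatter (Ω : Set (Space (m + 1))) (σa σb : Space (m + 1) → ℝ)
    (k : Space (m + 1) → Sph (m + 1) → Sph (m + 1) → ℝ) (h : Space (m + 1) → ℝ)
    (θ' : Sph (m + 1)) (δ : ℝ) (ε : ℕ → ℝ) (q : ℕ → Space (m + 1) → ℝ) (j : ℕ)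
    (p : Space (m + 1) × Sph (m + 1)) : ℝ := scatter k (ball Ω σa σb h θ' δ ε q j) p.1 p.2

lemma delta_pos (hs : PeakSequence Ω σa σb k c₀ μ h θ' δ ε u q) : 0 < δ :=
  (hs.solution 0).delta_pos

lemma bound_nonneg (hs : PeakSequence Ω σa σb k c₀ μ h θ' δ ε u q)
    (H : Coeff Ω σa σb k a b κ c₀ μ ν) : 0 ≤ (c₀ + 2 * δ) / (1 - μ) :=
  div_nonneg (by linarith [H.c_pos, hs.delta_pos]) (by linarith [H.mu_lt])

lemma enorm_q_le (hs : PeakSequence Ω σa σb k c₀ μ h θ' δ ε u q) (j : ℕ) (x : Space (m + 1)) :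
    ‖q j x‖ₑ ≤ ENNReal.ofReal ((c₀ + 2 * δ) / (1 - μ)) := by
  rw [Real.enorm_of_nonneg ((hs.solution j).nice.nonneg x)]
  exact ENNReal.ofReal_le_ofReal ((hs.solution j).nice.le x)

lemma angNorm_ball_le (hs : PeakSequence Ω σa σb k c₀ μ h θ' δ ε u q)
    (H : Coeff Ω σa σb k a b κ c₀ μ ν) (j : ℕ) (x : Space (m + 1)) :
    angNorm (ball Ω σa σb h θ' δ ε q j) x ≤ ENNReal.ofReal (2 * δ) := by
  refine le_trans (lintegral_mono fun θ => ?_) (hs.solution j).mass_le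
  rw [ball, ballistic, enorm_mul]
  refine mul_le_of_le_one_right bot_le ?_
  rw [Real.enorm_of_nonneg (lineExp_pos _ _).le, ENNReal.ofReal_le_one]
  exact lineExp_le_one (H.absorb_nonneg (hs.solution j).nice.nonneg) _

lemma enorm_ballAver_le (hs : PeakSequence Ω σa σb k c₀ μ h θ' δ ε u q)
    (H : Coeff Ω σa σb k a b κ c₀ μ ν) (j : ℕ) (x : Space (m + 1)) :
    ‖ballAver Ω σa σb h θ' δ ε q j x‖ₑ ≤ ENNReal.ofReal (2 * δ) :=
  (enorm_aver_le _ _).trans (hs.angNorm_ball_le H j x)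

lemma enorm_ballScatter_le (hs : PeakSequence Ω σa σb k c₀ μ h θ' δ ε u q)
    (H : Coeff Ω σa σb k a b κ c₀ μ ν) (j : ℕ) (p : Space (m + 1) × Sph (m + 1)) :
    ‖ballScatter Ω σa σb k h θ' δ ε q j p‖ₑ ≤ ENNReal.ofReal κ * ENNReal.ofReal (2 * δ) :=
  (H.enorm_scatter_le _ _ _).trans (mul_le_mul_right (hs.angNorm_ball_le H j p.1) _)

lemma measurable_ball (hs : PeakSequence Ω σa σb k c₀ μ h θ' δ ε u q)
    (H : Coeff Ω σa σb k a b κ c₀ μ ν) (hΩ : IsDomainC1 Ω) (hh : IsCutoff h) (j : ℕ) :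
    Measurable fun p : Space (m + 1) × Sph (m + 1) => ball Ω σa σb h θ' δ ε q j p.1 p.2 :=
  measurable_ballistic hΩ hh (H.measurable_absorb (hs.solution j).nice.measurable) _ _

lemma measurable_ballAver (hs : PeakSequence Ω σa σb k c₀ μ h θ' δ ε u q)
    (H : Coeff Ω σa σb k a b κ c₀ μ ν) (hΩ : IsDomainC1 Ω) (hh : IsCutoff h) (j : ℕ) :
    Measurable (ballAver Ω σa σb h θ' δ ε q j) :=
  (hs.measurable_ball H hΩ hh j).stronglyMeasurable.integral_prod_right'.measurable

lemma measurable_ballScatter (hs : PeakSequence Ω σa σb k c₀ μ h θ' δ ε u q)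
    (H : Coeff Ω σa σb k a b κ c₀ μ ν) (hΩ : IsDomainC1 Ω) (hh : IsCutoff h) (j : ℕ) :
    Measurable (ballScatter Ω σa σb k h θ' δ ε q j) := by
  have h1 : Measurable fun r : (Space (m + 1) × Sph (m + 1)) × Sph (m + 1) =>
      k r.1.1 r.2 r.1.2 * ball Ω σa σb h θ' δ ε q j r.1.1 r.2 :=
    (H.measurable_k.comp (f := fun r : (Space (m + 1) × Sph (m + 1)) × Sph (m + 1) =>
      ((r.1.1, r.2), r.1.2)) (by fun_prop)).mul
      ((hs.measurable_ball H hΩ hh j).comp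
        (f := fun r : (Space (m + 1) × Sph (m + 1)) × Sph (m + 1) => (r.1.1, r.2)) (by fun_prop))
  exact h1.stronglyMeasurable.integral_prod_right'.measurable

/-- The oscillation of the absorption coefficients of a tail. -/
def absOsc (b : ℝ) (q : ℕ → Space (m + 1) → ℝ) (I : ℕ) (x : Space (m + 1)) : ℝ :=
  b * (tailOsc q I x).toReal

lemma tailOsc_q_le (hs : PeakSequence Ω σa σb k c₀ μ h θ' δ ε u q) (I : ℕ) (x : Space (m + 1)) :
    tailOsc q I x ≤ ENNReal.ofReal ((c₀ + 2 * δ) / (1 - μ)) + ENNReal.ofReal ((c₀ + 2 * δ) / (1 - μ)) :=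
  tailOsc_le_of_bound (fun j => hs.enorm_q_le j x) I

lemma tailOsc_q_ne_top (hs : PeakSequence Ω σa σb k c₀ μ h θ' δ ε u q) (I : ℕ)
    (x : Space (m + 1)) : tailOsc q I x ≠ ⊤ :=
  ne_top_of_le_ne_top (by simp) (hs.tailOsc_q_le I x)

lemma measurable_absOsc (hs : PeakSequence Ω σa σb k c₀ μ h θ' δ ε u q) (I : ℕ) :
    Measurable (absOsc b q I) :=
  (measurable_tailOsc (fun j => (hs.solution j).nice.measurable) I).ennreal_toReal.const_mul b

lemma absOsc_nonneg (H : Coeff Ω σa σb k a b κ c₀ μ ν) (I : ℕ) (x : Space (m + 1)) :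
    0 ≤ absOsc b q I x := mul_nonneg H.b_const_nonneg ENNReal.toReal_nonneg

lemma absOsc_le (hs : PeakSequence Ω σa σb k c₀ μ h θ' δ ε u q)
    (H : Coeff Ω σa σb k a b κ c₀ μ ν) (I : ℕ) (x : Space (m + 1)) :
    absOsc b q I x ≤ b * (2 * ((c₀ + 2 * δ) / (1 - μ))) := by
  have hB := hs.bound_nonneg H
  refine mul_le_mul_of_nonneg_left (ENNReal.toReal_le_of_le_ofReal (by positivity) ?_)
    H.b_const_nonneg
  refine (hs.tailOsc_q_le I x).trans_eq ?_
  rw [← ENNReal.ofReal_add hB hB]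
  congr 1
  ring

lemma abs_absorb_sub_le (hs : PeakSequence Ω σa σb k c₀ μ h θ' δ ε u q)
    (H : Coeff Ω σa σb k a b κ c₀ μ ν) {I j : ℕ} (hj : I ≤ j) (x : Space (m + 1)) :
    |absorb σa σb (q j) x - absorb σa σb (q I) x| ≤ absOsc b q I x := by
  rw [Coeff.absorb_sub, abs_mul, abs_of_nonneg (H.b_nonneg x), absOsc]
  refine mul_le_mul (H.b_le x) ?_ (abs_nonneg _) H.b_const_nonneg
  have h1 := le_tailOsc q hj le_rfl x
  rw [Real.enorm_eq_ofReal_abs] at h1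
  exact (ENNReal.ofReal_le_iff_le_toReal (hs.tailOsc_q_ne_top I x)).1 h1

/-- The bound for the oscillation of weighted averages of the ballistic parts. -/
lemma ae_iInf_tailOsc_le (hs : PeakSequence Ω σa σb k c₀ μ h θ' δ ε u q)
    (H : Coeff Ω σa σb k a b κ c₀ μ ν) (hΩ : IsDomainC1 Ω) (hh : IsCutoff h) (I : ℕ) :
    ∀ᵐ x ∂(volume.restrict Ω), ∀ (Y : Type) (y : Y) (K c : ℝ) (g : Sph (m + 1) → ℝ) (f : ℕ → Y → ℝ),
      Measurable g → (∀ θ, 0 ≤ g θ) → (∀ θ, g θ ≤ K) →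
      Tendsto (fun s : ℝ => ENNReal.ofReal ((s ^ m)⁻¹) *
        ∫⁻ θ in Metric.closedBall θ' s, ‖g θ - c‖ₑ ∂(sphereMeasure (m + 1))) (𝓝[>] 0) (𝓝 0) →
      (∀ j, f j y = ∫ θ, g θ * ball Ω σa σb h θ' δ ε q j x θ ∂(sphereMeasure (m + 1))) →
      ⨅ J, tailOsc f J y ≤ ENNReal.ofReal (2 * (K * (δ * xray Ω (absOsc b q I) (x, θ')))) := by
  set B := max (a + b * ((c₀ + 2 * δ) / (1 - μ))) (b * (2 * ((c₀ + 2 * δ) / (1 - μ))))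
  have hA : ∀ j x, |absorb σa σb (q j) x| ≤ B := fun j x =>
    (H.norm_absorb_le (hs.solution j).nice.nonneg (hs.solution j).nice.le x).trans (le_max_left _ _)
  have hr : ∀ x, |absOsc b q I x| ≤ B := fun x => by
    rw [abs_of_nonneg (absOsc_nonneg H I x)]
    exact (hs.absOsc_le H I x).trans (le_max_right _ _)
  have hAm : ∀ j, Measurable (absorb σa σb (q j)) := fun j =>
    H.measurable_absorb (hs.solution j).nice.measurable
  -- These Lebesgue point conditions do not involve the weight. Hence one null set of points x
  -- serves all weights g, in particular k(x, ·, θ) for every θ.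
  filter_upwards [ae_tendsto_xray_cap hΩ (hs.measurable_absOsc I) hr θ',
    ae_tendsto_xray_cap hΩ (hAm I) (hA I) θ', ae_restrict_mem hΩ.isOpen.measurableSet]
    with x h1 h2 hx Y y K c g f hg hg0 hgK hlim hf
  exact iInf_tailOsc_peak_le hΩ hh hs.delta_pos hx (fun j => (hs.solution j).eps_pos) hs.tendsto
    hAm (fun j => H.absorb_nonneg (hs.solution j).nice.nonneg) hA (hs.measurable_absOsc I) hr
    (fun j hj => hs.abs_absorb_sub_le H hj) h1 h2 hg hg0 hgK hlim hf

lemma lintegral_xray_absOsc_le (hs : PeakSequence Ω σa σb k c₀ μ h θ' δ ε u q)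
    (H : Coeff Ω σa σb k a b κ c₀ μ ν) (hΩ : IsDomainC1 Ω) {L : ℝ} (hL0 : 0 < L)
    (hL : ∀ x ∈ Ω, ∀ y ∈ Ω, ‖x - y‖ < L) (I : ℕ) {K : ℝ} (hK : 0 ≤ K) :
    ∫⁻ x in Ω, ENNReal.ofReal (2 * (K * (δ * xray Ω (absOsc b q I) (x, θ'))))
      ≤ ENNReal.ofReal (K * (2 * δ * L * b)) * ∫⁻ x in Ω, tailOsc q I x := by
  have hδ := hs.delta_pos
  have hb := H.b_const_nonneg
  have e1 : ∀ x, ENNReal.ofReal (2 * (K * (δ * xray Ω (absOsc b q I) (x, θ'))))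
      = ENNReal.ofReal (2 * K * δ) * ENNReal.ofReal (xray Ω (absOsc b q I) (x, θ')) := fun x => by
    rw [← ENNReal.ofReal_mul (by positivity)]
    congr 1
    ring
  have e2 : ∀ x, ENNReal.ofReal (absOsc b q I x) = ENNReal.ofReal b * tailOsc q I x := fun x => by
    rw [absOsc, ENNReal.ofReal_mul hb, ENNReal.ofReal_toReal (hs.tailOsc_q_ne_top I x)]
  simp only [e1]
  rw [lintegral_const_mul' _ _ ENNReal.ofReal_ne_top]
  refine (mul_le_mul_right (lintegral_ofReal_xray_le hΩ hL0 hL (hs.measurable_absOsc I) θ')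
    _).trans_eq ?_
  simp only [e2]
  rw [lintegral_const_mul' _ _ ENNReal.ofReal_ne_top, ← mul_assoc, ← mul_assoc,
    ← ENNReal.ofReal_mul (by positivity), ← ENNReal.ofReal_mul (by positivity)]
  congr 2
  ring

lemma isFiniteMeasure_restrict (hΩ : IsDomainC1 Ω) :
    IsFiniteMeasure ((volume : Measure (Space (m + 1))).restrict Ω) :=
  ⟨by rw [Measure.restrict_apply_univ]; exact hΩ.isBounded.measure_lt_top⟩

/-- The inequality O ≤ cP of the closing system, with c = 2δLb. The weight is constant, so nothing
is required of θ'. -/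
lemma iInf_lintegral_ballAver_le (hs : PeakSequence Ω σa σb k c₀ μ h θ' δ ε u q)
    (H : Coeff Ω σa σb k a b κ c₀ μ ν) (hΩ : IsDomainC1 Ω) (hh : IsCutoff h) {L : ℝ} (hL0 : 0 < L)
    (hL : ∀ x ∈ Ω, ∀ y ∈ Ω, ‖x - y‖ < L) :
    ⨅ J, ∫⁻ x in Ω, tailOsc (ballAver Ω σa σb h θ' δ ε q) J x
      ≤ ENNReal.ofReal (2 * δ * L * b) * ⨅ I, ∫⁻ x in Ω, tailOsc q I x := by
  have := isFiniteMeasure_restrict hΩ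
  rw [← lintegral_iInf_tailOsc (fun j => (hs.measurable_ballAver H hΩ hh j).aemeasurable)
    ENNReal.ofReal_ne_top (fun j => .of_forall fun x => hs.enorm_ballAver_le H j x),
    ENNReal.mul_iInf (by simp)]
  refine le_iInf fun I => ?_
  have h1 := hs.lintegral_xray_absOsc_le H hΩ hL0 hL I zero_le_one
  rw [one_mul] at h1
  refine le_trans (lintegral_mono_ae ?_) h1
  filter_upwards [hs.ae_iInf_tailOsc_le H hΩ hh I] with x hx
  exact hx _ x 1 1 (fun _ => 1) _ measurable_const (fun _ => zero_le_one) (fun _ => le_rfl)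
    (by simp) (fun j => by simp only [one_mul]; rfl)

/-- The inequality S ≤ κcP. The weight is now k(x, ·, θ), which must have a Lebesgue point at θ';
the Lebesgue direction enters the convergence proof through this estimate. -/
lemma iInf_lintegral_ballScatter_le (hs : PeakSequence Ω σa σb k c₀ μ h θ' δ ε u q)
    (H : Coeff Ω σa σb k a b κ c₀ μ ν) (hΩ : IsDomainC1 Ω) (hh : IsCutoff h) {L : ℝ} (hL0 : 0 < L)
    (hL : ∀ x ∈ Ω, ∀ y ∈ Ω, ‖x - y‖ < L) (hk : IsLebesgueDirection Ω k θ') :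
    ⨅ J, ∫⁻ p, tailOsc (ballScatter Ω σa σb k h θ' δ ε q) J p ∂(phaseMeasure Ω)
      ≤ ENNReal.ofReal (κ * (2 * δ * L * b)) * ⨅ I, ∫⁻ x in Ω, tailOsc q I x := by
  have := isFiniteMeasure_phase hΩ
  have hκ := H.kappa_nonneg θ'
  rw [← lintegral_iInf_tailOsc (fun j => (hs.measurable_ballScatter H hΩ hh j).aemeasurable)
    (ENNReal.mul_ne_top ENNReal.ofReal_ne_top ENNReal.ofReal_ne_top)
    (fun j => .of_forall fun p => hs.enorm_ballScatter_le H j p), ENNReal.mul_iInf (by simp)]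
  refine le_iInf fun I => ?_
  refine le_trans (b := ∫⁻ p, ENNReal.ofReal (2 * (κ * (δ * xray Ω (absOsc b q I) (p.1, θ'))))
    ∂(phaseMeasure Ω)) (lintegral_mono_ae ?_) ?_
  · filter_upwards [ae_phase_of_ae (hs.ae_iInf_tailOsc_le H hΩ hh I),
      hk.ae_tendsto H.measurable_k (B := κ) (fun x θ₁ θ₂ => by
        rw [abs_of_nonneg (H.k_nonneg _ _ _)]; exact H.k_le _ _ _)] with p hp ⟨c, hc⟩
    exact hp _ p κ c (fun θ'' => k p.1 θ'' p.2) _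
      (H.measurable_k.comp (f := fun θ => ((p.1, θ), p.2)) (by fun_prop))
      (fun _ => H.k_nonneg _ _ _) (fun _ => H.k_le _ _ _) hc (fun j => rfl)
  · refine le_trans (le_of_eq ?_) (hs.lintegral_xray_absOsc_le H hΩ hL0 hL I hκ)
    have hm : Measurable fun p : Space (m + 1) × Sph (m + 1) =>
        ENNReal.ofReal (2 * (κ * (δ * xray Ω (absOsc b q I) (p.1, θ')))) := by
      have := (stronglyMeasurable_xray hΩ.isOpen
        (hs.measurable_absOsc (b := b) I).stronglyMeasurable).measurable.comp
        (f := fun p : Space (m + 1) × Sph (m + 1) => (p.1, θ')) (by fun_prop)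
      exact ((((this.const_mul _).const_mul _).const_mul _)).ennreal_ofReal
    rw [phaseMeasure, lintegral_prod _ hm.aemeasurable]
    simp

end PeakSequence

end TwoPhoton

end

/-! ### Oscillation of the regular parts, the closed system of inequalities, and convergence as ε →
0. -/

noncomputable section

namespace TwoPhoton

variable {m : ℕ} {Ω : Set (Space (m + 1))} {h : Space (m + 1) → ℝ} {θ' : Sph (m + 1)}
  {σa σb : Space (m + 1) → ℝ} {k : Space (m + 1) → Sph (m + 1) → Sph (m + 1) → ℝ}
  {a b κ c₀ μ ν δ : ℝ} {w : Space (m + 1) → Sph (m + 1) → ℝ} {qw : Space (m + 1) → ℝ}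
  {ε : ℕ → ℝ} {u : ℕ → Space (m + 1) → Sph (m + 1) → ℝ} {q : ℕ → Space (m + 1) → ℝ}

namespace PeakSequence

/-- The angular average of the oscillation of the regular parts. -/
def regOsc (Ω : Set (Space (m + 1))) (σa σb : Space (m + 1) → ℝ) (h : Space (m + 1) → ℝ)
    (θ' : Sph (m + 1)) (δ : ℝ) (ε : ℕ → ℝ) (u : ℕ → Space (m + 1) → Sph (m + 1) → ℝ)
    (q : ℕ → Space (m + 1) → ℝ) (J : ℕ) (x : Space (m + 1)) : ℝ≥0∞ :=
  ∫⁻ θ, tailOsc (reg Ω σa σb h θ' δ ε u q) J (x, θ) ∂(sphereMeasure (m + 1))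

lemma aemeasurable_reg (hs : PeakSequence Ω σa σb k c₀ μ h θ' δ ε u q)
    (H : Coeff Ω σa σb k a b κ c₀ μ ν) (hΩ : IsDomainC1 Ω) (hh : IsCutoff h) (j : ℕ) :
    AEMeasurable (reg Ω σa σb h θ' δ ε u q j) (phaseMeasure Ω) :=
  ((hs.solution j).solves_regular H hΩ hh).integrable.1.aemeasurable

lemma aemeasurable_tailOsc_reg (hs : PeakSequence Ω σa σb k c₀ μ h θ' δ ε u q)
    (H : Coeff Ω σa σb k a b κ c₀ μ ν) (hΩ : IsDomainC1 Ω) (hh : IsCutoff h) (J : ℕ) :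
    AEMeasurable (tailOsc (reg Ω σa σb h θ' δ ε u q) J) (phaseMeasure Ω) :=
  aemeasurable_tailOsc (hs.aemeasurable_reg H hΩ hh) J

lemma aemeasurable_regOsc (hs : PeakSequence Ω σa σb k c₀ μ h θ' δ ε u q)
    (H : Coeff Ω σa σb k a b κ c₀ μ ν) (hΩ : IsDomainC1 Ω) (hh : IsCutoff h) (J : ℕ) :
    AEMeasurable (regOsc Ω σa σb h θ' δ ε u q J) (volume.restrict Ω) :=
  (hs.aemeasurable_tailOsc_reg H hΩ hh J).lintegral_prod_right'

lemma lintegral_regOsc (hs : PeakSequence Ω σa σb k c₀ μ h θ' δ ε u q)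
    (H : Coeff Ω σa σb k a b κ c₀ μ ν) (hΩ : IsDomainC1 Ω) (hh : IsCutoff h) (J : ℕ) :
    ∫⁻ x in Ω, regOsc Ω σa σb h θ' δ ε u q J x
      = ∫⁻ p, tailOsc (reg Ω σa σb h θ' δ ε u q) J p ∂(phaseMeasure Ω) := by
  rw [phaseMeasure, lintegral_prod _ (hs.aemeasurable_tailOsc_reg H hΩ hh J)]
  rfl

lemma angNorm_reg_sub_le {J j l : ℕ} (hj : J ≤ j) (hl : J ≤ l) (x : Space (m + 1)) :
    angNorm (fun x θ => reg Ω σa σb h θ' δ ε u q j (x, θ) - reg Ω σa σb h θ' δ ε u q l (x, θ)) x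
      ≤ regOsc Ω σa σb h θ' δ ε u q J x :=
  lintegral_mono fun θ => le_tailOsc (reg Ω σa σb h θ' δ ε u q) hj hl (x, θ)

lemma ae_scatter_eq (hs : PeakSequence Ω σa σb k c₀ μ h θ' δ ε u q)
    (H : Coeff Ω σa σb k a b κ c₀ μ ν) (hΩ : IsDomainC1 Ω) (hh : IsCutoff h) (j : ℕ) :
    ∀ᵐ p ∂(phaseMeasure Ω), scatter k (u j) p.1 p.2 =
      scatter k (fun x θ => reg Ω σa σb h θ' δ ε u q j (x, θ)) p.1 p.2
        + ballScatter Ω σa σb k h θ' δ ε q j p := by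
  filter_upwards [H.ae_scatter_sub (hs.solution j).nice.solves.integrable
    ((hs.solution j).integrable_ballistic H hΩ hh)] with p hp
  rw [← sub_eq_iff_eq_add]
  exact hp

lemma ae_scatter_sub_le (hs : PeakSequence Ω σa σb k c₀ μ h θ' δ ε u q)
    (H : Coeff Ω σa σb k a b κ c₀ μ ν) (hΩ : IsDomainC1 Ω) (hh : IsCutoff h) {J j l : ℕ}
    (hj : J ≤ j) (hl : J ≤ l) :
    ∀ᵐ p ∂(phaseMeasure Ω), ‖scatter k (u j) p.1 p.2 - scatter k (u l) p.1 p.2‖ₑ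
      ≤ ENNReal.ofReal κ * regOsc Ω σa σb h θ' δ ε u q J p.1
        + tailOsc (ballScatter Ω σa σb k h θ' δ ε q) J p := by
  filter_upwards [hs.ae_scatter_eq H hΩ hh j, hs.ae_scatter_eq H hΩ hh l,
    H.ae_scatter_sub (u := fun x θ => reg Ω σa σb h θ' δ ε u q j (x, θ))
      (w := fun x θ => reg Ω σa σb h θ' δ ε u q l (x, θ))
      ((hs.solution j).solves_regular H hΩ hh).integrable
      ((hs.solution l).solves_regular H hΩ hh).integrable] with p h1 h2 h3
  rw [h1, h2, add_sub_add_comm, h3]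
  refine (enorm_add_le _ _).trans (add_le_add ?_ (le_tailOsc _ hj hl p))
  exact (H.enorm_scatter_le _ _ _).trans (mul_le_mul_right (angNorm_reg_sub_le hj hl _) _)

/-- The bound for the right hand side of the equation for differences of regular parts. -/
def regSource (Ω : Set (Space (m + 1))) (σa σb : Space (m + 1) → ℝ)
    (k : Space (m + 1) → Sph (m + 1) → Sph (m + 1) → ℝ) (h : Space (m + 1) → ℝ)
    (θ' : Sph (m + 1)) (δ : ℝ) (ε : ℕ → ℝ) (u : ℕ → Space (m + 1) → Sph (m + 1) → ℝ)
    (q : ℕ → Space (m + 1) → ℝ) (κ b V : ℝ) (J : ℕ) (p : Space (m + 1) × Sph (m + 1)) : ℝ≥0∞ :=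
  ENNReal.ofReal κ * regOsc Ω σa σb h θ' δ ε u q J p.1
    + tailOsc (ballScatter Ω σa σb k h θ' δ ε q) J p
    + ENNReal.ofReal (b * V) * tailOsc q J p.1

/-- Two regular parts have the same boundary value, so their difference is driven by the differences
of scattering and of absorption, the latter times a regular part bounded independently of ε. The
bound does not depend on the pair of indices and passes to the supremum over the countably many
pairs. -/
lemma ae_tailOsc_reg_le (hs : PeakSequence Ω σa σb k c₀ μ h θ' δ ε u q)
    (hw : NiceSolution Ω σa σb k (fun _ => c₀) (c₀ / (1 - μ)) w qw)
    (H : Coeff Ω σa σb k a b κ c₀ μ ν) (hΩ : IsDomainC1 Ω) (hh : IsCutoff h) (J : ℕ) :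
    ∀ᵐ p ∂(phaseMeasure Ω), tailOsc (reg Ω σa σb h θ' δ ε u q) J p ≤
      lineInt Ω (regSource Ω σa σb k h θ' δ ε u q κ b
        (regBound (tauNorm Ω).toReal b κ c₀ μ ν δ) J) p := by
  have hb := H.b_const_nonneg
  have hkey : ∀ j l, J ≤ j → J ≤ l → ∀ᵐ p ∂(phaseMeasure Ω),
      ‖reg Ω σa σb h θ' δ ε u q j p - reg Ω σa σb h θ' δ ε u q l p‖ₑ ≤
      lineInt Ω (regSource Ω σa σb k h θ' δ ε u q κ b
        (regBound (tauNorm Ω).toReal b κ c₀ μ ν δ) J) p := by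
    intro j l hj hl
    have h1 := ((hs.solution j).solves_regular H hΩ hh).enorm_sub_le hΩ
      ((hs.solution l).solves_regular H hΩ hh)
      (.of_forall fun p => H.absorb_nonneg (hs.solution j).nice.nonneg p.1)
    have h2 : (fun p : Space (m + 1) × Sph (m + 1) =>
        ‖scatter k (u j) p.1 p.2 - scatter k (u l) p.1 p.2‖ₑ +
        ‖absorb σa σb (q j) p.1 - absorb σa σb (q l) p.1‖ₑ *
          ‖u l p.1 p.2 - ballistic Ω h θ' (ε l) δ (absorb σa σb (q l)) p.1 p.2‖ₑ)
        ≤ᵐ[phaseMeasure Ω] regSource Ω σa σb k h θ' δ ε u q κ b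
          (regBound (tauNorm Ω).toReal b κ c₀ μ ν δ) J := by
      filter_upwards [hs.ae_scatter_sub_le H hΩ hh hj hl,
        (hs.solution l).ae_regular_le hw H hΩ hh] with p e1 e2
      refine add_le_add e1 ?_
      rw [ENNReal.ofReal_mul hb, mul_right_comm]
      exact mul_le_mul' ((H.enorm_absorb_sub_le _ _ _).trans
        (mul_le_mul_right (le_tailOsc q hj hl p.1) _)) e2
    filter_upwards [h1, lineInt_mono_ae hΩ h2] with p e1 e2
    simp only [sub_self, enorm_zero, zero_add] at e1
    exact e1.trans e2
  have hall : ∀ᵐ p ∂(phaseMeasure Ω), ∀ j l, J ≤ j → J ≤ l →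
      ‖reg Ω σa σb h θ' δ ε u q j p - reg Ω σa σb h θ' δ ε u q l p‖ₑ ≤
      lineInt Ω (regSource Ω σa σb k h θ' δ ε u q κ b
        (regBound (tauNorm Ω).toReal b κ c₀ μ ν δ) J) p := by
    rw [ae_all_iff]
    intro j
    rw [ae_all_iff]
    intro l
    by_cases hj : J ≤ j
    · by_cases hl : J ≤ l
      · exact (hkey j l hj hl).mono fun p hp _ _ => hp
      · exact .of_forall fun p _ hl' => absurd hl' hl
    · exact .of_forall fun p hj' => absurd hj' hj
  exact hall.mono fun p hp => tailOsc_le hp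

lemma lintegral_fst {g : Space (m + 1) → ℝ≥0∞} (hg : AEMeasurable g (volume.restrict Ω)) :
    ∫⁻ p, g p.1 ∂(phaseMeasure Ω) = ∫⁻ x in Ω, g x := by
  rw [phaseMeasure, lintegral_prod _ hg.comp_fst]
  simp

lemma lintegral_tailOsc_reg_le (hs : PeakSequence Ω σa σb k c₀ μ h θ' δ ε u q)
    (hw : NiceSolution Ω σa σb k (fun _ => c₀) (c₀ / (1 - μ)) w qw)
    (H : Coeff Ω σa σb k a b κ c₀ μ ν) (hΩ : IsDomainC1 Ω) (hh : IsCutoff h) (J : ℕ) :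
    ∫⁻ p, tailOsc (reg Ω σa σb h θ' δ ε u q) J p ∂(phaseMeasure Ω) ≤
      tauNorm Ω * (ENNReal.ofReal κ * ∫⁻ p, tailOsc (reg Ω σa σb h θ' δ ε u q) J p ∂(phaseMeasure Ω)
        + ∫⁻ p, tailOsc (ballScatter Ω σa σb k h θ' δ ε q) J p ∂(phaseMeasure Ω)
        + ENNReal.ofReal (b * regBound (tauNorm Ω).toReal b κ c₀ μ ν δ) *
          ∫⁻ x in Ω, tailOsc q J x) := by
  have m1 : AEMeasurable (fun p : Space (m + 1) × Sph (m + 1) =>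
      regOsc Ω σa σb h θ' δ ε u q J p.1) (phaseMeasure Ω) :=
    (hs.aemeasurable_regOsc H hΩ hh J).comp_fst
  have m2 : Measurable (tailOsc (ballScatter Ω σa σb k h θ' δ ε q) J) :=
    measurable_tailOsc (hs.measurable_ballScatter H hΩ hh) J
  have m3 : Measurable (tailOsc q J) := measurable_tailOsc (fun j => (hs.solution j).nice.measurable) J
  have m3' : Measurable fun p : Space (m + 1) × Sph (m + 1) => tailOsc q J p.1 :=
    m3.comp measurable_fst
  refine (lintegral_mono_ae (hs.ae_tailOsc_reg_le hw H hΩ hh J)).trans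
    ((lintegral_lineInt_le hΩ ?_).trans_eq ?_)
  · exact ((m1.const_mul _).add m2.aemeasurable).add (m3'.const_mul _).aemeasurable
  · unfold regSource
    rw [lintegral_add_right _ (m3'.const_mul _), lintegral_add_right _ m2,
      lintegral_const_mul' _ _ ENNReal.ofReal_ne_top, lintegral_const_mul' _ _ ENNReal.ofReal_ne_top,
      lintegral_fst (hs.aemeasurable_regOsc H hΩ hh J), lintegral_fst m3.aemeasurable,
      hs.lintegral_regOsc H hΩ hh]

/-- The average of u_j is that of its regular part plus that of its ballistic part, and taking
absolute values does not increase differences. In the limit this is P ≤ R + O. -/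
lemma ae_tailOsc_q_le (hs : PeakSequence Ω σa σb k c₀ μ h θ' δ ε u q)
    (H : Coeff Ω σa σb k a b κ c₀ μ ν) (hΩ : IsDomainC1 Ω) (hh : IsCutoff h) (J : ℕ) :
    ∀ᵐ x ∂(volume.restrict Ω), tailOsc q J x ≤ regOsc Ω σa σb h θ' δ ε u q J x
      + tailOsc (ballAver Ω σa σb h θ' δ ε q) J x := by
  have h1 : ∀ᵐ x ∂(volume.restrict Ω), ∀ j, |aver (u j) x| = q j x :=
    ae_all_iff.2 fun j => (hs.solution j).nice.ae_eq
  have h2 : ∀ᵐ x ∂(volume.restrict Ω), ∀ j, Integrable (u j x) (sphereMeasure (m + 1)) :=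
    ae_all_iff.2 fun j => ae_integrable_slice (hs.solution j).nice.solves.integrable
  filter_upwards [h1, h2] with x e1 e2
  refine tailOsc_le fun j l hj hl => ?_
  have i1 : ∀ j, Integrable (ball Ω σa σb h θ' δ ε q j x) (sphereMeasure (m + 1)) := fun j =>
    PeakSolution.integrable_ballistic_slice hh hΩ
      (H.measurable_absorb (hs.solution j).nice.measurable)
      (H.absorb_nonneg (hs.solution j).nice.nonneg) _ _ x
  have hsplit : ∀ j, aver (u j) x = aver (fun x θ => reg Ω σa σb h θ' δ ε u q j (x, θ)) x
      + ballAver Ω σa σb h θ' δ ε q j x := fun j => by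
    have := integral_add (f := fun θ => reg Ω σa σb h θ' δ ε u q j (x, θ))
      (g := ball Ω σa σb h θ' δ ε q j x) ((e2 j).sub (i1 j)) (i1 j)
    rw [ballAver, aver, aver, aver, ← this]
    congr 1 with θ
    simp only [reg]
    ring
  have hreg : aver (fun x θ => reg Ω σa σb h θ' δ ε u q j (x, θ)) x
      - aver (fun x θ => reg Ω σa σb h θ' δ ε u q l (x, θ)) x
      = aver (fun x θ => reg Ω σa σb h θ' δ ε u q j (x, θ)
        - reg Ω σa σb h θ' δ ε u q l (x, θ)) x :=
    (integral_sub (f := fun θ => reg Ω σa σb h θ' δ ε u q j (x, θ))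
      (g := fun θ => reg Ω σa σb h θ' δ ε u q l (x, θ))
      ((e2 j).sub (i1 j)) ((e2 l).sub (i1 l))).symm
  calc ‖q j x - q l x‖ₑ ≤ ‖aver (u j) x - aver (u l) x‖ₑ := by
        rw [← e1 j, ← e1 l, Real.enorm_eq_ofReal_abs, Real.enorm_eq_ofReal_abs]
        exact ENNReal.ofReal_le_ofReal (abs_abs_sub_abs_le_abs_sub _ _)
    _ = ‖aver (fun x θ => reg Ω σa σb h θ' δ ε u q j (x, θ)
        - reg Ω σa σb h θ' δ ε u q l (x, θ)) x
        + (ballAver Ω σa σb h θ' δ ε q j x - ballAver Ω σa σb h θ' δ ε q l x)‖ₑ := by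
        rw [hsplit j, hsplit l, add_sub_add_comm, hreg]
    _ ≤ _ := (enorm_add_le _ _).trans (add_le_add
        ((enorm_aver_le _ _).trans (angNorm_reg_sub_le hj hl x)) (le_tailOsc _ hj hl x))

/-- P, R, O, S stand for the limiting oscillations of |⟨u_j⟩|, of the regular parts, of the
ballistic averages and of the scattered ballistic parts. The bound for R gives (1 - μ)R ≤ (μc +
Te)P; inserted into P ≤ R + cP it gives (1 - μ)P ≤ (c + Te)P, which the smallness assumption
excludes unless P = 0. -/
lemma closing_argument {T κ μ c e R O S P : ℝ} (hT : 0 ≤ T) (hμ : T * κ ≤ μ) 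
    (hμ1 : μ < 1) (hc : 0 ≤ c) (hsmall : c + T * e < 1 - μ) (hR0 : 0 ≤ R) (hP0 : 0 ≤ P)
    (hP : P ≤ R + O) (hO : O ≤ c * P) (hS : S ≤ κ * c * P)
    (hR : R ≤ T * (κ * R + S + e * P)) : P = 0 ∧ R = 0 := by
  have h1 : T * S ≤ μ * c * P := by
    calc T * S ≤ T * (κ * c * P) := by gcongr
      _ = T * κ * (c * P) := by ring
      _ ≤ μ * (c * P) := by gcongr
      _ = _ := by ring
  have h2 : T * κ * R ≤ μ * R := by gcongr
  have h3 : (1 - μ) * R ≤ (μ * c + T * e) * P := by linarith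
  have h4 : (1 - μ) * P ≤ (1 - μ) * R + (1 - μ) * (c * P) := by
    rw [← mul_add]
    exact mul_le_mul_of_nonneg_left (by linarith) (by linarith)
  have h5 : (1 - μ - (c + T * e)) * P ≤ 0 := by linarith
  have hP1 : P = 0 := by
    refine le_antisymm ?_ hP0
    by_contra hlt
    have := mul_pos (sub_pos.2 hsmall) (not_le.1 hlt)
    linarith
  refine ⟨hP1, le_antisymm ?_ hR0⟩
  rw [hP1, mul_zero] at h3
  by_contra hlt
  have := mul_pos (sub_pos.2 hμ1) (not_le.1 hlt)
  linarith

/-- All the oscillations vanish in the limit. -/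
lemma iInf_eq_zero (hs : PeakSequence Ω σa σb k c₀ μ h θ' δ ε u q)
    (hw : NiceSolution Ω σa σb k (fun _ => c₀) (c₀ / (1 - μ)) w qw)
    (H : Coeff Ω σa σb k a b κ c₀ μ ν) (hΩ : IsDomainC1 Ω) (hh : IsCutoff h)
    (hk : IsLebesgueDirection Ω k θ') {L : ℝ} (hL0 : 0 < L) (hL : ∀ x ∈ Ω, ∀ y ∈ Ω, ‖x - y‖ < L)
    (hsmall : 2 * δ * L * b + (tauNorm Ω).toReal *
      (b * regBound (tauNorm Ω).toReal b κ c₀ μ ν δ) < 1 - μ) :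
    ⨅ J, ∫⁻ x in Ω, tailOsc (ballAver Ω σa σb h θ' δ ε q) J x = 0 ∧
      ⨅ J, ∫⁻ p, tailOsc (reg Ω σa σb h θ' δ ε u q) J p ∂(phaseMeasure Ω) = 0 := by
  have fin1 := isFiniteMeasure_restrict hΩ
  have fin2 := isFiniteMeasure_phase hΩ
  have hδ := hs.delta_pos
  have hb := H.b_const_nonneg
  have hκ := H.kappa_nonneg θ'
  have hV := PeakSolution.regBound_nonneg H hδ
  set V := regBound (tauNorm Ω).toReal b κ c₀ μ ν δ
  set T := (tauNorm Ω).toReal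
  set o : ℕ → ℝ≥0∞ := fun J => ∫⁻ x in Ω, tailOsc (ballAver Ω σa σb h θ' δ ε q) J x with ho
  set s : ℕ → ℝ≥0∞ := fun J =>
    ∫⁻ p, tailOsc (ballScatter Ω σa σb k h θ' δ ε q) J p ∂(phaseMeasure Ω) with hsd
  set r : ℕ → ℝ≥0∞ := fun J => ∫⁻ p, tailOsc (reg Ω σa σb h θ' δ ε u q) J p ∂(phaseMeasure Ω) with hr
  set P : ℕ → ℝ≥0∞ := fun J => ∫⁻ x in Ω, tailOsc q J x with hP
  -- Tail oscillations decrease with J, so the infima are limits and the inequalities valid at each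
  -- J pass to them.
  have ao : Antitone o := fun _ _ hJ => lintegral_mono fun x => tailOsc_antitone _ x hJ
  have as : Antitone s := fun _ _ hJ => lintegral_mono fun x => tailOsc_antitone _ x hJ
  have ar : Antitone r := fun _ _ hJ => lintegral_mono fun x => tailOsc_antitone _ x hJ
  have aP : Antitone P := fun _ _ hJ => lintegral_mono fun x => tailOsc_antitone _ x hJ
  have tO := tendsto_atTop_iInf ao
  have ts := tendsto_atTop_iInf as
  have tr := tendsto_atTop_iInf ar
  have tP := tendsto_atTop_iInf aP
  have fo : ⨅ J, o J ≠ ⊤ := ne_top_of_le_ne_top (lintegral_tailOsc_ne_top ENNReal.ofReal_ne_top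
    (fun j => .of_forall fun x => hs.enorm_ballAver_le H j x) 0) (iInf_le o 0)
  have fs : ⨅ J, s J ≠ ⊤ := ne_top_of_le_ne_top (lintegral_tailOsc_ne_top
    (ENNReal.mul_ne_top ENNReal.ofReal_ne_top ENNReal.ofReal_ne_top)
    (fun j => .of_forall fun p => hs.enorm_ballScatter_le H j p) 0) (iInf_le s 0)
  have fr : ⨅ J, r J ≠ ⊤ := ne_top_of_le_ne_top (lintegral_tailOsc_ne_top ENNReal.ofReal_ne_top
    (fun j => (hs.solution j).ae_regular_le hw H hΩ hh) 0) (iInf_le r 0)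
  have fP : ⨅ J, P J ≠ ⊤ := ne_top_of_le_ne_top (lintegral_tailOsc_ne_top ENNReal.ofReal_ne_top
    (fun j => .of_forall fun x => hs.enorm_q_le j x) 0) (iInf_le P 0)
  have g1 : ⨅ J, o J ≤ ENNReal.ofReal (2 * δ * L * b) * ⨅ J, P J :=
    hs.iInf_lintegral_ballAver_le H hΩ hh hL0 hL
  have g2 : ⨅ J, s J ≤ ENNReal.ofReal (κ * (2 * δ * L * b)) * ⨅ J, P J :=
    hs.iInf_lintegral_ballScatter_le H hΩ hh hL0 hL hk
  have g3 : ⨅ J, P J ≤ (⨅ J, r J) + ⨅ J, o J := by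
    refine le_of_tendsto_of_tendsto' tP (tr.add tO) fun J => ?_
    simp only [hP, hr, ho]
    rw [← hs.lintegral_regOsc H hΩ hh,
      ← lintegral_add_right _ (measurable_tailOsc (hs.measurable_ballAver H hΩ hh) J)]
    exact lintegral_mono_ae (hs.ae_tailOsc_q_le H hΩ hh J)
  have g4 : ⨅ J, r J ≤ tauNorm Ω * (ENNReal.ofReal κ * (⨅ J, r J) + (⨅ J, s J)
      + ENNReal.ofReal (b * V) * ⨅ J, P J) := by
    refine le_of_tendsto_of_tendsto' tr (ENNReal.Tendsto.const_mul
      (((ENNReal.Tendsto.const_mul tr (.inr ENNReal.ofReal_ne_top)).add ts).add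
        (ENNReal.Tendsto.const_mul tP (.inr ENNReal.ofReal_ne_top)))
      (.inr (tauNorm_lt_top hΩ).ne)) fun J => ?_
    exact hs.lintegral_tailOsc_reg_le hw H hΩ hh J
  have hc : 0 ≤ 2 * δ * L * b := by positivity
  have k1 := ENNReal.toReal_mono (ENNReal.mul_ne_top ENNReal.ofReal_ne_top fP) g1
  have k2 := ENNReal.toReal_mono (ENNReal.mul_ne_top ENNReal.ofReal_ne_top fP) g2
  have k3 := ENNReal.toReal_mono (ENNReal.add_ne_top.2 ⟨fr, fo⟩) g3
  have k4 := ENNReal.toReal_mono (ENNReal.mul_ne_top (tauNorm_lt_top hΩ).ne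
    (ENNReal.add_ne_top.2 ⟨ENNReal.add_ne_top.2 ⟨ENNReal.mul_ne_top ENNReal.ofReal_ne_top fr, fs⟩,
      ENNReal.mul_ne_top ENNReal.ofReal_ne_top fP⟩)) g4
  rw [ENNReal.toReal_mul, ENNReal.toReal_ofReal hc] at k1
  rw [ENNReal.toReal_mul, ENNReal.toReal_ofReal (by positivity)] at k2
  rw [ENNReal.toReal_add fr fo] at k3
  rw [ENNReal.toReal_mul, ENNReal.toReal_add (ENNReal.add_ne_top.2
      ⟨ENNReal.mul_ne_top ENNReal.ofReal_ne_top fr, fs⟩)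
      (ENNReal.mul_ne_top ENNReal.ofReal_ne_top fP),
    ENNReal.toReal_add (ENNReal.mul_ne_top ENNReal.ofReal_ne_top fr) fs, ENNReal.toReal_mul,
    ENNReal.toReal_mul, ENNReal.toReal_ofReal hκ, ENNReal.toReal_ofReal (by positivity)] at k4
  obtain ⟨p0, r0⟩ := closing_argument ENNReal.toReal_nonneg H.scatter_small H.mu_lt
    hc hsmall ENNReal.toReal_nonneg ENNReal.toReal_nonneg k3 k1 k2 k4
  have o0 : (⨅ J, o J).toReal = 0 := by
    rw [p0, mul_zero] at k1
    exact le_antisymm k1 ENNReal.toReal_nonneg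
  exact ⟨(ENNReal.toReal_eq_zero_iff _).1 o0 |>.resolve_right fo,
    (ENNReal.toReal_eq_zero_iff _).1 r0 |>.resolve_right fr⟩

/-- The averages of the ballistic parts converge almost everywhere. -/
lemma ae_cauchySeq_ballAver (hs : PeakSequence Ω σa σb k c₀ μ h θ' δ ε u q)
    (hw : NiceSolution Ω σa σb k (fun _ => c₀) (c₀ / (1 - μ)) w qw)
    (H : Coeff Ω σa σb k a b κ c₀ μ ν) (hΩ : IsDomainC1 Ω) (hh : IsCutoff h)
    (hk : IsLebesgueDirection Ω k θ') {L : ℝ} (hL0 : 0 < L) (hL : ∀ x ∈ Ω, ∀ y ∈ Ω, ‖x - y‖ < L)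
    (hsmall : 2 * δ * L * b + (tauNorm Ω).toReal *
      (b * regBound (tauNorm Ω).toReal b κ c₀ μ ν δ) < 1 - μ) :
    ∀ᵐ x ∂(volume.restrict Ω), CauchySeq fun j => ballAver Ω σa σb h θ' δ ε q j x := by
  have fin1 := isFiniteMeasure_restrict hΩ
  have hm : ∀ j, Measurable (ballAver Ω σa σb h θ' δ ε q j) := hs.measurable_ballAver H hΩ hh
  have h0 := (hs.iInf_eq_zero hw H hΩ hh hk hL0 hL hsmall).1
  rw [← lintegral_iInf_tailOsc (fun j => (hm j).aemeasurable) ENNReal.ofReal_ne_top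
    (fun j => .of_forall fun x => hs.enorm_ballAver_le H j x),
    lintegral_eq_zero_iff (.iInf fun J => measurable_tailOsc hm J)] at h0
  filter_upwards [h0] with x hx
  exact cauchySeq_of_iInf_eq_zero ENNReal.one_ne_top hx fun J j l hj hl => by
    rw [one_mul]
    exact le_tailOsc (ballAver Ω σa σb h θ' δ ε q) hj hl x

/-- The measurements converge almost everywhere as the peak concentrates. -/
lemma ae_cauchySeq_measurement (hs : PeakSequence Ω σa σb k c₀ μ h θ' δ ε u q)
    (hw : NiceSolution Ω σa σb k (fun _ => c₀) (c₀ / (1 - μ)) w qw)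
    (H : Coeff Ω σa σb k a b κ c₀ μ ν) (hΩ : IsDomainC1 Ω) (hh : IsCutoff h)
    (hk : IsLebesgueDirection Ω k θ') {L : ℝ} (hL0 : 0 < L) (hL : ∀ x ∈ Ω, ∀ y ∈ Ω, ‖x - y‖ < L)
    (hsmall : 2 * δ * L * b + (tauNorm Ω).toReal *
      (b * regBound (tauNorm Ω).toReal b κ c₀ μ ν δ) < 1 - μ) {r₀ γ : ℝ}
    (h1 : ∀ y, ‖y‖ ≤ r₀ → h y = 1) (hγ : 0 < γ) (hεγ : ∀ j, ε j ≤ r₀ * γ) :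
    ∀ᵐ x ∂(volume.restrict Ω), CauchySeq fun j => measurement h θ' δ γ (u j) x := by
  have hδ := hs.delta_pos
  have h0 := (hs.iInf_eq_zero hw H hΩ hh hk hL0 hL hsmall).2
  simp only [← hs.lintegral_regOsc H hΩ hh] at h0
  -- The oscillations tend to zero in L¹; by monotonicity in J this yields convergence to zero
  -- almost everywhere along the full sequence, without passing to a subsequence.
  have hz : ∫⁻ x in Ω, ⨅ J, regOsc Ω σa σb h θ' δ ε u q J x = 0 := by
    refine le_antisymm ?_ bot_le
    rw [← h0]
    exact le_iInf fun J => lintegral_mono fun x => iInf_le _ J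
  rw [lintegral_eq_zero_iff' (.iInf fun J => hs.aemeasurable_regOsc H hΩ hh J)] at hz
  have h2 : ∀ᵐ x ∂(volume.restrict Ω), ∀ j, measurement h θ' δ γ (u j) x
      - ballAver Ω σa σb h θ' δ ε q j x / δ
      = ∫ θ, reg Ω σa σb h θ' δ ε u q j (x, θ) / δ * bump h θ' γ θ ∂(sphereMeasure (m + 1)) :=
    ae_all_iff.2 fun j => (hs.solution j).ae_measurement_sub_eq H hΩ hh h1 hγ (hεγ j)
  have h3 : ∀ᵐ x ∂(volume.restrict Ω), ∀ j,
      Integrable (fun θ => reg Ω σa σb h θ' δ ε u q j (x, θ)) (sphereMeasure (m + 1)) :=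
    ae_all_iff.2 fun j => ae_integrable_slice
      (v := fun x θ => reg Ω σa σb h θ' δ ε u q j (x, θ))
      ((hs.solution j).solves_regular H hΩ hh).integrable
  filter_upwards [hz, h2, h3, hs.ae_cauchySeq_ballAver hw H hΩ hh hk hL0 hL hsmall]
    with x e1 e2 e3 e4
  have c1 : CauchySeq fun j => ∫ θ, reg Ω σa σb h θ' δ ε u q j (x, θ) / δ * bump h θ' γ θ
      ∂(sphereMeasure (m + 1)) := by
    refine cauchySeq_of_iInf_eq_zero (C := ENNReal.ofReal δ⁻¹) ENNReal.ofReal_ne_top e1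
      fun J j l hj hl => ?_
    rw [← integral_sub (PeakSolution.integrable_mul_bump hh ((e3 j).div_const δ) γ)
      (PeakSolution.integrable_mul_bump hh ((e3 l).div_const δ) γ)]
    refine (enorm_integral_le_lintegral_enorm _).trans ?_
    rw [regOsc, ← lintegral_const_mul' _ _ ENNReal.ofReal_ne_top]
    refine lintegral_mono fun θ => ?_
    rw [← sub_mul, ← sub_div, enorm_mul, div_eq_inv_mul, enorm_mul,
      Real.enorm_of_nonneg (inv_nonneg.2 hδ.le)]
    refine (mul_le_of_le_one_right bot_le ?_).trans (mul_le_mul_right (le_tailOsc _ hj hl (x, θ)) _)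
    rw [Real.enorm_of_nonneg (bump_nonneg hh _ _ _), ENNReal.ofReal_le_one]
    exact bump_le_one hh _ _ _
  obtain ⟨y₁, t1⟩ := cauchySeq_tendsto_of_complete c1
  obtain ⟨y₂, t2⟩ := cauchySeq_tendsto_of_complete e4
  refine ((t1.add (t2.div_const δ)).congr fun j => ?_).cauchySeq
  rw [← e2 j]
  ring

end PeakSequence

end TwoPhoton

end

noncomputable section

namespace TwoPhoton

/-! ### The iterated limit -/

/-- If a family converges along every sequence of parameters, the limits agree. -/
lemma exists_tendstoAE {X : Type*} [MeasurableSpace X] {ρ : Measure X} {F : ℝ → X → ℝ}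
    (hF : ∀ t : ℕ → ℝ, Tendsto t atTop (𝓝[>] 0) → ∀ᵐ x ∂ρ, CauchySeq fun j => F (t j) x) :
    ∃ G, TendstoAE ρ F G := by
  obtain ⟨t₀, ht₀⟩ := exists_seq_tendsto (𝓝[>] (0 : ℝ))
  refine ⟨fun x => limUnder atTop fun j => F (t₀ j) x, fun t ht => ?_⟩
  -- Interleaving t with a reference sequence t₀: a Cauchy sequence has the same limit along even
  -- and odd indices, so the limit along t is the one along t₀.
  have hs : Tendsto (fun j : ℕ => if Even j then t₀ (j / 2) else t (j / 2)) atTop (𝓝[>] 0) := by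
    have hd : Tendsto (fun j : ℕ => j / 2) atTop atTop := Nat.tendsto_div_const_atTop two_ne_zero
    exact (ht₀.comp hd).if' (ht.comp hd)
  filter_upwards [hF _ hs] with x hx
  obtain ⟨y, hy⟩ := cauchySeq_tendsto_of_complete hx
  have h0 : Tendsto (fun j => F (t₀ j) x) atTop (𝓝 y) := by
    have h2 : Tendsto (fun j : ℕ => 2 * j) atTop atTop :=
      tendsto_atTop_mono (fun j => by simp only [id]; omega) tendsto_id
    refine (hy.comp h2).congr fun j => ?_
    simp
  have h1 : Tendsto (fun j => F (t j) x) atTop (𝓝 y) := by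
    have h2 : Tendsto (fun j : ℕ => 2 * j + 1) atTop atTop :=
      tendsto_atTop_mono (fun j => by simp only [id]; omega) tendsto_id
    refine (hy.comp h2).congr fun j => ?_
    have : ¬ Even (2 * j + 1) := by simp
    have h3 : (2 * j + 1) / 2 = j := by omega
    simp [h3]
  rwa [h0.limUnder_eq]

variable {m : ℕ} {Ω : Set (Space (m + 1))} {h : Space (m + 1) → ℝ} {θ' : Sph (m + 1)}
  {σa σb : Space (m + 1) → ℝ} {k : Space (m + 1) → Sph (m + 1) → Sph (m + 1) → ℝ}
  {a b κ c₀ μ ν δ : ℝ} {w : Space (m + 1) → Sph (m + 1) → ℝ} {qw : Space (m + 1) → ℝ}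

/-- The error made by replacing the measurement with the ballistic average of the solution `w`. -/
lemma PeakSolution.ae_abs_measurement_sub_base_le {ε : ℝ} {u : Space (m + 1) → Sph (m + 1) → ℝ}
    {q : Space (m + 1) → ℝ} (hu : PeakSolution Ω σa σb k c₀ μ h θ' ε δ u q)
    (hw : NiceSolution Ω σa σb k (fun _ => c₀) (c₀ / (1 - μ)) w qw)
    (H : Coeff Ω σa σb k a b κ c₀ μ ν) (hΩ : IsDomainC1 Ω) (hh : IsCutoff h) {r₀ γ : ℝ}
    (h1 : ∀ y, ‖y‖ ≤ r₀ → h y = 1) (hγ : 0 < γ) (hεγ : ε ≤ r₀ * γ) :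
    ∀ᵐ x ∂(volume.restrict Ω), |measurement h θ' δ γ u x
      - aver (ballistic Ω h θ' ε δ (absorb σa σb qw)) x / δ|
      ≤ regBound (tauNorm Ω).toReal b κ c₀ μ ν δ / δ *
        (sphereMeasure (m + 1)).real (Metric.closedBall θ' γ)
        + 2 * (tauNorm Ω).toReal * b * lipConst μ ν * δ := by
  have hδ := hu.delta_pos
  filter_upwards [hu.ae_abs_measurement_sub_le hw H hΩ hh h1 hγ hεγ,
    hu.ae_abs_aver_ballistic_sub_le hw H hΩ hh] with x e1 e2
  refine (abs_sub_le _ (aver (ballistic Ω h θ' ε δ (absorb σa σb q)) x / δ) _).trans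
    (add_le_add e1 ?_)
  rw [← sub_div, abs_div, abs_of_pos hδ, div_le_iff₀' hδ]
  exact e2

/-- The ballistic averages of `w`, normalized. -/
lemma ae_tendsto_base (hw : NiceSolution Ω σa σb k (fun _ => c₀) (c₀ / (1 - μ)) w qw)
    (H : Coeff Ω σa σb k a b κ c₀ μ ν) (hΩ : IsDomainC1 Ω) (hh : IsCutoff h) (hδ : 0 < δ) :
    ∀ᵐ x ∂(volume.restrict Ω),
      Tendsto (fun ε => aver (ballistic Ω h θ' ε δ (absorb σa σb qw)) x / δ) (𝓝[>] 0)
        (𝓝 (lineExp Ω (absorb σa σb qw) (x, θ'))) := by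
  filter_upwards [ae_tendsto_aver_ballistic hΩ hh hδ (H.measurable_absorb hw.measurable)
    (H.absorb_nonneg hw.nonneg) (H.norm_absorb_le hw.nonneg hw.le) (θ' := θ')] with x hx
  have := hx.div_const δ
  rwa [mul_div_cancel_left₀ _ hδ.ne'] at this

/-- Three errors, each below η/3: O(δ) for replacing the absorption of u by that of w, a cap of
radius γ for the regular part once δ is fixed, and the convergence in ε with absorption frozen. No
limit for the actual absorptions is claimed, so θ' is arbitrary. -/
lemma ae_eventually_abs_measurement_sub_lt (hm : m ≠ 0)
    (hw : NiceSolution Ω σa σb k (fun _ => c₀) (c₀ / (1 - μ)) w qw)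
    (H : Coeff Ω σa σb k a b κ c₀ μ ν) (hΩ : IsDomainC1 Ω) (hh : IsCutoff h)
    {u : ℝ → ℝ → Space (m + 1) → Sph (m + 1) → ℝ}
    (hu : ∀ᶠ δ in 𝓝[>] (0 : ℝ), ∀ᶠ ε in 𝓝[>] (0 : ℝ),
      ∃ q, PeakSolution Ω σa σb k c₀ μ h θ' ε δ (u ε δ) q) {η : ℝ} (hη : 0 < η) :
    ∀ᶠ δ in 𝓝[>] (0 : ℝ), ∀ᶠ γ in 𝓝[>] (0 : ℝ), ∀ ε : ℕ → ℝ, Tendsto ε atTop (𝓝[>] 0) →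
      ∀ᵐ x ∂(volume.restrict Ω), ∀ᶠ j in atTop, |measurement h θ' δ γ (u (ε j) δ) x
        - lineExp Ω (absorb σa σb qw) (x, θ')| < η := by
  obtain ⟨r₀, hr0, -, h1⟩ := hh.exists_eq_one
  have hlin : Tendsto (fun δ : ℝ => 2 * (tauNorm Ω).toReal * b * lipConst μ ν * δ) (𝓝[>] 0) (𝓝 0) := by
    have : Tendsto (fun δ : ℝ => 2 * (tauNorm Ω).toReal * b * lipConst μ ν * δ) (𝓝 0)
        (𝓝 (2 * (tauNorm Ω).toReal * b * lipConst μ ν * 0)) := Continuous.tendsto (by fun_prop) _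
    rw [mul_zero] at this
    exact this.mono_left nhdsWithin_le_nhds
  filter_upwards [hu, hlin.eventually (gt_mem_nhds (show 0 < η / 3 by positivity)),
    self_mem_nhdsWithin] with δ hδu hδ1 hδ0
  have hcap := (tendsto_cap θ' hm).const_mul (regBound (tauNorm Ω).toReal b κ c₀ μ ν δ / δ)
  rw [mul_zero] at hcap
  filter_upwards [hcap.eventually (gt_mem_nhds (show 0 < η / 3 by positivity)),
    self_mem_nhdsWithin] with γ hγ1 hγ0 ε hε
  have hpos : 0 < r₀ * γ := mul_pos hr0 hγ0
  have hgood : ∀ᶠ j in atTop, (∃ q, PeakSolution Ω σa σb k c₀ μ h θ' (ε j) δ (u (ε j) δ) q) ∧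
      ε j ≤ r₀ * γ :=
    (hε.eventually hδu).and (hε.eventually (mem_nhdsWithin_of_mem_nhds (Iic_mem_nhds hpos)))
  have hall : ∀ᵐ x ∂(volume.restrict Ω), ∀ j,
      (∃ q, PeakSolution Ω σa σb k c₀ μ h θ' (ε j) δ (u (ε j) δ) q) ∧ ε j ≤ r₀ * γ →
      |measurement h θ' δ γ (u (ε j) δ) x
        - aver (ballistic Ω h θ' (ε j) δ (absorb σa σb qw)) x / δ|
      ≤ regBound (tauNorm Ω).toReal b κ c₀ μ ν δ / δ *
        (sphereMeasure (m + 1)).real (Metric.closedBall θ' γ)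
        + 2 * (tauNorm Ω).toReal * b * lipConst μ ν * δ := by
    refine ae_all_iff.2 fun j => ?_
    by_cases hj : (∃ q, PeakSolution Ω σa σb k c₀ μ h θ' (ε j) δ (u (ε j) δ) q) ∧ ε j ≤ r₀ * γ
    · obtain ⟨⟨q, hq⟩, hle⟩ := hj
      filter_upwards [hq.ae_abs_measurement_sub_base_le hw H hΩ hh h1 hγ0 hle] with x hx _ using hx
    · exact .of_forall fun x hx => absurd hx hj
  filter_upwards [hall, ae_tendsto_base hw H hΩ hh (θ' := θ') hδ0] with x e1 e2
  have e3 := (Metric.tendsto_nhds.1 (e2.comp hε)) (η / 3) (by positivity)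
  filter_upwards [hgood, e3] with j g1 g2
  rw [Function.comp_apply, Real.dist_eq] at g2
  have := abs_sub_le (measurement h θ' δ γ (u (ε j) δ) x)
    (aver (ballistic Ω h θ' (ε j) δ (absorb σa σb qw)) x / δ)
    (lineExp Ω (absorb σa σb qw) (x, θ'))
  linarith [e1 j g1]

/-- For small perturbations of the source, the two inner limits exist. -/
lemma exists_inner_limits (hm : m ≠ 0)
    (hw : NiceSolution Ω σa σb k (fun _ => c₀) (c₀ / (1 - μ)) w qw)
    (H : Coeff Ω σa σb k a b κ c₀ μ ν) (hΩ : IsDomainC1 Ω) (hh : IsCutoff h)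
    (hk : IsLebesgueDirection Ω k θ') {L : ℝ} (hL0 : 0 < L) (hL : ∀ x ∈ Ω, ∀ y ∈ Ω, ‖x - y‖ < L)
    (hδ : 0 < δ) (hsmall : 2 * δ * L * b + (tauNorm Ω).toReal *
      (b * regBound (tauNorm Ω).toReal b κ c₀ μ ν δ) < 1 - μ)
    {u : ℝ → Space (m + 1) → Sph (m + 1) → ℝ}
    (hu : ∀ᶠ ε in 𝓝[>] (0 : ℝ), ∃ q, PeakSolution Ω σa σb k c₀ μ h θ' ε δ (u ε) q) :
    ∃ (G₂ : ℝ → Space (m + 1) → ℝ) (G₁ : Space (m + 1) → ℝ),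
      (∀ᶠ γ in 𝓝[>] (0 : ℝ), TendstoAE (volume.restrict Ω)
        (fun ε => measurement h θ' δ γ (u ε)) (G₂ γ)) ∧
      TendstoAE (volume.restrict Ω) G₂ G₁ ∧
      ∀ᵐ x ∂(volume.restrict Ω), |G₁ x - lineExp Ω (absorb σa σb qw) (x, θ')|
        ≤ 2 * (tauNorm Ω).toReal * b * lipConst μ ν * δ := by
  obtain ⟨r₀, hr0, -, h1⟩ := hh.exists_eq_one
  -- One representative is chosen for every ε, with the dummy value 0 where no peak solution exists,
  -- so that sequences of parameters can share it.
  have hex : ∀ ε, ∃ q, (∃ q', PeakSolution Ω σa σb k c₀ μ h θ' ε δ (u ε) q') →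
      PeakSolution Ω σa σb k c₀ μ h θ' ε δ (u ε) q := fun ε => by
    by_cases hε : ∃ q', PeakSolution Ω σa σb k c₀ μ h θ' ε δ (u ε) q'
    · exact ⟨hε.choose, fun _ => hε.choose_spec⟩
    · exact ⟨0, fun hε' => absurd hε' hε⟩
  choose q hq using hex
  have hgood : ∀ᶠ ε in 𝓝[>] (0 : ℝ), PeakSolution Ω σa σb k c₀ μ h θ' ε δ (u ε) (q ε) :=
    hu.mono fun ε hε => hq ε hε
  -- The hypotheses hold for small ε only, so finitely many initial terms of a parameter sequence
  -- are dropped.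
  have hshift : ∀ {f : ℕ → ℝ} (N : ℕ), (CauchySeq fun j => f (j + N)) → CauchySeq f :=
    fun N hf => by
      obtain ⟨y, hy⟩ := cauchySeq_tendsto_of_complete hf
      exact ((tendsto_add_atTop_iff_nat N).1 hy).cauchySeq
  have hM : ∀ γ, ∃ G, 0 < γ → TendstoAE (volume.restrict Ω)
      (fun ε => measurement h θ' δ γ (u ε)) G := fun γ => by
    by_cases hγ : 0 < γ
    · obtain ⟨G, hG⟩ := exists_tendstoAE (ρ := volume.restrict Ω)
        (F := fun ε => measurement h θ' δ γ (u ε)) fun t ht => by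
        have hle : ∀ᶠ ε in 𝓝[>] (0 : ℝ), ε ≤ r₀ * γ :=
          mem_nhdsWithin_of_mem_nhds (Iic_mem_nhds (mul_pos hr0 hγ))
        obtain ⟨N, hN⟩ := eventually_atTop.1 (ht.eventually (hgood.and hle))
        have hs : PeakSequence Ω σa σb k c₀ μ h θ' δ (fun j => t (j + N)) (fun j => u (t (j + N)))
            (fun j => q (t (j + N))) :=
          ⟨ht.comp (tendsto_add_atTop_nat N), fun j => (hN _ (Nat.le_add_left N j)).1⟩
        filter_upwards [hs.ae_cauchySeq_measurement hw H hΩ hh hk hL0 hL hsmall h1 hγ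
          fun j => (hN _ (Nat.le_add_left N j)).2] with x hx
        exact hshift N hx
      exact ⟨G, fun _ => hG⟩
    · exact ⟨0, fun hγ' => absurd hγ' hγ⟩
  choose G₂ hG₂ using hM
  -- The candidate for the limit in γ is the limit in ε of the normalized ballistic averages. It
  -- does not involve γ, because eventually ε ≤ r₀γ, and it differs from the limit of the
  -- measurements by the cap term only.
  obtain ⟨G₁, hG₁⟩ := exists_tendstoAE (ρ := volume.restrict Ω)
    (F := fun ε x => aver (ballistic Ω h θ' ε δ (absorb σa σb (q ε))) x / δ) fun t ht => by
      obtain ⟨N, hN⟩ := eventually_atTop.1 (ht.eventually hgood)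
      have hs : PeakSequence Ω σa σb k c₀ μ h θ' δ (fun j => t (j + N)) (fun j => u (t (j + N)))
          (fun j => q (t (j + N))) :=
        ⟨ht.comp (tendsto_add_atTop_nat N), fun j => hN _ (Nat.le_add_left N j)⟩
      filter_upwards [hs.ae_cauchySeq_ballAver hw H hΩ hh hk hL0 hL hsmall] with x hx
      obtain ⟨y, hy⟩ := cauchySeq_tendsto_of_complete hx
      exact hshift N (hy.div_const δ).cauchySeq
  obtain ⟨t, ht⟩ := exists_seq_tendsto (𝓝[>] (0 : ℝ))
  refine ⟨G₂, G₁, ?_, fun s hs => ?_, ?_⟩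
  · filter_upwards [self_mem_nhdsWithin] with γ hγ using hG₂ γ hγ
  · have hcap := (tendsto_cap θ' hm).const_mul (regBound (tauNorm Ω).toReal b κ c₀ μ ν δ / δ)
    rw [mul_zero] at hcap
    have hall : ∀ᵐ x ∂(volume.restrict Ω), ∀ i, 0 < s i → |G₂ (s i) x - G₁ x| ≤
        regBound (tauNorm Ω).toReal b κ c₀ μ ν δ / δ *
          (sphereMeasure (m + 1)).real (Metric.closedBall θ' (s i)) := by
      refine ae_all_iff.2 fun i => ?_
      by_cases hi : 0 < s i
      · have hle : ∀ᶠ ε in 𝓝[>] (0 : ℝ), ε ≤ r₀ * s i :=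
          mem_nhdsWithin_of_mem_nhds (Iic_mem_nhds (mul_pos hr0 hi))
        obtain ⟨N, hN⟩ := eventually_atTop.1 (ht.eventually (hgood.and hle))
        have hb : ∀ᵐ x ∂(volume.restrict Ω), ∀ j, |measurement h θ' δ (s i) (u (t (j + N))) x
            - aver (ballistic Ω h θ' (t (j + N)) δ (absorb σa σb (q (t (j + N))))) x / δ|
            ≤ regBound (tauNorm Ω).toReal b κ c₀ μ ν δ / δ *
              (sphereMeasure (m + 1)).real (Metric.closedBall θ' (s i)) :=
          ae_all_iff.2 fun j => (hN _ (Nat.le_add_left N j)).1.ae_abs_measurement_sub_le hw H hΩ hh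
            h1 hi (hN _ (Nat.le_add_left N j)).2
        filter_upwards [hG₂ _ hi _ (ht.comp (tendsto_add_atTop_nat N)),
          hG₁ _ (ht.comp (tendsto_add_atTop_nat N)), hb] with x e1 e2 e3 _
        exact le_of_tendsto' (e1.sub e2).abs e3
      · exact .of_forall fun x hx => absurd hx hi
    filter_upwards [hall] with x hx
    rw [tendsto_iff_norm_sub_tendsto_zero]
    refine squeeze_zero' (.of_forall fun _ => norm_nonneg _) ?_ (hcap.comp hs)
    filter_upwards [hs.eventually self_mem_nhdsWithin] with i hi using hx i hi
  · obtain ⟨N, hN⟩ := eventually_atTop.1 (ht.eventually hgood)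
    have hb : ∀ᵐ x ∂(volume.restrict Ω), ∀ j,
        |aver (ballistic Ω h θ' (t (j + N)) δ (absorb σa σb (q (t (j + N))))) x
          - aver (ballistic Ω h θ' (t (j + N)) δ (absorb σa σb qw)) x|
        ≤ δ * (2 * (tauNorm Ω).toReal * b * lipConst μ ν * δ) :=
      ae_all_iff.2 fun j => (hN _ (Nat.le_add_left N j)).ae_abs_aver_ballistic_sub_le hw H hΩ hh
    have htN := ht.comp (tendsto_add_atTop_nat N)
    filter_upwards [hG₁ _ htN, ae_tendsto_base hw H hΩ hh (θ' := θ') hδ, hb] with x e1 e2 e3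
    refine le_of_tendsto' (e1.sub (e2.comp htN)).abs fun j => ?_
    simp only [Function.comp_apply]
    rw [← sub_div, abs_div, abs_of_pos hδ, div_le_iff₀' hδ]
    exact e3 j

/-- At δ = 0 the left side is ‖τ‖bc₀/(1 - μ) ≤ ν(1 - μ) < 1 - μ, and it is continuous in δ. -/
lemma eventually_small (H : Coeff Ω σa σb k a b κ c₀ μ ν) (L : ℝ) :
    ∀ᶠ δ in 𝓝[>] (0 : ℝ), 2 * δ * L * b + (tauNorm Ω).toReal *
      (b * regBound (tauNorm Ω).toReal b κ c₀ μ ν δ) < 1 - μ := by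
  have hμ : 0 < 1 - μ := by linarith [H.mu_lt]
  have h0 : 2 * 0 * L * b + (tauNorm Ω).toReal *
      (b * regBound (tauNorm Ω).toReal b κ c₀ μ ν 0) < 1 - μ := by
    have h1 : 2 * 0 * L * b + (tauNorm Ω).toReal *
      (b * regBound (tauNorm Ω).toReal b κ c₀ μ ν 0) = (tauNorm Ω).toReal * b * c₀ / (1 - μ) := by
      rw [regBound]
      ring
    rw [h1, div_lt_iff₀ hμ]
    have := H.nonlin_small
    nlinarith [H.nu_lt, mul_pos hμ hμ]
  have hc : Continuous fun δ : ℝ => 2 * δ * L * b + (tauNorm Ω).toReal *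
      (b * regBound (tauNorm Ω).toReal b κ c₀ μ ν δ) := by
    unfold regBound
    fun_prop
  exact ((hc.tendsto 0).mono_left nhdsWithin_le_nhds).eventually (gt_mem_nhds h0)

lemma iteratedLimitAE_measurement (hm : m ≠ 0)
    (hw : NiceSolution Ω σa σb k (fun _ => c₀) (c₀ / (1 - μ)) w qw)
    (H : Coeff Ω σa σb k a b κ c₀ μ ν) (hΩ : IsDomainC1 Ω) (hh : IsCutoff h)
    (hk : IsLebesgueDirection Ω k θ') {u : ℝ → ℝ → Space (m + 1) → Sph (m + 1) → ℝ}
    (hu : ∀ᶠ δ in 𝓝[>] (0 : ℝ), ∀ᶠ ε in 𝓝[>] (0 : ℝ),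
      ∃ q, PeakSolution Ω σa σb k c₀ μ h θ' ε δ (u ε δ) q) :
    IteratedLimitAE (volume.restrict Ω) (fun ε δ γ => measurement h θ' δ γ (u ε δ))
      fun x => lineExp Ω (absorb σa σb qw) (x, θ') := by
  obtain ⟨L, hL0, hL⟩ := exists_tau_le hΩ
  have hgood : ∀ᶠ δ in 𝓝[>] (0 : ℝ), 0 < δ ∧ (2 * δ * L * b + (tauNorm Ω).toReal *
      (b * regBound (tauNorm Ω).toReal b κ c₀ μ ν δ) < 1 - μ) ∧
      ∀ᶠ ε in 𝓝[>] (0 : ℝ), ∃ q, PeakSolution Ω σa σb k c₀ μ h θ' ε δ (u ε δ) q := by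
    filter_upwards [self_mem_nhdsWithin, eventually_small H L, hu] with δ h1 h2 h3
    exact ⟨h1, h2, h3⟩
  have hex : ∀ δ, ∃ (G₂ : ℝ → Space (m + 1) → ℝ) (G₁ : Space (m + 1) → ℝ),
      (0 < δ ∧ (2 * δ * L * b + (tauNorm Ω).toReal *
        (b * regBound (tauNorm Ω).toReal b κ c₀ μ ν δ) < 1 - μ) ∧
        ∀ᶠ ε in 𝓝[>] (0 : ℝ), ∃ q, PeakSolution Ω σa σb k c₀ μ h θ' ε δ (u ε δ) q) →
      (∀ᶠ γ in 𝓝[>] (0 : ℝ), TendstoAE (volume.restrict Ω)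
        (fun ε => measurement h θ' δ γ (u ε δ)) (G₂ γ)) ∧
      TendstoAE (volume.restrict Ω) G₂ G₁ ∧
      ∀ᵐ x ∂(volume.restrict Ω), |G₁ x - lineExp Ω (absorb σa σb qw) (x, θ')|
        ≤ 2 * (tauNorm Ω).toReal * b * lipConst μ ν * δ := fun δ => by
    by_cases hδ : 0 < δ ∧ (2 * δ * L * b + (tauNorm Ω).toReal *
        (b * regBound (tauNorm Ω).toReal b κ c₀ μ ν δ) < 1 - μ) ∧
        ∀ᶠ ε in 𝓝[>] (0 : ℝ), ∃ q, PeakSolution Ω σa σb k c₀ μ h θ' ε δ (u ε δ) q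
    · obtain ⟨G₂, G₁, hG⟩ := exists_inner_limits hm hw H hΩ hh hk hL0 hL hδ.1 hδ.2.1 hδ.2.2
      exact ⟨G₂, G₁, fun _ => hG⟩
    · exact ⟨0, 0, fun hδ' => absurd hδ' hδ⟩
  choose G₂ G₁ hG using hex
  refine ⟨G₂, G₁, hgood.mono fun δ hδ => ⟨(hG δ hδ).1, (hG δ hδ).2.1⟩, fun t ht => ?_⟩
  obtain ⟨N, hN⟩ := eventually_atTop.1 (ht.eventually hgood)
  have hall : ∀ᵐ x ∂(volume.restrict Ω), ∀ j,
      |G₁ (t (j + N)) x - lineExp Ω (absorb σa σb qw) (x, θ')|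
        ≤ 2 * (tauNorm Ω).toReal * b * lipConst μ ν * t (j + N) :=
    ae_all_iff.2 fun j => (hG _ (hN _ (Nat.le_add_left N j))).2.2
  have ht0 : Tendsto (fun j => 2 * (tauNorm Ω).toReal * b * lipConst μ ν * t (j + N)) atTop
      (𝓝 0) := by
    have := ((tendsto_nhds_of_tendsto_nhdsWithin ht).comp (tendsto_add_atTop_nat N)).const_mul
      (2 * (tauNorm Ω).toReal * b * lipConst μ ν)
    rwa [mul_zero] at this
  filter_upwards [hall] with x hx
  rw [← tendsto_add_atTop_iff_nat N, tendsto_iff_norm_sub_tendsto_zero]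
  exact squeeze_zero (fun _ => norm_nonneg _) hx ht0

end TwoPhoton

end

noncomputable section

namespace TwoPhoton

/-! ### Injectivity of the X-ray transform -/

section XRay

variable {n : ℕ}

lemma measurePreserving_line (v : Space n) :
    MeasurePreserving (fun p : ℝ × Space n => (p.1, p.2 - p.1 • v))
      ((volume : Measure ℝ).prod volume) ((volume : Measure ℝ).prod volume) :=
  (MeasurePreserving.id volume).skew_product (g := fun s x => x - s • v)
    (by unfold Function.uncurry; fun_prop)
    (.of_forall fun s => (measurePreserving_sub_right volume (s • v)).map_eq)

lemma measurePreserving_tilt (v : Space n) :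
    MeasurePreserving (fun p : ℝ × Space n => (p.1 + inner ℝ p.2 v, p.2))
      ((volume : Measure ℝ).prod volume) ((volume : Measure ℝ).prod volume) := by
  have h : MeasurePreserving (fun p : Space n × ℝ => (p.1, p.2 + inner ℝ p.1 v))
      ((volume : Measure (Space n)).prod volume) ((volume : Measure (Space n)).prod volume) :=
    (MeasurePreserving.id volume).skew_product (g := fun x s => s + inner ℝ x v)
      (by unfold Function.uncurry; fun_prop)
      (.of_forall fun x => (measurePreserving_add_right volume (inner ℝ x v)).map_eq)
  exact Measure.measurePreserving_swap.comp (h.comp Measure.measurePreserving_swap)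

lemma ae_ae_line {Q : Space n → Prop} (h : ∀ᵐ x, Q x) (v : Space n) :
    ∀ᵐ x : Space n, ∀ᵐ s : ℝ, Q (x - s • v) := by
  have h1 : ∀ᵐ p ∂((volume : Measure ℝ).prod (volume : Measure (Space n))), Q p.2 :=
    Measure.quasiMeasurePreserving_snd.ae h
  exact Measure.ae_ae_of_ae_prod ((Measure.measurePreserving_swap.quasiMeasurePreserving).ae
    ((measurePreserving_line v).quasiMeasurePreserving.ae h1))

/-- The Fourier slice theorem for functions whose integrals along the lines in a direction
vanish. -/
lemma fourier_eq_zero {f : Space n → ℝ} (hf : Integrable f) {v ξ : Space n} (hv : ‖v‖ = 1)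
    (hξ : inner ℝ v ξ = 0) (h : ∀ᵐ x : Space n, ∫ s : ℝ, f (x - s • v) = 0) :
    ∫ x : Space n, Complex.exp (inner ℝ x ξ * Complex.I) * f x = 0 := by
  set e : Space n → ℂ := fun x => Complex.exp (inner ℝ x ξ * Complex.I) with he
  have hec : Continuous e := by fun_prop
  have hen : ∀ x, ‖e x‖ = 1 := fun x => Complex.norm_exp_ofReal_mul_I _
  -- An auxiliary variable with a window of integral one. The volume preserving map (s, x) ↦ (x·v, x
  -- - sv) turns ψ(s)e(x)f(x) into ψ(x·v)e(x)f(x - sv), as ξ is orthogonal to v, and the integral in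
  -- s is then a line integral of f. No splitting of space along v is needed.
  set ψ : ℝ → ℂ := (Ioc (0 : ℝ) 1).indicator 1 with hψ
  have hψi : Integrable ψ := (integrable_indicator_iff measurableSet_Ioc).2
    (integrableOn_const (by simp))
  have hψ1 : ∫ s, ψ s = 1 := by
    rw [hψ, integral_indicator measurableSet_Ioc]
    simp
  have hef : Integrable fun x => e x * (f x : ℂ) :=
    hf.ofReal.bdd_mul (c := 1) hec.aestronglyMeasurable (.of_forall fun x => (hen x).le)
  set G : ℝ × Space n → ℂ := fun p => ψ p.1 * (e p.2 * f p.2) with hG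
  have hGi : Integrable G ((volume : Measure ℝ).prod volume) := hψi.mul_prod hef
  have hT := (measurePreserving_tilt v).comp (measurePreserving_line v)
  have hcomp : ∀ p : ℝ × Space n, (G ∘ ((fun p : ℝ × Space n => (p.1 + inner ℝ p.2 v, p.2)) ∘
      fun p : ℝ × Space n => (p.1, p.2 - p.1 • v))) p
      = ψ (inner ℝ p.2 v) * e p.2 * f (p.2 - p.1 • v) := fun p => by
    have h1 : p.1 + inner ℝ (p.2 - p.1 • v) v = inner ℝ p.2 v := by
      rw [inner_sub_left, real_inner_smul_left, real_inner_self_eq_norm_sq, hv]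
      ring
    have h2 : inner ℝ (p.2 - p.1 • v) ξ = inner ℝ p.2 ξ := by
      rw [inner_sub_left, real_inner_smul_left, hξ]
      ring
    simp only [Function.comp_apply, hG, h1, he, h2]
    ring
  have hHi := (hT.integrable_comp hGi.1).2 hGi
  have hint : ∫ p, G p ∂((volume : Measure ℝ).prod volume) = ∫ x, e x * (f x : ℂ) := by
    rw [hG, integral_prod_mul ψ (fun x => e x * (f x : ℂ)), hψ1, one_mul]
  rw [← hint, ← hT.map_eq, integral_map hT.aemeasurable (by rw [hT.map_eq]; exact hGi.1)]
  change ∫ p, (G ∘ _) p ∂_ = 0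
  rw [integral_prod_symm _ hHi]
  refine integral_eq_zero_of_ae ?_
  filter_upwards [h] with x hx
  simp only [hcomp]
  rw [integral_const_mul, integral_complex_ofReal, hx]
  simp

lemma exists_sph_orthogonal (hn : 2 ≤ n) (ξ : Space n) :
    ∃ θ : Sph n, inner ℝ (θ : Space n) ξ = 0 := by
  have hker : LinearMap.ker (innerₛₗ ℝ ξ : Space n →ₗ[ℝ] ℝ) ≠ ⊥ := by
    refine LinearMap.ker_ne_bot_of_finrank_lt ?_
    rw [Module.finrank_self, finrank_euclideanSpace_fin]
    omega
  obtain ⟨y, hy, hy0⟩ := Submodule.exists_mem_ne_zero_of_ne_bot hker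
  have h0 : inner ℝ ξ y = 0 := hy
  refine ⟨⟨‖y‖⁻¹ • y, by simp [norm_smul, hy0]⟩, ?_⟩
  simp only [real_inner_smul_left]
  rw [real_inner_comm, h0, mul_zero]

/-- An integrable function with vanishing Fourier transform is zero. -/
lemma ae_eq_zero_of_fourier_eq_zero {f : Space n → ℝ} (hfm : Measurable f) (hf : Integrable f)
    (h : ∀ ξ : Space n, ∫ x : Space n, Complex.exp (inner ℝ x ξ * Complex.I) * f x = 0) :
    f =ᵐ[volume] 0 := by
  have hpm : Measurable fun x => ENNReal.ofReal (f x) := hfm.ennreal_ofReal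
  have hnm : Measurable fun x => ENNReal.ofReal (-f x) := hfm.neg.ennreal_ofReal
  have fin1 : IsFiniteMeasure (volume.withDensity fun x => ENNReal.ofReal (f x)) :=
    isFiniteMeasure_withDensity_ofReal hf.2
  have fin2 : IsFiniteMeasure (volume.withDensity fun x => ENNReal.ofReal (-f x)) :=
    isFiniteMeasure_withDensity_ofReal hf.neg.2
  -- The positive and the negative part of f are densities of finite measures with equal
  -- characteristic functions.
  have heq : volume.withDensity (fun x => ENNReal.ofReal (f x))
      = volume.withDensity (fun x => ENNReal.ofReal (-f x)) := by
    refine Measure.ext_of_charFun (funext fun ξ => ?_)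
    have hb : ∀ {g : Space n → ℝ}, Integrable g → Integrable fun x =>
        ((max (g x) 0 : ℝ) : ℂ) * Complex.exp (inner ℝ x ξ * Complex.I) := fun hg =>
      hg.pos_part.ofReal.mul_bdd (c := 1)
        (Continuous.aestronglyMeasurable (by fun_prop))
        (.of_forall fun x => (Complex.norm_exp_ofReal_mul_I _).le)
    rw [charFun_apply, charFun_apply,
      integral_withDensity_eq_integral_toReal_smul hpm (.of_forall fun _ => ENNReal.ofReal_lt_top),
      integral_withDensity_eq_integral_toReal_smul hnm (.of_forall fun _ => ENNReal.ofReal_lt_top)]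
    simp only [ENNReal.toReal_ofReal', Complex.real_smul]
    have hneg := hb hf.neg
    simp only [Pi.neg_apply] at hneg
    rw [← sub_eq_zero, ← integral_sub (hb hf) hneg, ← h ξ]
    congr 1 with x
    rw [← sub_mul, mul_comm, ← Complex.ofReal_sub]
    congr 2
    rcases le_total 0 (f x) with hx | hx
    · rw [max_eq_left hx, max_eq_right (neg_nonpos.2 hx), sub_zero]
    · rw [max_eq_right hx, max_eq_left (neg_nonneg.2 hx), zero_sub, neg_neg]
  have hae := (withDensity_eq_iff hpm.aemeasurable hnm.aemeasurable
    hf.lintegral_lt_top.ne).1 heq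
  filter_upwards [hae] with x hx
  rcases le_total 0 (f x) with h0 | h0
  · rw [ENNReal.ofReal_of_nonpos (neg_nonpos.2 h0), ENNReal.ofReal_eq_zero] at hx
    exact le_antisymm hx h0
  · rw [ENNReal.ofReal_of_nonpos h0, eq_comm, ENNReal.ofReal_eq_zero] at hx
    exact le_antisymm h0 (neg_nonpos.1 hx)

end XRay

/-- A function whose integrals along almost all lines vanish is zero. -/
theorem ae_eq_zero_of_ae_integral_line_eq_zero {m : ℕ} (hm : m ≠ 0) {f : Space (m + 1) → ℝ}
    (hfm : Measurable f) (hf : Integrable f)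
    (h : ∀ᵐ θ : Sph (m + 1) ∂(sphereMeasure (m + 1)), ∀ᵐ x : Space (m + 1),
      ∫ s : ℝ, f (x - s • (θ : Space (m + 1))) = 0) :
    f =ᵐ[volume] 0 := by
  refine ae_eq_zero_of_fourier_eq_zero hfm hf fun ξ => ?_
  set Φ : Space (m + 1) → ℂ := fun ζ =>
    ∫ x : Space (m + 1), Complex.exp (inner ℝ x ζ * Complex.I) * f x with hΦ
  have hΦc : Continuous Φ := by
    refine continuous_of_dominated (μ := volume) (bound := fun x => ‖f x‖) (fun ζ => ?_) (fun ζ => ?_) hf.norm ?_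
    · exact (Continuous.aestronglyMeasurable (by fun_prop)).mul
        (Complex.continuous_ofReal.comp_aestronglyMeasurable hf.1)
    · refine .of_forall fun x => ?_
      rw [norm_mul, Complex.norm_exp_ofReal_mul_I, one_mul, Complex.norm_real]
    · exact .of_forall fun x => by fun_prop
  -- The projection of ξ to the hyperplane orthogonal to θ. By the slice theorem Φ ∘ p vanishes for
  -- almost every θ, hence for every θ by continuity. In dimension at least two some θ is orthogonal
  -- to ξ, and there p(θ) = ξ.
  set p : Sph (m + 1) → Space (m + 1) := fun θ =>
    ξ - inner ℝ (θ : Space (m + 1)) ξ • (θ : Space (m + 1)) with hp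
  have hpc : Continuous p := by fun_prop
  have hae : (fun θ => Φ (p θ)) =ᵐ[sphereMeasure (m + 1)] fun _ => 0 := by
    filter_upwards [h] with θ hθ
    refine fourier_eq_zero hf (norm_sph θ) ?_ hθ
    simp only [hp]
    rw [inner_sub_right, real_inner_smul_right, real_inner_self_eq_norm_sq, norm_sph]
    ring
  have hall := (Continuous.ae_eq_iff_eq (sphereMeasure (m + 1)) (hΦc.comp hpc)
    continuous_const).1 hae
  obtain ⟨θ, hθ⟩ := exists_sph_orthogonal (n := m + 1) (by omega) ξ
  have := congrFun hall θ
  simp only [Function.comp_apply, hp, hθ, zero_smul, sub_zero] at this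
  exact this

end TwoPhoton

end

noncomputable section

namespace TwoPhoton

/-! ### Determination of the absorption from the attenuation along chords -/

section Chords

variable {n : ℕ} {Ω : Set (Space n)}

lemma integral_chord_eq (hΩ : IsDomainC1 Ω) {x : Space n} (hx : x ∈ Ω) (θ : Sph n)
    (f : Space n → ℝ) :
    ∫ s in (-(tauPlus Ω x θ))..(tauMinus Ω x θ), f (x - s • (θ : Space n))
      = ∫ s : ℝ, Ω.indicator f (x - s • (θ : Space n)) := by
  have h1 := tauPlus_pos hΩ hx θ
  have h2 := tauMinus_pos hΩ hx θ
  rw [intervalIntegral.integral_of_le (by linarith), integral_Ioc_eq_integral_Ioo,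
    ← integral_indicator measurableSet_Ioo]
  congr 1 with s
  by_cases hs : x - s • (θ : Space n) ∈ Ω
  · rw [indicator_of_mem hs, indicator_of_mem ((mem_line_iff hΩ hx θ s).1 hs)]
  · rw [indicator_of_notMem hs, indicator_of_notMem fun h => hs ((mem_line_iff hΩ hx θ s).2 h)]

lemma integrable_indicator_line (hΩ : IsDomainC1 Ω) {x : Space n} (hx : x ∈ Ω) (θ : Sph n)
    {f : Space n → ℝ} (hf : Measurable f) {B : ℝ} (hB : ∀ x, |f x| ≤ B) :
    Integrable fun s : ℝ => Ω.indicator f (x - s • (θ : Space n)) := by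
  have h1 : IntegrableOn (fun s : ℝ => Ω.indicator f (x - s • (θ : Space n)))
      (Ioo (-tauPlus Ω x θ) (tauMinus Ω x θ)) := by
    refine IntegrableOn.of_bound (by simp)
      ((hf.indicator hΩ.isOpen.measurableSet).comp (by fun_prop)).aestronglyMeasurable B
      (.of_forall fun s => ?_)
    by_cases hs : x - s • (θ : Space n) ∈ Ω
    · rw [indicator_of_mem hs]; exact hB _
    · rw [indicator_of_notMem hs, norm_zero]; exact (abs_nonneg _).trans (hB x)
  rw [← integrableOn_univ]
  refine h1.of_forall_sdiff_eq_zero MeasurableSet.univ fun s hs => indicator_of_notMem (fun hm => ?_) _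
  exact hs.2 ((mem_line_iff hΩ hx θ s).1 hm)

lemma chordAttenuation_ae_eq (hΩ : IsDomainC1 Ω) {σa σb σa' σb' : Space n → ℝ}
    {w : Space n → Sph n → ℝ} {m : Space n → ℝ}
    (ha : ∀ᵐ x ∂(volume.restrict Ω), σa x = σa' x) (hb : ∀ᵐ x ∂(volume.restrict Ω), σb x = σb' x)
    (hm : ∀ᵐ x ∂(volume.restrict Ω), |aver w x| = m x) (θ : Sph n) :
    ∀ᵐ x ∂(volume.restrict Ω), chordAttenuation Ω (fun x _ => σa x) (fun x _ => σb x) w θ x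
      = Real.exp (-∫ s : ℝ, Ω.indicator (absorb σa' σb' m) (x - s • (θ : Space n))) := by
  have h : ∀ᵐ x, x ∈ Ω →
      Sig (fun x _ => σa x) (fun x _ => σb x) (fun y => |aver w y|) x θ = -absorb σa' σb' m x := by
    rw [← ae_restrict_iff' hΩ.isOpen.measurableSet]
    filter_upwards [ha, hb, hm] with x h1 h2 h3
    rw [Sig, absorb, h1, h2, h3]
  filter_upwards [ae_restrict_of_ae (ae_ae_line h (θ : Space n)),
    ae_restrict_mem hΩ.isOpen.measurableSet] with x h1 hx
  rw [chordAttenuation, integral_chord_eq hΩ hx θ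
    (fun y => Sig (fun x _ => σa x) (fun x _ => σb x) (fun y => |aver w y|) y θ), ← integral_neg]
  congr 1
  refine integral_congr_ae ?_
  filter_upwards [h1] with s hs
  by_cases hm : x - s • (θ : Space n) ∈ Ω
  · rw [indicator_of_mem hm, indicator_of_mem hm, hs hm]
  · rw [indicator_of_notMem hm, indicator_of_notMem hm, neg_zero]

/-- If the integrals of a function vanish along almost every line through `Ω`, they vanish along
almost every line. -/
lemma ae_integral_line_eq_zero (hΩ : IsOpen Ω) {f : Space n → ℝ} {v : Space n}
    (h : ∀ᵐ x ∂(volume.restrict Ω), ∫ s : ℝ, Ω.indicator f (x - s • v) = 0) :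
    ∀ᵐ x : Space n, ∫ s : ℝ, Ω.indicator f (x - s • v) = 0 := by
  rw [ae_restrict_iff' hΩ.measurableSet] at h
  -- A line that meets Ω does so for an open set of parameters, hence at a rational one. Countably
  -- many translates of the null set therefore suffice.
  have hq : ∀ᵐ x : Space n, ∀ r : ℚ, x - (r : ℝ) • v ∈ Ω →
      ∫ s : ℝ, Ω.indicator f (x - (r : ℝ) • v - s • v) = 0 :=
    ae_all_iff.2 fun r =>
      (measurePreserving_sub_right volume ((r : ℝ) • v)).quasiMeasurePreserving.ae h
  filter_upwards [hq] with x hx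
  by_cases hne : ∃ s : ℝ, x - s • v ∈ Ω
  · have hopen : IsOpen {s : ℝ | x - s • v ∈ Ω} := hΩ.preimage (by fun_prop)
    obtain ⟨r, hr⟩ := Rat.denseRange_cast.exists_mem_open hopen hne
    rw [← hx r hr, ← integral_add_left_eq_self (fun s : ℝ => Ω.indicator f (x - s • v)) (r : ℝ)]
    simp only [sub_sub, add_smul]
  · push Not at hne
    simp [indicator_of_notMem (hne _)]

end Chords

variable {m : ℕ} {Ω : Set (Space (m + 1))}

lemma ae_eq_of_ae_chord (hm : m ≠ 0) (hΩ : IsDomainC1 Ω) {A A' : Space (m + 1) → ℝ}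
    (hA : Measurable A) (hA' : Measurable A') {B B' : ℝ} (hB : ∀ x, |A x| ≤ B)
    (hB' : ∀ x, |A' x| ≤ B')
    (h : ∀ᵐ θ : Sph (m + 1) ∂(sphereMeasure (m + 1)), ∀ᵐ x ∂(volume.restrict Ω),
      ∫ s : ℝ, Ω.indicator A (x - s • (θ : Space (m + 1)))
        = ∫ s : ℝ, Ω.indicator A' (x - s • (θ : Space (m + 1)))) :
    ∀ᵐ x ∂(volume.restrict Ω), A x = A' x := by
  have hΩm := hΩ.isOpen.measurableSet
  have hDb : ∀ x, |A x - A' x| ≤ B + B' := fun x =>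
    (abs_sub _ _).trans (add_le_add (hB x) (hB' x))
  have hint : Integrable (Ω.indicator fun x => A x - A' x) := by
    rw [integrable_indicator_iff hΩm]
    exact IntegrableOn.of_bound hΩ.isBounded.measure_lt_top
      (hA.sub hA').aestronglyMeasurable (B + B') (.of_forall hDb)
  have hz := ae_eq_zero_of_ae_integral_line_eq_zero hm ((hA.sub hA').indicator hΩm) hint (by
    filter_upwards [h] with θ hθ
    refine ae_integral_line_eq_zero hΩ.isOpen ?_
    filter_upwards [hθ, ae_restrict_mem hΩm] with x h1 hx
    rw [← sub_eq_zero, ← integral_sub (integrable_indicator_line hΩ hx θ hA hB)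
      (integrable_indicator_line hΩ hx θ hA' hB')] at h1
    rw [← h1]
    congr 1 with s
    exact congrFun (indicator_sub Ω A A') _)
  rw [ae_restrict_iff' hΩm]
  filter_upwards [hz] with x hx hxΩ
  rw [indicator_of_mem hxΩ] at hx
  exact sub_eq_zero.1 hx

/-! ### Recovery of the average from the total absorption. -/

section Uniqueness

variable {n : ℕ} {Ω : Set (Space n)} [IsProbabilityMeasure (sphereMeasure n)]
  {σa σb σb' : Space n → ℝ} {k : Space n → Sph n → Sph n → ℝ} {a b κ c₀ μ ν B B' : ℝ}
  {c : Sph n → ℝ} {u w : Space n → Sph n → ℝ} {q q' : Space n → ℝ}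

/-- Solutions with the same source and total absorption have the same average. -/
lemma NiceSolution.ae_eq_of_absorb (h : NiceSolution Ω σa σb k c B u q)
    (h' : NiceSolution Ω σa σb' k c B' w q') (H : Coeff Ω σa σb k a b κ c₀ μ ν)
    (hΩ : IsDomainC1 Ω)
    (hA : ∀ᵐ x ∂(volume.restrict Ω), absorb σa σb q x = absorb σa σb' q' x) :
    ∀ᵐ x ∂(volume.restrict Ω), q x = q' x := by
  obtain ⟨θ₀⟩ := nonempty_sph n
  -- With equal total absorptions the nonlinear term cancels. What is left is a linear scattering
  -- problem with zero data and contraction factor μ < 1.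
  have hd := h.solves.enorm_sub_le hΩ h'.solves
    (Eventually.of_forall fun p => H.absorb_nonneg h.nonneg p.1)
  have hmono : (fun p : Space n × Sph n => ‖scatter k u p.1 p.2 - scatter k w p.1 p.2‖ₑ
      + ‖absorb σa σb q p.1 - absorb σa σb' q' p.1‖ₑ * ‖w p.1 p.2‖ₑ) ≤ᵐ[phaseMeasure Ω]
      fun p => ENNReal.ofReal κ * angNorm (fun x θ => u x θ - w x θ) p.1 := by
    filter_upwards [H.ae_scatter_sub h.solves.integrable h'.solves.integrable,
      ae_phase_of_ae hA] with p h1 h2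
    rw [h1, h2, sub_self, enorm_zero, zero_mul, add_zero]
    exact H.enorm_scatter_le _ _ _
  have := ae_angNorm_le hΩ (v := fun x θ => u x θ - w x θ)
    (h.solves.integrable.sub h'.solves.integrable) (C := fun _ => 0) measurable_const le_rfl
    (H.kappa_nonneg θ₀) H.mu_lt H.scatter_small (by simp) (by
      filter_upwards [hd, lineInt_mono_ae hΩ hmono] with p h1 h2
      rw [sub_self, enorm_zero, zero_add] at h1
      rw [zero_add]
      exact h1.trans h2)
  filter_upwards [this, h.ae_eq, h'.ae_eq, ae_integrable_slice h.solves.integrable,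
    ae_integrable_slice h'.solves.integrable] with x h1 h2 h3 h4 h5
  have h6 := (enorm_aver_le (fun x θ => u x θ - w x θ) x).trans h1
  rw [zero_div, ENNReal.ofReal_zero, le_zero_iff, enorm_eq_zero, aver, integral_sub h4 h5,
    sub_eq_zero] at h6
  rw [← h2, ← h3, aver, aver, h6]

/-- The average of a solution with constant source is bounded from below. -/
lemma NiceSolution.ae_lower_bound_aver (h : NiceSolution Ω σa σb k (fun _ => c₀) B u q)
    (H : Coeff Ω σa σb k a b κ c₀ μ ν) (hΩ : IsDomainC1 Ω) : ∀ᵐ x ∂(volume.restrict Ω),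
      Real.exp (-((tauNorm Ω).toReal * (a + b * B))) * c₀ ≤ q x := by
  filter_upwards [Measure.ae_ae_of_ae_prod (h.ae_lower_bound H hΩ),
    ae_integrable_slice h.solves.integrable, h.ae_eq] with x h1 h2 h3
  rw [← h3]
  refine le_trans ?_ (le_abs_self _)
  have := integral_mono_ae (integrable_const _) h2 h1
  simpa [aver] using this

end Uniqueness

end TwoPhoton

end

noncomputable section

namespace TwoPhoton

/-! ### From weak solutions to integrated solutions -/

variable {m : ℕ} {Ω : Set (Space (m + 1))} {h : Space (m + 1) → ℝ} {θ' : Sph (m + 1)}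
  {σa σb σa' σb' : Space (m + 1) → ℝ} {k k' : Space (m + 1) → Sph (m + 1) → Sph (m + 1) → ℝ}
  {a b κ c₀ μ ν : ℝ}

lemma IsSolution.exists_niceSolution {w : Space (m + 1) → Sph (m + 1) → ℝ}
    (hw : IsSolution Ω (fun x _ => σa x) (fun x _ => σb x) k (fun _ _ => c₀) w)
    (H : Coeff Ω σa' σb' k' a b κ c₀ μ ν) (hΩ : IsDomainC1 Ω)
    (ha : ∀ᵐ x ∂(volume.restrict Ω), σa x = σa' x) (hb : ∀ᵐ x ∂(volume.restrict Ω), σb x = σb' x)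
    (hk : ∀ᵐ q ∂((phaseMeasure Ω).prod (sphereMeasure (m + 1))),
      k q.1.1 q.1.2 q.2 = k' q.1.1 q.1.2 q.2) :
    ∃ q, NiceSolution Ω σa' σb' k' (fun _ => c₀) (c₀ / (1 - μ)) w q :=
  H.niceSolution hΩ measurable_const H.c_pos.le
    (by simp [Real.enorm_of_nonneg H.c_pos.le]) (hw.solves (c := fun _ => c₀) hΩ ha hb hk)

lemma IsSolution.exists_peakSolution {u : Space (m + 1) → Sph (m + 1) → ℝ} {ε δ : ℝ}
    (hu : IsSolution Ω (fun x _ => σa x) (fun x _ => σb x) k (source h c₀ θ' ε δ) u)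
    (H : Coeff Ω σa' σb' k' a b κ c₀ μ ν) (hΩ : IsDomainC1 Ω) (hh : IsCutoff h)
    (ha : ∀ᵐ x ∂(volume.restrict Ω), σa x = σa' x) (hb : ∀ᵐ x ∂(volume.restrict Ω), σb x = σb' x)
    (hk : ∀ᵐ q ∂((phaseMeasure Ω).prod (sphereMeasure (m + 1))),
      k q.1.1 q.1.2 q.2 = k' q.1.1 q.1.2 q.2) (hε : 0 < ε) (hδ : 0 < δ)
    (hmass : ∫⁻ θ, ‖peak h θ' ε δ θ‖ₑ ∂(sphereMeasure (m + 1)) ≤ ENNReal.ofReal (2 * δ)) :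
    ∃ q, PeakSolution Ω σa' σb' k' c₀ μ h θ' ε δ u q := by
  rw [source_eq] at hu
  have hc := H.c_pos.le
  have hM : ∫⁻ θ, ‖c₀ + peak h θ' ε δ θ‖ₑ ∂(sphereMeasure (m + 1))
      ≤ ENNReal.ofReal (c₀ + 2 * δ) := by
    calc _ ≤ ∫⁻ θ, (‖c₀‖ₑ + ‖peak h θ' ε δ θ‖ₑ) ∂(sphereMeasure (m + 1)) :=
          lintegral_mono fun θ => enorm_add_le _ _
      _ = ENNReal.ofReal c₀ + ∫⁻ θ, ‖peak h θ' ε δ θ‖ₑ ∂(sphereMeasure (m + 1)) := by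
          rw [lintegral_add_left measurable_const]
          simp [Real.enorm_of_nonneg hc]
      _ ≤ _ := by
          rw [ENNReal.ofReal_add hc (by positivity)]
          gcongr
  obtain ⟨q, hq⟩ := H.niceSolution hΩ (c := fun θ => c₀ + peak h θ' ε δ θ)
    ((continuous_peak hh θ' ε δ).measurable.const_add c₀) (M := c₀ + 2 * δ) (by positivity) hM
    (hu.solves hΩ ha hb hk)
  exact ⟨q, hε, hδ, hmass, hq⟩

lemma TendstoAE.congr_right {X : Type*} [MeasurableSpace X] {ρ : Measure X} {F : ℝ → X → ℝ}
    {g g' : X → ℝ} (hF : TendstoAE ρ F g) (hg : g =ᵐ[ρ] g') : TendstoAE ρ F g' := fun t ht => by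
  filter_upwards [hF t ht, hg] with x h1 h2
  rwa [← h2]

/-- The absorption is determined by the attenuation along chords. -/
lemma ae_eq_of_chordAttenuation (hm : m ≠ 0) (hΩ : IsDomainC1 Ω)
    {σb₂ σb₂' : Space (m + 1) → ℝ} {b₂ μ₂ ν₂ : ℝ} {w w₂ : Space (m + 1) → Sph (m + 1) → ℝ}
    {q q₂ : Space (m + 1) → ℝ} {B B₂ : ℝ}
    (H : Coeff Ω σa' σb' k' a b κ c₀ μ ν) (H₂ : Coeff Ω σa' σb₂' k' a b₂ κ c₀ μ₂ ν₂)
    (hw : NiceSolution Ω σa' σb' k' (fun _ => c₀) B w q)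
    (hw₂ : NiceSolution Ω σa' σb₂' k' (fun _ => c₀) B₂ w₂ q₂)
    (ha : ∀ᵐ x ∂(volume.restrict Ω), σa x = σa' x) (hb : ∀ᵐ x ∂(volume.restrict Ω), σb x = σb' x)
    (hb₂ : ∀ᵐ x ∂(volume.restrict Ω), σb₂ x = σb₂' x)
    (h : ∀ᵐ p ∂(phaseMeasure Ω),
        chordAttenuation Ω (fun x _ => σa x) (fun x _ => σb x) w p.2 p.1
          = chordAttenuation Ω (fun x _ => σa x) (fun x _ => σb₂ x) w₂ p.2 p.1) :
    ∀ᵐ x ∂(volume.restrict Ω), σb x = σb₂ x := by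
  have hA : ∀ᵐ x ∂(volume.restrict Ω), absorb σa' σb' q x = absorb σa' σb₂' q₂ x := by
    refine ae_eq_of_ae_chord hm hΩ (H.measurable_absorb hw.measurable)
      (H₂.measurable_absorb hw₂.measurable) (H.norm_absorb_le hw.nonneg hw.le)
      (H₂.norm_absorb_le hw₂.nonneg hw₂.le) ?_
    have h1 : ∀ᵐ θ ∂(sphereMeasure (m + 1)), ∀ᵐ x ∂(volume.restrict Ω),
        chordAttenuation Ω (fun x _ => σa x) (fun x _ => σb x) w θ x
          = chordAttenuation Ω (fun x _ => σa x) (fun x _ => σb₂ x) w₂ θ x :=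
      ae_ae_of_ae_prod_swap h
    filter_upwards [h1] with θ hθ
    filter_upwards [hθ, chordAttenuation_ae_eq hΩ ha hb hw.ae_eq θ,
      chordAttenuation_ae_eq hΩ ha hb₂ hw₂.ae_eq θ] with x e1 e2 e3
    rw [e2, e3] at e1
    exact neg_injective (Real.exp_injective e1)
  -- The total absorption fixes the average, the common σ_a cancels, and the average is positive, so
  -- it can be divided out.
  filter_upwards [hA, hw.ae_eq_of_absorb hw₂ H hΩ hA, hw.ae_lower_bound_aver H hΩ, hb, hb₂]
    with x e1 e2 e3 e4 e5
  have hpos : 0 < q x := (mul_pos (Real.exp_pos _) H.c_pos).trans_le e3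
  rw [absorb, absorb, ← e2, add_right_inj] at e1
  rw [e4, e5]
  exact mul_right_cancel₀ hpos.ne' e1

end TwoPhoton

end

/-! ### Assembly of the main theorem. -/

theorem theorem3p3 {n : ℕ} (hn : 2 ≤ n) (Ω : Set (TwoPhoton.Space n))
    (hΩ : TwoPhoton.IsDomainC1 Ω)
    (σa σb : TwoPhoton.Space n → ℝ)
    (k : TwoPhoton.Space n → TwoPhoton.Sph n → TwoPhoton.Sph n → ℝ)
    (h : TwoPhoton.Space n → ℝ) (hh : TwoPhoton.IsCutoff h)
    (c₀ : ℝ) (hc₀ : 0 < c₀) (θ' : TwoPhoton.Sph n)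
    -- the tuple is admissible for all small parameters
    (hadm : ∀ᶠ δ in 𝓝[>] (0 : ℝ), ∀ᶠ ε in 𝓝[>] (0 : ℝ),
      TwoPhoton.Admissible Ω (fun x _ => σa x) (fun x _ => σb x) k
        (TwoPhoton.source h c₀ θ' ε δ))
    (u : ℝ → ℝ → TwoPhoton.Space n → TwoPhoton.Sph n → ℝ)
    (hu : ∀ᶠ δ in 𝓝[>] (0 : ℝ), ∀ᶠ ε in 𝓝[>] (0 : ℝ),
      TwoPhoton.IsSolution Ω (fun x _ => σa x) (fun x _ => σb x) k
        (TwoPhoton.source h c₀ θ' ε δ) (u ε δ))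
    (w : TwoPhoton.Space n → TwoPhoton.Sph n → ℝ)
    (hw : TwoPhoton.IsSolution Ω (fun x _ => σa x) (fun x _ => σb x) k (fun _ _ => c₀) w) :
    -- the normalizing constant of the source exists and is positive
    (Tendsto (TwoPhoton.bumpMass h θ') (𝓝[>] 0) (𝓝 (TwoPhoton.omega h θ')) ∧
      0 < TwoPhoton.omega h θ') ∧
    -- the iterated limit, all inner limits existing, at the Lebesgue directions of `k`
    (TwoPhoton.IsLebesgueDirection Ω k θ' →
      TwoPhoton.IteratedLimitAE (volume.restrict Ω)
        (fun ε δ γ => TwoPhoton.measurement h θ' δ γ (u ε δ))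
        (TwoPhoton.attenuation Ω (fun x _ => σa x) (fun x _ => σb x) w θ')) ∧
    -- almost every direction is a Lebesgue direction of `k`
    (∀ᵐ θ'' ∂(TwoPhoton.sphereMeasure n), TwoPhoton.IsLebesgueDirection Ω k θ'') ∧
    -- at every direction, the iterated limit as an iterated upper limit of the error
    (∀ η : ℝ, 0 < η → ∀ᶠ δ in 𝓝[>] (0 : ℝ), ∀ᶠ γ in 𝓝[>] (0 : ℝ),
      ∀ ε : ℕ → ℝ, Tendsto ε atTop (𝓝[>] 0) →
        ∀ᵐ x ∂(volume.restrict Ω), ∀ᶠ j in atTop,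
          |TwoPhoton.measurement h θ' δ γ (u (ε j) δ) x
            - TwoPhoton.attenuation Ω (fun x _ => σa x) (fun x _ => σb x) w θ' x| < η) ∧
    -- lower bound for `w`
    (∃ C : ℝ, 0 < C ∧ ∀ᵐ p ∂(TwoPhoton.phaseMeasure Ω), C * c₀ ≤ w p.1 p.2) ∧
    -- the formula for `σ_b`
    (∀ᵐ p ∂(TwoPhoton.phaseMeasure Ω), 0 < |TwoPhoton.aver w p.1| ∧
      σb p.1 = (-TwoPhoton.Sig (fun x _ => σa x) (fun x _ => σb x)
        (fun y => |TwoPhoton.aver w y|) p.1 p.2 - σa p.1) / |TwoPhoton.aver w p.1|) ∧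
    -- `σ_a`, `k` and the attenuation along chords determine `σ_b`
    (∀ (σb' : TwoPhoton.Space n → ℝ) (w' : TwoPhoton.Space n → TwoPhoton.Sph n → ℝ),
      TwoPhoton.Admissible Ω (fun x _ => σa x) (fun x _ => σb' x) k (fun _ _ => c₀) →
      TwoPhoton.IsSolution Ω (fun x _ => σa x) (fun x _ => σb' x) k (fun _ _ => c₀) w' →
      (∀ᵐ p ∂(TwoPhoton.phaseMeasure Ω),
        TwoPhoton.chordAttenuation Ω (fun x _ => σa x) (fun x _ => σb x) w p.2 p.1
          = TwoPhoton.chordAttenuation Ω (fun x _ => σa x) (fun x _ => σb' x) w' p.2 p.1) →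
      ∀ᵐ x ∂(volume.restrict Ω), σb x = σb' x) := by
  obtain ⟨m, rfl⟩ : ∃ m, n = m + 1 := ⟨n - 1, by omega⟩
  have hm : m ≠ 0 := by omega
  obtain ⟨hω, hω0⟩ := TwoPhoton.tendsto_bumpMass hh θ'
  -- A single admissible pair of parameters supplies the representatives and the constants μ, ν for
  -- all others: the conditions in `Coeff` refer to c₀ and not to the peak.
  obtain ⟨δ₀, hadm₀, hδ₀⟩ := (hadm.and self_mem_nhdsWithin).exists
  obtain ⟨ε₀, hadm₁, hε₀⟩ := (hadm₀.and self_mem_nhdsWithin).exists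
  obtain ⟨σa', ha1, ha2, ha3, ha4⟩ := TwoPhoton.exists_rep_coeff hadm₁.σa_mem hadm₁.σa_nonneg
  obtain ⟨σb', hb1, hb2, hb3, hb4⟩ := TwoPhoton.exists_rep_coeff hadm₁.σb_mem hadm₁.σb_nonneg
  obtain ⟨k', hk1, hk2, hk3, hk4⟩ := TwoPhoton.exists_rep_kernel hadm₁.k_mem hadm₁.k_nonneg
  obtain ⟨μ, ν, H⟩ := TwoPhoton.coeff_of_admissible
    (c := fun θ => c₀ + TwoPhoton.peak h θ' ε₀ δ₀ θ) hΩ hadm₁ hc₀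
    (fun θ => le_add_of_nonneg_right (TwoPhoton.peak_nonneg hh θ' hε₀ hδ₀ θ))
    ha1 ha2 ha3 hb1 hb2 hb3 hk1 hk2 hk3
  have hk5 : ∀ᵐ q ∂((TwoPhoton.phaseMeasure Ω).prod (TwoPhoton.sphereMeasure (m + 1))),
      k' q.1.1 q.1.2 q.2 = k q.1.1 q.1.2 q.2 := hk4.mono fun q hq => hq.symm
  obtain ⟨q, hq⟩ := hw.exists_niceSolution H hΩ ha4 hb4 hk4
  have hpeak : ∀ᶠ δ in 𝓝[>] (0 : ℝ), ∀ᶠ ε in 𝓝[>] (0 : ℝ), ∃ q,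
      TwoPhoton.PeakSolution Ω σa' σb' k' c₀ μ h θ' ε δ (u ε δ) q := by
    filter_upwards [hu, self_mem_nhdsWithin] with δ hδu hδ
    filter_upwards [hδu, self_mem_nhdsWithin, TwoPhoton.eventually_lintegral_peak_le hh θ' hδ]
      with ε hεu hε hmass
    exact hεu.exists_peakSolution H hΩ hh ha4 hb4 hk4 hε hδ hmass
  have hatt := TwoPhoton.attenuation_ae_eq hΩ ha4 hb4 hq.ae_eq θ'
  have hlow := hq.ae_lower_bound_aver H hΩ
  refine ⟨⟨hω, hω0⟩, fun hL => ?_, ?_, fun η hη => ?_, ⟨_, Real.exp_pos _, hq.ae_lower_bound H hΩ⟩,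
    ?_, fun σb₂ w₂ hadm₂ hw₂ hchord => ?_⟩
  · obtain ⟨G₂, G₁, h1, h2⟩ := TwoPhoton.iteratedLimitAE_measurement hm hq H hΩ hh
      (TwoPhoton.isLebesgueDirection_congr hk4 hL) hpeak
    exact ⟨G₂, G₁, h1, h2.congr_right (hatt.mono fun x hx => hx.symm)⟩
  · filter_upwards [TwoPhoton.ae_isLebesgueDirection (Ω := Ω) hk1 (fun x θ₁ θ => by
      rw [abs_of_nonneg (hk2 x θ₁ θ)]; exact hk3 x θ₁ θ)] with θ hθ
    exact TwoPhoton.isLebesgueDirection_congr hk5 hθ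
  · filter_upwards [TwoPhoton.ae_eventually_abs_measurement_sub_lt hm hq H hΩ hh hpeak hη] with δ hδ
    filter_upwards [hδ] with γ hγ ε hε
    filter_upwards [hγ ε hε, hatt] with x h1 h2
    rwa [h2]
  · filter_upwards [TwoPhoton.ae_phase_of_ae hlow, TwoPhoton.ae_phase_of_ae hq.ae_eq] with p h1 h2
    have hpos : 0 < |TwoPhoton.aver w p.1| := by
      rw [h2]
      exact (mul_pos (Real.exp_pos _) hc₀).trans_le h1
    refine ⟨hpos, ?_⟩
    rw [TwoPhoton.Sig, neg_neg, add_sub_cancel_left, mul_div_cancel_right₀ _ hpos.ne']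
  · obtain ⟨σb₂', hc1, hc2, hc3, hc4⟩ :=
      TwoPhoton.exists_rep_coeff hadm₂.σb_mem hadm₂.σb_nonneg
    obtain ⟨μ₂, ν₂, H₂⟩ := TwoPhoton.coeff_of_admissible (c := fun _ => c₀) hΩ hadm₂ hc₀
      (fun _ => le_rfl) ha1 ha2 ha3 hc1 hc2 hc3 hk1 hk2 hk3
    obtain ⟨q₂, hq₂⟩ := hw₂.exists_niceSolution H₂ hΩ ha4 hc4 hk4
    exact TwoPhoton.ae_eq_of_chordAttenuation hm hΩ H H₂ hq hq₂ ha4 hb4 hc4 hchord
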